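/- Let $G$ be a bichromatic DAG: a directed acyclic graph without parallel edges, with $n$ vertices, each colored red or blue (both colors occur), and $m$ edges carrying nonnegative integer weights that are polynomially bounded in $n$; $G$ is assumed to be weakly connected. Let $d(u,v)\in\mathbb N\cup\{\infty\}$ be the directed distance, let $D=\max\{\min(d(a,b),d(b,a)) : a\text{ red},\ b\text{ blue}\}\in\mathbb N\cup\{\infty\}$ be the bichromatic min-diameter of $G$, and let $M_0$ be the maximum weight of an edge between a red and a blue vertex. There is a deterministic word-RAM algorithm (with words of $\Theta(\log n)$ bits) that, given $G$, runs in time $\tilde O\bigl(\min(m^{4/3}n^{1/3},\,m^{1/2}n^{3/2})\bigr)$ and outputs $D_0\in\mathbb N\cup\{\infty\}$ with $$D\le D_0\le 2D+M_0\qquad\text{and}\qquad D_0\le 3D.$$ More precisely, there are one program $P$ and one exponent $c$ such that for every $\kappa\in\mathbb N$ there are constants $C,b$ for which, on every such $G$ with all edge weights at most $n^\kappa$ (given as a list of colors and a list of weighted edges in arbitrary order), and for every word length $w$ with $2^w\ge n^b$, $P$ halts with such an output $D_0$ after at most $C\cdot\min(m^{4/3}n^{1/3},m^{1/2}n^{3/2})\cdot(\log_2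 n)^c$ steps. -/

import Mathlib

/-! ## The word RAM

A machine has finitely many registers in use (named by natural numbers) and a random access
memory; both hold `w`-bit words, that is, natural numbers below `2 ^ w`, and arithmetic is modulo
`2 ^ w`.  Programs are written in structured form: straight-line instructions, sequencing,
branching and loops. -/

namespace WordRAM

/-- Binary operations on words, each of unit cost. -/
inductive Op where
  | add | sub | mul | div | mod | band | bor | bxor | shl | shr | lt | eq

/-- The result of an operation on two `w`-bit words; comparisons return `1` for true and `0` for
false, and division by zero returns `0`. -/
def Op.eval (w : ℕ) (o : Op) (a b : ℕ) : ℕ :=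
  (match o with
    | .add => a + b
    | .sub => a + (2 ^ w - b)
    | .mul => a * b
    | .div => a / b
    | .mod => a % b
    | .band => a &&& b
    | .bor => a ||| b
    | .bxor => a ^^^ b
    | .shl => a <<< b
    | .shr => a >>> b
    | .lt => if a < b then 1 else 0
    | .eq => if a = b then 1 else 0) % 2 ^ w

/-- Programs.  A program is a finite object that depends neither on the input nor on `w`. -/
inductive Program where
  /-- do nothing -/
  | skip
  /-- `reg x := c` -/
  | const (x c : ℕ)
  /-- `reg x := reg y o reg z` -/
  | op (o : Op) (x y z : ℕ)
  /-- `reg x := mem (reg y)` -/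
  | load (x y : ℕ)
  /-- `mem (reg x) := reg y` -/
  | store (x y : ℕ)
  /-- first `p`, then `q` -/
  | seq (p q : Program)
  /-- if `reg x ≠ 0` then `p` else `q` -/
  | cond (x : ℕ) (p q : Program)
  /-- while `reg x ≠ 0` repeat `p` -/
  | loop (x : ℕ) (p : Program)

/-- The contents of the registers and of the memory. -/
structure State where
  reg : ℕ → ℕ
  mem : ℕ → ℕ

/-- Assign a value to a register. -/
def State.setReg (s : State) (x a : ℕ) : State := { s with reg := Function.update s.reg x a }

/-- Assign a value to a memory cell. -/
def State.setMem (s : State) (i a : ℕ) : State := { s with mem := Function.update s.mem i a }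

/-- `Runs w p s s' t`: on the machine with word size `w`, the program `p` started in the state `s`
halts in the state `s'` after exactly `t` steps.  Every instruction and every test costs one step. -/
inductive Runs (w : ℕ) : Program → State → State → ℕ → Prop where
  | skip (s : State) : Runs w .skip s s 1
  | const (s : State) (x c : ℕ) : Runs w (.const x c) s (s.setReg x (c % 2 ^ w)) 1
  | op (s : State) (o : Op) (x y z : ℕ) :
      Runs w (.op o x y z) s (s.setReg x (o.eval w (s.reg y) (s.reg z))) 1
  | load (s : State) (x y : ℕ) : Runs w (.load x y) s (s.setReg x (s.mem (s.reg y))) 1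
  | store (s : State) (x y : ℕ) : Runs w (.store x y) s (s.setMem (s.reg x) (s.reg y)) 1
  | seq {p q : Program} {s₁ s₂ s₃ : State} {t₁ t₂ : ℕ} :
      Runs w p s₁ s₂ t₁ → Runs w q s₂ s₃ t₂ → Runs w (.seq p q) s₁ s₃ (t₁ + t₂)
  | cond_true {p q : Program} {x : ℕ} {s s' : State} {t : ℕ} :
      s.reg x ≠ 0 → Runs w p s s' t → Runs w (.cond x p q) s s' (t + 1)
  | cond_false {p q : Program} {x : ℕ} {s s' : State} {t : ℕ} :
      s.reg x = 0 → Runs w q s s' t → Runs w (.cond x p q) s s' (t + 1)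
  | loop_done {p : Program} {x : ℕ} {s : State} :
      s.reg x = 0 → Runs w (.loop x p) s s 1
  | loop_step {p : Program} {x : ℕ} {s₁ s₂ s₃ : State} {t₁ t₂ : ℕ} :
      s₁.reg x ≠ 0 → Runs w p s₁ s₂ t₁ → Runs w (.loop x p) s₂ s₃ t₂ →
      Runs w (.loop x p) s₁ s₃ (t₁ + t₂ + 1)

/-- The machine is deterministic: final state and running time are determined by the start. -/
theorem Runs.deterministic {w : ℕ} {p : Program} {s s' s'' : State} {t t' : ℕ}
    (h : Runs w p s s' t) (h' : Runs w p s s'' t') : s' = s'' ∧ t = t' := by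
  induction h generalizing s'' t' with
  | skip | const | op | load | store => cases h'; exact ⟨rfl, rfl⟩
  | seq _ _ ih₁ ih₂ =>
    cases h' with
    | seq k₁ k₂ =>
      obtain ⟨rfl, rfl⟩ := ih₁ k₁
      obtain ⟨rfl, rfl⟩ := ih₂ k₂
      exact ⟨rfl, rfl⟩
  | cond_true hx _ ih =>
    cases h' with
    | cond_true _ k => obtain ⟨rfl, rfl⟩ := ih k; exact ⟨rfl, rfl⟩
    | cond_false hx' _ => exact absurd hx' hx
  | cond_false hx _ ih =>
    cases h' with
    | cond_true hx' _ => exact absurd hx hx'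
    | cond_false _ k => obtain ⟨rfl, rfl⟩ := ih k; exact ⟨rfl, rfl⟩
  | loop_done hx =>
    cases h' with
    | loop_done => exact ⟨rfl, rfl⟩
    | loop_step hx' _ _ => exact absurd hx hx'
  | loop_step hx _ _ ih₁ ih₂ =>
    cases h' with
    | loop_done hx' => exact absurd hx' hx
    | loop_step _ k₁ k₂ =>
      obtain ⟨rfl, rfl⟩ := ih₁ k₁
      obtain ⟨rfl, rfl⟩ := ih₂ k₂
      exact ⟨rfl, rfl⟩

/-- The value in `ℕ ∪ {∞}` that a final state stands for: `∞` if register `0` holds `0`, and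
otherwise the number in register `1`. -/
noncomputable def State.output (s : State) : ℕ∞ := if s.reg 0 = 0 then ⊤ else (s.reg 1 : ℕ∞)

end WordRAM

/-! ## Two-colored weighted directed graphs -/

/-- A directed graph without parallel edges, with vertices `0, …, n - 1` colored red or blue, and
`m` edges carrying nonnegative integer weights, listed in an arbitrary order. -/
structure BicoloredDigraph (n m : ℕ) where
  src : Fin m → Fin n
  tgt : Fin m → Fin n
  weight : Fin m → ℕ
  isRed : Fin n → Bool
  simple : Function.Injective fun e => (src e, tgt e)

namespace BicoloredDigraph

variable {n m : ℕ} (G : BicoloredDigraph n m)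

/-- There is an edge from `u` to `v`. -/
def Adj (u v : Fin n) : Prop := ∃ e, G.src e = u ∧ G.tgt e = v

/-- No vertex lies on a directed cycle. -/
def Acyclic : Prop := ∀ v, ¬ Relation.TransGen G.Adj v v

/-- Any two vertices are joined by a path when the directions of the edges are ignored. -/
def WeaklyConnected : Prop := ∀ u v, Relation.EqvGen G.Adj u v

/-- `G.HasWalk u v k`: there is a directed walk from `u` to `v` of total weight `k`. -/
inductive HasWalk : Fin n → Fin n → ℕ → Prop where
  | nil (u : Fin n) : HasWalk u u 0
  | cons (e : Fin m) {v : Fin n} {k : ℕ} :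
      HasWalk (G.tgt e) v k → HasWalk (G.src e) v (G.weight e + k)

/-- The distance from `u` to `v`, which is `∞` if there is no directed walk from `u` to `v`. -/
noncomputable def dist (u v : Fin n) : ℕ∞ := ⨅ (k : ℕ) (_ : G.HasWalk u v k), (k : ℕ∞)

/-- The min-distance between `u` and `v`. -/
noncomputable def minDist (u v : Fin n) : ℕ∞ := min (G.dist u v) (G.dist v u)

/-- The bichromatic min-diameter: the largest min-distance between a red and a blue vertex. -/
noncomputable def bichromaticMinDiam : ℕ∞ :=
  ⨆ (a : Fin n) (b : Fin n) (_ : G.isRed a = true) (_ : G.isRed b = false), G.minDist a b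

/-- The largest weight of an edge (of either direction) between a red and a blue vertex. -/
def maxRedBlueWeight : ℕ :=
  (Finset.univ.filter fun e => G.isRed (G.src e) ≠ G.isRed (G.tgt e)).sup G.weight

/-- The memory contents that represent `G`: the `n` colors (`1` for red, `0` for blue), then for
each edge its source, its target and its weight, and zeros from there on. -/
def inputMem (i : ℕ) : ℕ :=
  if h : i < n then (if G.isRed ⟨i, h⟩ then 1 else 0)
  else if h : (i - n) / 3 < m then
    (if (i - n) % 3 = 0 then (G.src ⟨(i - n) / 3, h⟩ : ℕ)
     else if (i - n) % 3 = 1 then (G.tgt ⟨(i - n) / 3, h⟩ : ℕ)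
     else G.weight ⟨(i - n) / 3, h⟩)
  else 0

/-- The initial state on input `G`: register `0` holds `n`, register `1` holds `m`, all other
registers hold `0`, and the memory represents `G`. -/
def inputState : WordRAM.State where
  reg i := if i = 0 then n else if i = 1 then m else 0
  mem := G.inputMem

end BicoloredDigraph

/-! In an acyclic graph at most one of two vertices reaches the other, so after a topological sort
the min-distance of two positions `x < y` is simply the distance from `x` to `y`. The algorithm
rests on a test for a threshold `K` with two one-sided answers: either there is a red-blue pair at
distance above `K` (`BadP`), or all red-blue pairs are at distance at most `2 * K + min M₀ K`
(`Good`). Binary search yields an `L` that passes while `L - 1` fails (or `L = 0`); hence `L ≤ D ≤ 2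
* L + min M₀ L`, and the right-hand side is at most both `2 * D + M₀` and `3 * D`. If the search
fails even at the largest weight times `n`, which exceeds every finite distance, then `D = ∞`. This
is `search_spec` with `main_spec`.

For the test, the topological order is cut into maximal runs of one color, so two vertices differ in
color exactly when the indices of their runs differ by an odd number. Suppose `x` lies in run `i`
and `y` in run `j ≥ i + 3`. Between them there is a boundary of runs `k` and `k + 1` with `k - i`
odd; its last vertex `u` before and first vertex `v` after the boundary occupy consecutive
positions, so a walk from `u` to `v` is a single edge between the two colors. If the red-blue pairs
`(x, u)`, `(u, v)`, `(v, y)` all have distance at most `K`, then `d(x, y) ≤ 2 * K + min M₀ K`.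
Searches from all run boundaries would be too slow, so most of them are confined to a window of
about `bw ≈ √n` runs on either side, and only three runs out of every `bw` get a search of the whole
graph; `exists_boundary` finds a suitable `k`, `test_spec` assembles the walk.

For neighboring runs (`seg_spec`) the basic operation is to hit a vertex `x` of the first block:
check that `x` reaches the whole second block within `K` (otherwise a bad pair is found) and mark
all vertices of the first block that reach `x` within `K`. Marked vertices reach the second block
within `2 * K`. First all vertices of degree at least `hh` are hit, so that the balls of radius `K`
around unmarked vertices contain only vertices of small degree and can be listed cheaply up to size
`kk`. A greedy hitting set with about `n log n / kk` elements (`greedy_spec`) then marks every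
vertex whose list is full. What remains are vertices whose ball in the first block is known
completely.

In the sparse case one remaining vertex `a` is enough: any walk from `a` into the second block
enters it through one of at most `kk * hh` edges that leave the ball, and hitting the far ends of
these edges in the reversed graph marks every vertex of the second block that `a` reaches within `K`
(`sparseFinal_spec`). In the dense case the marking is also done for the reversed graph, and for the
remaining pairs the comparison with `K` is exact, by combining the lists of the two ends
(`denseFinal_spec`).

The costs per test are of the order of `m * bw`, `m * m / hh`, `m * n log n / kk`, and `m * kk * hh`
or `kk * n ^ 2`, respectively. They are balanced by `kk ≈ (n ^ 2 / m) ^ (1 / 3)`, `hh ≈ (m ^ 2 / n)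
^ (1 / 3)` if `m ^ 5 < n ^ 7`, and by `kk ≈ (m / n) ^ (1 / 2)` without any use of degrees otherwise;
this is `testBound_le_timeX`. Weak connectivity enters through `n ≤ 2 * m`.

To obtain an actual word RAM program, everything is written in a small language with saturating
arithmetic, whose semantics is a total function and whose compiler is proved correct with a constant
overhead (`compile_correct`). Saturation makes overflow harmless: a capped distance is still larger
than the threshold. -/

set_option linter.unusedSimpArgs false
set_option linter.unusedSectionVars false

namespace SatRAM

/-! ## A saturating random access language

Programs over scalar variables and arrays of natural numbers; all arithmetic saturates at a bound
`B`, so every program has a total functional semantics.  Programs are compiled to the word RAM. -/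

/-- Expressions: `top` is the saturation bound, `inp` reads the input, `rd` reads an array. -/
inductive Ex where
  | lit (c : ℕ)
  | var (x : ℕ)
  | top
  | inp (e : Ex)
  | rd (j : ℕ) (e : Ex)
  | add (a b : Ex)
  | sub (a b : Ex)
  | mul (a b : Ex)
  | div (a b : Ex)
  | mod (a b : Ex)
  | lt (a b : Ex)
  | eq (a b : Ex)

instance : Add Ex := ⟨Ex.add⟩
instance : Sub Ex := ⟨Ex.sub⟩
instance : Mul Ex := ⟨Ex.mul⟩
instance (n : ℕ) : OfNat Ex n := ⟨Ex.lit n⟩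

/-- Commands.  `loop x lo hi g c` runs `c` for `x = lo, …, hi - 1`, but stops as soon as the guard
`g` evaluates to `0`. -/
inductive Cmd where
  | skip
  | asg (x : ℕ) (e : Ex)
  | wr (j : ℕ) (i e : Ex)
  | seq (c d : Cmd)
  | ite (e : Ex) (c d : Cmd)
  | loop (x : ℕ) (lo hi g : Ex) (c : Cmd)

/-- Values of the scalar variables and of the arrays. -/
structure St where
  v : ℕ → ℕ
  a : ℕ → ℕ → ℕ

def St.setV (s : St) (x n : ℕ) : St := { s with v := Function.update s.v x n }

def St.setA (s : St) (j i n : ℕ) : St :=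
  { s with a := Function.update s.a j (Function.update (s.a j) i n) }

theorem setA_apply (s : St) (j i n j' i' : ℕ) :
    (s.setA j i n).a j' i' = if j' = j ∧ i' = i then n else s.a j' i' := by
  unfold St.setA
  by_cases h : j' = j
  · subst h
    by_cases h' : i' = i
    · subst h'; simp
    · simp [h']
  · simp [h]

/-- The saturation bound and the input. -/
structure Env where
  B : ℕ
  I : ℕ → ℕ

variable (E : Env)

/-- Only sums and products can exceed the operands, so only they are capped; literals are kept small
by `Ex.ok`. Division and remainder by zero follow the conventions of `ℕ`, as the machine does. -/
def ev (s : St) : Ex → ℕ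
  | .lit c => c
  | .var x => s.v x
  | .top => E.B
  | .inp e => E.I (ev s e)
  | .rd j e => s.a j (ev s e)
  | .add a b => min (ev s a + ev s b) E.B
  | .sub a b => ev s a - ev s b
  | .mul a b => min (ev s a * ev s b) E.B
  | .div a b => ev s a / ev s b
  | .mod a b => ev s a % ev s b
  | .lt a b => if ev s a < ev s b then 1 else 0
  | .eq a b => if ev s a = ev s b then 1 else 0

/-- The loop variable is assigned before the guard is evaluated, so a loop that is left through its
guard keeps the current index in `x`. Searches for a smallest index (`find_spec`) use this value as
their result. -/
def loopRun (x : ℕ) (g : St → ℕ) (f : St → St) : ℕ → ℕ → St → St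
  | 0, _, s => s
  | k + 1, i, s =>
    if g (s.setV x i) = 0 then s.setV x i else loopRun x g f k (i + 1) (f (s.setV x i))

def loopCost (x : ℕ) (g : St → ℕ) (f : St → St) (c : St → ℕ) : ℕ → ℕ → St → ℕ
  | 0, _, _ => 1
  | k + 1, i, s =>
    if g (s.setV x i) = 0 then 2
    else c (s.setV x i) + 1 + loopCost x g f c k (i + 1) (f (s.setV x i))

def run : Cmd → St → St
  | .skip, s => s
  | .asg x e, s => s.setV x (ev E s e)
  | .wr j i e, s => s.setA j (ev E s i) (ev E s e)
  | .seq c d, s => run d (run c s)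
  | .ite e c d, s => if ev E s e = 0 then run d s else run c s
  | .loop x lo hi g c, s =>
    loopRun x (fun s => ev E s g) (run c) (ev E s hi - ev E s lo) (ev E s lo) s

/-- The number of elementary steps; it agrees with the running time of the compiled program up to a
constant factor. -/
def cost : Cmd → St → ℕ
  | .skip, _ => 1
  | .asg _ _, _ => 1
  | .wr _ _ _, _ => 1
  | .seq c d, s => cost c s + cost d (run E c s)
  | .ite e c d, s => 1 + if ev E s e = 0 then cost d s else cost c s
  | .loop x lo hi g c, s =>
    loopCost x (fun s => ev E s g) (run E c) (cost c) (ev E s hi - ev E s lo) (ev E s lo) s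

/-! ### Compilation -/

section Compile

open WordRAM

/-- The register holding the scalar variable `x`. -/
def rV (x : ℕ) : ℕ := 3 * x
/-- Registers for the bounds of loops. -/
def rH (d : ℕ) : ℕ := 3 * d + 1
/-- Registers for intermediate values. -/
def rT (d : ℕ) : ℕ := 3 * (d + 5) + 2

/-- Code at depth `d` leaves its value in `rT d` and writes only to `rT d'` with `d' ≥ d`, so an
operand computed earlier survives. The registers are divided by their residues modulo `3`; the shift
by `5` in `rT` keeps `2, 5, 8, 11, 14` free for the constants `E.B`, `64`, `base`, `1`, `0`. Adding
register `14` is a copy. Array `j` is interleaved with the others at the cells `i * 64 + base + j`.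
Input reads are multiplied by the test `address < base`, because the cells from `base` on hold
arrays while the input has to read as `0` there. -/
def cEx : ℕ → Ex → Program
  | d, .lit c => .const (rT d) c
  | d, .var x => .op .add (rT d) (rV x) 14
  | d, .top => .op .add (rT d) 2 14
  | d, .inp e => .seq (cEx d e) (.seq (.load (rT (d + 1)) (rT d))
      (.seq (.op .lt (rT d) (rT d) 8) (.op .mul (rT d) (rT d) (rT (d + 1)))))
  | d, .rd j e => .seq (cEx d e) (.seq (.op .mul (rT d) (rT d) 5) (.seq (.op .add (rT d) (rT d) 8)
      (.seq (.const (rT (d + 1)) j) (.seq (.op .add (rT d) (rT d) (rT (d + 1)))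
      (.load (rT d) (rT d))))))
  | d, .add a b => .seq (cEx d a) (.seq (cEx (d + 1) b)
      (.seq (.op .add (rT d) (rT d) (rT (d + 1))) (.seq (.op .lt (rT (d + 1)) 2 (rT d))
      (.seq (.op .sub (rT (d + 2)) (rT d) 2) (.seq (.op .mul (rT (d + 2)) (rT (d + 2)) (rT (d + 1)))
      (.op .sub (rT d) (rT d) (rT (d + 2))))))))
  | d, .sub a b => .seq (cEx d a) (.seq (cEx (d + 1) b)
      (.seq (.op .lt (rT (d + 2)) (rT (d + 1)) (rT d)) (.seq (.op .sub (rT d) (rT d) (rT (d + 1)))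
      (.op .mul (rT d) (rT d) (rT (d + 2))))))
  | d, .mul a b => .seq (cEx d a) (.seq (cEx (d + 1) b)
      (.seq (.op .div (rT (d + 2)) 2 (rT (d + 1))) (.seq (.op .lt (rT (d + 2)) (rT (d + 2)) (rT d))
      (.seq (.op .lt (rT (d + 3)) 14 (rT (d + 1)))
      (.seq (.op .mul (rT (d + 2)) (rT (d + 2)) (rT (d + 3)))
      (.cond (rT (d + 2)) (.op .add (rT d) 2 14) (.op .mul (rT d) (rT d) (rT (d + 1)))))))))
  | d, .div a b => .seq (cEx d a) (.seq (cEx (d + 1) b) (.op .div (rT d) (rT d) (rT (d + 1))))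
  | d, .mod a b => .seq (cEx d a) (.seq (cEx (d + 1) b) (.op .mod (rT d) (rT d) (rT (d + 1))))
  | d, .lt a b => .seq (cEx d a) (.seq (cEx (d + 1) b) (.op .lt (rT d) (rT d) (rT (d + 1))))
  | d, .eq a b => .seq (cEx d a) (.seq (cEx (d + 1) b) (.op .eq (rT d) (rT d) (rT (d + 1))))

/-- The bounds of a loop at depth `d` stay in `rH (2 * d)` and `rH (2 * d + 1)`, which inner loops
do not use. The machine loop runs on `rT 0`, which also receives the guard: a guard equal to `0`
skips the body and leaves `0` there, which ends the loop at once. -/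
def cCmd : ℕ → Cmd → Program
  | _, .skip => .skip
  | _, .asg x e => .seq (cEx 0 e) (.op .add (rV x) (rT 0) 14)
  | _, .wr j i e => .seq (cEx 0 i) (.seq (cEx 1 e) (.seq (.op .mul (rT 0) (rT 0) 5)
      (.seq (.op .add (rT 0) (rT 0) 8) (.seq (.const (rT 2) j)
      (.seq (.op .add (rT 0) (rT 0) (rT 2)) (.store (rT 0) (rT 1)))))))
  | d, .seq a b => .seq (cCmd d a) (cCmd d b)
  | d, .ite e a b => .seq (cEx 0 e) (.cond (rT 0) (cCmd d a) (cCmd d b))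
  | d, .loop x lo hi g a => .seq (cEx 0 lo) (.seq (cEx 1 hi) (.seq (.op .add (rH (2 * d)) (rT 0) 14)
      (.seq (.op .add (rH (2 * d + 1)) (rT 1) 14)
      (.seq (.op .lt (rT 0) (rH (2 * d)) (rH (2 * d + 1)))
      (.loop (rT 0) (.seq (.op .add (rV x) (rH (2 * d)) 14) (.seq (cEx 0 g) (.cond (rT 0)
        (.seq (cCmd (d + 1) a) (.seq (.op .add (rH (2 * d)) (rH (2 * d)) 11)
          (.op .lt (rT 0) (rH (2 * d)) (rH (2 * d + 1))))) .skip))))))))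

/-- Static bound for the time needed to evaluate an expression. -/
def exT : Ex → ℕ
  | .lit _ => 1
  | .var _ => 1
  | .top => 1
  | .inp e => exT e + 8
  | .rd _ e => exT e + 8
  | .add a b => exT a + exT b + 8
  | .sub a b => exT a + exT b + 8
  | .mul a b => exT a + exT b + 8
  | .div a b => exT a + exT b + 8
  | .mod a b => exT a + exT b + 8
  | .lt a b => exT a + exT b + 8
  | .eq a b => exT a + exT b + 8

/-- Static bound for the ratio of the running time of the compiled program and `cost`. -/
def cmdT : Cmd → ℕ
  | .skip => 1
  | .asg _ e => exT e + 8
  | .wr _ i e => exT i + exT e + 8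
  | .seq c d => cmdT c + cmdT d
  | .ite e c d => exT e + 1 + cmdT c + cmdT d
  | .loop _ lo hi g c => exT lo + exT hi + exT g + cmdT c + 12

/-- Literals and array names are small. -/
def Ex.ok : Ex → Bool
  | .lit c => decide (c ≤ 64)
  | .var _ => true
  | .top => true
  | .inp e => e.ok
  | .rd j e => decide (j < 64) && e.ok
  | .add a b => a.ok && b.ok
  | .sub a b => a.ok && b.ok
  | .mul a b => a.ok && b.ok
  | .div a b => a.ok && b.ok
  | .mod a b => a.ok && b.ok
  | .lt a b => a.ok && b.ok
  | .eq a b => a.ok && b.ok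

def Cmd.ok : Cmd → Bool
  | .skip => true
  | .asg _ e => e.ok
  | .wr j i e => decide (j < 64) && i.ok && e.ok
  | .seq c d => c.ok && d.ok
  | .ite e c d => e.ok && c.ok && d.ok
  | .loop _ lo hi g c => lo.ok && hi.ok && g.ok && c.ok

/-- Total correctness on the word RAM, with time. -/
def Ter (w : ℕ) (p : Program) (s : State) (Q : State → ℕ → Prop) : Prop :=
  ∃ s' t, Runs w p s s' t ∧ Q s' t

variable {w : ℕ} {s : State} {Q : State → ℕ → Prop}

/-- Determinism turns one run into an equivalence; therefore the rules for single instructions can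
be used for rewriting. -/
theorem ter_of_runs {p : Program} {s' : State} {t : ℕ} (h : Runs w p s s' t) :
    Ter w p s Q ↔ Q s' t := by
  constructor
  · rintro ⟨s'', t', h', hq⟩
    obtain ⟨rfl, rfl⟩ := h.deterministic h'
    exact hq
  · exact fun hq => ⟨_, _, h, hq⟩

theorem ter_skip : Ter w .skip s Q ↔ Q s 1 := ter_of_runs (.skip s)

theorem ter_const {x c : ℕ} : Ter w (.const x c) s Q ↔ Q (s.setReg x (c % 2 ^ w)) 1 :=
  ter_of_runs (.const s x c)

theorem ter_op {o : Op} {x y z : ℕ} :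
    Ter w (.op o x y z) s Q ↔ Q (s.setReg x (o.eval w (s.reg y) (s.reg z))) 1 :=
  ter_of_runs (.op s o x y z)

theorem ter_load {x y : ℕ} : Ter w (.load x y) s Q ↔ Q (s.setReg x (s.mem (s.reg y))) 1 :=
  ter_of_runs (.load s x y)

theorem ter_store {x y : ℕ} : Ter w (.store x y) s Q ↔ Q (s.setMem (s.reg x) (s.reg y)) 1 :=
  ter_of_runs (.store s x y)

theorem ter_seq {p q : Program} :
    Ter w (.seq p q) s Q ↔ Ter w p s fun s₁ t₁ => Ter w q s₁ fun s₂ t₂ => Q s₂ (t₁ + t₂) := by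
  constructor
  · rintro ⟨s', t, h, hq⟩
    cases h with
    | seq h₁ h₂ => exact ⟨_, _, h₁, _, _, h₂, hq⟩
  · rintro ⟨s₁, t₁, h₁, s₂, t₂, h₂, hq⟩
    exact ⟨_, _, .seq h₁ h₂, hq⟩

theorem ter_cond {x : ℕ} {p q : Program} : Ter w (.cond x p q) s Q ↔
    if s.reg x = 0 then Ter w q s fun s' t => Q s' (t + 1) else
      Ter w p s fun s' t => Q s' (t + 1) := by
  split_ifs with hx
  · constructor
    · rintro ⟨s', t, h, hq⟩
      cases h with
      | cond_true hx' _ => exact absurd hx hx'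
      | cond_false _ h => exact ⟨_, _, h, hq⟩
    · rintro ⟨s', t, h, hq⟩
      exact ⟨_, _, .cond_false hx h, hq⟩
  · constructor
    · rintro ⟨s', t, h, hq⟩
      cases h with
      | cond_true _ h => exact ⟨_, _, h, hq⟩
      | cond_false hx' _ => exact absurd hx' hx
    · rintro ⟨s', t, h, hq⟩
      exact ⟨_, _, .cond_true hx h, hq⟩

theorem ter_loop_done {x : ℕ} {p : Program} (h : s.reg x = 0) :
    Ter w (.loop x p) s Q ↔ Q s 1 := ter_of_runs (.loop_done h)

theorem ter_loop_step {x : ℕ} {p : Program} (h : s.reg x ≠ 0)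
    (h' : Ter w p s fun s₁ t₁ => Ter w (.loop x p) s₁ fun s₂ t₂ => Q s₂ (t₁ + t₂ + 1)) :
    Ter w (.loop x p) s Q := by
  obtain ⟨s₁, t₁, h₁, s₂, t₂, h₂, hq⟩ := h'
  exact ⟨_, _, .loop_step h h₁ h₂, hq⟩

theorem Ter.mono {p : Program} {Q' : State → ℕ → Prop} (h : Ter w p s Q)
    (hq : ∀ s' t, Q s' t → Q' s' t) : Ter w p s Q' := by
  obtain ⟨s', t, h, h'⟩ := h
  exact ⟨_, _, h, hq _ _ h'⟩

/-! ### How a state of the saturating machine is represented on the word RAM. -/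

/-- Compatibility of the bound with the word length and with the input, which lies in the memory
cells below `base`. -/
structure Env.Fits (w base : ℕ) : Prop where
  -- The largest number formed is an address `i * 64 + base + j` with `i, base ≤ E.B` and `j < 64`;
  -- so nothing the compiled code relies on wraps around.
  bnd : 70 * E.B + 70 < 2 ^ w
  lits : 64 ≤ E.B
  base_le : base ≤ E.B
  inp_le : ∀ i, E.I i ≤ E.B
  inp_zero : ∀ i, base ≤ i → E.I i = 0

/-- The state of the word RAM represents a state of the saturating machine. -/
structure Rel (base : ℕ) (σ : St) (s : State) : Prop where
  hv : ∀ x, s.reg (rV x) = σ.v x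
  ha : ∀ j i, j < 64 → i ≤ E.B → s.mem (i * 64 + base + j) = σ.a j i
  hi : ∀ i, i < base → s.mem i = E.I i
  h2 : s.reg 2 = E.B
  h5 : s.reg 5 = 64
  h8 : s.reg 8 = base
  h11 : s.reg 11 = 1
  h14 : s.reg 14 = 0
  bv : ∀ x, σ.v x ≤ E.B
  ba : ∀ j i, σ.a j i ≤ E.B

@[simp] theorem rT_inj {a b : ℕ} : rT a = rT b ↔ a = b := by unfold rT; omega
@[simp] theorem rV_inj {a b : ℕ} : rV a = rV b ↔ a = b := by unfold rV; omega
@[simp] theorem rH_inj {a b : ℕ} : rH a = rH b ↔ a = b := by unfold rH; omega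
@[simp] theorem rT_ne_rV {a b : ℕ} : rT a ≠ rV b := by unfold rT rV; omega
@[simp] theorem rV_ne_rT {a b : ℕ} : rV a ≠ rT b := by unfold rT rV; omega
@[simp] theorem rV_ne_rH {a b : ℕ} : rV a ≠ rH b := by unfold rH rV; omega
@[simp] theorem rH_ne_rV {a b : ℕ} : rH a ≠ rV b := by unfold rH rV; omega
@[simp] theorem rT_ne_rH {a b : ℕ} : rT a ≠ rH b := by unfold rT rH; omega
@[simp] theorem rH_ne_rT {a b : ℕ} : rH a ≠ rT b := by unfold rT rH; omega
@[simp] theorem ne_rT {a : ℕ} : 2 ≠ rT a ∧ 5 ≠ rT a ∧ 8 ≠ rT a ∧ 11 ≠ rT a ∧ 14 ≠ rT a := by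
  unfold rT; omega
@[simp] theorem ne_rV {a : ℕ} : 2 ≠ rV a ∧ 5 ≠ rV a ∧ 8 ≠ rV a ∧ 11 ≠ rV a ∧ 14 ≠ rV a := by
  unfold rV; omega
@[simp] theorem ne_rH {a : ℕ} : 2 ≠ rH a ∧ 5 ≠ rH a ∧ 8 ≠ rH a ∧ 11 ≠ rH a ∧ 14 ≠ rH a := by
  unfold rH; omega

theorem setReg_reg (s : State) (x a y : ℕ) :
    (s.setReg x a).reg y = if y = x then a else s.reg y := by
  simp [State.setReg, Function.update_apply]

@[simp] theorem setReg_mem (s : State) (x a : ℕ) : (s.setReg x a).mem = s.mem := rfl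

theorem setMem_mem (s : State) (x a y : ℕ) :
    (s.setMem x a).mem y = if y = x then a else s.mem y := by
  simp [State.setMem, Function.update_apply]

@[simp] theorem setMem_reg (s : State) (x a : ℕ) : (s.setMem x a).reg = s.reg := rfl

variable {E} {base : ℕ} {σ : St}

theorem ev_le (hE : E.Fits w base) (hv : ∀ x, σ.v x ≤ E.B) (ha : ∀ j i, σ.a j i ≤ E.B) (e : Ex)
    (h : e.ok = true) : ev E σ e ≤ E.B := by
  have := hE.lits
  induction e with
  | lit c => simp only [Ex.ok, decide_eq_true_eq] at h; simp only [ev]; omega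
  | var x => exact hv x
  | top => exact le_rfl
  | inp e _ => exact hE.inp_le _
  | rd j e _ => exact ha _ _
  | add a b | mul a b => exact min_le_right _ _
  | sub a b iha _ =>
    simp only [Ex.ok, Bool.and_eq_true] at h
    exact (Nat.sub_le _ _).trans (iha h.1)
  | div a b iha _ =>
    simp only [Ex.ok, Bool.and_eq_true] at h
    exact (Nat.div_le_self _ _).trans (iha h.1)
  | mod a b iha _ =>
    simp only [Ex.ok, Bool.and_eq_true] at h
    exact (Nat.mod_le _ _).trans (iha h.1)
  | lt a b | eq a b => simp only [ev]; split_ifs <;> omega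

/-- The effect of the code for an expression: only registers for intermediate values change. -/
def ExPost (d val T : ℕ) (s s' : State) (t : ℕ) : Prop :=
  s'.reg (rT d) = val ∧ s'.mem = s.mem ∧ (∀ r, (∀ d', d ≤ d' → r ≠ rT d') → s'.reg r = s.reg r) ∧
    t ≤ T

theorem Rel.of_agree {s' : State} (h : Rel E base σ s) (hm : s'.mem = s.mem)
    (hr : ∀ r, (∀ d, r ≠ rT d) → s'.reg r = s.reg r) : Rel E base σ s' where
  hv x := by rw [hr _ (by simp)]; exact h.hv x
  ha := by rw [hm]; exact h.ha
  hi := by rw [hm]; exact h.hi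
  h2 := by rw [hr _ (fun d => ne_rT.1)]; exact h.h2
  h5 := by rw [hr _ (fun d => ne_rT.2.1)]; exact h.h5
  h8 := by rw [hr _ (fun d => ne_rT.2.2.1)]; exact h.h8
  h11 := by rw [hr _ (fun d => ne_rT.2.2.2.1)]; exact h.h11
  h14 := by rw [hr _ (fun d => ne_rT.2.2.2.2)]; exact h.h14
  bv := h.bv
  ba := h.ba

/-- The code subtracts the excess over `B`, multiplied by the truth value of `B < a + b`. Without an
excess the difference may wrap around, but then it is multiplied by `0`. The same device serves for
`trunc_sub`. -/
theorem sat_add {W B a b : ℕ} (hW : 70 * B + 70 < W) (ha : a ≤ B) (hb : b ≤ B) :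
    ((a + b) % W + (W - ((a + b) % W + (W - B)) % W * ((if B < (a + b) % W then 1 else 0) % W) % W))
      % W = min (a + b) B := by
  rw [Nat.mod_eq_of_lt (show a + b < W by omega)]
  split_ifs with h
  · have : a + b + (W - B) = (a + b - B) + W := by omega
    rw [Nat.mod_eq_of_lt (show 1 < W by omega), this, Nat.add_mod_right, mul_one, Nat.mod_mod,
      Nat.mod_eq_of_lt (show a + b - B < W by omega), show a + b + (W - (a + b - B)) = B + W by omega,
      Nat.add_mod_right, Nat.mod_eq_of_lt (by omega)]
    omega
  · simp only [Nat.zero_mod, mul_zero, Nat.sub_zero, Nat.add_mod_right]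
    rw [Nat.mod_eq_of_lt (by omega)]
    omega

theorem trunc_sub {W B a b : ℕ} (hW : 70 * B + 70 < W) (ha : a ≤ B) (hb : b ≤ B) :
    (a + (W - b)) % W * ((if b < a then 1 else 0) % W) % W = a - b := by
  split_ifs with h
  · have : a + (W - b) = (a - b) + W := by omega
    rw [Nat.mod_eq_of_lt (show 1 < W by omega), this, Nat.add_mod_right, mul_one, Nat.mod_mod,
      Nat.mod_eq_of_lt (by omega)]
  · simp; omega

/-- The frame common to all binary operations: the second operand is evaluated one level deeper,
which leaves the first one in `rT d`. -/
theorem ter_bin {d : ℕ} {a b : Ex} {va vb Ta Tb T val : ℕ} {p : Program}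
    (iha : ∀ d s, Rel E base σ s → Ter w (cEx d a) s (ExPost d va Ta s))
    (ihb : ∀ d s, Rel E base σ s → Ter w (cEx d b) s (ExPost d vb Tb s))
    (hp : ∀ s, Rel E base σ s → s.reg (rT d) = va → s.reg (rT (d + 1)) = vb →
      Ter w p s (ExPost d val T s)) (h : Rel E base σ s) :
    Ter w (.seq (cEx d a) (.seq (cEx (d + 1) b) p)) s (ExPost d val (Ta + Tb + T) s) := by
  rw [ter_seq]
  refine (iha d s h).mono fun s₁ t₁ ⟨e₁, m₁, r₁, l₁⟩ => ?_
  have h₁ := h.of_agree m₁ fun r hr => r₁ r fun d' _ => hr d'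
  rw [ter_seq]
  refine (ihb (d + 1) s₁ h₁).mono fun s₂ t₂ ⟨e₂, m₂, r₂, l₂⟩ => ?_
  have h₂ := h₁.of_agree m₂ fun r hr => r₂ r fun d' _ => hr d'
  refine (hp s₂ h₂ ?_ e₂).mono fun s₃ t₃ ⟨e₃, m₃, r₃, l₃⟩ => ?_
  · rw [r₂ _ (fun d' hd' => by simp; omega), e₁]
  · refine ⟨e₃, by rw [m₃, m₂, m₁], fun r hr => ?_, by omega⟩
    rw [r₃ r hr, r₂ r fun d' hd' => hr d' (by omega), r₁ r hr]

theorem ter_bin_op {o : Op} {d : ℕ} {a b : Ex} {va vb Ta Tb val : ℕ}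
    (iha : ∀ d s, Rel E base σ s → Ter w (cEx d a) s (ExPost d va Ta s))
    (ihb : ∀ d s, Rel E base σ s → Ter w (cEx d b) s (ExPost d vb Tb s))
    (hv : o.eval w va vb = val) (h : Rel E base σ s) :
    Ter w (.seq (cEx d a) (.seq (cEx (d + 1) b) (.op o (rT d) (rT d) (rT (d + 1))))) s
      (ExPost d val (Ta + Tb + 8) s) := by
  refine ter_bin iha ihb (fun s h e₁ e₂ => ?_) h
  rw [ter_op]
  refine ⟨?_, by simp, fun r hr => by simp [setReg_reg, hr d le_rfl], by omega⟩
  simp only [setReg_reg, if_true, e₁, e₂, hv]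

theorem cEx_correct (hE : E.Fits w base) (e : Ex) (he : e.ok = true) (d : ℕ) (s : State)
    (h : Rel E base σ s) : Ter w (cEx d e) s (ExPost d (ev E σ e) (exT e) s) := by
  have hb := hE.bnd
  have hl := hE.lits
  have hW : 0 < 2 ^ w := by omega
  induction e generalizing d s with
  | lit c =>
    simp only [Ex.ok, decide_eq_true_eq] at he
    rw [cEx, ter_const]
    refine ⟨?_, rfl, fun r hr => ?_, le_rfl⟩
    · simp only [setReg_reg, if_true, ev]
      exact Nat.mod_eq_of_lt (by omega)
    · simp [setReg_reg, hr d le_rfl]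
  | var x =>
    rw [cEx, ter_op]
    refine ⟨?_, rfl, fun r hr => ?_, le_rfl⟩
    · have := h.bv x
      simp only [setReg_reg, if_true, ev, Op.eval, h.hv, h.h14]
      exact Nat.mod_eq_of_lt (by omega)
    · simp [setReg_reg, hr d le_rfl]
  | top =>
    rw [cEx, ter_op]
    refine ⟨?_, rfl, fun r hr => ?_, le_rfl⟩
    · simp only [setReg_reg, if_true, ev, Op.eval, h.h2, h.h14]
      exact Nat.mod_eq_of_lt (by omega)
    · simp [setReg_reg, hr d le_rfl]
  | inp e ih =>
    have hle := ev_le hE h.bv h.ba e he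
    rw [cEx, ter_seq]
    refine (ih he d s h).mono fun s₁ t₁ ⟨e₁, m₁, r₁, l₁⟩ => ?_
    have h₁ := h.of_agree m₁ fun r hr => r₁ r fun d' _ => hr d'
    simp only [ter_seq, ter_load, ter_op]
    refine ⟨?_, by simp [m₁], fun r hr => ?_, by simp only [exT]; omega⟩
    · have h8 : (8 : ℕ) ≠ rT d := ne_rT.2.2.1
      have h8' : (8 : ℕ) ≠ rT (d + 1) := ne_rT.2.2.1
      simp only [setReg_reg, if_true, Op.eval, rT_inj, h8', if_false, e₁,
        h₁.h8, ev, show d ≠ d + 1 by omega, show d + 1 ≠ d by omega]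
      split_ifs with hlt
      · rw [Nat.mod_eq_of_lt (show 1 < 2 ^ w by omega), one_mul, h₁.hi _ hlt]
        have := hE.inp_le (ev E σ e)
        exact Nat.mod_eq_of_lt (by omega)
      · rw [hE.inp_zero _ (not_lt.1 hlt)]; simp
    · simp [setReg_reg, hr d le_rfl, hr (d + 1) (by omega), r₁ r hr]
  | rd j e ih =>
    simp only [Ex.ok, Bool.and_eq_true, decide_eq_true_eq] at he
    have hle := ev_le hE h.bv h.ba e he.2
    have hbase := hE.base_le
    rw [cEx, ter_seq]
    refine (ih he.2 d s h).mono fun s₁ t₁ ⟨e₁, m₁, r₁, l₁⟩ => ?_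
    have h₁ := h.of_agree m₁ fun r hr => r₁ r fun d' _ => hr d'
    simp only [ter_seq, ter_load, ter_op, ter_const]
    refine ⟨?_, by simp [m₁], fun r hr => ?_, by simp only [exT]; omega⟩
    · have h8 : (8 : ℕ) ≠ rT d := ne_rT.2.2.1
      simp only [setReg_reg, if_true, Op.eval, rT_inj, h8, if_false, e₁,
        h₁.h8, h₁.h5, ev, show d ≠ d + 1 by omega, setReg_mem, show d + 1 ≠ d by omega]
      rw [Nat.mod_eq_of_lt (show ev E σ e * 64 < 2 ^ w by omega),
        Nat.mod_eq_of_lt (show ev E σ e * 64 + base < 2 ^ w by omega),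
        Nat.mod_eq_of_lt (show j < 2 ^ w by omega), Nat.mod_eq_of_lt (by omega)]
      exact h₁.ha _ _ he.1 hle
    · simp [setReg_reg, hr d le_rfl, hr (d + 1) (by omega), r₁ r hr]
  | add a b iha ihb =>
    simp only [Ex.ok, Bool.and_eq_true] at he
    have hle := ev_le hE h.bv h.ba a he.1
    have hle' := ev_le hE h.bv h.ba b he.2
    refine ter_bin (iha he.1) (ihb he.2) (fun s h e₁ e₂ => ?_) h
    have h2 : (2 : ℕ) ≠ rT d := ne_rT.1
    have h2' : (2 : ℕ) ≠ rT (d + 1) := ne_rT.1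
    simp only [ter_seq, ter_op]
    refine ⟨?_, by simp, fun r hr => ?_, by omega⟩
    · simp only [setReg_reg, if_true, Op.eval, rT_inj, if_false, e₁, e₂, h2, h2', h.h2,
        show d ≠ d + 1 by omega, show d + 1 ≠ d by omega, show d ≠ d + 2 by omega,
        show d + 1 ≠ d + 2 by omega]
      exact sat_add hb hle hle'
    · simp [setReg_reg, hr d le_rfl, hr (d + 1) (by omega), hr (d + 2) (by omega)]
  | sub a b iha ihb =>
    simp only [Ex.ok, Bool.and_eq_true] at he
    have hle := ev_le hE h.bv h.ba a he.1
    have hle' := ev_le hE h.bv h.ba b he.2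
    refine ter_bin (iha he.1) (ihb he.2) (fun s h e₁ e₂ => ?_) h
    simp only [ter_seq, ter_op]
    refine ⟨?_, by simp, fun r hr => ?_, by omega⟩
    · simp only [setReg_reg, if_true, Op.eval, rT_inj, if_false, e₁, e₂, show d ≠ d + 2 by omega,
        show d + 1 ≠ d + 2 by omega, show d + 2 ≠ d by omega]
      exact trunc_sub hb hle hle'
    · simp [setReg_reg, hr d le_rfl, hr (d + 2) (by omega)]
  | mul a b iha ihb =>
    simp only [Ex.ok, Bool.and_eq_true] at he
    have hle := ev_le hE h.bv h.ba a he.1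
    have hle' := ev_le hE h.bv h.ba b he.2
    refine ter_bin (iha he.1) (ihb he.2) (fun s h e₁ e₂ => ?_) h
    have h2 : (2 : ℕ) ≠ rT (d + 2) := ne_rT.1
    have h2' : (2 : ℕ) ≠ rT (d + 3) := ne_rT.1
    have h14 : (14 : ℕ) ≠ rT (d + 2) := ne_rT.2.2.2.2
    have h14' : (14 : ℕ) ≠ rT (d + 3) := ne_rT.2.2.2.2
    have hdiv : E.B / ev E σ b % 2 ^ w = E.B / ev E σ b :=
      Nat.mod_eq_of_lt ((Nat.div_le_self _ _).trans_lt (by omega))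
    simp only [ter_seq, ter_op, ter_cond, setReg_reg, if_true, Op.eval, rT_inj, if_false, e₁, e₂,
        h2, h2', h14, h14', h.h2, h.h14, show d ≠ d + 2 by omega, show d + 1 ≠ d + 2 by omega,
        show d + 2 ≠ d + 3 by omega, show d ≠ d + 3 by omega, show d + 1 ≠ d + 3 by omega, hdiv]
    have e1 : 1 % 2 ^ w = 1 := Nat.mod_eq_of_lt (by omega)
    -- Overflow is tested by `E.B / b < a`, which for `b > 0` means `E.B < a * b`. For `b = 0` the
    -- quotient is `0`, and the factor `0 < b` in the code prevents a false alarm.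
    by_cases hpos : 0 < ev E σ b
    · by_cases hlt : E.B / ev E σ b < ev E σ a
      · simp only [hpos, hlt, if_true, e1, mul_one, one_ne_zero, if_false]
        refine ⟨?_, by simp, fun r hr => by
          simp [setReg_reg, hr d le_rfl, hr (d + 2) (by omega), hr (d + 3) (by omega)], by omega⟩
        have hm : E.B < ev E σ a * ev E σ b := (Nat.div_lt_iff_lt_mul hpos).1 hlt
        simp only [setReg_reg, if_true, ev, min_eq_right hm.le]
        exact Nat.mod_eq_of_lt (by omega)
      · simp only [hpos, hlt, if_true, if_false, Nat.zero_mod, zero_mul]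
        refine ⟨?_, by simp, fun r hr => by
          simp [setReg_reg, hr d le_rfl, hr (d + 2) (by omega), hr (d + 3) (by omega)], by omega⟩
        have hm : ev E σ a * ev E σ b ≤ E.B := (Nat.le_div_iff_mul_le hpos).1 (not_lt.1 hlt)
        simp only [setReg_reg, if_true, ev, min_eq_left hm]
        exact Nat.mod_eq_of_lt (by omega)
    · have hz : ev E σ b = 0 := by omega
      simp only [hpos, if_false, if_true, Nat.zero_mod, mul_zero]
      refine ⟨?_, by simp, fun r hr => by
        simp [setReg_reg, hr d le_rfl, hr (d + 2) (by omega), hr (d + 3) (by omega)], by omega⟩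
      simp [setReg_reg, ev, hz]
  | div a b iha ihb =>
    simp only [Ex.ok, Bool.and_eq_true] at he
    have hle := ev_le hE h.bv h.ba a he.1
    exact ter_bin_op (iha he.1) (ihb he.2)
      (Nat.mod_eq_of_lt ((Nat.div_le_self _ _).trans_lt (by omega))) h
  | mod a b iha ihb =>
    simp only [Ex.ok, Bool.and_eq_true] at he
    have hle := ev_le hE h.bv h.ba a he.1
    exact ter_bin_op (iha he.1) (ihb he.2)
      (Nat.mod_eq_of_lt ((Nat.mod_le _ _).trans_lt (by omega))) h
  | lt a b iha ihb | eq a b iha ihb =>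
    simp only [Ex.ok, Bool.and_eq_true] at he
    exact ter_bin_op (iha he.1) (ihb he.2) (Nat.mod_eq_of_lt (by dsimp only; split_ifs <;> omega)) h

/-! ### Correctness of compiled commands. -/

/-- The registers that the code for a command at loop depth `d` leaves alone. -/
def CmdPost (E : Env) (base d : ℕ) (σ' : St) (T : ℕ) (s s' : State) (t : ℕ) : Prop :=
  Rel E base σ' s' ∧ (∀ i, i < 2 * d → s'.reg (rH i) = s.reg (rH i)) ∧ t ≤ T

theorem Rel.setV {s' : State} {x n : ℕ} (h : Rel E base σ s) (hn : n ≤ E.B)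
    (hm : s'.mem = s.mem) (hx : s'.reg (rV x) = n)
    (hr : ∀ r, r ≠ rV x → (∀ d, r ≠ rT d) → (∀ d, r ≠ rH d) → s'.reg r = s.reg r) :
    Rel E base (σ.setV x n) s' where
  hv y := by
    rcases eq_or_ne y x with rfl | hy
    · simp [St.setV, hx]
    · rw [hr _ (by simp [hy]) (by simp) (by simp)]
      simp [St.setV, Function.update_of_ne hy, h.hv]
  ha := by rw [hm]; exact h.ha
  hi := by rw [hm]; exact h.hi
  h2 := by rw [hr _ ne_rV.1 (fun d => ne_rT.1) (fun d => ne_rH.1)]; exact h.h2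
  h5 := by rw [hr _ ne_rV.2.1 (fun d => ne_rT.2.1) (fun d => ne_rH.2.1)]; exact h.h5
  h8 := by
    rw [hr _ ne_rV.2.2.1 (fun d => ne_rT.2.2.1) (fun d => ne_rH.2.2.1)]; exact h.h8
  h11 := by
    rw [hr _ ne_rV.2.2.2.1 (fun d => ne_rT.2.2.2.1) (fun d => ne_rH.2.2.2.1)]; exact h.h11
  h14 := by
    rw [hr _ ne_rV.2.2.2.2 (fun d => ne_rT.2.2.2.2) (fun d => ne_rH.2.2.2.2)]; exact h.h14
  bv y := by
    simp only [St.setV, Function.update_apply]; split_ifs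
    exacts [hn, h.bv y]
  ba := h.ba

theorem Rel.of_reg {s' : State} (h : Rel E base σ s) (hm : s'.mem = s.mem)
    (hr : ∀ r, (∀ d, r ≠ rT d) → (∀ d, r ≠ rH d) → s'.reg r = s.reg r) :
    Rel E base σ s' where
  hv x := by rw [hr _ (by simp) (by simp)]; exact h.hv x
  ha := by rw [hm]; exact h.ha
  hi := by rw [hm]; exact h.hi
  h2 := by rw [hr _ (fun d => ne_rT.1) (fun d => ne_rH.1)]; exact h.h2
  h5 := by rw [hr _ (fun d => ne_rT.2.1) (fun d => ne_rH.2.1)]; exact h.h5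
  h8 := by rw [hr _ (fun d => ne_rT.2.2.1) (fun d => ne_rH.2.2.1)]; exact h.h8
  h11 := by rw [hr _ (fun d => ne_rT.2.2.2.1) (fun d => ne_rH.2.2.2.1)]; exact h.h11
  h14 := by rw [hr _ (fun d => ne_rT.2.2.2.2) (fun d => ne_rH.2.2.2.2)]; exact h.h14
  bv := h.bv
  ba := h.ba

theorem Rel.setA {j i n : ℕ} (h : Rel E base σ s) (hj : j < 64) (hn : n ≤ E.B) :
    Rel E base (σ.setA j i n) (s.setMem (i * 64 + base + j) n) where
  hv := h.hv
  ha j' i' hj' hi' := by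
    rw [setMem_mem, setA_apply, h.ha _ _ hj' hi']
    exact if_congr ⟨fun h => by omega, fun h => by omega⟩ rfl rfl
  hi i' hi' := by rw [setMem_mem, if_neg (by omega)]; exact h.hi _ hi'
  h2 := h.h2
  h5 := h.h5
  h8 := h.h8
  h11 := h.h11
  h14 := h.h14
  bv := h.bv
  ba j' i' := by
    rw [setA_apply]
    split_ifs
    exacts [hn, h.ba _ _]

/-- Induction on the number `k` of indices left. The second alternative for the upper bound covers
an empty range, where that bound may lie below the lower one. -/
theorem loop_correct {d x : ℕ} {g : Ex} {c : Cmd} (hE : E.Fits w base) (hg : g.ok = true)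
    (ih : ∀ σ s, Rel E base σ s → Ter w (cCmd (d + 1) c) s
      (CmdPost E base (d + 1) (run E c σ) (cmdT c * cost E c σ) s)) (k i : ℕ) (σ : St) (s : State)
    (h : Rel E base σ s) (hi : s.reg (rH (2 * d)) = i)
    (hk : s.reg (rH (2 * d + 1)) = i + k ∨ (k = 0 ∧ s.reg (rH (2 * d + 1)) ≤ i))
    (hB : i + k ≤ E.B) (hT : s.reg (rT 0) = if k = 0 then 0 else 1) :
    Ter w (.loop (rT 0) (.seq (.op .add (rV x) (rH (2 * d)) 14) (.seq (cEx 0 g) (.cond (rT 0)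
        (.seq (cCmd (d + 1) c) (.seq (.op .add (rH (2 * d)) (rH (2 * d)) 11)
          (.op .lt (rT 0) (rH (2 * d)) (rH (2 * d + 1))))) .skip)))) s
      (CmdPost E base d (loopRun x (fun s => ev E s g) (run E c) k i σ)
        ((exT g + cmdT c + 6) *
          loopCost x (fun s => ev E s g) (run E c) (cost E c) k i σ) s) := by
  have hb := hE.bnd
  induction k generalizing i σ s with
  | zero =>
    rw [ter_loop_done (by simpa using hT)]
    refine ⟨h, fun _ _ => rfl, ?_⟩
    simp only [loopCost]; omega
  | succ k ihk =>
    rw [if_neg (by omega)] at hT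
    refine ter_loop_step (by omega) ?_
    have hV : Rel E base (σ.setV x i) (s.setReg (rV x) i) :=
      h.setV (by omega) rfl (by simp [setReg_reg]) fun r h1 h2 h3 => by simp [setReg_reg, h1]
    have e0 : Op.add.eval w (s.reg (rH (2 * d))) (s.reg 14) = i := by
      simp only [Op.eval, hi, h.h14]; exact Nat.mod_eq_of_lt (by omega)
    rw [ter_seq, ter_op, e0, ter_seq]
    refine (cEx_correct hE g hg 0 _ hV).mono fun s₁ t₁ ⟨e₁, m₁, r₁, l₁⟩ => ?_
    have h₁ := hV.of_agree m₁ fun r hr => r₁ r fun d' _ => hr d'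
    have hH : ∀ j, s₁.reg (rH j) = s.reg (rH j) := fun j => by
      rw [r₁ _ (by simp)]; simp [setReg_reg]
    rw [ter_cond, e₁]
    split_ifs with hg0
    · rw [ter_skip]
      rw [ter_loop_done (by rw [e₁, hg0])]
      refine ⟨?_, fun j _ => hH j, ?_⟩
      · simpa only [loopRun, hg0, if_true] using h₁
      · simp only [loopCost, hg0, if_true]; omega
    · rw [ter_seq]
      refine (ih _ _ h₁).mono fun s₂ t₂ ⟨h₂, r₂, l₂⟩ => ?_
      rw [ter_seq, ter_op, ter_op]
      have e1 : Op.add.eval w (s₂.reg (rH (2 * d))) (s₂.reg 11) = i + 1 := by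
        simp only [Op.eval, r₂ (2 * d) (by omega), hH, hi, h₂.h11]
        exact Nat.mod_eq_of_lt (by omega)
      have hl : s₂.reg (rH (2 * d + 1)) = i + 1 + k := by
        rw [r₂ _ (by omega), hH]; omega
      rw [e1]
      set s₃ := s₂.setReg (rH (2 * d)) (i + 1) with hs₃
      have e2 : s₃.reg (rH (2 * d)) = i + 1 := by simp [hs₃, setReg_reg]
      have e3 : s₃.reg (rH (2 * d + 1)) = i + 1 + k := by simp [hs₃, setReg_reg, hl]
      have e4 : Op.lt.eval w (s₃.reg (rH (2 * d))) (s₃.reg (rH (2 * d + 1))) =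
          if k = 0 then 0 else 1 := by
        rw [e2, e3]
        simp only [Op.eval]
        split_ifs
        · omega
        · exact Nat.mod_eq_of_lt (by omega)
        · simp
        · omega
      rw [e4]
      have h₃ : Rel E base (run E c (σ.setV x i))
          (s₃.setReg (rT 0) (if k = 0 then 0 else 1)) :=
        h₂.of_reg rfl fun r h1 h2 => by
          rw [setReg_reg, if_neg (h1 0), hs₃, setReg_reg, if_neg (h2 _)]
      refine (ihk (i + 1) _ _ h₃ (by simp [setReg_reg, e2]) (Or.inl (by simp [setReg_reg, e3]))
        (by omega) (by simp [setReg_reg])).mono fun s₄ t₄ ⟨h₄, r₄, l₄⟩ => ?_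
      refine ⟨?_, fun j hj => ?_, ?_⟩
      · simpa only [loopRun, hg0, if_false] using h₄
      · rw [r₄ j hj, setReg_reg, if_neg (by simp), hs₃, setReg_reg,
          if_neg (by simp; omega), r₂ j (by omega), hH]
      · simp only [loopCost, hg0, if_false]
        have hc : cmdT c * cost E c (σ.setV x i) ≤ (exT g + cmdT c + 6) * cost E c (σ.setV x i) :=
          Nat.mul_le_mul_right _ (by omega)
        rw [mul_add, mul_add, mul_one]
        omega

theorem one_le_cost (c : Cmd) (σ : St) : 1 ≤ cost E c σ := by
  induction c generalizing σ with
  | skip | asg _ _ | wr _ _ _ => exact le_rfl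
  | seq c d ihc _ => exact (ihc σ).trans (Nat.le_add_right _ _)
  | ite e c d _ _ => exact Nat.le_add_right _ _
  | loop x lo hi g c _ =>
    simp only [cost]
    cases ev E σ hi - ev E σ lo with
    | zero => exact le_rfl
    | succ k => simp only [loopCost]; split_ifs <;> omega

theorem cCmd_correct (hE : E.Fits w base) (c : Cmd) (hc : c.ok = true) (d : ℕ) (σ : St)
    (s : State) (h : Rel E base σ s) :
    Ter w (cCmd d c) s (CmdPost E base d (run E c σ) (cmdT c * cost E c σ) s) := by
  have hb := hE.bnd
  induction c generalizing d σ s with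
  | skip => rw [cCmd, ter_skip]; exact ⟨h, fun _ _ => rfl, le_rfl⟩
  | asg x e =>
    rw [cCmd, ter_seq]
    have hle := ev_le hE h.bv h.ba e hc
    refine (cEx_correct hE e hc 0 s h).mono fun s₁ t₁ ⟨e₁, m₁, r₁, l₁⟩ => ?_
    have h₁ := h.of_agree m₁ fun r hr => r₁ r fun d' _ => hr d'
    rw [ter_op]
    have e0 : Op.add.eval w (s₁.reg (rT 0)) (s₁.reg 14) = ev E σ e := by
      simp only [Op.eval, e₁, h₁.h14]; exact Nat.mod_eq_of_lt (by omega)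
    rw [e0]
    refine ⟨h₁.setV hle rfl (by simp [setReg_reg]) fun r h1 _ _ => by simp [setReg_reg, h1],
      fun i _ => ?_, by simp only [cmdT, cost]; omega⟩
    rw [setReg_reg, if_neg (by simp), r₁ _ (by simp)]
  | wr j i e =>
    simp only [Cmd.ok, Bool.and_eq_true, decide_eq_true_eq] at hc
    obtain ⟨⟨hj, hi⟩, he⟩ := hc
    have hle := ev_le hE h.bv h.ba i hi
    have hle' := ev_le hE h.bv h.ba e he
    have hbase := hE.base_le
    rw [cCmd, ter_seq]
    refine (cEx_correct hE i hi 0 s h).mono fun s₁ t₁ ⟨e₁, m₁, r₁, l₁⟩ => ?_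
    have h₁ := h.of_agree m₁ fun r hr => r₁ r fun d' _ => hr d'
    rw [ter_seq]
    refine (cEx_correct hE e he 1 s₁ h₁).mono fun s₂ t₂ ⟨e₂, m₂, r₂, l₂⟩ => ?_
    have h₂ := h₁.of_agree m₂ fun r hr => r₂ r fun d' _ => hr d'
    have e₁' : s₂.reg (rT 0) = ev E σ i := by
      rw [r₂ _ (fun d' hd' => by simp; omega), e₁]
    have h8 : (8 : ℕ) ≠ rT 0 := ne_rT.2.2.1
    simp only [ter_seq, ter_op, ter_const, ter_store, setReg_reg, if_true, Op.eval, rT_inj, h8,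
      if_false, e₂, e₁', h₂.h8, h₂.h5, show (0 : ℕ) ≠ 2 by omega, show (1 : ℕ) ≠ 2 by omega,
      show (1 : ℕ) ≠ 0 by omega]
    rw [Nat.mod_eq_of_lt (show ev E σ i * 64 < 2 ^ w by omega),
        Nat.mod_eq_of_lt (show ev E σ i * 64 + base < 2 ^ w by omega),
        Nat.mod_eq_of_lt (show j < 2 ^ w by omega), Nat.mod_eq_of_lt (by omega)]
    refine ⟨Rel.setA (h₂.of_agree rfl fun r hr => ?_) hj hle', fun k _ => ?_, ?_⟩
    · simp [setReg_reg, hr]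
    · simp only [setMem_reg, setReg_reg, rH_ne_rT, if_false]
      rw [r₂ _ (by simp), r₁ _ (by simp)]
    · simp only [cmdT, cost]; omega
  | seq c₁ c₂ ih₁ ih₂ =>
    simp only [Cmd.ok, Bool.and_eq_true] at hc
    rw [cCmd, ter_seq]
    refine (ih₁ hc.1 d σ s h).mono fun s₁ t₁ ⟨h₁, r₁, l₁⟩ => ?_
    refine (ih₂ hc.2 d _ s₁ h₁).mono fun s₂ t₂ ⟨h₂, r₂, l₂⟩ => ?_
    refine ⟨h₂, fun i hi => by rw [r₂ i hi, r₁ i hi], ?_⟩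
    simp only [cmdT, cost]
    have := Nat.le_add_right (cmdT c₁ * cost E c₁ σ) (cmdT c₂ * cost E c₁ σ)
    have := Nat.le_add_left (cmdT c₂ * cost E c₂ (run E c₁ σ)) (cmdT c₁ * cost E c₂ (run E c₁ σ))
    rw [add_mul, mul_add, mul_add]
    omega
  | ite e c₁ c₂ ih₁ ih₂ =>
    simp only [Cmd.ok, Bool.and_eq_true] at hc
    rw [cCmd, ter_seq]
    refine (cEx_correct hE e hc.1.1 0 s h).mono fun s₁ t₁ ⟨e₁, m₁, r₁, l₁⟩ => ?_
    have h₁ := h.of_agree m₁ fun r hr => r₁ r fun d' _ => hr d'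
    rw [ter_cond, e₁]
    split_ifs with h0
    · refine (ih₂ hc.2 d _ s₁ h₁).mono fun s₂ t₂ ⟨h₂, r₂, l₂⟩ => ?_
      refine ⟨by simpa only [run, h0, if_true] using h₂, fun i hi => ?_, ?_⟩
      · rw [r₂ i hi, r₁ _ (by simp)]
      · simp only [cmdT, cost, h0, if_true, mul_add, add_mul, mul_one]
        omega
    · refine (ih₁ hc.1.2 d _ s₁ h₁).mono fun s₂ t₂ ⟨h₂, r₂, l₂⟩ => ?_
      refine ⟨by simpa only [run, h0, if_false] using h₂, fun i hi => ?_, ?_⟩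
      · rw [r₂ i hi, r₁ _ (by simp)]
      · simp only [cmdT, cost, h0, if_false, mul_add, add_mul, mul_one]
        omega
  | loop x lo hi g c ih =>
    simp only [Cmd.ok, Bool.and_eq_true] at hc
    obtain ⟨⟨⟨hlo, hhi⟩, hg⟩, hc⟩ := hc
    have hle := ev_le hE h.bv h.ba lo hlo
    have hle' := ev_le hE h.bv h.ba hi hhi
    rw [cCmd, ter_seq]
    refine (cEx_correct hE lo hlo 0 s h).mono fun s₁ t₁ ⟨e₁, m₁, r₁, l₁⟩ => ?_
    have h₁ := h.of_agree m₁ fun r hr => r₁ r fun d' _ => hr d'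
    rw [ter_seq]
    refine (cEx_correct hE hi hhi 1 s₁ h₁).mono fun s₂ t₂ ⟨e₂, m₂, r₂, l₂⟩ => ?_
    have h₂ := h₁.of_agree m₂ fun r hr => r₂ r fun d' _ => hr d'
    have e₁' : s₂.reg (rT 0) = ev E σ lo := by
      rw [r₂ _ (fun d' hd' => by simp; omega), e₁]
    have h14 : ∀ d, (14 : ℕ) ≠ rH d := fun d => ne_rH.2.2.2.2
    have z1 : (ev E σ lo + 0) % 2 ^ w = ev E σ lo := Nat.mod_eq_of_lt (by omega)
    have z2 : (ev E σ hi + 0) % 2 ^ w = ev E σ hi := Nat.mod_eq_of_lt (by omega)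
    have z3 : 1 % 2 ^ w = 1 := Nat.mod_eq_of_lt (by omega)
    rw [ter_seq, ter_op, ter_seq, ter_op, ter_seq, ter_op]
    simp only [setReg_reg, if_true, Op.eval, rH_inj, rT_ne_rH, h14,
      if_false, e₂, e₁', h₂.h14, z1, z2, show ¬ (2 * d = 2 * d + 1) by omega]
    have e4 : (if ev E σ lo < ev E σ hi then 1 else 0) % 2 ^ w =
        if ev E σ hi - ev E σ lo = 0 then 0 else 1 := by
      split_ifs <;> first | omega | simp
    rw [e4]
    have hR : Rel E base σ (((s₂.setReg (rH (2 * d)) (ev E σ lo)).setReg (rH (2 * d + 1))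
        (ev E σ hi)).setReg (rT 0) (if ev E σ hi - ev E σ lo = 0 then 0 else 1)) :=
      h₂.of_reg rfl fun r h1 h2 => by simp only [setReg_reg, h1, h2, if_false]
    refine (loop_correct (x := x) hE hg (fun σ s h => ih hc (d + 1) σ s h)
      (ev E σ hi - ev E σ lo) (ev E σ lo) σ _ hR ?_ ?_ ?_ ?_).mono
      fun s₃ t₃ ⟨h₃, r₃, l₃⟩ => ?_
    · simp [setReg_reg]
    · simp [setReg_reg]; omega
    · omega
    · simp [setReg_reg]
    · refine ⟨h₃, fun i hi => ?_, ?_⟩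
      · rw [r₃ i hi]
        simp only [setReg_reg, rH_ne_rT, if_false, rH_inj]
        rw [if_neg (by omega), if_neg (by omega), r₂ _ (by simp), r₁ _ (by simp)]
      -- Evaluating the bounds and setting up the registers takes a fixed time, which is charged to
      -- the cost of the loop; that cost is at least `1`.
      · have h1 := one_le_cost (E := E) (.loop x lo hi g c) σ
        have := Nat.le_mul_of_pos_right (exT lo + exT hi + 6) h1
        simp only [cmdT]
        rw [show exT lo + exT hi + exT g + cmdT c + 12 =
          (exT g + cmdT c + 6) + (exT lo + exT hi + 6) by ring, add_mul]
        simp only [cost] at this ⊢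
        omega

end Compile

section Start

open WordRAM

/-- The initial state of the saturating machine. -/
def St.init (n m : ℕ) : St where
  v i := if i = 0 then n else if i = 1 then m else 0
  a _ _ := 0

/-- The complete word RAM program: set up the constants, run `c`, move the result. -/
def compile (c : Cmd) : Program :=
  .seq (.op .add 3 1 14) (.seq (.const 11 1) (.seq (.op .sub 2 14 11) (.seq (.const 5 256)
    (.seq (.op .div 2 2 5) (.seq (.const 5 64) (.seq (.op .add 8 1 1) (.seq (.op .add 8 8 1)
    (.seq (.op .add 8 8 0) (.seq (cCmd 0 c)
    (.seq (.op .add 0 6 14) (.op .add 1 9 14)))))))))))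

theorem inputMem_eq_zero {n m : ℕ} (G : BicoloredDigraph n m) {i : ℕ} (h : n + 3 * m ≤ i) :
    G.inputMem i = 0 := by
  rw [BicoloredDigraph.inputMem, dif_neg (by omega), dif_neg (by omega)]

theorem inputMem_le {n m B : ℕ} (G : BicoloredDigraph n m) (hn : n ≤ B) (h1 : 1 ≤ B)
    (hB : ∀ e, G.weight e ≤ B) (i : ℕ) : G.inputMem i ≤ B := by
  rw [BicoloredDigraph.inputMem]
  split_ifs
  · exact h1
  · exact Nat.zero_le _
  · exact (Fin.is_lt _).le.trans hn
  · exact (Fin.is_lt _).le.trans hn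
  · exact hB _
  · exact Nat.zero_le _

/-- The saturating machine on word length `w` and input `G`. -/
def Env.of (w : ℕ) {n m : ℕ} (G : BicoloredDigraph n m) : Env where
  B := (2 ^ w - 1) / 256
  I := G.inputMem

/-- Register `3` is the place of variable `1`, so `m` is moved there, while `n` already sits at
variable `0`. The largest word arises as `0 - 1`, and a 256th of it is the saturation bound; `256`
leaves room for the factor `70` in `Env.Fits`, given that the bound is at least `64`. Variables `2`
and `3`, that is registers `6` and `9`, carry the result. -/
theorem compile_correct (c : Cmd) (hc : c.ok = true) {n m w : ℕ} (G : BicoloredDigraph n m)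
    (hnm : n + 3 * m ≤ (2 ^ w - 1) / 256) (h64 : 64 ≤ (2 ^ w - 1) / 256)
    (hw : ∀ e, G.weight e ≤ (2 ^ w - 1) / 256) :
    ∃ s t, Runs w (compile c) G.inputState s t ∧
      t ≤ (cmdT c + 11) * cost (Env.of w G) c (St.init n m) ∧
      s.output = if (run (Env.of w G) c (St.init n m)).v 2 = 0 then (⊤ : ℕ∞) else
        ((run (Env.of w G) c (St.init n m)).v 3 : ℕ∞) := by
  set E := Env.of w G with hE
  have hB : E.B = (2 ^ w - 1) / 256 := rfl
  have hF : E.Fits w (n + 3 * m) :=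
    { bnd := by rw [hB]; omega
      lits := by rw [hB]; omega
      base_le := by rw [hB]; omega
      inp_le := inputMem_le G (B := (2 ^ w - 1) / 256) (by omega) (by omega) hw
      inp_zero := fun i hi => inputMem_eq_zero G hi }
  change Ter w (compile c) G.inputState fun s t => _
  have m1 : 1 % 2 ^ w = 1 := Nat.mod_eq_of_lt (by omega)
  have m2 : (0 + (2 ^ w - 1)) % 2 ^ w = 2 ^ w - 1 := by
    rw [zero_add]; exact Nat.mod_eq_of_lt (by omega)
  have m3 : 256 % 2 ^ w = 256 := Nat.mod_eq_of_lt (by omega)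
  have m4 : (2 ^ w - 1) / 256 % 2 ^ w = (2 ^ w - 1) / 256 := Nat.mod_eq_of_lt (by omega)
  have m5 : 64 % 2 ^ w = 64 := Nat.mod_eq_of_lt (by omega)
  have m6 : (m + m) % 2 ^ w = m + m := Nat.mod_eq_of_lt (by omega)
  have m7 : (m + m + m) % 2 ^ w = m + m + m := Nat.mod_eq_of_lt (by omega)
  have m8 : (m + m + m + n) % 2 ^ w = n + 3 * m := by
    rw [Nat.mod_eq_of_lt (by omega)]; omega
  have m9 : (m + 0) % 2 ^ w = m := by
    rw [add_zero]; exact Nat.mod_eq_of_lt (by omega)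
  simp only [compile, ter_seq, ter_op, ter_const, Op.eval, setReg_reg]
  simp only [BicoloredDigraph.inputState, reduceIte, OfNat.ofNat_ne_zero, OfNat.ofNat_ne_one,
    OfNat.one_ne_ofNat, OfNat.zero_ne_ofNat, Nat.reduceEqDiff, one_ne_zero,
    m1, m2, m3, m4, m5, m6, m7, m8, m9]
  refine (cCmd_correct hF c hc 0 (St.init n m) _ ?_).mono fun s t ⟨h, _, ht⟩ => ?_
  · refine ⟨fun x => ?_, fun j i hj hi => ?_, fun i _ => rfl, ?_, ?_, ?_, ?_, ?_, fun x => ?_,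
      fun j i => Nat.zero_le _⟩
    · by_cases h1 : x = 1
      · simp [setReg_reg, rV, St.init, h1]
      · have e1 : 3 * x ≠ 8 := by omega
        have e2 : 3 * x ≠ 5 := by omega
        have e3 : 3 * x ≠ 2 := by omega
        have e4 : 3 * x ≠ 11 := by omega
        have e5 : 3 * x ≠ 3 := by omega
        have e6 : 3 * x ≠ 1 := by omega
        simp only [setReg_reg, rV, St.init, h1, e1, e2, e3, e4, e5, e6, if_false]
        simp
    · simp only [setReg_mem, St.init]
      exact inputMem_eq_zero G (by omega)
    · simp [setReg_reg, hB]
    · simp [setReg_reg]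
    · simp [setReg_reg]
    · simp [setReg_reg]
    · simp [setReg_reg]
    · simp only [St.init]; split_ifs <;> omega
  · refine ⟨?_, ?_⟩
    · have := one_le_cost (E := E) c (St.init n m)
      rw [add_mul]; omega
    · have e2 := h.hv 2
      have e3 := h.hv 3
      simp only [rV] at e2 e3
      have b2 := h.bv 2
      have b3 := h.bv 3
      have n2 : ((run E c (St.init n m)).v 2 + 0) % 2 ^ w = (run E c (St.init n m)).v 2 :=
        Nat.mod_eq_of_lt (by omega)
      have n3 : ((run E c (St.init n m)).v 3 + 0) % 2 ^ w = (run E c (St.init n m)).v 3 :=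
        Nat.mod_eq_of_lt (by omega)
      simp only [State.output, setReg_reg, h.h14]
      simp only [reduceIte, zero_ne_one, one_ne_zero, e2, e3, n2, n3, Nat.reduceMul] at *

end Start

/-! ### Reasoning about programs -/

infixr:60 " ;; " => Cmd.seq

/-- A loop without guard. -/
abbrev Cmd.for (x : ℕ) (lo hi : Ex) (c : Cmd) : Cmd := .loop x lo hi 1 c

/-- A conditional without alternative. -/
abbrev Cmd.when (e : Ex) (c : Cmd) : Cmd := .ite e c .skip

/-- Whether a command can change a variable. -/
def Cmd.wv : Cmd → ℕ → Bool
  | .skip, _ => false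
  | .asg x _, y => y == x
  | .wr _ _ _, _ => false
  | .seq c d, y => c.wv y || d.wv y
  | .ite _ c d, y => c.wv y || d.wv y
  | .loop x _ _ _ c, y => y == x || c.wv y

/-- Whether a command can change an array. -/
def Cmd.wa : Cmd → ℕ → Bool
  | .skip, _ => false
  | .asg _ _, _ => false
  | .wr j _ _, y => y == j
  | .seq c d, y => c.wa y || d.wa y
  | .ite _ c d, y => c.wa y || d.wa y
  | .loop _ _ _ _ c, y => c.wa y

@[simp] theorem setV_v (s : St) (x n y : ℕ) : (s.setV x n).v y = if y = x then n else s.v y := by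
  simp [St.setV, Function.update_apply]

@[simp] theorem setV_a (s : St) (x n : ℕ) : (s.setV x n).a = s.a := rfl

@[simp] theorem setA_v (s : St) (j i n : ℕ) : (s.setA j i n).v = s.v := rfl

@[simp] theorem setA_a (s : St) (j i n k : ℕ) :
    (s.setA j i n).a k = if k = j then Function.update (s.a j) i n else s.a k := by
  ext i'
  rw [setA_apply]
  by_cases h : k = j
  · subst h; simp [Function.update_apply]
  · simp [h]

variable {E : Env}

@[simp] theorem ev_0 (s : St) : ev E s 0 = 0 := rfl
@[simp] theorem ev_1 (s : St) : ev E s 1 = 1 := rfl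
@[simp] theorem ev_2 (s : St) : ev E s 2 = 2 := rfl
@[simp] theorem ev_3 (s : St) : ev E s 3 = 3 := rfl
@[simp] theorem ev_4 (s : St) : ev E s 4 = 4 := rfl
@[simp] theorem ev_var (s : St) (x : ℕ) : ev E s (.var x) = s.v x := rfl
@[simp] theorem ev_top (s : St) : ev E s .top = E.B := rfl
@[simp] theorem ev_inp (s : St) (e : Ex) : ev E s (.inp e) = E.I (ev E s e) := rfl
@[simp] theorem ev_rd (s : St) (j : ℕ) (e : Ex) : ev E s (.rd j e) = s.a j (ev E s e) := rfl
@[simp] theorem ev_add (s : St) (a b : Ex) : ev E s (a + b) = min (ev E s a + ev E s b) E.B := rfl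
@[simp] theorem ev_sub (s : St) (a b : Ex) : ev E s (a - b) = ev E s a - ev E s b := rfl
@[simp] theorem ev_mul (s : St) (a b : Ex) : ev E s (a * b) = min (ev E s a * ev E s b) E.B := rfl
@[simp] theorem ev_div (s : St) (a b : Ex) : ev E s (.div a b) = ev E s a / ev E s b := rfl
@[simp] theorem ev_mod (s : St) (a b : Ex) : ev E s (.mod a b) = ev E s a % ev E s b := rfl
@[simp] theorem ev_lt (s : St) (a b : Ex) :
    ev E s (.lt a b) = if ev E s a < ev E s b then 1 else 0 := rfl
@[simp] theorem ev_eq (s : St) (a b : Ex) :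
    ev E s (.eq a b) = if ev E s a = ev E s b then 1 else 0 := rfl

@[simp] theorem run_skip (s : St) : run E .skip s = s := rfl
@[simp] theorem run_asg (s : St) (x : ℕ) (e : Ex) : run E (.asg x e) s = s.setV x (ev E s e) := rfl
@[simp] theorem run_wr (s : St) (j : ℕ) (i e : Ex) :
    run E (.wr j i e) s = s.setA j (ev E s i) (ev E s e) := rfl
@[simp] theorem run_seq (s : St) (c d : Cmd) : run E (c ;; d) s = run E d (run E c s) := rfl
@[simp] theorem run_ite (s : St) (e : Ex) (c d : Cmd) :
    run E (.ite e c d) s = if ev E s e = 0 then run E d s else run E c s := rfl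
@[simp] theorem cost_skip (s : St) : cost E .skip s = 1 := rfl
@[simp] theorem cost_asg (s : St) (x : ℕ) (e : Ex) : cost E (.asg x e) s = 1 := rfl
@[simp] theorem cost_wr (s : St) (j : ℕ) (i e : Ex) : cost E (.wr j i e) s = 1 := rfl
@[simp] theorem cost_seq (s : St) (c d : Cmd) :
    cost E (c ;; d) s = cost E c s + cost E d (run E c s) := rfl
@[simp] theorem cost_ite (s : St) (e : Ex) (c d : Cmd) :
    cost E (.ite e c d) s = 1 + if ev E s e = 0 then cost E d s else cost E c s := rfl

/-- The variables that a program may write are computed from its text, so the side condition holds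
by evaluation; for programs that depend on an orientation it does so after a case distinction. -/
theorem run_v (c : Cmd) (s : St) (y : ℕ) (h : c.wv y = false := by first | rfl | (cases ‹Bool› <;> rfl)) :
    (run E c s).v y = s.v y := by
  induction c generalizing s with
  | skip => rfl
  | asg x e =>
    simp only [Cmd.wv, beq_eq_false_iff_ne] at h
    simp [h]
  | wr j i e => rfl
  | seq c d ihc ihd =>
    simp only [Cmd.wv, Bool.or_eq_false_iff] at h
    rw [run_seq, ihd _ h.2, ihc _ h.1]
  | ite e c d ihc ihd =>
    simp only [Cmd.wv, Bool.or_eq_false_iff] at h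
    rw [run_ite]; split_ifs
    exacts [ihd _ h.2, ihc _ h.1]
  | loop x lo hi g c ih =>
    simp only [Cmd.wv, Bool.or_eq_false_iff, beq_eq_false_iff_ne] at h
    simp only [run]
    generalize ev E s hi - ev E s lo = k
    generalize ev E s lo = i
    induction k generalizing i s with
    | zero => rfl
    | succ k ihk =>
      simp only [loopRun]
      split_ifs
      · simp [h.1]
      · rw [ihk, ih _ h.2]; simp [h.1]

theorem run_a (c : Cmd) (s : St) (j : ℕ) (h : c.wa j = false := by first | rfl | (cases ‹Bool› <;> rfl)) :
    (run E c s).a j = s.a j := by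
  induction c generalizing s with
  | skip => rfl
  | asg x e => rfl
  | wr j i e =>
    simp only [Cmd.wa, beq_eq_false_iff_ne] at h
    simp [h]
  | seq c d ihc ihd =>
    simp only [Cmd.wa, Bool.or_eq_false_iff] at h
    rw [run_seq, ihd _ h.2, ihc _ h.1]
  | ite e c d ihc ihd =>
    simp only [Cmd.wa, Bool.or_eq_false_iff] at h
    rw [run_ite]; split_ifs
    exacts [ihd _ h.2, ihc _ h.1]
  | loop x lo hi g c ih =>
    simp only [Cmd.wa] at h
    simp only [run]
    generalize ev E s hi - ev E s lo = k
    generalize ev E s lo = i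
    induction k generalizing i s with
    | zero => rfl
    | succ k ihk =>
      simp only [loopRun]
      split_ifs
      · simp
      · rw [ihk, ih _ h]; simp

/-! ### Loop rules with running times and frame conditions. -/

/-- Invariant rule for loops; the third argument of the invariant is the time used so far. -/
theorem loop_rule {x : ℕ} {lo hi g : Ex} {c : Cmd} {s : St} (P : ℕ → St → ℕ → Prop)
    (h0 : P (ev E s lo) s 0)
    (hs : ∀ i s' t, ev E s lo ≤ i → i < ev E s hi → P i s' t → ev E (s'.setV x i) g ≠ 0 →
      P (i + 1) (run E c (s'.setV x i)) (t + (cost E c (s'.setV x i) + 1))) :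
    ∃ i s' t, P i s' t ∧ cost E (.loop x lo hi g c) s ≤ t + 2 ∧
      ((i < ev E s hi ∧ ev E (s'.setV x i) g = 0 ∧ run E (.loop x lo hi g c) s = s'.setV x i) ∨
        (i = max (ev E s lo) (ev E s hi) ∧ run E (.loop x lo hi g c) s = s')) := by
  simp only [run, cost]
  set H := ev E s hi
  set L := ev E s lo
  suffices ∀ k i s' t, k = H - i → L ≤ i → (i ≤ max L H) → P i s' t → ∃ i₁ s₁ t₁, P i₁ s₁ t₁ ∧
        t + loopCost x (fun s => ev E s g) (run E c) (cost E c) k i s' ≤ t₁ + 2 ∧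
        ((i₁ < H ∧ ev E (s₁.setV x i₁) g = 0 ∧
          loopRun x (fun s => ev E s g) (run E c) k i s' = s₁.setV x i₁) ∨
        (i₁ = max L H ∧ loopRun x (fun s => ev E s g) (run E c) k i s' = s₁)) by
    simpa using this (H - L) L s 0 rfl le_rfl (le_max_left _ _) h0
  intro k
  induction k with
  | zero =>
    intro i s' t hk hL hi hP
    exact ⟨i, s', t, hP, by simp [loopCost], Or.inr ⟨by omega, rfl⟩⟩
  | succ k ih =>
    intro i s' t hk hL hi hP
    simp only [loopRun, loopCost]
    split_ifs with hg
    · exact ⟨i, s', t, hP, le_rfl, Or.inl ⟨by omega, hg, rfl⟩⟩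
    · obtain ⟨i₁, s₁, t₁, h1, h2, h3⟩ := ih (i + 1) _ _ (by omega) (by omega) (by omega)
        (hs i s' t hL (by omega) hP hg)
      exact ⟨i₁, s₁, t₁, h1, by omega, h3⟩

theorem for_rule {x : ℕ} {lo hi : Ex} {c : Cmd} {s : St} (P : ℕ → St → ℕ → Prop)
    (hlo : ev E s lo ≤ ev E s hi) (h0 : P (ev E s lo) s 0)
    (hs : ∀ i s' t, ev E s lo ≤ i → i < ev E s hi → P i s' t →
      P (i + 1) (run E c (s'.setV x i)) (t + (cost E c (s'.setV x i) + 1))) :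
    ∃ t, P (ev E s hi) (run E (.for x lo hi c) s) t ∧ cost E (.for x lo hi c) s ≤ t + 2 := by
  obtain ⟨i, s', t, h1, h2, h3⟩ := loop_rule (g := 1) P h0
    (fun i s' t a b d _ => hs i s' t a b d)
  rcases h3 with ⟨_, h, _⟩ | ⟨h3, h4⟩
  · simp at h
  · rw [max_eq_right hlo] at h3
    subst h3
    exact ⟨t, h4 ▸ h1, h2⟩

/-- Invariant rule for loops all whose iterations have the same time bound. -/
theorem for_rule_const {x : ℕ} {lo hi : Ex} {c : Cmd} {s : St} (P : ℕ → St → Prop) (T : ℕ)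
    (hlo : ev E s lo ≤ ev E s hi) (h0 : P (ev E s lo) s)
    (hs : ∀ i s', ev E s lo ≤ i → i < ev E s hi → P i s' →
      P (i + 1) (run E c (s'.setV x i)) ∧ cost E c (s'.setV x i) ≤ T) :
    P (ev E s hi) (run E (.for x lo hi c) s) ∧
      cost E (.for x lo hi c) s ≤ (T + 1) * (ev E s hi - ev E s lo) + 2 := by
  obtain ⟨t, ⟨h1, h2⟩, h3⟩ := for_rule (x := x) (c := c)
    (fun i s' t => P i s' ∧ t ≤ (T + 1) * (i - ev E s lo)) hlo
    ⟨h0, by simp⟩ fun i s' t hl hh ⟨hP, ht⟩ => by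
      obtain ⟨h1, h2⟩ := hs i s' hl hh hP
      refine ⟨h1, ?_⟩
      rw [Nat.succ_sub hl, Nat.succ_eq_add_one, mul_add, mul_one]
      omega
  exact ⟨h1, by omega⟩

/-- Two states agree on everything that a command leaves alone. -/
structure Same (c : Cmd) (s s' : St) : Prop where
  v : ∀ y, (h : c.wv y = false := by first | rfl | (cases ‹Bool› <;> rfl)) → s'.v y = s.v y
  a : ∀ j, (h : c.wa j = false := by first | rfl | (cases ‹Bool› <;> rfl)) → s'.a j = s.a j

theorem Same.run (c : Cmd) (s : St) : Same c s (run E c s) :=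
  ⟨fun y h => run_v c s y h, fun j h => run_a c s j h⟩

theorem Same.step {x : ℕ} {lo hi g : Ex} {c : Cmd} {s s' : St} {i : ℕ}
    (h : Same (.loop x lo hi g c) s s') :
    Same (.loop x lo hi g c) s (SatRAM.run E c (s'.setV x i)) where
  v y hy := by
    have h1 := h.v y hy
    simp only [Cmd.wv, Bool.or_eq_false_iff, beq_eq_false_iff_ne] at hy
    rw [run_v c _ y hy.2, setV_v, if_neg hy.1, h1]
  a j hj := by
    have h1 := h.a j hj
    rw [run_a c _ j hj, setV_a, h1]

/-- Carrying `Same` along means that the invariants only have to mention what the body actually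
changes. -/
theorem loop_frame {x : ℕ} {lo hi g : Ex} {c : Cmd} {s : St} (P : ℕ → St → ℕ → Prop)
    (h0 : P (ev E s lo) s 0)
    (hs : ∀ i s' t, ev E s lo ≤ i → i < ev E s hi → Same (.loop x lo hi g c) s s' → P i s' t →
      ev E (s'.setV x i) g ≠ 0 →
      P (i + 1) (run E c (s'.setV x i)) (t + (cost E c (s'.setV x i) + 1))) :
    ∃ i s' t, Same (.loop x lo hi g c) s s' ∧ P i s' t ∧ cost E (.loop x lo hi g c) s ≤ t + 2 ∧
      ((i < ev E s hi ∧ ev E (s'.setV x i) g = 0 ∧ run E (.loop x lo hi g c) s = s'.setV x i) ∨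
        (i = max (ev E s lo) (ev E s hi) ∧ run E (.loop x lo hi g c) s = s')) := by
  obtain ⟨i, s', t, h1, h2, h3⟩ := loop_rule (E := E) (x := x) (g := g) (c := c) (lo := lo)
    (hi := hi) (s := s) (fun i s' t => Same (.loop x lo hi g c) s s' ∧ P i s' t)
    ⟨⟨fun _ _ => rfl, fun _ _ => rfl⟩, h0⟩
    fun i s' t hl hh ⟨hS, hP⟩ hg => ⟨hS.step, hs i s' t hl hh hS hP hg⟩
  exact ⟨i, s', t, h1.1, h1.2, h2, h3⟩

theorem for_frame (E : Env) (d : Cmd) (s : St) {x : ℕ} {lo hi : Ex} {c : Cmd}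
    (hd : d = .for x lo hi c) (P : ℕ → St → ℕ → Prop)
    (hlo : ev E s lo ≤ ev E s hi) (h0 : P (ev E s lo) s 0)
    (hs : ∀ i s' t, ev E s lo ≤ i → i < ev E s hi → Same d s s' → P i s' t →
      P (i + 1) (run E c (s'.setV x i)) (t + (cost E c (s'.setV x i) + 1))) :
    ∃ t, P (ev E s hi) (run E d s) t ∧ cost E d s ≤ t + 2 := by
  subst hd
  obtain ⟨t, h1, h2⟩ := for_rule (fun i s' t => Same (.for x lo hi c) s s' ∧ P i s' t) hlo
    ⟨⟨fun _ _ => rfl, fun _ _ => rfl⟩, h0⟩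
    fun i s' t hl hh ⟨hS, hP⟩ => ⟨hS.step, hs i s' t hl hh hS hP⟩
  exact ⟨t, h1.2, h2⟩

theorem for_frame_const (E : Env) (d : Cmd) (s : St) {x : ℕ} {lo hi : Ex} {c : Cmd}
    (hd : d = .for x lo hi c) (P : ℕ → St → Prop) (T : ℕ)
    (hlo : ev E s lo ≤ ev E s hi) (h0 : P (ev E s lo) s)
    (hs : ∀ i s', ev E s lo ≤ i → i < ev E s hi → Same d s s' → P i s' →
      P (i + 1) (run E c (s'.setV x i)) ∧ cost E c (s'.setV x i) ≤ T) :
    P (ev E s hi) (run E d s) ∧ cost E d s ≤ (T + 1) * (ev E s hi - ev E s lo) + 2 := by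
  subst hd
  obtain ⟨h1, h2⟩ := for_rule_const (fun i s' => Same (.for x lo hi c) s s' ∧ P i s') T hlo
    ⟨⟨fun _ _ => rfl, fun _ _ => rfl⟩, h0⟩
    fun i s' hl hh ⟨hS, hP⟩ => ⟨⟨hS.step, (hs i s' hl hh hS hP).1⟩, (hs i s' hl hh hS hP).2⟩
  exact ⟨h1.2, h2⟩

end SatRAM

/-! ## Walks in graphs whose vertices are the positions of a topological order -/

namespace MinDiam

/-- Weighted edge relations. -/
abbrev ERel := ℕ → ℕ → ℕ → Prop

/-- Walks with their weights. -/
inductive Wk (R : ERel) : ℕ → ℕ → ℕ → Prop where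
  | nil (u : ℕ) : Wk R u u 0
  | snoc {u x y k c : ℕ} : Wk R u x k → R x y c → Wk R u y (k + c)

/-- There is a walk of weight at most `K`. -/
def Le (R : ERel) (u v K : ℕ) : Prop := ∃ k, k ≤ K ∧ Wk R u v k

theorem Wk.mono {R R' : ERel} (h : ∀ x y c, R x y c → R' x y c) {u v k : ℕ} (hw : Wk R u v k) :
    Wk R' u v k := by
  induction hw with
  | nil => exact .nil _
  | snoc _ hr ih => exact ih.snoc (h _ _ _ hr)

theorem Wk.trans {R : ERel} {u v x k l : ℕ} (h : Wk R u v k) (h' : Wk R v x l) :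
    Wk R u x (k + l) := by
  induction h' with
  | nil => exact h
  | snoc _ hr ih => rw [← add_assoc]; exact ih.snoc hr

theorem Wk.single {R : ERel} {u v c : ℕ} (h : R u v c) : Wk R u v c := by
  simpa using (Wk.nil u).snoc h

theorem Le.refl (R : ERel) (u K : ℕ) : Le R u u K := ⟨0, Nat.zero_le _, .nil u⟩

theorem Le.trans {R : ERel} {u v x K L : ℕ} (h : Le R u v K) (h' : Le R v x L) :
    Le R u x (K + L) := by
  obtain ⟨k, hk, hw⟩ := h
  obtain ⟨l, hl, hw'⟩ := h'
  exact ⟨k + l, by omega, hw.trans hw'⟩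

theorem Le.mono {R : ERel} {u v K L : ℕ} (h : Le R u v K) (hKL : K ≤ L) : Le R u v L := by
  obtain ⟨k, hk, hw⟩ := h
  exact ⟨k, by omega, hw⟩

/-- The edge relation given by the first `b` entries of an edge list. -/
def edg (b : ℕ) (src tgt wt : ℕ → ℕ) : ERel := fun x y c =>
  ∃ e, e < b ∧ src e = x ∧ tgt e = y ∧ wt e = c

/-- Compressed sparse row format: the edges are sorted by their sources, those with source `p` have
the numbers `off p, …, off (p + 1) - 1`. -/
structure CSR (n m : ℕ) (src tgt wt off : ℕ → ℕ) : Prop where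
  src_lt_tgt : ∀ e, e < m → src e < tgt e
  tgt_lt : ∀ e, e < m → tgt e < n
  off_zero : off 0 = 0
  off_n : off n = m
  off_mono : ∀ p q, p ≤ q → q ≤ n → off p ≤ off q
  off_le : ∀ e, e < m → off (src e) ≤ e
  lt_off : ∀ e, e < m → e < off (src e + 1)
  inj : ∀ e f, e < m → f < m → src e = src f → tgt e = tgt f → e = f

namespace CSR

variable {n m : ℕ} {src tgt wt off : ℕ → ℕ} (h : CSR n m src tgt wt off)
include h

theorem src_lt {e : ℕ} (he : e < m) : src e < n := (h.src_lt_tgt e he).trans (h.tgt_lt e he)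

theorem off_le_m {p : ℕ} (hp : p ≤ n) : off p ≤ m := h.off_n ▸ h.off_mono p n hp le_rfl

theorem le_src {e p : ℕ} (he : e < m) (hp : off p ≤ e) (hpn : p ≤ n) : p ≤ src e := by
  by_contra hlt
  have := h.off_mono (src e + 1) p (by omega) hpn
  have := h.lt_off e he
  omega

theorem src_lt_of {e p : ℕ} (he : e < off p) (hpn : p ≤ n) : src e < p := by
  by_contra hlt
  have hm := h.off_le_m hpn
  have := h.off_mono p (src e) (by omega) (h.src_lt (by omega)).le
  have := h.off_le e (by omega)
  omega

theorem src_eq {e p : ℕ} (hp : p < n) (h1 : off p ≤ e) (h2 : e < off (p + 1)) : src e = p := by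
  have := h.off_le_m (p := p + 1) hp
  have := h.src_lt_of h2 hp
  have := h.le_src (e := e) (by omega) h1 hp.le
  omega

theorem src_mono {e f : ℕ} (hef : e ≤ f) (hf : f < m) : src e ≤ src f := by
  by_contra hlt
  have := h.lt_off f hf
  have := h.off_le e (by omega)
  have := h.off_mono (src f + 1) (src e) (by omega) (h.src_lt (by omega)).le
  omega

theorem wk_le {u v k : ℕ} (hw : Wk (edg m src tgt wt) u v k) : u ≤ v := by
  induction hw with
  | nil => exact le_rfl
  | snoc _ hr ih =>
    obtain ⟨e, he, rfl, rfl, _⟩ := hr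
    exact ih.trans (h.src_lt_tgt e he).le

theorem wk_bd {b u v k : ℕ} (hb : b ≤ m) (hw : Wk (edg b src tgt wt) u v k) :
    Wk (edg m src tgt wt) u v k :=
  hw.mono fun _ _ _ ⟨e, he, h'⟩ => ⟨e, by omega, h'⟩

/-- Edges are sorted by source and lead to larger positions. So no edge up to `e` starts at `tgt e`:
its source is at most `src e < tgt e`. Hence `e` can occur in such a walk only as the last edge, and
a single pass over the edges in this order computes distances. -/
theorem wk_succ {e u v k : ℕ} (he : e < m) (hw : Wk (edg (e + 1) src tgt wt) u v k) :
    Wk (edg e src tgt wt) u v k ∨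
      ∃ l, Wk (edg e src tgt wt) u (src e) l ∧ v = tgt e ∧ k = l + wt e := by
  induction hw with
  | nil => exact Or.inl (.nil _)
  | @snoc x y k c _ hr ih =>
    obtain ⟨f, hf, rfl, rfl, rfl⟩ := hr
    rcases ih with ih | ⟨l, _, h2, _⟩
    · rcases Nat.lt_succ_iff_lt_or_eq.1 hf with hf' | rfl
      · exact Or.inl (ih.snoc ⟨f, hf', rfl, rfl, rfl⟩)
      · exact Or.inr ⟨_, ih, rfl, rfl⟩
    · have := h.src_lt_tgt e he
      have := h.src_mono (Nat.lt_succ_iff.1 hf) he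
      omega

/-- A walk of weight at most `K` that used an edge with source in `[p, q)` would have visited a
vertex there by means of earlier edges. This is what allows a search to skip stretches without any
vertex found. -/
theorem wk_gap {K u v k b p q : ℕ} (hq : q ≤ n) (hpq : p ≤ q) (hb : b ≤ off q)
    (hno : ∀ x l, Wk (edg (off p) src tgt wt) u x l → l ≤ K → p ≤ x → x < q → False)
    (hw : Wk (edg b src tgt wt) u v k) (hk : k ≤ K) :
    Wk (edg (off p) src tgt wt) u v k := by
  induction hw with
  | nil => exact .nil _
  | @snoc x y k c _ hr ih =>
    obtain ⟨f, hf, rfl, rfl, rfl⟩ := hr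
    have ih := ih (by omega)
    rcases lt_or_ge f (off p) with hlt | hge
    · exact ih.snoc ⟨f, hlt, rfl, rfl, rfl⟩
    · have hm := h.off_le_m hq
      exact (hno _ _ ih (by omega) (h.le_src (by omega) hge (by omega))
        (h.src_lt_of (by omega) hq)).elim

/-- Edges with numbers below `off u` start before `u`, whereas a walk from `u` never goes back. -/
theorem wk_start {u v k : ℕ} (hu : u ≤ n) (hw : Wk (edg (off u) src tgt wt) u v k) :
    v = u ∧ k = 0 := by
  induction hw with
  | nil => exact ⟨rfl, rfl⟩
  | @snoc x y k c hw hr ih =>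
    obtain ⟨f, hf, rfl, rfl, rfl⟩ := hr
    have := h.src_lt_of hf hu
    have := h.wk_le (h.wk_bd (h.off_le_m hu) hw)
    omega

theorem wk_end {u v k b : ℕ} (hv : v ≤ b) (hb : b ≤ n) (hw : Wk (edg m src tgt wt) u v k) :
    Wk (edg (off b) src tgt wt) u v k := by
  induction hw with
  | nil => exact .nil _
  | @snoc x y k c hw hr ih =>
    obtain ⟨f, hf, rfl, rfl, rfl⟩ := hr
    have h1 := h.src_lt_tgt f hf
    have h2 := h.lt_off f hf
    have h3 := h.off_mono (src f + 1) b (by omega) hb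
    exact (ih (by omega)).snoc ⟨f, by omega, rfl, rfl, rfl⟩

theorem wk_lt {u v k : ℕ} (hu : u < n) (hw : Wk (edg m src tgt wt) u v k) : v < n := by
  induction hw with
  | nil => exact hu
  | snoc _ hr _ =>
    obtain ⟨e, he, _, rfl, _⟩ := hr
    exact h.tgt_lt e he

/-- There are no parallel edges, so the edges with one source have distinct targets. -/
theorem deg_le {p : ℕ} (hp : p < n) : off (p + 1) - off p ≤ n := by
  have hm := h.off_le_m (p := p + 1) hp
  have : (Finset.Ico (off p) (off (p + 1))).card ≤ (Finset.range n).card := by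
    refine Finset.card_le_card_of_injOn tgt (fun e he => ?_) fun e he f hf hef => ?_
    · simp only [Finset.coe_Ico, Set.mem_Ico] at he
      simpa using h.tgt_lt e (by omega)
    · simp only [Finset.coe_Ico, Set.mem_Ico] at he hf
      exact h.inj e f (by omega) (by omega)
        ((h.src_eq hp he.1 he.2).trans (h.src_eq hp hf.1 hf.2).symm) hef
  simpa using this

end CSR

/-- A graph on the positions `0, …, n - 1` of a topological order (`g = false`), the reversed graph
(`g = true`), the colors, the runs of equal color and the parameters of the algorithm. -/
structure Inst where
  n : ℕ
  m : ℕ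
  src : Bool → ℕ → ℕ
  tgt : Bool → ℕ → ℕ
  wt : Bool → ℕ → ℕ
  off : Bool → ℕ → ℕ
  col : Bool → ℕ → ℕ
  kk : ℕ
  hh : ℕ
  dense : ℕ
  bw : ℕ
  R : ℕ
  rs : ℕ → ℕ
  csr : ∀ g, CSR n m (src g) (tgt g) (wt g) (off g)
  rev : ∀ g x y c, x < n → y < n → edg m (src g) (tgt g) (wt g) x y c →
    edg m (src !g) (tgt !g) (wt !g) (n - 1 - y) (n - 1 - x) c
  col_rev : ∀ g p, p < n → col (!g) p = col g (n - 1 - p)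
  kk_pos : 1 ≤ kk
  kk_le : kk ≤ n

namespace Inst

variable (T : Inst)

/-- The edges of the graph with orientation `g`. -/
def E (g : Bool) : ERel := edg T.m (T.src g) (T.tgt g) (T.wt g)

variable {T}

theorem wk_rev {g : Bool} {u v k : ℕ} (hu : u < T.n) (h : Wk (T.E g) u v k) :
    Wk (T.E !g) (T.n - 1 - v) (T.n - 1 - u) k := by
  induction h with
  | nil => exact .nil _
  | @snoc x y k c hw hr ih =>
    have hx := (T.csr g).wk_lt hu hw
    have hy := (T.csr g).wk_lt hu (hw.snoc hr)
    rw [add_comm]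
    exact (Wk.single (T.rev g _ _ _ hx hy hr)).trans ih

theorem le_rev {g : Bool} {u v K : ℕ} (hu : u < T.n) (h : Le (T.E g) u v K) :
    Le (T.E !g) (T.n - 1 - v) (T.n - 1 - u) K := by
  obtain ⟨k, hk, hw⟩ := h
  exact ⟨k, hk, wk_rev hu hw⟩

theorem le_rev_iff {g : Bool} {u v K : ℕ} (hu : u < T.n) (hv : v < T.n) :
    Le (T.E !g) (T.n - 1 - v) (T.n - 1 - u) K ↔ Le (T.E g) u v K := by
  refine ⟨fun h => ?_, le_rev hu⟩
  have := le_rev (g := !g) (by omega) h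
  rw [Bool.not_not, show T.n - 1 - (T.n - 1 - u) = u by omega,
    show T.n - 1 - (T.n - 1 - v) = v by omega] at this
  exact this

theorem le_of_wk {g : Bool} {u v k : ℕ} (h : Wk (T.E g) u v k) : u ≤ v := (T.csr g).wk_le h

end Inst

open SatRAM

/-! ## Names of variables and arrays -/

/-- The two names with number `i`; for data that exist for both orientations, `g` is the
orientation. -/
def ix (i : ℕ) (g : Bool) : ℕ := 2 * i + g.toNat

@[simp] theorem ix_inj {i j : ℕ} {g h : Bool} : ix i g = ix j h ↔ i = j ∧ g = h := by
  cases g <;> cases h <;> simp [ix] <;> omega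

/-- The rules for the execution of straight line programs. -/
theorem exec : type_of% @run_skip ∧ type_of% @run_asg ∧ type_of% @run_wr ∧ type_of% @run_seq ∧
    type_of% @run_ite ∧ type_of% @cost_skip ∧ type_of% @cost_asg ∧ type_of% @cost_wr ∧
    type_of% @cost_seq ∧ type_of% @cost_ite ∧ type_of% @ev_0 ∧ type_of% @ev_1 ∧ type_of% @ev_2 ∧
    type_of% @ev_3 ∧ type_of% @ev_4 ∧ type_of% @ev_var ∧ type_of% @ev_inp ∧ type_of% @ev_rd ∧
    type_of% @ev_add ∧ type_of% @ev_sub ∧ type_of% @ev_mul ∧ type_of% @ev_div ∧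
    type_of% @ev_mod ∧ type_of% @ev_lt ∧ type_of% @ev_eq ∧ type_of% @setV_v ∧ type_of% @setV_a ∧
    type_of% @setA_v ∧ type_of% @setA_a ∧ type_of% @ix_inj ∧ type_of% @false_and ∧
    type_of% @and_false ∧ type_of% @true_and ∧ type_of% @and_true ∧ type_of% @if_true.{1} ∧
    type_of% @if_false.{1} ∧ type_of% @ite_self.{1} ∧ ((1 : ℕ) = 0) = False ∧
    (true = false) = False ∧ (false = true) = False :=
  ⟨@run_skip, @run_asg, @run_wr, @run_seq, @run_ite, @cost_skip, @cost_asg, @cost_wr, @cost_seq,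
   @cost_ite, @ev_0, @ev_1, @ev_2, @ev_3, @ev_4, @ev_var, @ev_inp, @ev_rd, @ev_add, @ev_sub,
   @ev_mul, @ev_div, @ev_mod, @ev_lt, @ev_eq, @setV_v, @setV_a, @setA_v, @setA_a, @ix_inj,
   @false_and, @and_false, @true_and, @and_true, @if_true, @if_false, @ite_self, by simp,
   by simp, by simp⟩

abbrev vN : ℕ := ix 0 false
abbrev vM : ℕ := ix 0 true
abbrev vFlag : ℕ := ix 1 false
abbrev vOut : ℕ := ix 1 true
abbrev vK : ℕ := ix 2 false
abbrev vOK : ℕ := ix 2 true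
abbrev vS : ℕ := ix 3 false
abbrev vHI : ℕ := ix 3 true
abbrev vP : ℕ := ix 4 false
abbrev vE : ℕ := ix 4 true
abbrev vD : ℕ := ix 5 false
abbrev vKH : ℕ := ix 6 false
abbrev vHH : ℕ := ix 6 true
abbrev vDense : ℕ := ix 7 false
abbrev vBW : ℕ := ix 7 true
abbrev vR : ℕ := ix 8 false
abbrev vP0 (g : Bool) : ℕ := ix 9 g
abbrev vP1 (g : Bool) : ℕ := ix 10 g
abbrev vP2 (g : Bool) : ℕ := ix 11 g

abbrev aSRC (g : Bool) : ℕ := ix 0 g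
abbrev aTGT (g : Bool) : ℕ := ix 1 g
abbrev aWT (g : Bool) : ℕ := ix 2 g
abbrev aOFF (g : Bool) : ℕ := ix 3 g
abbrev aDIST (g : Bool) : ℕ := ix 4 g
abbrev aHIT (g : Bool) : ℕ := ix 5 g
abbrev aLEN (g : Bool) : ℕ := ix 6 g
abbrev aLU (g : Bool) : ℕ := ix 7 g
abbrev aLD (g : Bool) : ℕ := ix 8 g
abbrev aBIG (g : Bool) : ℕ := ix 9 g
abbrev aCOV (g : Bool) : ℕ := ix 10 g
abbrev aTD (g : Bool) : ℕ := ix 11 g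
abbrev aCOL (g : Bool) : ℕ := ix 12 g
abbrev aRS : ℕ := ix 13 false
abbrev aDV : ℕ := ix 13 true

/-- `x`, as an expression. -/
abbrev V (x : ℕ) : Ex := .var x

/-! ## The context of the distance computations -/

/-- The memory holds the instance `T` and the threshold `K`. -/
structure Holds (T : Inst) (K : ℕ) (s : St) : Prop where
  n : s.v vN = T.n
  thr : s.v vK = K
  kk : s.v vKH = T.kk
  hh : s.v vHH = T.hh
  dense : s.v vDense = T.dense
  bw : s.v vBW = T.bw
  R : s.v vR = T.R
  src : ∀ g, s.a (aSRC g) = T.src g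
  tgt : ∀ g, s.a (aTGT g) = T.tgt g
  wt : ∀ g, s.a (aWT g) = T.wt g
  off : ∀ g, s.a (aOFF g) = T.off g
  col : ∀ g, s.a (aCOL g) = T.col g
  rs : s.a aRS = T.rs

/-- A command does not change the instance. -/
def keeps (c : Cmd) : Bool :=
  !c.wv vN && !c.wv vK && !c.wv vKH && !c.wv vHH && !c.wv vDense && !c.wv vBW && !c.wv vR &&
  !c.wa (aSRC false) && !c.wa (aSRC true) && !c.wa (aTGT false) && !c.wa (aTGT true) &&
  !c.wa (aWT false) && !c.wa (aWT true) && !c.wa (aOFF false) && !c.wa (aOFF true) &&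
  !c.wa (aCOL false) && !c.wa (aCOL true) && !c.wa aRS

variable {T : Inst} {K : ℕ} {E : Env} {s : St}

theorem Holds.same {s' : St} {c : Cmd} (h : Holds T K s) (hs : Same c s s')
    (hc : keeps c = true := by first | rfl | (cases ‹Bool› <;> rfl)) : Holds T K s' := by
  simp only [keeps, Bool.and_eq_true, Bool.not_eq_true'] at hc
  obtain ⟨⟨⟨⟨⟨⟨⟨⟨⟨⟨⟨⟨⟨⟨⟨⟨⟨h1, h2⟩, h3⟩, h4⟩, h5⟩, h6⟩, h7⟩, a1⟩, a2⟩, a3⟩, a4⟩, a5⟩, a6⟩, a7⟩, a8⟩,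
    a9⟩, a10⟩, a11⟩ := hc
  constructor
  · rw [hs.v _ h1, h.n]
  · rw [hs.v _ h2, h.thr]
  · rw [hs.v _ h3, h.kk]
  · rw [hs.v _ h4, h.hh]
  · rw [hs.v _ h5, h.dense]
  · rw [hs.v _ h6, h.bw]
  · rw [hs.v _ h7, h.R]
  · intro g; rw [hs.a _ (by cases g <;> assumption), h.src]
  · intro g; rw [hs.a _ (by cases g <;> assumption), h.tgt]
  · intro g; rw [hs.a _ (by cases g <;> assumption), h.wt]
  · intro g; rw [hs.a _ (by cases g <;> assumption), h.off]
  · intro g; rw [hs.a _ (by cases g <;> assumption), h.col]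
  · rw [hs.a _ a11, h.rs]

theorem Holds.run (h : Holds T K s) (c : Cmd) (hc : keeps c = true :=
      by first | rfl | (cases ‹Bool› <;> rfl)) :
    Holds T K (run E c s) := h.same (Same.run c s) hc

theorem Holds.setV (h : Holds T K s) (x n : ℕ) (hx : keeps (.asg x 0) = true :=
      by first | rfl | (cases ‹Bool› <;> rfl)) :
    Holds T K (s.setV x n) := by
  -- An assignment of a given number is the command `.asg x .top` for a machine with this number as
  -- its bound, so the frame rule for commands applies.
  have : s.setV x n = SatRAM.run ⟨n, fun _ => 0⟩ (.asg x .top) s := rfl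
  rw [this]
  exact h.run _ hx

/-- The saturation bound is large. -/
structure Big (T : Inst) (K : ℕ) (E : Env) : Prop where
  lin : T.n + T.m + K + 100 ≤ E.B
  sq : (T.n + 1) * (T.n + 1) ≤ E.B

/-! ## Distances from one vertex -/

/-- Distances from `S` to the positions below `HI`; distances above `K` become at least `K + 1`. -/
def fwd (g : Bool) : Cmd :=
  .for vP (V vS) (V vHI) (.wr (aDIST g) (V vP) (V vK + 1)) ;;
  .wr (aDIST g) (V vS) 0 ;;
  .for vE (.rd (aOFF g) (V vS)) (.rd (aOFF g) (V vHI))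
    (.asg vD (.rd (aDIST g) (.rd (aSRC g) (V vE)) + .rd (aWT g) (V vE)) ;;
    .when (.lt (V vD) (.rd (aDIST g) (.rd (aTGT g) (V vE))))
      (.wr (aDIST g) (.rd (aTGT g) (V vE)) (V vD)))

/-- `d` gives the distances from `x` to the positions in `[x, h)`, as far as they are at most `K`. -/
def IsDist (T : Inst) (g : Bool) (K x h : ℕ) (d : ℕ → ℕ) : Prop :=
  ∀ v, x ≤ v → v < h → ∀ k, k ≤ K → (d v ≤ k ↔ Le (T.E g) x v k)

/-- The effect of relaxing one edge. -/
def relax (B : ℕ) (src tgt wt : ℕ → ℕ) (e : ℕ) (d : ℕ → ℕ) : ℕ → ℕ :=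
  if min (d (src e) + wt e) B < d (tgt e) then
    Function.update d (tgt e) (min (d (src e) + wt e) B) else d

/-- Invariant of a single source computation: `d` is sound, and it takes all walks along the edges
with numbers below `e` into account. -/
structure Relaxed (T : Inst) (g : Bool) (K x h e : ℕ) (d : ℕ → ℕ) : Prop where
  sound : ∀ v, x ≤ v → v < h → d v ≤ K → Wk (T.E g) x v (d v)
  complete : ∀ v k, x ≤ v → v < h → k ≤ K → Wk (edg e (T.src g) (T.tgt g) (T.wt g)) x v k → d v ≤ k

/-- By `wk_succ` a new walk consists of a walk along earlier edges followed by the edge `e`. Capping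
at `B` is harmless since `K < B`: a stored value of at most `K` has not been capped. -/
theorem Relaxed.step {g : Bool} {x h e B : ℕ} {d : ℕ → ℕ} (hd : Relaxed T g K x h e d)
    (hK : K < B) (he : e < T.m) (hx : x ≤ T.src g e) (hh : T.src g e < h) :
    Relaxed T g K x h (e + 1) (relax B (T.src g) (T.tgt g) (T.wt g) e d) := by
  have hlt := (T.csr g).src_lt_tgt e he
  constructor
  · intro v hv hvh hk
    unfold relax at hk ⊢
    split_ifs at hk ⊢ with hc
    · by_cases hvt : v = T.tgt g e
      · subst hvt
        rw [Function.update_self] at hk ⊢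
        have : min (d (T.src g e) + T.wt g e) B = d (T.src g e) + T.wt g e := by omega
        rw [this]
        exact (hd.sound _ hx hh (by omega)).snoc ⟨e, he, rfl, rfl, rfl⟩
      · rw [Function.update_of_ne hvt] at hk ⊢
        exact hd.sound v hv hvh hk
    · exact hd.sound v hv hvh hk
  · intro v k hv hvh hk hw
    have hle : relax B (T.src g) (T.tgt g) (T.wt g) e d v ≤ d v := by
      unfold relax
      split_ifs
      · by_cases hvt : v = T.tgt g e
        · subst hvt; rw [Function.update_self]; omega
        · rw [Function.update_of_ne hvt]
      · exact le_rfl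
    rcases (T.csr g).wk_succ he hw with hw' | ⟨l, hw', rfl, rfl⟩
    · exact hle.trans (hd.complete v k hv hvh hk hw')
    · have := hd.complete _ l hx hh (by omega) hw'
      unfold relax at hle ⊢
      split_ifs with hc
      · rw [Function.update_self]; omega
      · omega

/-- One pass over the edges with sources in `[x, h)` is sufficient in topological order. Only the
positions in `[x, h)` are initialized; entries for targets beyond `h` may be stale, but nothing is
claimed about them. So the cost depends only on the window. -/
theorem fwd_spec (g : Bool) (hB : Big T K E) (hH : Holds T K s) {x h : ℕ} (hx : s.v vS = x)
    (hh : s.v vHI = h) (hxh : x < h) (hn : h ≤ T.n) :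
    IsDist T g K x h ((run E (fwd g) s).a (aDIST g)) ∧
      cost E (fwd g) s ≤ 4 * ((h - x) + (T.off g h - T.off g x)) + 5 := by
  have hlin := hB.lin
  rw [fwd, run_seq, cost_seq, run_seq, cost_seq]
  set c₁ := Cmd.for vP (V vS) (V vHI) (.wr (aDIST g) (V vP) (V vK + 1)) with hc₁
  obtain ⟨h1, t1⟩ := for_rule_const (E := E) (x := vP) (lo := V vS) (hi := V vHI)
    (c := .wr (aDIST g) (V vP) (V vK + 1)) (s := s)
    (fun i s' => s'.v vK = K ∧ ∀ v, x ≤ v → v < i → s'.a (aDIST g) v = K + 1) 1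
    (by simp; omega) ⟨hH.thr, by simp [hx]; omega⟩ (by
      rintro i s' _ _ ⟨hk, ih⟩
      refine ⟨⟨by simp [hk], fun v hv hvi => ?_⟩, by simp⟩
      simp only [run_wr, ev_var, setV_v, setA_a, if_true, ev_add, ev_1, ix_inj, setV_a]
      by_cases hvi' : v = i
      · subst hvi'; simp [hk]; omega
      · simp [Function.update_of_ne hvi']; exact ih v hv (by omega))
  rw [← hc₁] at h1 t1
  have hH₁ : Holds T K (run E c₁ s) := hH.run _
  have e1 : (run E c₁ s).v vS = x := by rw [run_v c₁ s _, hx]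
  have e2 : (run E c₁ s).v vHI = h := by rw [run_v c₁ s _, hh]
  set s₁ := run E c₁ s with hs₁
  simp only [ev_var, hx, hh] at h1 t1
  set s₂ := run E (.wr (aDIST g) (V vS) 0) s₁ with hs₂
  have hH₂ : Holds T K s₂ := hH₁.run _
  have e3 : s₂.v vS = x := e1
  have e4 : s₂.v vHI = h := e2
  have e5 : s₂.a (aDIST g) = Function.update (s₁.a (aDIST g)) x 0 := by
    simp [hs₂, e1]
  have hcsr := T.csr g
  have hof : T.off g x ≤ T.off g h := hcsr.off_mono _ _ hxh.le hn
  have hom : T.off g h ≤ T.m := hcsr.off_le_m hn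
  obtain ⟨h2, t2⟩ := for_rule_const (E := E) (x := vE) (lo := .rd (aOFF g) (V vS))
    (hi := .rd (aOFF g) (V vHI))
    (c := .asg vD (.rd (aDIST g) (.rd (aSRC g) (V vE)) + .rd (aWT g) (V vE)) ;;
    .when (.lt (V vD) (.rd (aDIST g) (.rd (aTGT g) (V vE))))
      (.wr (aDIST g) (.rd (aTGT g) (V vE)) (V vD))) (s := s₂)
    (fun e s' => Holds T K s' ∧ Relaxed T g K x h e (s'.a (aDIST g))) 3
    (by simpa [hH₂.off, e3, e4] using hof) (by
      refine ⟨hH₂, fun v hv hvh hk => ?_, fun v k hv hvh hk hw => ?_⟩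
      · rw [e5] at hk ⊢
        by_cases hvx : v = x
        · subst hvx; rw [Function.update_self]; exact .nil _
        · rw [Function.update_of_ne hvx, h1.2 v hv hvh] at hk; omega
      · simp only [ev_rd, ev_var, hH₂.off, e3] at hw
        obtain ⟨rfl, rfl⟩ := hcsr.wk_start (by omega) hw
        rw [e5, Function.update_self]) (by
      rintro e s' hle hlt ⟨hH', hr⟩
      simp only [ev_rd, ev_var, hH₂.off, e3, e4] at hle hlt
      refine ⟨⟨(hH'.setV _ _).run _, ?_⟩, ?_⟩
      · have := hr.step (B := E.B) (by omega) (by omega) (hcsr.le_src (by omega) hle (by omega))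
          (hcsr.src_lt_of hlt hn)
        unfold relax at this
        convert this using 1
        simp only [run_seq, run_asg, run_ite, ev_add, ev_rd, ev_var, setV_v, setV_a, ev_lt,
          hH'.src, hH'.wt, hH'.tgt, if_true, ix_inj]
        split_ifs <;> simp_all [hH'.tgt]
      · simp only [cost_seq, cost_asg, cost_ite, cost_wr, cost_skip, ite_self]; omega)
  simp only [ev_rd, ev_var, hH₂.off, e3, e4] at h2 t2
  refine ⟨fun v hv hvh k hk => ⟨fun hle => ⟨_, hle, h2.2.sound v hv hvh (by omega)⟩, ?_⟩, ?_⟩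
  · rintro ⟨l, hl, hw⟩
    exact (h2.2.complete v l hv hvh (by omega) (hcsr.wk_end hvh.le hn hw)).trans hl
  · simp only [cost_wr]
    omega

/-! ## Pairs of consecutive blocks of positions -/

/-- Two consecutive blocks `[p0, p1)` and `[p1, p2)` of positions, in both orientations. -/
structure Seg (T : Inst) where
  p0 : Bool → ℕ
  p1 : Bool → ℕ
  p2 : Bool → ℕ
  h01 : ∀ g, p0 g < p1 g
  h12 : ∀ g, p1 g < p2 g
  h2n : ∀ g, p2 g ≤ T.n
  r0 : ∀ g, p0 (!g) = T.n - p2 g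
  r1 : ∀ g, p1 (!g) = T.n - p1 g
  r2 : ∀ g, p2 (!g) = T.n - p0 g

/-- The number of positions and of edges that a search may see. -/
def Seg.size (S : Seg T) : ℕ :=
  (S.p2 false - S.p0 false) + (T.off false (S.p2 false) - T.off false (S.p0 false)) +
    (T.off true (S.p2 true) - T.off true (S.p0 true))

/-- Reversal maps the two blocks to two blocks of the same total length and exchanges the two edge
counts, so one bound serves both orientations. -/
theorem Seg.size_eq (S : Seg T) (g : Bool) : S.size = (S.p2 g - S.p0 g) +
    (T.off g (S.p2 g) - T.off g (S.p0 g)) + (T.off (!g) (S.p2 !g) - T.off (!g) (S.p0 !g)) := by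
  cases g with
  | false => rfl
  | true =>
    have h0 := S.r0 true
    have h2 := S.r2 true
    have a := S.h01 true
    have b := S.h12 true
    have c := S.h2n true
    simp only [Bool.not_true] at *
    unfold Seg.size
    omega

variable (S : Seg T)

/-- The instance and the two blocks are in the memory. -/
structure SegHolds (K : ℕ) (s : St) : Prop extends Holds T K s where
  p0 : ∀ g, s.v (vP0 g) = S.p0 g
  p1 : ∀ g, s.v (vP1 g) = S.p1 g
  p2 : ∀ g, s.v (vP2 g) = S.p2 g

def keepsSeg (c : Cmd) : Bool :=
  keeps c && !c.wv (vP0 false) && !c.wv (vP0 true) && !c.wv (vP1 false) && !c.wv (vP1 true) &&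
    !c.wv (vP2 false) && !c.wv (vP2 true)

variable {S}

theorem SegHolds.same {s' : St} {c : Cmd} (h : SegHolds S K s) (hs : Same c s s')
    (hc : keepsSeg c = true := by first | rfl | (cases ‹Bool› <;> rfl)) : SegHolds S K s' := by
  simp only [keepsSeg, Bool.and_eq_true, Bool.not_eq_true'] at hc
  obtain ⟨⟨⟨⟨⟨⟨h0, h1⟩, h2⟩, h3⟩, h4⟩, h5⟩, h6⟩ := hc
  refine ⟨h.toHolds.same hs h0, fun g => ?_, fun g => ?_, fun g => ?_⟩
  · rw [hs.v _ (by cases g <;> assumption), h.p0]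
  · rw [hs.v _ (by cases g <;> assumption), h.p1]
  · rw [hs.v _ (by cases g <;> assumption), h.p2]

theorem SegHolds.run (h : SegHolds S K s) (c : Cmd) (hc : keepsSeg c = true :=
      by first | rfl | (cases ‹Bool› <;> rfl)) :
    SegHolds S K (run E c s) := h.same (Same.run c s) hc

theorem SegHolds.setV (h : SegHolds S K s) (x n : ℕ)
    (hx : keepsSeg (.asg x 0) = true :=
      by first | rfl | (cases ‹Bool› <;> rfl)) : SegHolds S K (s.setV x n) := by
  have : s.setV x n = SatRAM.run ⟨n, fun _ => 0⟩ (.asg x .top) s := rfl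
  rw [this]
  exact h.run _ hx

theorem Holds.setA (h : Holds T K s) (j i n : ℕ) (hj : keeps (.wr j 0 0) = true :=
      by first | rfl | (cases ‹Bool› <;> rfl)) :
    Holds T K (s.setA j i n) := by
  refine h.same (c := .wr j 0 0) ⟨fun _ _ => rfl, fun k hk => ?_⟩ hj
  simp only [Cmd.wa, beq_eq_false_iff_ne] at hk
  simp [hk]

/-! ### Occurrences of vertices in lists -/

/-- A vertex that is not hit and has a long list. -/
def live (hit big : ℕ → ℕ) (x : ℕ) : Prop := hit x = 0 ∧ big x ≠ 0

instance (hit big : ℕ → ℕ) (x : ℕ) : Decidable (live hit big x) := by unfold live; infer_instance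

/-- How often `u` occurs in the list of `x`. -/
def occ (k : ℕ) (lu : ℕ → ℕ) (x u : ℕ) : ℕ :=
  ((Finset.range k).filter fun i => lu (x * k + i) = u).card

/-- Sum over the live vertices. -/
def liveSum (a b : ℕ) (hit big f : ℕ → ℕ) : ℕ :=
  ∑ x ∈ Finset.Ico a b, if live hit big x then f x else 0

/-- `cov u` counts the occurrences of `u` in the lists of live vertices. -/
def CovOK (a b k : ℕ) (hit big lu cov : ℕ → ℕ) : Prop :=
  ∀ u, a ≤ u → u < b → cov u = liveSum a b hit big fun x => occ k lu x u

theorem liveSum_update {a b x : ℕ} {hit big : ℕ → ℕ} (f : ℕ → ℕ) (ha : a ≤ x) (hb : x < b)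
    (hx : hit x = 0) : liveSum a b (Function.update hit x 1) big f +
      (if big x = 0 then 0 else f x) = liveSum a b hit big f := by
  unfold liveSum
  have hm : x ∈ Finset.Ico a b := Finset.mem_Ico.2 ⟨ha, hb⟩
  rw [← Finset.add_sum_erase _ _ hm, ← Finset.add_sum_erase (Finset.Ico a b) (fun x =>
    if live hit big x then f x else 0) hm]
  have h1 : ¬ live (Function.update hit x 1) big x := by simp [live]
  have h2 : ∑ y ∈ (Finset.Ico a b).erase x, (if live (Function.update hit x 1) big y then f y
      else 0) = ∑ y ∈ (Finset.Ico a b).erase x, if live hit big y then f y else 0 := by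
    refine Finset.sum_congr rfl fun y hy => ?_
    have : y ≠ x := Finset.ne_of_mem_erase hy
    simp [live, Function.update_of_ne this]
  rw [h2, if_neg h1]
  by_cases hbx : big x = 0
  · simp [live, hx, hbx]
  · simp [live, hx, hbx]; omega

theorem occ_succ (k : ℕ) (lu : ℕ → ℕ) (x u j : ℕ) :
    ((Finset.range (j + 1)).filter fun i => lu (x * k + i) = u).card =
      ((Finset.range j).filter fun i => lu (x * k + i) = u).card +
        if lu (x * k + j) = u then 1 else 0 := by
  rw [Finset.range_add_one, Finset.filter_insert]
  split_ifs
  · rw [Finset.card_insert_of_notMem (by simp)]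
  · rfl

abbrev vQ : ℕ := ix 5 true
abbrev vX1 : ℕ := ix 12 false
abbrev vI1 : ℕ := ix 12 true
abbrev vU1 : ℕ := ix 13 false

/-- Remove the list of a vertex from the counts. -/
def decCov (g : Bool) : Cmd :=
  .for vI1 0 (V vKH) (.asg vU1 (.rd (aLU g) (V vX1 * V vKH + V vI1)) ;;
    .wr (aCOV g) (V vU1) (.rd (aCOV g) (V vU1) - 1))

theorem Big.index (hB : Big T K E) {x i : ℕ} (hx : x < T.n) (hi : i < T.kk) :
    min (min (x * T.kk) E.B + i) E.B = x * T.kk + i := by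
  have h1 := hB.sq
  have h2 := T.kk_le
  have h3 : (x + 1) * T.kk ≤ T.n * T.n := Nat.mul_le_mul hx h2
  have h4 : T.n * T.n ≤ (T.n + 1) * (T.n + 1) := Nat.mul_le_mul (by omega) (by omega)
  rw [add_mul, one_mul] at h3
  omega

theorem decCov_spec (g : Bool) (hB : Big T K E) (hH : Holds T K s) {x : ℕ} (hx : s.v vX1 = x)
    (hn : x < T.n) :
    (run E (decCov g) s).a (aCOV g) = (fun u => s.a (aCOV g) u - occ T.kk (s.a (aLU g)) x u) ∧
      cost E (decCov g) s ≤ 3 * T.kk + 2 := by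
  have hlin := hB.lin
  obtain ⟨h1, t1⟩ := for_frame_const E (decCov g) s rfl
    (fun j s' => ∀ u, s'.a (aCOV g) u = s.a (aCOV g) u -
      ((Finset.range j).filter fun i => s.a (aLU g) (x * T.kk + i) = u).card) 2
    (by simp) (by simp) (by
      intro j s' _ hj hS ih
      have hH' := hH.same hS
      have e1 : s'.v vX1 = x := by rw [hS.v _, hx]
      have e2 : s'.a (aLU g) = s.a (aLU g) := hS.a _
      simp only [ev_var, hH.kk] at hj
      refine ⟨fun u => ?_, by simp⟩
      rw [occ_succ]
      simp [hH'.kk, e1, e2, hB.index hn hj, Function.update_apply, ih]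
      split_ifs <;> simp_all
      omega)
  simp only [ev_0, ev_var, hH.kk] at h1 t1
  exact ⟨funext h1, by simpa [decCov] using t1⟩

/-! ### Hitting -/

/-- All vertices of the second block are close to `x`. -/
def Cert (S : Seg T) (K : ℕ) (g : Bool) (x : ℕ) : Prop :=
  ∀ y, S.p1 g ≤ y → y < S.p2 g → Le (T.E g) x y (2 * K)

/-- There are vertices in the two blocks with distance above `K`. -/
def BadPair (S : Seg T) (K : ℕ) (g : Bool) : Prop :=
  ∃ x y, S.p0 g ≤ x ∧ x < S.p1 g ∧ S.p1 g ≤ y ∧ y < S.p2 g ∧ ¬ Le (T.E g) x y K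

theorem badPair_rev {g : Bool} (h : BadPair S K g) : BadPair S K !g := by
  obtain ⟨x, y, h1, h2, h3, h4, h5⟩ := h
  have a := S.r0 g
  have b := S.r1 g
  have c := S.r2 g
  have d := S.h2n g
  have e := S.h12 g
  have f := S.h01 g
  refine ⟨T.n - 1 - y, T.n - 1 - x, by omega, by omega, by omega, by omega, ?_⟩
  rwa [Inst.le_rev_iff (by omega) (by omega)]

/-- The meaning of the flag `OK` and of the marks of the vertices that are hit. -/
structure SegInv (S : Seg T) (K : ℕ) (Bad : Prop) (s : St) : Prop extends SegHolds S K s where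
  ok : s.v vOK = 0 → Bad
  cert : s.v vOK ≠ 0 → ∀ g x, S.p0 g ≤ x → x < S.p1 g → s.a (aHIT g) x ≠ 0 → Cert S K g x

/-- Check that the distances to the second block are at most `K`. -/
def hitCheck (g : Bool) : Cmd :=
  .for vP (V (vP1 g)) (V (vP2 g)) (.when (.lt (V vK) (.rd (aDIST g) (V vP))) (.asg vOK 0))

/-- Mark the vertices of the first block whose distance to the vertex `S` is at most `K`. -/
def hitMark (g : Bool) : Cmd :=
  .for vQ (V vS) (V vHI) (.when (.lt (.rd (aDIST !g) (V vQ)) (V vK + 1))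
    (.asg vX1 (V vN - 1 - V vQ) ;;
    .when (.eq (.rd (aHIT g) (V vX1)) 0)
      (.wr (aHIT g) (V vX1) 1 ;; .when (.rd (aBIG g) (V vX1)) (decCov g))))

/-- Hit the vertex `S`: check that it is close to the second block and mark the vertices of the
first block that are close to it. -/
def hit (g : Bool) : Cmd :=
  .asg vHI (V (vP2 g)) ;; fwd g ;; hitCheck g ;;
  .asg vS (V vN - 1 - V vS) ;; .asg vHI (V vN - V (vP0 g)) ;; fwd (!g) ;; hitMark g

/-- The number of live vertices. -/
def rem (S : Seg T) (g : Bool) (s : St) : ℕ :=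
  liveSum (S.p0 g) (S.p1 g) (s.a (aHIT g)) (s.a (aBIG g)) fun _ => 1

/-- The counts are correct. -/
def CovInv (S : Seg T) (g : Bool) (s : St) : Prop :=
  CovOK (S.p0 g) (S.p1 g) T.kk (s.a (aHIT g)) (s.a (aBIG g)) (s.a (aLU g)) (s.a (aCOV g))

theorem hitCheck_spec (g : Bool) {Bad : Prop} {s₂ : St} (hS₂ : SegHolds S K s₂)
    (hbad : BadPair S K g → Bad) (hok : s₂.v vOK = 0 → Bad) {x : ℕ} (hx0 : S.p0 g ≤ x)
    (hx1 : x < S.p1 g) (d₂ : IsDist T g K x (S.p2 g) (s₂.a (aDIST g))) :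
    ((run E (hitCheck g) s₂).v vOK = 0 → Bad) ∧
    ((run E (hitCheck g) s₂).v vOK ≠ 0 → s₂.v vOK ≠ 0 ∧
      ∀ y, S.p1 g ≤ y → y < S.p2 g → Le (T.E g) x y K) ∧
    cost E (hitCheck g) s₂ ≤ 3 * (S.p2 g - S.p1 g) + 2 := by
  have h12 := S.h12 g
  have h2n := S.h2n g
  obtain ⟨h₃, t₃⟩ := for_frame_const E (hitCheck g) s₂ rfl
    (fun i s' => (s'.v vOK = 0 → Bad) ∧ (s'.v vOK ≠ 0 → s₂.v vOK ≠ 0 ∧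
      ∀ y, S.p1 g ≤ y → y < i → Le (T.E g) x y K)) 2
    (by simp [hS₂.p1, hS₂.p2]; omega)
    ⟨hok, fun h => ⟨h, fun y h1 h2 => by
      simp [hS₂.p1] at h2; omega⟩⟩ (by
      rintro i s' hi1 hi2 hS ⟨h1, h2⟩
      simp only [ev_var, hS₂.p1, hS₂.p2] at hi1 hi2
      have hH' := hS₂.same hS
      have ed : s'.a (aDIST g) = s₂.a (aDIST g) := hS.a _
      have hd := d₂ i (by omega) hi2 K le_rfl
      simp only [exec, hH'.thr, ed]
      refine ⟨?_, by omega⟩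
      by_cases hlt : K < s₂.a (aDIST g) i
      · simp [hlt]
        exact hbad ⟨x, i, hx0, hx1, hi1, hi2, fun hl => by have := hd.2 hl; omega⟩
      · simp [hlt]
        refine ⟨h1, fun h => ⟨(h2 h).1, fun y hy1 hy2 => ?_⟩⟩
        rcases (by omega : y < i ∨ y = i) with hy | rfl
        · exact (h2 h).2 y hy1 hy
        · exact hd.1 (by omega))
  simp only [ev_var, hS₂.p2, hS₂.p1] at h₃ t₃
  exact ⟨h₃.1, h₃.2, t₃⟩

/-- The search starts at the image `T.n - 1 - x` in the reversed graph, so a position `q` met there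
stands for the vertex `T.n - 1 - q ≤ x` of the original one. A vertex is marked once only; if it has
a long list, the time `3 * T.kk + 8` for taking its list out of the counts is paid by the decrease
of `rem`. -/
theorem hitMark_spec (g : Bool) (hB : Big T K E) {s₅ : St} (hS₅ : SegHolds S K s₅)
    (hC : CovInv S g s₅) {x : ℕ} (hx0 : S.p0 g ≤ x) (hx1 : x < S.p1 g)
    (e5S : s₅.v vS = T.n - 1 - x) (e5H : s₅.v vHI = T.n - S.p0 g)
    (d₅ : IsDist T (!g) K (T.n - 1 - x) (T.n - S.p0 g) (s₅.a (aDIST !g))) :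
    CovInv S g (run E (hitMark g) s₅) ∧
      (∀ y, s₅.a (aHIT g) y ≠ 0 → (run E (hitMark g) s₅).a (aHIT g) y ≠ 0) ∧
      (∀ y, S.p0 g ≤ y → y < S.p1 g → Le (T.E g) y x K → (run E (hitMark g) s₅).a (aHIT g) y ≠ 0) ∧
      (∀ y, S.p0 g ≤ y → y < S.p1 g → (run E (hitMark g) s₅).a (aHIT g) y ≠ 0 →
        s₅.a (aHIT g) y ≠ 0 ∨ Le (T.E g) y x K) ∧
      cost E (hitMark g) s₅ + (3 * T.kk + 8) * rem S g (run E (hitMark g) s₅) ≤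
        8 * (x + 1 - S.p0 g) + 2 + (3 * T.kk + 8) * rem S g s₅ := by
  have hlin := hB.lin
  have h01 := S.h01 g
  have h12 := S.h12 g
  have h2n := S.h2n g
  obtain ⟨t₆, h₆, ht₆⟩ := for_frame E (hitMark g) s₅ rfl
    (fun q s' t => CovInv S g s' ∧ (∀ y, s₅.a (aHIT g) y ≠ 0 → s'.a (aHIT g) y ≠ 0) ∧
      (∀ y, S.p0 g ≤ y → y < S.p1 g → T.n - 1 - y < q → Le (T.E g) y x K → s'.a (aHIT g) y ≠ 0) ∧
      (∀ y, S.p0 g ≤ y → y < S.p1 g → s'.a (aHIT g) y ≠ 0 →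
        s₅.a (aHIT g) y ≠ 0 ∨ Le (T.E g) y x K) ∧
      t + (3 * T.kk + 8) * rem S g s' ≤ 8 * (q - (T.n - 1 - x)) + (3 * T.kk + 8) * rem S g s₅)
    (by simp [e5S, e5H]; omega)
    (by
      refine ⟨hC, fun _ h => h, fun y hy0 hy1 hy hl => ?_, fun _ _ _ h => Or.inl h, by
        simp only [ev_var, e5S]; omega⟩
      simp only [ev_var, e5S] at hy
      obtain ⟨k, _, hw⟩ := hl
      have := Inst.le_of_wk hw
      omega) (by
      rintro q s' t hq1 hq2 hS ⟨a1, a2, a3, a4, a5⟩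
      simp only [ev_var, e5S, e5H] at hq1 hq2
      have hH' := hS₅.same hS
      have fB : s'.a (aBIG g) = s₅.a (aBIG g) := hS.a _
      have fL : s'.a (aLU g) = s₅.a (aLU g) := hS.a _
      have fD : s'.a (aDIST !g) = s₅.a (aDIST !g) := hS.a _
      have hd := d₅ q hq1 hq2 K le_rfl
      obtain ⟨y, rfl⟩ : ∃ y, q = T.n - 1 - y := ⟨T.n - 1 - q, by omega⟩
      obtain ⟨hyn, hyx, hy0⟩ : T.n - 1 - (T.n - 1 - (T.n - 1 - y)) = T.n - 1 - y ∧
        (T.n - 1 - (T.n - 1 - y)) ≤ x ∧ S.p0 g ≤ T.n - 1 - (T.n - 1 - y) := by omega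
      set z := T.n - 1 - (T.n - 1 - y) with hz
      rw [← hyn] at hd hq1 hq2 a3 a5 ⊢
      rw [Inst.le_rev_iff (by omega) (by omega)] at hd
      have hmin : min (K + 1) E.B = K + 1 := by omega
      have hsucc : ∀ y, S.p0 g ≤ y → y < S.p1 g → T.n - 1 - y < T.n - 1 - z + 1 → y ≠ z →
          T.n - 1 - y < T.n - 1 - z := by omega
      have hm : T.n - 1 - (T.n - 1 - z) = z := by omega
      simp only [exec, hH'.thr, fD, hmin, hH'.n, hm, Nat.reduceEqDiff, fB, reduceCtorEq]
      by_cases hlt : s₅.a (aDIST !g) (T.n - 1 - z) < K + 1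
      swap
      · simp only [hlt, if_true, if_false]
        refine ⟨a1, a2, fun u hu0 hu1 hu hl => ?_, a4, ?_⟩
        · rcases eq_or_ne u z with rfl | hne
          · exact absurd (hd.2 hl) (by omega)
          · exact a3 u hu0 hu1 (hsucc u hu0 hu1 hu hne) hl
        · change _ + (3 * T.kk + 8) * rem S g s' ≤ _
          omega
      have hle := hd.1 (by omega)
      simp only [hlt, exec]
      by_cases hh : s'.a (aHIT g) z = 0
      swap
      · simp only [hh, if_true, if_false]
        refine ⟨a1, a2, fun u hu0 hu1 hu hl => ?_, a4, ?_⟩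
        · rcases eq_or_ne u z with rfl | hne
          · exact hh
          · exact a3 u hu0 hu1 (hsucc u hu0 hu1 hu hne) hl
        · change _ + (3 * T.kk + 8) * rem S g s' ≤ _
          omega
      simp only [hh, exec]
      have m2 : ∀ u, s₅.a (aHIT g) u ≠ 0 → Function.update (s'.a (aHIT g)) z 1 u ≠ 0 := by
        intro u hu
        rw [Function.update_apply]; split_ifs
        exacts [one_ne_zero, a2 u hu]
      have m3 : ∀ u, S.p0 g ≤ u → u < S.p1 g → T.n - 1 - u < T.n - 1 - z + 1 →
          Le (T.E g) u x K → Function.update (s'.a (aHIT g)) z 1 u ≠ 0 := by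
        intro u hu0 hu1 hu hl
        rw [Function.update_apply]; split_ifs with hne
        exacts [one_ne_zero, a3 u hu0 hu1 (hsucc u hu0 hu1 hu hne) hl]
      have m4 : ∀ u, S.p0 g ≤ u → u < S.p1 g → Function.update (s'.a (aHIT g)) z 1 u ≠ 0 →
          s₅.a (aHIT g) u ≠ 0 ∨ Le (T.E g) u x K := by
        intro u hu0 hu1 hu
        rw [Function.update_apply] at hu
        split_ifs at hu with hne
        · exact Or.inr (hne ▸ hle)
        · exact a4 u hu0 hu1 hu
      have hz1 : z < S.p1 g := by omega
      have hrem := liveSum_update (big := s₅.a (aBIG g)) (fun _ => 1) hy0 hz1 hh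
      have hcov := fun u => liveSum_update (big := s₅.a (aBIG g))
        (fun x => occ T.kk (s₅.a (aLU g)) x u) hy0 hz1 hh
      unfold CovInv CovOK at a1
      unfold CovInv CovOK
      unfold rem at a5 ⊢
      by_cases hb : s₅.a (aBIG g) z = 0
      · simp only [hb, if_true, add_zero] at hrem hcov ⊢
        simp only [exec, Nat.reduceEqDiff, fB, fL, hrem, hcov] at a1 a5 ⊢
        exact ⟨a1, m2, m3, m4, by omega⟩
      · simp only [hb, if_false] at hrem hcov ⊢
        set s₇ := (((s'.setV vQ (T.n - 1 - z)).setV vX1 z).setA (aHIT g) z 1) with hs₇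
        have hH₇ : Holds T K s₇ := ((hH'.toHolds.setV vQ _ rfl).setV vX1 _ rfl).setA _ _ _
        obtain ⟨b1, b2⟩ := decCov_spec (s := s₇) g hB hH₇ (x := z) (by simp [hs₇]) (by omega)
        rw [run_a (decCov g) s₇ (aHIT g), run_a (decCov g) s₇ (aBIG g),
          run_a (decCov g) s₇ (aLU g), b1]
        simp only [hs₇, exec, Nat.reduceEqDiff, fB, fL] at a1 a5 b2 ⊢
        refine ⟨fun u hu0 hu1 => ?_, m2, m3, m4, ?_⟩
        · rw [a1 u hu0 hu1, ← hcov u]; omega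
        · rw [← hrem, mul_add, mul_one] at a5
          omega)
  simp only [ev_var, e5H] at h₆
  obtain ⟨b1, b2, b3, b4, b5⟩ := h₆
  refine ⟨b1, b2, fun y hy0 hy1 hl => ?_, b4, ?_⟩
  · refine b3 y hy0 hy1 ?_ hl
    obtain ⟨k, _, hw⟩ := hl
    have := Inst.le_of_wk hw
    omega
  · omega

/-- A newly marked `u` reaches `x` within `K`, and `x` has been checked to reach the second block
within `K`; the triangle inequality gives `Cert`. If the check fails, the pair found is bad. The
time is amortized: the two searches cost at most a multiple of `S.size`, the removal of lists is
paid by `rem`. -/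
theorem hit_spec (g : Bool) {Bad : Prop} (hB : Big T K E) (hI : SegInv S K Bad s)
    (hbad : BadPair S K g → Bad) (hC : CovInv S g s) {x : ℕ} (hx : s.v vS = x)
    (hx0 : S.p0 g ≤ x) (hx1 : x < S.p1 g) :
    SegInv S K Bad (run E (hit g) s) ∧ CovInv S g (run E (hit g) s) ∧
      ((run E (hit g) s).v vOK ≠ 0 → s.v vOK ≠ 0) ∧
      (∀ y, s.a (aHIT g) y ≠ 0 → (run E (hit g) s).a (aHIT g) y ≠ 0) ∧
      (∀ y, S.p0 g ≤ y → y < S.p1 g → Le (T.E g) y x K → (run E (hit g) s).a (aHIT g) y ≠ 0) ∧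
      cost E (hit g) s + (3 * T.kk + 8) * rem S g (run E (hit g) s) ≤
        20 * S.size + 40 + (3 * T.kk + 8) * rem S g s := by
  have hlin := hB.lin
  have h01 := S.h01 g
  have h12 := S.h12 g
  have h2n := S.h2n g
  have hr0 := S.r0 g
  have hr1 := S.r1 g
  have hr2 := S.r2 g
  -- forward search
  set s₁ := run E (.asg vHI (V (vP2 g))) s with hs₁
  have hS₁ : SegHolds S K s₁ := hI.toSegHolds.run _
  obtain ⟨d₂, t₂⟩ := fwd_spec (s := s₁) g hB hS₁.toHolds (x := x) (h := S.p2 g) (by simp [hs₁, hx])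
    (by simp [hs₁, hI.p2]) (by omega) h2n
  set s₂ := run E (fwd g) s₁ with hs₂
  have hS₂ : SegHolds S K s₂ := hS₁.run _
  have e₂ : s₂.v vOK = s.v vOK := by
    rw [hs₂, run_v _ _ _, hs₁, run_v _ _ _]
  obtain ⟨h₃, h₃', t₃⟩ := hitCheck_spec (E := E) g hS₂ hbad (fun h => hI.ok (by rw [← e₂, h]))
    hx0 hx1 d₂
  set s₃ := run E (hitCheck g) s₂ with hs₃
  have hS₃ : SegHolds S K s₃ := hS₂.run _
  -- backward search
  set s₄ := run E (.asg vHI (V vN - V (vP0 g))) (run E (.asg vS (V vN - 1 - V vS)) s₃) with hs₄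
  have hS₄ : SegHolds S K s₄ := (hS₃.run _).run _
  have e₃ : s₃.v vS = x := by
    rw [hs₃, run_v _ _ _, hs₂, run_v _ _ _, hs₁]
    simp [hx]
  have e4S : s₄.v vS = T.n - 1 - x := by simp [hs₄, e₃, hS₃.n]
  have e4H : s₄.v vHI = T.n - S.p0 g := by simp [hs₄, hS₃.n, hS₃.p0]
  obtain ⟨d₅, t₅⟩ := fwd_spec (s := s₄) (!g) hB hS₄.toHolds e4S e4H (by omega) (by omega)
  set s₅ := run E (fwd (!g)) s₄ with hs₅
  have hS₅ : SegHolds S K s₅ := hS₄.run _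
  have e5S : s₅.v vS = T.n - 1 - x := by rw [hs₅, run_v _ _ _, e4S]
  have e5H : s₅.v vHI = T.n - S.p0 g := by rw [hs₅, run_v _ _ _, e4H]
  have frame : ∀ j, (j = aBIG g ∨ j = aLU g ∨ j = aHIT g ∨ j = aCOV g ∨ j = aHIT !g) →
      s₅.a j = s.a j := by
    intro j hj
    rw [hs₅, run_a _ _ _ (by rcases hj with rfl | rfl | rfl | rfl | rfl <;> cases g <;> rfl), hs₄,
      run_a _ _ _, run_a _ _ _, hs₃,
      run_a _ _ _, hs₂,
      run_a _ _ _ (by rcases hj with rfl | rfl | rfl | rfl | rfl <;> cases g <;> rfl), hs₁,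
      run_a _ _ _]
  have hBIG := frame (aBIG g) (by simp)
  have hLU := frame (aLU g) (by simp)
  have hHIT := frame (aHIT g) (by simp)
  have hCOV := frame (aCOV g) (by simp)
  have hHIT' := frame (aHIT !g) (by simp)
  have hC₅ : CovInv S g s₅ := by
    unfold CovInv at hC ⊢; rw [hBIG, hLU, hHIT, hCOV]; exact hC
  obtain ⟨b1, b2, b3, b4, b5⟩ := hitMark_spec g hB hS₅ hC₅ hx0 hx1 e5S e5H d₅
  have hrem : rem S g s₅ = rem S g s := by unfold rem; rw [hHIT, hBIG]
  rw [hHIT] at b2 b4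
  rw [hrem] at b5
  set s₆ := run E (hitMark g) s₅ with hs₆
  have hfin : run E (hit g) s = s₆ := rfl
  have hcost : cost E (hit g) s = 1 + (cost E (fwd g) s₁ + (cost E (hitCheck g) s₂ + (1 + (1 +
      (cost E (fwd !g) s₄ + cost E (hitMark g) s₅))))) := rfl
  have hS₆ : SegHolds S K s₆ := hS₅.run _
  have o6 : s₆.v vOK = s₃.v vOK := by
    rw [hs₆, run_v _ _ _, hs₅, run_v _ _ _, hs₄, run_v _ _ _, run_v _ _ _]
  have h6' : s₆.a (aHIT !g) = s.a (aHIT !g) := by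
    rw [hs₆, run_a _ _ _, hHIT']
  rw [hfin, hcost]
  clear_value s₆ s₅ s₄ s₃ s₂ s₁
  refine ⟨⟨hS₆, fun h => h₃ (by rw [← o6, h]), fun hok g' u hu0 hu1 hu => ?_⟩, b1,
    fun h => by rw [← e₂]; exact (h₃' (by rw [← o6]; exact h)).1, b2, b3, ?_⟩
  · rw [o6] at hok
    obtain ⟨hok', hy⟩ := h₃' hok
    rw [e₂] at hok'
    by_cases hg : g' = g
    · subst hg
      rcases b4 u hu0 hu1 hu with h | h
      · exact hI.cert hok' g' u hu0 hu1 h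
      · intro y hy1 hy2
        rw [two_mul]
        exact h.trans (hy y hy1 hy2)
    · have hg' : g' = !g := Bool.eq_not_iff.2 hg
      subst hg'
      rw [h6'] at hu
      exact hI.cert hok' _ u hu0 hu1 hu
  · have hsz := S.size_eq g
    have ho1 := (T.csr g).off_mono (S.p0 g) x hx0 (by omega)
    have ho2 := (T.csr g).off_mono x (S.p2 g) (by omega) h2n
    have ho3 := (T.csr !g).off_mono (S.p0 !g) (T.n - 1 - x) (by omega) (by omega)
    have ho4 := (T.csr !g).off_mono (T.n - 1 - x) (S.p2 !g) (by omega) (by omega)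
    rw [hr2] at ho4 hsz
    generalize (3 * T.kk + 8) * rem S g s = A at *
    generalize (3 * T.kk + 8) * rem S g s₆ = A' at *
    omega

/-! ## Truncated balls -/

abbrev vX : ℕ := ix 13 true
abbrev vB : ℕ := ix 14 false
abbrev vL : ℕ := ix 14 true
abbrev vBig : ℕ := ix 15 false
abbrev vCur : ℕ := ix 15 true
abbrev vBest : ℕ := ix 16 false
abbrev vI : ℕ := ix 16 true
abbrev vJ : ℕ := ix 17 false
abbrev vU : ℕ := ix 17 true

/-- State of the exploration of the ball of radius `K` around `x` below `p`: `td` holds the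
distances to the vertices found so far, which are `lu b, …, lu (b + L - 1)`; all walks along edges
with numbers below `e` have been considered, unless `big` is set. -/
structure Ball (T : Inst) (g : Bool) (K x p b e : ℕ) (td lu : ℕ → ℕ) (L big : ℕ) : Prop where
  pos : 1 ≤ L
  le : L ≤ T.kk
  mem : ∀ j, j < L → x ≤ lu (b + j) ∧ lu (b + j) < p ∧ td (lu (b + j)) ≤ K
  inj : ∀ i j, i < L → j < L → lu (b + i) = lu (b + j) → i = j
  surj : ∀ u, x ≤ u → u < p → td u ≤ K → ∃ j, j < L ∧ lu (b + j) = u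
  far : ∀ u, x ≤ u → u < p → K < td u → td u = K + 1
  sound : ∀ u, x ≤ u → u < p → td u ≤ K → Wk (T.E g) x u (td u)
  full : big ≠ 0 → L = T.kk
  complete : big = 0 → ∀ u k, u < p → k ≤ K →
    Wk (edg e (T.src g) (T.tgt g) (T.wt g)) x u k → td u ≤ k

namespace Ball

variable {g : Bool} {x p b e : ℕ} {td lu : ℕ → ℕ} {L big : ℕ}

/-- The new walks are those that end with the edge `e`, by `wk_succ`. It therefore suffices that the
entry of `tgt e` is at most the sum over this edge whenever that sum is at most `K`. -/
theorem complete_step (h : Ball T g K x p b e td lu L big) {td' : ℕ → ℕ} {big' : ℕ}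
    (hle : ∀ u, td' u ≤ td u) (hb : big' = 0 → big = 0) (he : e < T.m) (hp : T.src g e < p)
    (hd : big' = 0 → T.tgt g e < p → td (T.src g e) + T.wt g e ≤ K →
      td' (T.tgt g e) ≤ td (T.src g e) + T.wt g e) :
    big' = 0 → ∀ u k, u < p → k ≤ K →
      Wk (edg (e + 1) (T.src g) (T.tgt g) (T.wt g)) x u k → td' u ≤ k := by
  intro hb' u k hu hk hw
  rcases (T.csr g).wk_succ he hw with hw' | ⟨l, hw', rfl, rfl⟩
  · exact (hle u).trans (h.complete (hb hb') u k hu hk hw')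
  · have := h.complete (hb hb') _ l hp (by omega) hw'
    have := hd hb' hu (by omega)
    omega

theorem skip (h : Ball T g K x p b e td lu L big) (he : e < T.m) (hp : T.src g e < p)
    (hd : T.tgt g e < p → td (T.src g e) + T.wt g e ≤ K →
      td (T.tgt g e) ≤ td (T.src g e) + T.wt g e) :
    Ball T g K x p b (e + 1) td lu L big :=
  { h with complete := h.complete_step (fun _ => le_rfl) (fun h => h) he hp fun _ => hd }

/-- Once the list is full and another vertex turns up, completeness is given up: it is only claimed
while `big = 0`. -/
theorem overflow (h : Ball T g K x p b e td lu L big) (hL : T.kk ≤ L) :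
    Ball T g K x p b (e + 1) td lu L 1 :=
  { h with
    full := fun _ => le_antisymm h.le hL
    complete := fun h => absurd h one_ne_zero }

theorem improve (h : Ball T g K x p b e td lu L big) (he : e < T.m) (hx : x ≤ T.src g e)
    (hp : T.src g e < p) (hs : td (T.src g e) ≤ K) (hu : td (T.tgt g e) ≤ K)
    (hlt : td (T.src g e) + T.wt g e < td (T.tgt g e)) :
    Ball T g K x p b (e + 1) (Function.update td (T.tgt g e) (td (T.src g e) + T.wt g e)) lu L
      big := by
  have hle : ∀ u, Function.update td (T.tgt g e) (td (T.src g e) + T.wt g e) u ≤ td u := by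
    intro u
    rw [Function.update_apply]
    split_ifs with h
    · rw [h]; exact hlt.le
    · exact le_rfl
  have hiff : ∀ u, Function.update td (T.tgt g e) (td (T.src g e) + T.wt g e) u ≤ K →
      td u ≤ K := by
    intro u hu'
    rw [Function.update_apply] at hu'
    split_ifs at hu' with h
    · rw [h]; exact hu
    · exact hu'
  refine ⟨h.pos, h.le, fun j hj => ⟨(h.mem j hj).1, (h.mem j hj).2.1,
    (hle _).trans (h.mem j hj).2.2⟩, h.inj, fun u h0 h1 h2 => h.surj u h0 h1 (hiff u h2),
    fun u h0 h1 h2 => ?_, fun u h0 h1 h2 => ?_, h.full, h.complete_step hle (fun h => h) he hp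
      fun _ _ _ => by rw [Function.update_self]⟩
  · rw [Function.update_apply] at h2 ⊢
    split_ifs at h2 ⊢
    · omega
    · exact h.far u h0 h1 h2
  · rw [Function.update_apply]
    split_ifs with hut
    · subst hut
      exact (h.sound _ hx hp hs).snoc ⟨e, he, rfl, rfl, rfl⟩
    · exact h.sound u h0 h1 (hiff u h2)

theorem append (h : Ball T g K x p b e td lu L big) (he : e < T.m) (hx : x ≤ T.src g e)
    (hp : T.src g e < p) (hs : td (T.src g e) + T.wt g e ≤ K) (hu : K < td (T.tgt g e))
    (ht : T.tgt g e < p) (hL : L < T.kk) :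
    Ball T g K x p b (e + 1) (Function.update td (T.tgt g e) (td (T.src g e) + T.wt g e))
      (Function.update lu (b + L) (T.tgt g e)) (L + 1) big := by
  have hxt : x ≤ T.tgt g e := hx.trans ((T.csr g).src_lt_tgt e he).le
  have hle : ∀ u, Function.update td (T.tgt g e) (td (T.src g e) + T.wt g e) u ≤ td u := by
    intro u
    rw [Function.update_apply]
    split_ifs with h
    · rw [h]; omega
    · exact le_rfl
  have hlu : ∀ j, j < L → Function.update lu (b + L) (T.tgt g e) (b + j) = lu (b + j) :=
    fun j hj => Function.update_of_ne (by omega) _ _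
  have hne : ∀ j, j < L → lu (b + j) ≠ T.tgt g e := fun j hj hc => by
    have := (h.mem j hj).2.2
    rw [hc] at this; omega
  refine ⟨by omega, hL, fun j hj => ?_, fun i j hi hj hij => ?_, fun u h0 h1 h2 => ?_,
    fun u h0 h1 h2 => ?_, fun u h0 h1 h2 => ?_, fun hb => by have := h.full hb; omega,
    h.complete_step hle (fun h => h) he hp fun _ _ _ => by rw [Function.update_self]⟩
  · rcases Nat.lt_succ_iff_lt_or_eq.1 hj with hj | rfl
    · rw [hlu j hj]
      exact ⟨(h.mem j hj).1, (h.mem j hj).2.1, (hle _).trans (h.mem j hj).2.2⟩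
    · rw [Function.update_self, Function.update_self]
      exact ⟨hxt, ht, hs⟩
  · rcases Nat.lt_succ_iff_lt_or_eq.1 hj with hj | rfl <;>
      rcases Nat.lt_succ_iff_lt_or_eq.1 hi with hi | rfl
    · rw [hlu j hj, hlu i hi] at hij
      exact h.inj i j hi hj hij
    · rw [hlu j hj, Function.update_self] at hij
      exact absurd hij.symm (hne j hj)
    · rw [hlu i hi, Function.update_self] at hij
      exact absurd hij (hne i hi)
    · rfl
  · by_cases hut : u = T.tgt g e
    · exact ⟨L, by omega, by rw [Function.update_self, hut]⟩
    · rw [Function.update_of_ne hut] at h2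
      obtain ⟨j, hj, hj'⟩ := h.surj u h0 h1 h2
      exact ⟨j, by omega, by rw [hlu j hj, hj']⟩
  · rw [Function.update_apply] at h2 ⊢
    split_ifs at h2 ⊢
    · omega
    · exact h.far u h0 h1 h2
  · rw [Function.update_apply] at h2 ⊢
    split_ifs at h2 ⊢ with hut
    · subst hut
      exact (h.sound _ hx hp (by omega)).snoc ⟨e, he, rfl, rfl, rfl⟩
    · exact h.sound u h0 h1 h2

/-- There is nothing to do for the vertices in `[c, q)` if none of them has been found. -/
theorem jump {c q : ℕ} (h : Ball T g K x p b (T.off g c) td lu L big) (hcq : c ≤ q) (hx : x ≤ c)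
    (hqp : q ≤ p) (hq : q ≤ T.n) (hno : ∀ j, j < L → c ≤ lu (b + j) → q ≤ lu (b + j)) :
    Ball T g K x p b (T.off g q) td lu L big where
  __ := h
  complete := fun hb u k hu hk hw => by
    refine h.complete hb u k hu hk ((T.csr g).wk_gap hq hcq le_rfl ?_ hw hk)
    intro y l hy hl h1 h2
    obtain ⟨j, hj, rfl⟩ := h.surj y (by omega) (by omega)
      ((h.complete hb y l (by omega) hl hy).trans hl)
    have := hno j hj h1
    omega

end Ball

/-- Find the first vertex that has been found and is not below `Cur`. -/
def exPick (g : Bool) : Cmd :=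
  .asg vBest (V (vP1 g)) ;;
  .for vJ 0 (V vL) (.asg vU (.rd (aLU g) (V vB + V vJ)) ;;
    .ite (.lt (V vU) (V vCur)) .skip (.when (.lt (V vU) (V vBest)) (.asg vBest (V vU))))

/-- The vertices of a ball are processed in the order of their positions. A linear scan of the list
replaces a priority queue, at cost `O(kk)` for each processed vertex. The value `S.p1 g` means that
no vertex is left. -/
theorem exPick_spec (g : Bool) (hH : SegHolds S K s) {b L cur : ℕ} {lu : ℕ → ℕ}
    (hb : s.v vB = b) (hL : s.v vL = L) (hc : s.v vCur = cur) (hlu : s.a (aLU g) = lu)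
    (hbj : ∀ j, j < L → min (b + j) E.B = b + j) :
    (run E (exPick g) s).v vBest ≤ S.p1 g ∧
    (∀ j, j < L → cur ≤ lu (b + j) → (run E (exPick g) s).v vBest ≤ lu (b + j)) ∧
    ((run E (exPick g) s).v vBest = S.p1 g ∨ ∃ j, j < L ∧
      lu (b + j) = (run E (exPick g) s).v vBest ∧ cur ≤ (run E (exPick g) s).v vBest) ∧
    cost E (exPick g) s ≤ 5 * L + 3 := by
  rw [exPick, run_seq, cost_seq]
  obtain ⟨h1, t1⟩ := for_frame_const E (.for vJ 0 (V vL) (.asg vU (.rd (aLU g) (V vB + V vJ)) ;; .ite (.lt (V vU) (V vCur)) .skip (.when (.lt (V vU) (V vBest)) (.asg vBest (V vU)))))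
      (run E (.asg vBest (V (vP1 g))) s) rfl
    (fun i s' => s'.v vBest ≤ S.p1 g ∧ (∀ j, j < i → cur ≤ lu (b + j) → s'.v vBest ≤ lu (b + j)) ∧
      (s'.v vBest = S.p1 g ∨ ∃ j, j < L ∧ lu (b + j) = s'.v vBest ∧ cur ≤ s'.v vBest)) 4
    (by simp) (by simp [hH.p1]) (by
      rintro i s' - hi hS ⟨a1, a2, a3⟩
      have e1 : s'.v vB = b := by rw [hS.v _]; simp [hb]
      have e2 : s'.v vCur = cur := by rw [hS.v _]; simp [hc]
      have e3 : s'.a (aLU g) = lu := by rw [hS.a _]; simp [hlu]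
      have hi : i < L := by simpa [hL] using hi
      simp only [exec, e1, e2, e3, hbj i hi, Nat.reduceEqDiff, reduceCtorEq]
      have hstep : ∀ j, j ≤ i → j < i ∨ j = i := by omega
      by_cases h1 : lu (b + i) < cur
      · simp [h1]
        refine ⟨a1, fun j hj hcj => ?_, a3⟩
        rcases hstep j hj with hj | rfl
        · exact a2 j hj hcj
        · omega
      · by_cases h2 : lu (b + i) < s'.v vBest
        · simp [h1, h2]
          refine ⟨by omega, fun j hj hcj => ?_, Or.inr ⟨i, hi, rfl, by omega⟩⟩
          rcases hstep j hj with hj | rfl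
          · exact h2.le.trans (a2 j hj hcj)
          · omega
        · simp [h1, h2]
          refine ⟨a1, fun j hj hcj => ?_, by simpa using a3⟩
          rcases hstep j hj with hj | rfl
          · exact a2 j hj hcj
          · omega)
  simp only [ev_var, run_asg, setV_v, ix_inj, Nat.reduceEqDiff, false_and, if_false, hL,
    ev_0, Nat.sub_zero] at h1 t1 ⊢
  refine ⟨h1.1, h1.2.1, h1.2.2, ?_⟩
  simp only [cost_asg]
  omega

/-- Relax the edges that leave `Best`. -/
def exRelax (g : Bool) : Cmd :=
  .for vE (.rd (aOFF g) (V vBest)) (.rd (aOFF g) (V vBest + 1))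
    (.asg vU (.rd (aTGT g) (V vE)) ;;
    .when (.lt (V vU) (V (vP1 g)))
      (.asg vD (.rd (aTD g) (V vBest) + .rd (aWT g) (V vE)) ;;
      .when (.lt (V vD) (V vK + 1))
        (.ite (.lt (V vK) (.rd (aTD g) (V vU)))
          (.ite (.lt (V vL) (V vKH))
            (.wr (aLU g) (V vB + V vL) (V vU) ;; .wr (aTD g) (V vU) (V vD) ;;
              .asg vL (V vL + 1))
            (.asg vBig 1))
          (.when (.lt (V vD) (.rd (aTD g) (V vU))) (.wr (aTD g) (V vU) (V vD))))))

theorem exRelax_spec (g : Bool) (hB : Big T K E) (hH : SegHolds S K s) {x q : ℕ}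
    (hb : s.v vB = x * T.kk) (hq : s.v vBest = q) (hx : x ≤ q) (hqp : q < S.p1 g)
    (hbj : ∀ j, j < T.kk → min (x * T.kk + j) E.B = x * T.kk + j)
    (htd : s.a (aTD g) q ≤ K)
    (hBall : Ball T g K x (S.p1 g) (x * T.kk) (T.off g q) (s.a (aTD g)) (s.a (aLU g)) (s.v vL)
      (s.v vBig)) :
    Ball T g K x (S.p1 g) (x * T.kk) (T.off g (q + 1)) ((run E (exRelax g) s).a (aTD g))
      ((run E (exRelax g) s).a (aLU g)) ((run E (exRelax g) s).v vL)
      ((run E (exRelax g) s).v vBig) ∧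
    s.v vL ≤ (run E (exRelax g) s).v vL ∧
    (∀ i, (i < x * T.kk + s.v vL ∨ x * T.kk + T.kk ≤ i) →
      (run E (exRelax g) s).a (aLU g) i = s.a (aLU g) i) ∧
    (∀ u, ¬ (x ≤ u ∧ u < S.p1 g) → (run E (exRelax g) s).a (aTD g) u = s.a (aTD g) u) ∧
    cost E (exRelax g) s ≤ 11 * (T.off g (q + 1) - T.off g q) + 2 := by
  have hlin := hB.lin
  have h12 := S.h12 g
  have h2n := S.h2n g
  have hq1 : min (q + 1) E.B = q + 1 := by omega
  have hKB : min (K + 1) E.B = K + 1 := by omega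
  have hoff := (T.csr g).off_mono q (q + 1) (by omega) (by omega)
  have hoffm := (T.csr g).off_le_m (p := q + 1) (by omega)
  obtain ⟨h1, t1⟩ := for_frame_const E (exRelax g) s rfl
    (fun e s' => Ball T g K x (S.p1 g) (x * T.kk) e (s'.a (aTD g)) (s'.a (aLU g)) (s'.v vL)
      (s'.v vBig) ∧ s'.a (aTD g) q ≤ K ∧ s.v vL ≤ s'.v vL ∧
      (∀ i, (i < x * T.kk + s.v vL ∨ x * T.kk + T.kk ≤ i) → s'.a (aLU g) i = s.a (aLU g) i) ∧
      (∀ u, ¬ (x ≤ u ∧ u < S.p1 g) → s'.a (aTD g) u = s.a (aTD g) u)) 10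
    (by simpa [hH.off, hq, hq1] using hoff)
    ⟨by simpa [hH.off, hq] using hBall, htd, le_rfl, fun _ _ => rfl, fun _ _ => rfl⟩ (by
      rintro e s' he1 he2 hS ⟨a1, a2, a3, a4, a5⟩
      simp only [exec, hH.off, hq, hq1] at he1 he2
      have hsrc := (T.csr g).src_eq (by omega) he1 he2
      have hst := (T.csr g).src_lt_tgt e (by omega)
      have hH' := hH.same hS
      have e1 : s'.v vB = x * T.kk := by rw [hS.v _, hb]
      have e2 : s'.v vBest = q := by rw [hS.v _, hq]
      simp only [exec, e1, e2, Nat.reduceEqDiff, reduceCtorEq, hH'.tgt, hH'.wt, hH'.thr, hH'.kk,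
        hH'.p1, hKB]
      have ne0 : (1 : ℕ) ≠ 0 := one_ne_zero
      by_cases c1 : T.tgt g e < S.p1 g
      swap
      · simp [c1]
        exact ⟨a1.skip (by omega) (by omega) fun h => absurd h c1, a2, a3, a4, fun u hu => a5 u (by omega)⟩
      simp only [c1, if_true, ne0, if_false]
      by_cases c2 : min (s'.a (aTD g) q + T.wt g e) E.B < K + 1
      swap
      · simp [c2]
        refine ⟨a1.skip (by omega) (by omega) fun h h' => ?_, a2, a3, a4, fun u hu => a5 u (by omega)⟩
        rw [hsrc] at h'; omega
      simp only [c2, if_true, ne0, if_false]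
      have hD : min (s'.a (aTD g) q + T.wt g e) E.B = s'.a (aTD g) q + T.wt g e := by omega
      rw [hD] at c2 ⊢
      by_cases c3 : K < s'.a (aTD g) (T.tgt g e)
      · simp only [c3, if_true, ne0, if_false]
        by_cases c4 : s'.v vL < T.kk
        · have hL1 : min (s'.v vL + 1) E.B = s'.v vL + 1 := by have := T.kk_le; omega
          simp [c4, hbj _ c4, hL1]
          refine ⟨?_, ?_, by omega, fun i hi => ?_, fun u hu => ?_⟩
          · have := a1.append (by omega) (by omega) (by omega) (by rw [hsrc]; omega) c3 c1 c4
            rwa [hsrc] at this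
          · rw [Function.update_of_ne (by omega)]; exact a2
          · rw [Function.update_of_ne (by omega)]; exact a4 i hi
          · rw [Function.update_of_ne (by omega)]; exact a5 u (by omega)
        · simp [c4]
          exact ⟨a1.overflow (by omega), a2, a3, a4, fun u hu => a5 u (by omega)⟩
      · simp only [c3, if_true, if_false]
        by_cases c4 : s'.a (aTD g) q + T.wt g e < s'.a (aTD g) (T.tgt g e)
        · simp [c4]
          refine ⟨?_, ?_, by omega, a4, fun u hu => ?_⟩
          · have := a1.improve (by omega) (by omega) (by omega) (by rw [hsrc]; omega)
              (by omega) (by rw [hsrc]; exact c4)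
            rwa [hsrc] at this
          · rw [Function.update_of_ne (by omega)]; exact a2
          · rw [Function.update_of_ne (by omega)]; exact a5 u (by omega)
        · simp [c4]
          refine ⟨a1.skip (by omega) (by omega) fun _ _ => ?_, a2, a3, a4, fun u hu => a5 u (by omega)⟩
          rw [hsrc]; omega)
  simp only [exec, hH.off, hq, hq1] at h1 t1
  exact ⟨h1.1, h1.2.2.1, h1.2.2.2.1, h1.2.2.2.2, by simpa [exRelax] using t1⟩

/-- Explore the ball around `X`. -/
def exMain (g : Bool) : Cmd :=
  .asg vB (V vX * V vKH) ;; .wr (aLU g) (V vB) (V vX) ;; .wr (aTD g) (V vX) 0 ;;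
  .asg vL 1 ;; .asg vBig 0 ;; .asg vCur (V vX) ;;
  .for vI 0 (V vKH) (exPick g ;; .ite (.lt (V vBest) (V (vP1 g)))
    (exRelax g ;; .asg vCur (V vBest + 1)) (.asg vCur (V (vP1 g))))

theorem Big.idx (hB : Big T K E) {x i : ℕ} (hx : x < T.n) (hi : i < T.kk) :
    min (x * T.kk + i) E.B = x * T.kk + i := by
  have h1 := hB.sq
  have h2 := T.kk_le
  have h3 : (x + 1) * T.kk ≤ T.n * T.n := Nat.mul_le_mul hx h2
  have h4 : T.n * T.n ≤ (T.n + 1) * (T.n + 1) := Nat.mul_le_mul (by omega) (by omega)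
  rw [add_mul, one_mul] at h3
  omega

/-- Every round processes a vertex of the list that lies beyond all processed ones, and the list has
at most `kk` entries, so `kk` rounds suffice; the invariant counts the entries below `Cur`. A round
costs `O(kk + hh)`, because all vertices found lie within `K` of `x` and so have degree at most `hh`
by `hdeg`. -/
theorem exMain_spec (g : Bool) (hB : Big T K E) (hH : SegHolds S K s) {x : ℕ}
    (hvx : s.v vX = x) (hx0 : S.p0 g ≤ x) (hx1 : x < S.p1 g)
    (htd : ∀ u, x ≤ u → u < S.p1 g → s.a (aTD g) u = K + 1)
    (hdeg : ∀ u, x ≤ u → u < S.p1 g → Le (T.E g) x u K → T.off g (u + 1) - T.off g u ≤ T.hh) :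
    Ball T g K x (S.p1 g) (x * T.kk) (T.off g (S.p1 g)) ((run E (exMain g) s).a (aTD g))
      ((run E (exMain g) s).a (aLU g)) ((run E (exMain g) s).v vL)
      ((run E (exMain g) s).v vBig) ∧
    (run E (exMain g) s).v vB = x * T.kk ∧
    (∀ i, (i < x * T.kk ∨ x * T.kk + T.kk ≤ i) →
      (run E (exMain g) s).a (aLU g) i = s.a (aLU g) i) ∧
    (∀ u, ¬ (x ≤ u ∧ u < S.p1 g) → (run E (exMain g) s).a (aTD g) u = s.a (aTD g) u) ∧
    cost E (exMain g) s ≤ (5 * T.kk + 11 * T.hh + 9) * T.kk + 8 := by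
  have hlin := hB.lin
  have h12 := S.h12 g
  have h2n := S.h2n g
  have hkp := T.kk_pos
  have hbj : ∀ j, j < T.kk → min (x * T.kk + j) E.B = x * T.kk + j :=
    fun j hj => hB.idx (by omega) hj
  have hb0 : min (x * T.kk) E.B = x * T.kk := by simpa using hbj 0 (by omega)
  set c₁ : Cmd := .asg vB (V vX * V vKH) ;; .wr (aLU g) (V vB) (V vX) ;; .wr (aTD g) (V vX) 0 ;;
    .asg vL 1 ;; .asg vBig 0 ;; .asg vCur (V vX) with hc₁
  set c₂ := Cmd.for vI 0 (V vKH) (exPick g ;; .ite (.lt (V vBest) (V (vP1 g)))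
    (exRelax g ;; .asg vCur (V vBest + 1)) (.asg vCur (V (vP1 g)))) with hc₂
  have hrun : run E (exMain g) s = run E c₂ (run E c₁ s) := rfl
  have hcost : cost E (exMain g) s = 6 + cost E c₂ (run E c₁ s) := by
    simp [exMain, hc₁, hc₂]; ring
  rw [hrun, hcost]
  have f1 : (run E c₁ s).v vB = x * T.kk := by simp [hc₁, hvx, hH.kk, hb0]
  have f2 : (run E c₁ s).v vL = 1 := by simp [hc₁]
  have f3 : (run E c₁ s).v vBig = 0 := by simp [hc₁]
  have f4 : (run E c₁ s).v vCur = x := by simp [hc₁, hvx]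
  have f5 : (run E c₁ s).a (aLU g) = Function.update (s.a (aLU g)) (x * T.kk) x := by
    simp [hc₁, hvx, hH.kk, hb0]
  have f6 : (run E c₁ s).a (aTD g) = Function.update (s.a (aTD g)) x 0 := by
    simp [hc₁, hvx, hH.kk, hb0]
  have hH₁ : SegHolds S K (run E c₁ s) := hH.run _
  set s₁ := run E c₁ s with hs₁
  clear_value s₁
  have hball : Ball T g K x (S.p1 g) (x * T.kk) (T.off g x) (s₁.a (aTD g)) (s₁.a (aLU g))
      (s₁.v vL) (s₁.v vBig) := by
    rw [f2, f3, f5, f6]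
    refine ⟨le_rfl, hkp, fun j hj => ?_, fun i j hi hj _ => by omega, fun u h0 h1 hu => ?_,
      fun u h0 h1 hu => ?_, fun u h0 h1 hu => ?_, fun h => absurd rfl h, fun _ u k hu hk hw => ?_⟩
    · obtain rfl : j = 0 := by omega
      simp [hx1]
    · rw [Function.update_apply] at hu
      split_ifs at hu with h
      · exact ⟨0, by omega, by simp [h]⟩
      · rw [htd u h0 h1] at hu; omega
    · rw [Function.update_apply] at hu ⊢
      split_ifs at hu ⊢ with h
      · omega
      · exact htd u h0 h1
    · rw [Function.update_apply] at hu ⊢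
      split_ifs at hu ⊢ with h
      · subst h; exact .nil _
      · rw [htd u h0 h1] at hu; omega
    · obtain ⟨rfl, rfl⟩ := (T.csr g).wk_start (by omega) hw
      simp
  obtain ⟨h1, t1⟩ := for_frame_const E (.for vI 0 (V vKH) (exPick g ;; .ite (.lt (V vBest) (V (vP1 g))) (exRelax g ;; .asg vCur (V vBest + 1)) (.asg vCur (V (vP1 g)))))
      s₁ rfl
    (fun i s' => s'.v vCur ≤ S.p1 g ∧ x ≤ s'.v vCur ∧
      Ball T g K x (S.p1 g) (x * T.kk) (T.off g (s'.v vCur)) (s'.a (aTD g)) (s'.a (aLU g))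
        (s'.v vL) (s'.v vBig) ∧
      (s'.v vCur = S.p1 g ∨ i ≤ ((Finset.range (s'.v vL)).filter fun j =>
        s'.a (aLU g) (x * T.kk + j) < s'.v vCur).card) ∧
      (∀ i, (i < x * T.kk ∨ x * T.kk + T.kk ≤ i) → s'.a (aLU g) i = s.a (aLU g) i) ∧
      (∀ u, ¬ (x ≤ u ∧ u < S.p1 g) → s'.a (aTD g) u = s.a (aTD g) u))
    (5 * T.kk + 11 * T.hh + 8)
    (by simp) ⟨by omega, by omega, by rw [f4]; exact hball, Or.inr (by simp), fun i hi => by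
      rw [f5, Function.update_of_ne (by omega)], fun u hu => by
      rw [f6, Function.update_of_ne (by omega)]⟩ (by
      rintro i s' - hi hS ⟨a1, a2, a3, a4, a5, a6⟩
      simp only [ev_var, hH₁.kk] at hi
      have hH' : SegHolds S K (s'.setV vI i) := (hH₁.same hS).setV _ _ rfl
      have eB : (s'.setV vI i).v vB = x * T.kk := by
        simp only [exec, Nat.reduceEqDiff]
        rw [hS.v _, f1]
      have eL : (s'.setV vI i).v vL = s'.v vL := by simp
      have eC : (s'.setV vI i).v vCur = s'.v vCur := by simp
      have eG : (s'.setV vI i).v vBig = s'.v vBig := by simp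
      rw [run_seq, cost_seq]
      obtain ⟨p1, p2, p3, pt⟩ := exPick_spec (E := E) g hH' eB eL eC rfl
        (fun j hj => hbj j (by have := a3.le; omega))
      rw [setV_a] at p2 p3
      have hH₂ : SegHolds S K (run E (exPick g) (s'.setV vI i)) := hH'.run _
      have gB : (run E (exPick g) (s'.setV vI i)).v vB = x * T.kk := by
        rw [run_v _ _ _, eB]
      have gL : (run E (exPick g) (s'.setV vI i)).v vL = s'.v vL := by
        rw [run_v _ _ _, eL]
      have gC : (run E (exPick g) (s'.setV vI i)).v vCur = s'.v vCur := by
        rw [run_v _ _ _, eC]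
      have gG : (run E (exPick g) (s'.setV vI i)).v vBig = s'.v vBig := by
        rw [run_v _ _ _, eG]
      have gLU : (run E (exPick g) (s'.setV vI i)).a (aLU g) = s'.a (aLU g) := by
        rw [run_a _ _ _, setV_a]
      have gTD : (run E (exPick g) (s'.setV vI i)).a (aTD g) = s'.a (aTD g) := by
        rw [run_a _ _ _, setV_a]
      set s₂ := run E (exPick g) (s'.setV vI i) with hs₂
      clear_value s₂
      set q := s₂.v vBest with hq
      have hle := a3.le
      have hLkk : 5 * s'.v vL ≤ 5 * T.kk := by omega
      by_cases hlt : q < S.p1 g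
      · obtain ⟨j0, hj0, hj1, hj2⟩ := p3.resolve_left (by omega)
        have htdq : s'.a (aTD g) q ≤ K := by rw [← hj1]; exact (a3.mem j0 hj0).2.2
        have hxq : x ≤ q := by rw [← hj1]; exact (a3.mem j0 hj0).1
        have hd := hdeg q hxq hlt ⟨_, htdq, a3.sound q hxq hlt htdq⟩
        have hB2 := a3.jump hj2 a2 hlt.le (by omega) p2
        rw [← gLU, ← gTD, ← gL, ← gG] at hB2
        obtain ⟨r1, r2, r3, r4, rt⟩ := exRelax_spec g hB hH₂ gB hq.symm hxq hlt hbj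
          (by rw [gTD]; exact htdq) hB2
        have hq1 : min (q + 1) E.B = q + 1 := by omega
        have hbq : (run E (exRelax g) s₂).v vBest = q := by
          rw [run_v _ _ _]
        simp only [exec, ← hq, hH₂.p1, hlt, hbq, hq1, Nat.reduceEqDiff, reduceCtorEq]
        rw [gL] at r2 r3
        refine ⟨⟨hlt, by omega, r1, Or.inr ?_, fun i hi => ?_, fun u hu => ?_⟩, by omega⟩
        · rcases a4 with a4 | a4
          · omega
          refine Nat.succ_le_of_lt (lt_of_le_of_lt a4 (Finset.card_lt_card ?_))
          rw [Finset.ssubset_iff_of_subset]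
          · refine ⟨j0, ?_, ?_⟩
            · rw [Finset.mem_filter, Finset.mem_range, r3 _ (Or.inl (by omega)), gLU, hj1]
              omega
            · rw [Finset.mem_filter, hj1]
              omega
          · intro j hj
            rw [Finset.mem_filter, Finset.mem_range] at hj ⊢
            rw [r3 _ (Or.inl (by omega)), gLU]
            omega
        · rw [r3 _ (by omega), gLU, a5 i hi]
        · rw [r4 u hu, gTD, a6 u hu]
      · have hq1 : q = S.p1 g := by omega
        rw [hq1] at p2
        simp only [exec, ← hq, hH₂.p1, hlt, Nat.reduceEqDiff, reduceCtorEq, gTD, gLU, gL, gG]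
        exact ⟨⟨le_rfl, by omega, a3.jump a1 a2 le_rfl (by omega) p2, Or.inl trivial, a5, a6⟩,
          by omega⟩)
  have hkk : ev E s₁ (V vKH) = T.kk := hH₁.kk
  rw [hkk] at h1 t1
  rw [← hc₂] at h1 t1
  have hB₂ : (run E c₂ s₁).v vB = x * T.kk := by
    rw [run_v _ _ _, f1]
  set s₂ := run E c₂ s₁
  obtain ⟨a1, a2, a3, a4, a5, a6⟩ := h1
  refine ⟨a3.jump a1 a2 le_rfl (by omega) ?_, hB₂, a5, a6, ?_⟩
  · rcases a4 with a4 | a4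
    · intro j hj hc; omega
    -- After `kk` rounds at least `kk` list entries lie below `Cur`. The list has no more than `kk`
    -- entries, so all of them do, and none is left to process.
    · intro j hj hc
      have hc1 := Finset.card_filter_le (Finset.range (s₂.v vL)) fun j =>
        s₂.a (aLU g) (x * T.kk + j) < s₂.v vCur
      rw [Finset.card_range] at hc1
      have := Finset.filter_card_eq (s := Finset.range (s₂.v vL))
        (p := fun j => s₂.a (aLU g) (x * T.kk + j) < s₂.v vCur)
        (by rw [Finset.card_range]; have := a3.le; omega) j (Finset.mem_range.2 hj)
      omega
  · simp only [ev_0, Nat.sub_zero] at t1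
    change _ ≤ (5 * T.kk + 11 * T.hh + 9) * T.kk + 2 at t1
    omega

/-! ### Storing one list and entering it into the counts. -/

/-- The list of `x` is the ball of radius `K` around `x` within the first block if `big` is `0`, and
consists of `kk` vertices of that ball otherwise. -/
structure ListOK (S : Seg T) (K : ℕ) (g : Bool) (x len big : ℕ) (lu ld : ℕ → ℕ) : Prop where
  pos : 1 ≤ len
  le : len ≤ T.kk
  mem : ∀ j, j < len → x ≤ lu (x * T.kk + j) ∧ lu (x * T.kk + j) < S.p1 g ∧
    ld (x * T.kk + j) ≤ K ∧ Wk (T.E g) x (lu (x * T.kk + j)) (ld (x * T.kk + j))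
  inj : ∀ i j, i < len → j < len → lu (x * T.kk + i) = lu (x * T.kk + j) → i = j
  full : big ≠ 0 → len = T.kk
  complete : big = 0 → ∀ u k, u < S.p1 g → k ≤ K → Wk (T.E g) x u k →
    ∃ j, j < len ∧ lu (x * T.kk + j) = u ∧ ld (x * T.kk + j) ≤ k

theorem ListOK.congr {g : Bool} {x len big : ℕ} {lu ld lu' ld' : ℕ → ℕ}
    (h : ListOK S K g x len big lu ld)
    (h1 : ∀ j, j < T.kk → lu' (x * T.kk + j) = lu (x * T.kk + j))
    (h2 : ∀ j, j < T.kk → ld' (x * T.kk + j) = ld (x * T.kk + j)) :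
    ListOK S K g x len big lu' ld' := by
  have hl := h.le
  refine ⟨h.pos, h.le, fun j hj => ?_, fun i j hi hj => ?_, h.full, fun hb u k hu hk hw => ?_⟩
  · rw [h1 j (by omega), h2 j (by omega)]; exact h.mem j hj
  · rw [h1 i (by omega), h1 j (by omega)]; exact h.inj i j hi hj
  · obtain ⟨j, hj, e1, e2⟩ := h.complete hb u k hu hk hw
    exact ⟨j, hj, by rw [h1 j (by omega), e1], by rwa [h2 j (by omega)]⟩

/-- Store the distances and clean up. -/
def exStore (g : Bool) : Cmd :=
  .for vJ 0 (V vL) (.asg vU (.rd (aLU g) (V vB + V vJ)) ;;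
    .wr (aLD g) (V vB + V vJ) (.rd (aTD g) (V vU)) ;; .wr (aTD g) (V vU) (V vK + 1))

/-- The entries of `TD` are reset to `K + 1` along the list only; by `Ball.far` all other entries in
the block have this value anyway. So the array is clean for the next ball in time `O(kk)` instead of
the length of the block. -/
theorem exStore_spec (g : Bool) (hB : Big T K E) (hH : SegHolds S K s) {x : ℕ} (hxn : x < T.n)
    (hb : s.v vB = x * T.kk)
    (hBall : Ball T g K x (S.p1 g) (x * T.kk) (T.off g (S.p1 g)) (s.a (aTD g)) (s.a (aLU g))
      (s.v vL) (s.v vBig)) :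
    ListOK S K g x (s.v vL) (s.v vBig) (s.a (aLU g)) ((run E (exStore g) s).a (aLD g)) ∧
    (∀ i, (i < x * T.kk ∨ x * T.kk + T.kk ≤ i) →
      (run E (exStore g) s).a (aLD g) i = s.a (aLD g) i) ∧
    (∀ u, x ≤ u → u < S.p1 g → (run E (exStore g) s).a (aTD g) u = K + 1) ∧
    (∀ u, ¬ (x ≤ u ∧ u < S.p1 g) → (run E (exStore g) s).a (aTD g) u = s.a (aTD g) u) ∧
    cost E (exStore g) s ≤ 4 * T.kk + 2 := by
  have hlin := hB.lin
  have hKB : min (K + 1) E.B = K + 1 := by omega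
  have hle := hBall.le
  obtain ⟨h1, t1⟩ := for_frame_const E (exStore g) s rfl
    (fun i s' => (∀ j, j < i → s'.a (aLD g) (x * T.kk + j) =
        s.a (aTD g) (s.a (aLU g) (x * T.kk + j)) ∧
        s'.a (aTD g) (s.a (aLU g) (x * T.kk + j)) = K + 1) ∧
      (∀ u, (∀ j, j < i → s.a (aLU g) (x * T.kk + j) ≠ u) → s'.a (aTD g) u = s.a (aTD g) u) ∧
      (∀ i, (i < x * T.kk ∨ x * T.kk + T.kk ≤ i) → s'.a (aLD g) i = s.a (aLD g) i)) 3
    (by simp) ⟨by simp, fun _ _ => rfl, fun _ _ => rfl⟩ (by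
      rintro i s' - hi hS ⟨a1, a2, a3⟩
      simp only [ev_var] at hi
      have e1 : s'.v vB = x * T.kk := by rw [hS.v _, hb]
      have e2 : s'.a (aLU g) = s.a (aLU g) := hS.a _
      have e3 : s'.v vK = K := by rw [hS.v _, hH.thr]
      have hidx := hB.idx hxn (i := i) (by omega)
      simp only [exec, e1, e2, e3, hidx, hKB, Nat.reduceEqDiff, reduceCtorEq]
      refine ⟨⟨fun j hj => ?_, fun u hu => ?_, fun l hl => ?_⟩, by omega⟩
      · rcases Nat.lt_succ_iff_lt_or_eq.1 hj with hj | rfl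
        · have hne : s.a (aLU g) (x * T.kk + j) ≠ s.a (aLU g) (x * T.kk + i) := fun h => by
            have := hBall.inj j i (by omega) hi h; omega
          rw [Function.update_of_ne (by omega), Function.update_of_ne hne]
          exact a1 j hj
        · rw [Function.update_self, Function.update_self]
          refine ⟨?_, rfl⟩
          exact a2 _ fun l hl h => by have := hBall.inj l j (by omega) hi h; omega
      · rw [Function.update_of_ne (hu i (by omega)).symm]
        exact a2 u fun j hj => hu j (by omega)
      · rw [Function.update_of_ne (by omega)]
        exact a3 l hl)
  simp at h1 t1
  obtain ⟨b1, b2, b3⟩ := h1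
  have hTD : ∀ u, x ≤ u → u < S.p1 g → (run E (exStore g) s).a (aTD g) u = K + 1 := by
    intro u hu0 hu1
    by_cases hu : s.a (aTD g) u ≤ K
    · obtain ⟨j, hj, rfl⟩ := hBall.surj u hu0 hu1 hu
      exact (b1 j hj).2
    · rw [b2 u fun j hj h => hu (h ▸ (hBall.mem j hj).2.2)]
      exact hBall.far u hu0 hu1 (by omega)
  refine ⟨⟨hBall.pos, hle, fun j hj => ?_, hBall.inj, hBall.full, fun hb u k hu hk hw => ?_⟩,
    b3, hTD, fun u hu => b2 u fun j hj h => hu ?_, by omega⟩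
  · obtain ⟨m1, m2, m3⟩ := hBall.mem j hj
    rw [(b1 j hj).1]
    exact ⟨m1, m2, m3, hBall.sound _ m1 m2 m3⟩
  · have hxu := Inst.le_of_wk hw
    have hc := hBall.complete hb u k hu hk ((T.csr g).wk_end hu.le (by
      have := S.h12 g; have := S.h2n g; omega) hw)
    obtain ⟨j, hj, rfl⟩ := hBall.surj u hxu hu (hc.trans hk)
    exact ⟨j, hj, rfl, by rw [(b1 j hj).1]; exact hc⟩
  · rw [← h]
    exact ⟨(hBall.mem j hj).1, (hBall.mem j hj).2.1⟩

/-- Add a list to the counts. -/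
def incCov (g : Bool) : Cmd :=
  .for vJ 0 (V vKH) (.asg vU (.rd (aLU g) (V vB + V vJ)) ;;
    .wr (aCOV g) (V vU) (.rd (aCOV g) (V vU) + 1))

/-- The room of `T.kk` below the bound in `hcov` guarantees that none of the up to `T.kk` increments
of one entry saturates. -/
theorem incCov_spec (g : Bool) (hB : Big T K E) (hH : Holds T K s) {x : ℕ}
    (hb : s.v vB = x * T.kk) (hn : x < T.n)
    (hcov : ∀ j, j < T.kk → s.a (aCOV g) (s.a (aLU g) (x * T.kk + j)) + T.kk ≤ E.B) :
    (run E (incCov g) s).a (aCOV g) = (fun u => s.a (aCOV g) u + occ T.kk (s.a (aLU g)) x u) ∧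
      cost E (incCov g) s ≤ 3 * T.kk + 2 := by
  obtain ⟨h1, t1⟩ := for_frame_const E (incCov g) s rfl
    (fun j s' => ∀ u, s'.a (aCOV g) u = s.a (aCOV g) u +
      ((Finset.range j).filter fun i => s.a (aLU g) (x * T.kk + i) = u).card) 2
    (by simp) (by simp) (by
      intro j s' _ hj hS ih
      have e1 : s'.v vB = x * T.kk := by rw [hS.v _, hb]
      have e2 : s'.a (aLU g) = s.a (aLU g) := hS.a _
      simp only [ev_var, hH.kk] at hj
      refine ⟨fun u => ?_, by simp⟩
      rw [occ_succ]
      have hm : min (s'.a (aCOV g) (s.a (aLU g) (x * T.kk + j)) + 1) E.B =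
          s'.a (aCOV g) (s.a (aLU g) (x * T.kk + j)) + 1 := by
        have h2 := hcov j hj
        generalize s.a (aLU g) (x * T.kk + j) = v at h2 ⊢
        have h1 := ih v
        have h3 : ((Finset.range j).filter fun i => s.a (aLU g) (x * T.kk + i) = v).card ≤ j :=
          (Finset.card_filter_le _ _).trans (by simp)
        omega
      simp [e1, e2, hB.idx hn hj, Function.update_apply, hm]
      by_cases hu : u = s.a (aLU g) (x * T.kk + j)
      · rw [if_pos hu, if_pos hu.symm, ← hu, ih u]; rfl
      · rw [if_neg hu, if_neg (Ne.symm hu), ih u]; rfl)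
  simp only [ev_0, ev_var, hH.kk] at h1 t1
  exact ⟨funext h1, by simpa [incCov] using t1⟩

/-- Compute the list of `X`. -/
def exOne (g : Bool) : Cmd :=
  exMain g ;; exStore g ;; .wr (aLEN g) (V vX) (V vL) ;; .wr (aBIG g) (V vX) (V vBig) ;;
    .when (V vBig) (incCov g)

theorem exOne_spec (g : Bool) (hB : Big T K E) (hH : SegHolds S K s) {x : ℕ}
    (hvx : s.v vX = x) (hx0 : S.p0 g ≤ x) (hx1 : x < S.p1 g)
    (htd : ∀ u, x ≤ u → u < S.p1 g → s.a (aTD g) u = K + 1)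
    (hdeg : ∀ u, x ≤ u → u < S.p1 g → Le (T.E g) x u K → T.off g (u + 1) - T.off g u ≤ T.hh)
    (hcov : ∀ u, S.p0 g ≤ u → u < S.p1 g → s.a (aCOV g) u + T.kk ≤ E.B) :
    ∃ L big, ListOK S K g x L big ((run E (exOne g) s).a (aLU g)) ((run E (exOne g) s).a (aLD g)) ∧
    (run E (exOne g) s).a (aLEN g) = Function.update (s.a (aLEN g)) x L ∧
    (run E (exOne g) s).a (aBIG g) = Function.update (s.a (aBIG g)) x big ∧
    (∀ i, (i < x * T.kk ∨ x * T.kk + T.kk ≤ i) → (run E (exOne g) s).a (aLU g) i = s.a (aLU g) i ∧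
      (run E (exOne g) s).a (aLD g) i = s.a (aLD g) i) ∧
    (∀ u, x ≤ u → u < S.p1 g → (run E (exOne g) s).a (aTD g) u = K + 1) ∧
    (∀ u, ¬ (x ≤ u ∧ u < S.p1 g) → (run E (exOne g) s).a (aTD g) u = s.a (aTD g) u) ∧
    (∀ u, (run E (exOne g) s).a (aCOV g) u = s.a (aCOV g) u +
      if big = 0 then 0 else occ T.kk ((run E (exOne g) s).a (aLU g)) x u) ∧
    cost E (exOne g) s ≤ (5 * T.kk + 11 * T.hh + 16) * T.kk + 15 := by
  have h12 := S.h12 g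
  have h2n := S.h2n g
  obtain ⟨a1, a2, a3, a4, a5⟩ := exMain_spec g hB hH hvx hx0 hx1 htd hdeg
  have hH₁ : SegHolds S K (run E (exMain g) s) := hH.run _
  have e1 : (run E (exMain g) s).v vX = x := by rw [run_v _ _ _, hvx]
  have e2 : (run E (exMain g) s).a (aLD g) = s.a (aLD g) := run_a _ _ _
  have e3 : (run E (exMain g) s).a (aCOV g) = s.a (aCOV g) := run_a _ _ _
  have e4 : (run E (exMain g) s).a (aLEN g) = s.a (aLEN g) := run_a _ _ _
  have e5 : (run E (exMain g) s).a (aBIG g) = s.a (aBIG g) := run_a _ _ _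
  rw [exOne, run_seq, cost_seq]
  set s₁ := run E (exMain g) s
  obtain ⟨b1, b2, b3, b4, b5⟩ := exStore_spec g hB hH₁ (by omega) a2 a1
  have hH₂ : SegHolds S K (run E (exStore g) s₁) := hH₁.run _
  have f1 : (run E (exStore g) s₁).v vX = x := by rw [run_v _ _ _, e1]
  have f2 : (run E (exStore g) s₁).a (aLU g) = s₁.a (aLU g) := run_a _ _ _
  have f3 : (run E (exStore g) s₁).a (aCOV g) = s.a (aCOV g) := by
    rw [run_a _ _ _, e3]
  have f4 : (run E (exStore g) s₁).a (aLEN g) = s.a (aLEN g) := by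
    rw [run_a _ _ _, e4]
  have f5 : (run E (exStore g) s₁).a (aBIG g) = s.a (aBIG g) := by
    rw [run_a _ _ _, e5]
  have f6 : (run E (exStore g) s₁).v vL = s₁.v vL := run_v _ _ _
  have f7 : (run E (exStore g) s₁).v vBig = s₁.v vBig := run_v _ _ _
  have f8 : (run E (exStore g) s₁).v vB = x * T.kk := by
    rw [run_v _ _ _, a2]
  rw [run_seq, cost_seq]
  rw [← f2] at b1 a3
  rw [e2] at b2
  rw [← f6, ← f7] at b1
  replace b4 := fun u hu => (b4 u hu).trans (a4 u hu)
  set s₂ := run E (exStore g) s₁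
  simp only [run_seq, cost_seq]
  set s₃ := run E (.wr (aBIG g) (V vX) (V vBig)) (run E (.wr (aLEN g) (V vX) (V vL)) s₂) with hs₃
  have hH₃ : Holds T K s₃ := (hH₂.toHolds.run _).run _
  have g1 : s₃.v vBig = s₂.v vBig := by simp [hs₃]
  have g2 : s₃.a (aLU g) = s₂.a (aLU g) := by simp [hs₃]
  have g3 : s₃.a (aLD g) = s₂.a (aLD g) := by simp [hs₃]
  have g4 : s₃.a (aLEN g) = Function.update (s.a (aLEN g)) x (s₂.v vL) := by simp [hs₃, f1, f4]
  have g5 : s₃.a (aBIG g) = Function.update (s.a (aBIG g)) x (s₂.v vBig) := by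
    simp [hs₃, f1, f5]
  have g6 : s₃.a (aTD g) = s₂.a (aTD g) := by simp [hs₃]
  have g7 : s₃.a (aCOV g) = s.a (aCOV g) := by simp [hs₃, f3]
  have g8 : s₃.v vB = x * T.kk := by simp [hs₃, f8]
  simp only [cost_wr]
  refine ⟨s₂.v vL, s₂.v vBig, ?_⟩
  rw [run_ite, cost_ite, ev_var, g1]
  by_cases hb : s₂.v vBig = 0
  · simp only [hb, exec]
    rw [g2, g3, g4, g5, g6, g7, hb]
    rw [hb] at b1
    refine ⟨b1, rfl, rfl, fun i hi => ⟨a3 i hi, b2 i hi⟩, b3, b4, fun _ => rfl, ?_⟩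
    simp only [add_mul, add_assoc] at a5 ⊢
    omega
  · simp only [hb, if_false]
    obtain ⟨c1, c2⟩ := incCov_spec g hB hH₃ g8 (by omega) (fun j hj => by
      rw [g7, g2]
      have hL := b1.full hb
      have := b1.mem j (by omega)
      exact hcov _ (by omega) this.2.1)
    rw [c1, run_a (incCov g) _ (aLU g), run_a (incCov g) _ (aLD g), run_a (incCov g) _ (aLEN g),
      run_a (incCov g) _ (aBIG g),
      run_a (incCov g) _ (aTD g), g2, g3, g4, g5, g6, g7]
    refine ⟨b1, rfl, rfl, fun i hi => ⟨a3 i hi, b2 i hi⟩, b3, b4, fun _ => rfl, ?_⟩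
    simp only [add_mul, add_assoc] at a5 ⊢
    omega

/-! ### All lists -/

theorem liveSum_insert {a b x c : ℕ} {hit big : ℕ → ℕ} {f f' : ℕ → ℕ} (ha : a ≤ x) (hb : x < b)
    (hx : hit x = 0) (hbig : big x = 0) (hf : ∀ y, y ≠ x → f' y = f y) :
    liveSum a b hit (Function.update big x c) f' =
      liveSum a b hit big f + if c = 0 then 0 else f' x := by
  unfold liveSum
  have hm : x ∈ Finset.Ico a b := Finset.mem_Ico.2 ⟨ha, hb⟩
  rw [← Finset.add_sum_erase _ _ hm, ← Finset.add_sum_erase (Finset.Ico a b) (fun x =>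
    if live hit big x then f x else 0) hm]
  have h1 : ¬ live hit big x := by simp [live, hbig]
  have h2 : ∑ y ∈ (Finset.Ico a b).erase x, (if live hit (Function.update big x c) y then f' y
      else 0) = ∑ y ∈ (Finset.Ico a b).erase x, if live hit big y then f y else 0 := by
    refine Finset.sum_congr rfl fun y hy => ?_
    have : y ≠ x := Finset.ne_of_mem_erase hy
    simp [live, Function.update_of_ne this, hf y this]
  rw [h2, if_neg h1]
  by_cases hc : c = 0
  · simp [live, hx, hc]
  · simp [live, hx, hc]; omega

theorem liveSum_le {a b k : ℕ} {hit big f : ℕ → ℕ} (hf : ∀ x, f x ≤ k) :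
    liveSum a b hit big f ≤ (b - a) * k := by
  unfold liveSum
  refine (Finset.sum_le_card_nsmul _ _ k fun x _ => ?_).trans (by simp)
  split_ifs
  exacts [hf x, Nat.zero_le _]

theorem occ_le (k : ℕ) (lu : ℕ → ℕ) (x u : ℕ) : occ k lu x u ≤ k :=
  (Finset.card_filter_le _ _).trans (by simp)

/-- Compute the lists of all vertices that are not hit. -/
def explore (g : Bool) : Cmd :=
  .for vX (V (vP0 g)) (V (vP1 g)) (.when (.eq (.rd (aHIT g) (V vX)) 0) (exOne g))

/-- The hypothesis on degrees is what hitting the vertices of high degree has achieved. A count is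
at most `(p1 - p0) * kk ≤ n ^ 2`, so the counts do not saturate. -/
theorem explore_spec (g : Bool) (hB : Big T K E) (hH : SegHolds S K s) (hC : CovInv S g s)
    (hbig : ∀ y, S.p0 g ≤ y → y < S.p1 g → s.a (aBIG g) y = 0)
    (htd : ∀ u, S.p0 g ≤ u → u < S.p1 g → s.a (aTD g) u = K + 1)
    (hdeg : ∀ x u, S.p0 g ≤ x → x < S.p1 g → s.a (aHIT g) x = 0 → x ≤ u → u < S.p1 g →
      Le (T.E g) x u K → T.off g (u + 1) - T.off g u ≤ T.hh) :
    CovInv S g (run E (explore g) s) ∧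
    (∀ x, S.p0 g ≤ x → x < S.p1 g → s.a (aHIT g) x = 0 →
      ListOK S K g x ((run E (explore g) s).a (aLEN g) x) ((run E (explore g) s).a (aBIG g) x)
        ((run E (explore g) s).a (aLU g)) ((run E (explore g) s).a (aLD g))) ∧
    cost E (explore g) s ≤ ((5 * T.kk + 11 * T.hh + 16) * T.kk + 18) * (S.p1 g - S.p0 g) + 2 := by
  have h01 := S.h01 g
  have h12 := S.h12 g
  have h2n := S.h2n g
  have hkk := T.kk_le
  have hsq := hB.sq
  obtain ⟨h1, t1⟩ := for_frame_const E (explore g) s rfl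
    (fun x s' => CovInv S g s' ∧ (∀ y, x ≤ y → y < S.p1 g → s'.a (aBIG g) y = 0) ∧
      (∀ u, S.p0 g ≤ u → u < S.p1 g → s'.a (aTD g) u = K + 1) ∧
      ∀ y, S.p0 g ≤ y → y < x → s.a (aHIT g) y = 0 →
        ListOK S K g y (s'.a (aLEN g) y) (s'.a (aBIG g) y) (s'.a (aLU g)) (s'.a (aLD g)))
    ((5 * T.kk + 11 * T.hh + 16) * T.kk + 17)
    (by simp [hH.p0, hH.p1]; omega)
    ⟨hC, by simpa [hH.p0] using hbig, htd, fun y h1 h2 => by simp [hH.p0] at h2; omega⟩ (by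
      rintro x s' hx0 hx1 hS ⟨a1, a2, a3, a4⟩
      simp only [ev_var, hH.p0, hH.p1] at hx0 hx1
      have hH' : SegHolds S K (s'.setV vX x) := (hH.same hS).setV _ _ rfl
      have e1 : s'.a (aHIT g) = s.a (aHIT g) := hS.a _
      simp only [exec, e1]
      by_cases hh : s.a (aHIT g) x = 0
      swap
      · simp only [hh, exec]
        refine ⟨⟨a1, fun y hy => a2 y (by omega), a3, fun y hy0 hy1 hy => ?_⟩, by omega⟩
        exact a4 y hy0 (lt_of_le_of_ne (by omega) fun h => hh (h ▸ hy)) hy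
      simp only [hh, exec]
      have hcov : ∀ u, S.p0 g ≤ u → u < S.p1 g → (s'.setV vX x).a (aCOV g) u + T.kk ≤ E.B := by
        intro u hu0 hu1
        rw [setV_a, a1 u hu0 hu1]
        have h1 := liveSum_le (a := S.p0 g) (b := S.p1 g) (hit := s'.a (aHIT g))
          (big := s'.a (aBIG g)) fun x => occ_le T.kk (s'.a (aLU g)) x u
        have h2 : (S.p1 g - S.p0 g) * T.kk ≤ T.n * T.n := Nat.mul_le_mul (by omega) hkk
        have h3 : (T.n + 1) * (T.n + 1) = T.n * T.n + 2 * T.n + 1 := by ring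
        omega
      obtain ⟨L, big, c1, c2, c3, c4, c5, c6, c7, c8⟩ := exOne_spec g hB hH' (by simp)
        hx0 hx1 (fun u h1 h2 => a3 u (by omega) h2)
        (fun u h1 h2 h3 => hdeg x u hx0 hx1 hh h1 h2 h3) hcov
      have hHIT : (run E (exOne g) (s'.setV vX x)).a (aHIT g) = s.a (aHIT g) := by
        rw [run_a _ _ _, setV_a, e1]
      simp only [setV_a] at c2 c3 c4 c6 c7
      set s₂ := run E (exOne g) (s'.setV vX x)
      -- Each vertex owns `kk` consecutive slots, so computing one list does not disturb those of
      -- other vertices.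
      have hblk : ∀ y, y ≠ x → ∀ j, j < T.kk →
          (y * T.kk + j < x * T.kk ∨ x * T.kk + T.kk ≤ y * T.kk + j) := by
        intro y hy j hj
        rcases lt_or_gt_of_ne hy with h | h
        · have := Nat.mul_le_mul_right T.kk (Nat.succ_le_of_lt h)
          rw [Nat.succ_mul] at this
          omega
        · have := Nat.mul_le_mul_right T.kk (Nat.succ_le_of_lt h)
          rw [Nat.succ_mul] at this
          omega
      refine ⟨⟨fun u hu0 hu1 => ?_, fun y h1 h2 => ?_, fun u h1 h2 => ?_, fun y hy0 hy1 hy => ?_⟩,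
        by omega⟩
      · rw [c7 u, hHIT, c3, a1 u hu0 hu1, e1]
        rw [liveSum_insert (f := fun x => occ T.kk (s'.a (aLU g)) x u) hx0 hx1 hh
          (a2 x le_rfl hx1)]
        intro y hy
        unfold occ
        congr 1
        refine Finset.filter_congr fun j hj => ?_
        rw [(c4 _ (hblk y hy j (Finset.mem_range.1 hj))).1]
      · rw [c3, Function.update_of_ne (by omega)]
        exact a2 y (by omega) h2
      · by_cases hu : x ≤ u ∧ u < S.p1 g
        · exact c5 u hu.1 hu.2
        · rw [c6 u hu]; exact a3 u h1 h2
      · rcases Nat.lt_succ_iff_lt_or_eq.1 hy1 with hy1 | rfl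
        · rw [c2, c3, Function.update_of_ne (by omega), Function.update_of_ne (by omega)]
          exact (a4 y hy0 hy1 hy).congr (fun j hj => (c4 _ (hblk y (by omega) j hj)).1)
            fun j hj => (c4 _ (hblk y (by omega) j hj)).2
        · rw [c2, c3, Function.update_self, Function.update_self]
          exact c1)
  simp only [ev_var, hH.p0, hH.p1] at h1 t1
  exact ⟨h1.1, h1.2.2.2, t1⟩

/-! ## Initialization and vertices of high degree -/

/-- Clear the marks of the first block. -/
def segInit (g : Bool) : Cmd :=
  .for vX (V (vP0 g)) (V (vP1 g)) (.wr (aHIT g) (V vX) 0 ;; .wr (aBIG g) (V vX) 0 ;;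
    .wr (aCOV g) (V vX) 0 ;; .wr (aTD g) (V vX) (V vK + 1))

theorem segInit_spec (g : Bool) (hB : Big T K E) (hH : SegHolds S K s) :
    (∀ x, S.p0 g ≤ x → x < S.p1 g → (run E (segInit g) s).a (aHIT g) x = 0 ∧
      (run E (segInit g) s).a (aBIG g) x = 0 ∧ (run E (segInit g) s).a (aCOV g) x = 0 ∧
      (run E (segInit g) s).a (aTD g) x = K + 1) ∧
    cost E (segInit g) s ≤ 5 * (S.p1 g - S.p0 g) + 2 := by
  have hlin := hB.lin
  have hKB : min (K + 1) E.B = K + 1 := by omega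
  have h01 := S.h01 g
  obtain ⟨h1, t1⟩ := for_frame_const E (segInit g) s rfl
    (fun i s' => ∀ x, S.p0 g ≤ x → x < i → s'.a (aHIT g) x = 0 ∧ s'.a (aBIG g) x = 0 ∧
      s'.a (aCOV g) x = 0 ∧ s'.a (aTD g) x = K + 1) 4
    (by simp [hH.p0, hH.p1]; omega) (by simp [hH.p0]; omega) (by
      rintro i s' - - hS ih
      have e3 : s'.v vK = K := by rw [hS.v _, hH.thr]
      refine ⟨fun x hx0 hx1 => ?_, by simp⟩
      simp [e3, hKB, Function.update_apply]
      rcases Nat.lt_succ_iff_lt_or_eq.1 hx1 with hx1 | rfl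
      · obtain ⟨a1, a2, a3, a4⟩ := ih x hx0 hx1
        simp [a1, a2, a3, a4]
      · simp)
  simp only [ev_var, hH.p0, hH.p1] at h1 t1
  exact ⟨h1, t1⟩

/-- The number of vertices of high degree. -/
def Inst.high (T : Inst) (g : Bool) (a b : ℕ) : ℕ :=
  ((Finset.Ico a b).filter fun u => T.hh ≤ T.off g (u + 1) - T.off g u).card

/-- Hit all vertices of high degree. -/
def stage1 (g : Bool) : Cmd :=
  .for vX (V (vP0 g)) (V (vP1 g))
    (.ite (.lt (.rd (aOFF g) (V vX + 1) - .rd (aOFF g) (V vX)) (V vHH)) .skip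
      (.asg vS (V vX) ;; hit g))

theorem liveSum_eq_zero {a b : ℕ} {hit big f : ℕ → ℕ}
    (h : ∀ x, a ≤ x → x < b → big x = 0) : liveSum a b hit big f = 0 := by
  refine Finset.sum_eq_zero fun x hx => ?_
  rw [Finset.mem_Ico] at hx
  rw [if_neg fun hl => hl.2 (h x hx.1 hx.2)]

/-- If an unmarked `x` reached a vertex `u` of high degree in the block within `K`, then hitting `u`
would have marked `x`. No lists exist at this time, so `rem` is `0` and every hit costs just its two
searches. -/
theorem stage1_spec (g : Bool) {Bad : Prop} (hB : Big T K E) (hI : SegInv S K Bad s)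
    (hbad : BadPair S K g → Bad) (hC : CovInv S g s)
    (hbig : ∀ x, S.p0 g ≤ x → x < S.p1 g → s.a (aBIG g) x = 0) :
    SegInv S K Bad (run E (stage1 g) s) ∧ CovInv S g (run E (stage1 g) s) ∧
      ((run E (stage1 g) s).v vOK ≠ 0 → s.v vOK ≠ 0) ∧
      (∀ y, s.a (aHIT g) y ≠ 0 → (run E (stage1 g) s).a (aHIT g) y ≠ 0) ∧
      (∀ x u, S.p0 g ≤ x → x < S.p1 g → (run E (stage1 g) s).a (aHIT g) x = 0 → x ≤ u →
        u < S.p1 g → Le (T.E g) x u K → T.off g (u + 1) - T.off g u ≤ T.hh) ∧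
      cost E (stage1 g) s ≤ (20 * S.size + 44) * T.high g (S.p0 g) (S.p1 g) +
        3 * (S.p1 g - S.p0 g) + 2 := by
  have hlin := hB.lin
  have h01 := S.h01 g
  have h12 := S.h12 g
  have h2n := S.h2n g
  obtain ⟨t, h1, t1⟩ := for_frame E (stage1 g) s rfl
    (fun i s' t => SegInv S K Bad s' ∧ CovInv S g s' ∧ (s'.v vOK ≠ 0 → s.v vOK ≠ 0) ∧
      (∀ y, s.a (aHIT g) y ≠ 0 → s'.a (aHIT g) y ≠ 0) ∧
      (∀ x u, S.p0 g ≤ x → x < S.p1 g → s'.a (aHIT g) x = 0 → x ≤ u → u < i →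
        Le (T.E g) x u K → T.off g (u + 1) - T.off g u ≤ T.hh) ∧
      t ≤ (20 * S.size + 44) * T.high g (S.p0 g) i + 3 * (i - S.p0 g))
    (by simp [hI.p0, hI.p1]; omega)
    ⟨hI, hC, fun h => h, fun _ h => h, fun x u h0 h1 _ h2 h3 => by simp [hI.p0] at h3; omega,
      Nat.zero_le _⟩ (by
      rintro i s' t hi1 hi2 hS ⟨a1, a2, a3, a4, a5, a6⟩
      simp only [ev_var, hI.p0, hI.p1] at hi1 hi2
      have hn : min (i + 1) E.B = i + 1 := by omega
      have hbig' : ∀ s'', (∀ x, s''.a (aBIG g) x = s.a (aBIG g) x) →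
          rem S g s'' = 0 := fun s'' h => liveSum_eq_zero fun x h0 h1 => by rw [h, hbig x h0 h1]
      have hhigh : T.high g (S.p0 g) (i + 1) = T.high g (S.p0 g) i +
          if T.hh ≤ T.off g (i + 1) - T.off g i then 1 else 0 := by
        unfold Inst.high
        rw [← Finset.insert_Ico_right_eq_Ico_add_one hi1, Finset.filter_insert]
        split_ifs
        · rw [Finset.card_insert_of_notMem (by simp)]
        · rfl
      simp only [exec, a1.off, hn, Nat.reduceEqDiff, a1.hh]
      by_cases hlt : T.off g (i + 1) - T.off g i < T.hh
      · have hI' : SegInv S K Bad (s'.setV vX i) :=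
          ⟨a1.toSegHolds.setV _ _ rfl, by simpa using a1.ok, by simpa using a1.cert⟩
        simp only [hlt, exec, Nat.reduceEqDiff]
        refine ⟨hI', a2, a3, a4, fun x u h0 h1 h2 h3 h4 h5 => ?_, ?_⟩
        · rcases Nat.lt_succ_iff_lt_or_eq.1 h4 with h4 | rfl
          · exact a5 x u h0 h1 h2 h3 h4 h5
          · exact hlt.le
        · rw [hhigh, if_neg (by omega), add_zero]
          omega
      · simp only [hlt, exec]
        have hI' : SegInv S K Bad ((s'.setV vX i).setV vS i) :=
          ⟨(a1.toSegHolds.setV _ _ rfl).setV _ _ rfl, by simpa using a1.ok, by simpa using a1.cert⟩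
        have hBIG : s'.a (aBIG g) = s.a (aBIG g) := hS.a _
        have hBIG' : (run E (hit g) ((s'.setV vX i).setV vS i)).a (aBIG g) = s.a (aBIG g) := by
          rw [run_a _ _ _]; exact hBIG
        obtain ⟨b1, b2, b3, b4, b5, b6⟩ := hit_spec (E := E) g hB hI' hbad a2 (x := i) (by simp)
          hi1 hi2
        rw [hbig' _ fun x => by rw [hBIG'], hbig' _ fun x => by rw [setV_a, setV_a, hBIG]] at b6
        refine ⟨b1, b2, fun h => a3 (by simpa using b3 h), fun y hy => b4 y (a4 y hy),
          fun x u h0 h1 h2 h3 h4 h5 => ?_, ?_⟩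
        · rcases Nat.lt_succ_iff_lt_or_eq.1 h4 with h4 | rfl
          · exact a5 x u h0 h1 (by by_contra h; exact b4 x h h2) h3 h4 h5
          · exact absurd h2 (b5 x h0 h1 h5)
        · rw [hhigh, if_pos (by omega), mul_add, mul_one]
          omega)
  simp only [ev_var, hI.p1] at h1 t1
  obtain ⟨b1, b2, b3, b4, b5, b6⟩ := h1
  exact ⟨b1, b2, b3, b4, b5, t1.trans (by omega)⟩

/-! ## Greedy hitting -/

theorem sum_occ {a b k x : ℕ} {lu : ℕ → ℕ}
    (h : ∀ i, i < k → a ≤ lu (x * k + i) ∧ lu (x * k + i) < b) :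
    ∑ u ∈ Finset.Ico a b, occ k lu x u = k := by
  unfold occ
  have := Finset.card_eq_sum_card_fiberwise (s := Finset.range k) (t := Finset.Ico a b)
    (f := fun i => lu (x * k + i)) (fun i hi => by
      simpa using h i (by simpa using hi))
  rw [Finset.card_range] at this
  exact this.symm

/-- The lists of all vertices that are not hit are correct. -/
def Lists (S : Seg T) (K : ℕ) (g : Bool) (s : St) : Prop :=
  ∀ x, S.p0 g ≤ x → x < S.p1 g → s.a (aHIT g) x = 0 →
    ListOK S K g x (s.a (aLEN g) x) (s.a (aBIG g) x) (s.a (aLU g)) (s.a (aLD g))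

/-- Double counting: the list of each live vertex has exactly `kk` entries, all in the block.
Consequently some count is at least `kk * rem` divided by the length of the block. -/
theorem sum_cov {g : Bool} (hC : CovInv S g s) (hL : Lists S K g s) :
    ∑ u ∈ Finset.Ico (S.p0 g) (S.p1 g), s.a (aCOV g) u = T.kk * rem S g s := by
  have h1 : ∑ u ∈ Finset.Ico (S.p0 g) (S.p1 g), s.a (aCOV g) u =
      ∑ u ∈ Finset.Ico (S.p0 g) (S.p1 g), ∑ x ∈ Finset.Ico (S.p0 g) (S.p1 g),
        if live (s.a (aHIT g)) (s.a (aBIG g)) x then occ T.kk (s.a (aLU g)) x u else 0 :=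
    Finset.sum_congr rfl fun u hu => by
      rw [Finset.mem_Ico] at hu
      exact hC u hu.1 hu.2
  rw [h1, Finset.sum_comm, rem, liveSum, Finset.mul_sum]
  refine Finset.sum_congr rfl fun x hx => ?_
  rw [Finset.mem_Ico] at hx
  split_ifs with hl
  · have hx' := hL x hx.1 hx.2 hl.1
    have hf := hx'.full hl.2
    rw [mul_one, sum_occ fun i hi => ?_]
    have := hx'.mem i (by omega)
    omega
  · simp

/-- The members of the list of `x` lie within `K` of `x`, so hitting `u` marks every live vertex
that lists `u`. Lists have no repetitions, so the count of `u` is the number of these vertices. -/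
theorem rem_drop {g : Bool} {s' : St} {u : ℕ} (hu0 : S.p0 g ≤ u) (hu1 : u < S.p1 g)
    (hC : CovInv S g s) (hL : Lists S K g s) (hB : s'.a (aBIG g) = s.a (aBIG g))
    (hmono : ∀ y, s.a (aHIT g) y ≠ 0 → s'.a (aHIT g) y ≠ 0)
    (hhit : ∀ y, S.p0 g ≤ y → y < S.p1 g → Le (T.E g) y u K → s'.a (aHIT g) y ≠ 0) :
    rem S g s' + s.a (aCOV g) u ≤ rem S g s := by
  rw [hC u hu0 hu1]
  unfold rem liveSum
  rw [← Finset.sum_add_distrib]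
  refine Finset.sum_le_sum fun x hx => ?_
  rw [Finset.mem_Ico] at hx
  rw [hB]
  beta_reduce
  by_cases hl : live (s.a (aHIT g)) (s.a (aBIG g)) x
  · have hx' := hL x hx.1 hx.2 hl.1
    have hf := hx'.full hl.2
    rw [if_pos hl, if_pos hl]
    split_ifs with hl'
    · have : occ T.kk (s.a (aLU g)) x u = 0 := by
        rw [occ, Finset.card_eq_zero, Finset.filter_eq_empty_iff]
        rintro i hi rfl
        rw [Finset.mem_range] at hi
        have := hx'.mem i (by omega)
        exact hhit x hx.1 hx.2 ⟨_, this.2.2⟩ hl'.1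
      omega
    · have : occ T.kk (s.a (aLU g)) x u ≤ 1 := by
        rw [occ, Finset.card_le_one]
        intro i hi j hj
        rw [Finset.mem_filter, Finset.mem_range] at hi hj
        exact hx'.inj i j (by omega) (by omega) (hi.2.trans hj.2.symm)
      omega
  · rw [if_neg hl, if_neg hl, if_neg fun hl' => hl ⟨?_, hl'.2⟩]
    by_contra h
    exact hmono x h hl'.1

abbrev vMx : ℕ := ix 18 false
abbrev vU2 : ℕ := ix 18 true
abbrev vRd : ℕ := ix 19 false

/-- Find the largest count. -/
def argmax (g : Bool) : Cmd :=
  .asg vMx 0 ;; .for vX (V (vP0 g)) (V (vP1 g))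
    (.when (.lt (V vMx) (.rd (aCOV g) (V vX)))
      (.asg vMx (.rd (aCOV g) (V vX)) ;; .asg vU2 (V vX)))

theorem argmax_spec (g : Bool) (hH : SegHolds S K s) :
    (∀ u, S.p0 g ≤ u → u < S.p1 g → s.a (aCOV g) u ≤ (run E (argmax g) s).v vMx) ∧
    ((run E (argmax g) s).v vMx ≠ 0 → S.p0 g ≤ (run E (argmax g) s).v vU2 ∧
      (run E (argmax g) s).v vU2 < S.p1 g ∧
      s.a (aCOV g) ((run E (argmax g) s).v vU2) = (run E (argmax g) s).v vMx) ∧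
    cost E (argmax g) s ≤ 4 * (S.p1 g - S.p0 g) + 3 := by
  have h01 := S.h01 g
  rw [argmax, run_seq, cost_seq]
  obtain ⟨h1, t1⟩ := for_frame_const E (.for vX (V (vP0 g)) (V (vP1 g)) (.when (.lt (V vMx) (.rd (aCOV g) (V vX))) (.asg vMx (.rd (aCOV g) (V vX)) ;; .asg vU2 (V vX))))
      (run E (.asg vMx 0) s) rfl
    (fun i s' => (∀ u, S.p0 g ≤ u → u < i → s.a (aCOV g) u ≤ s'.v vMx) ∧
      (s'.v vMx ≠ 0 → S.p0 g ≤ s'.v vU2 ∧ s'.v vU2 < S.p1 g ∧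
        s.a (aCOV g) (s'.v vU2) = s'.v vMx)) 3
    (by simp [hH.p0, hH.p1]; omega) ⟨fun u h0 h1 => by simp [hH.p0] at h1; omega, by simp⟩ (by
      rintro i s' hi1 hi2 hS ⟨a1, a2⟩
      simp [hH.p0, hH.p1] at hi1 hi2
      have e : s'.a (aCOV g) = s.a (aCOV g) := hS.a _
      simp only [exec, e, Nat.reduceEqDiff]
      by_cases hlt : s'.v vMx < s.a (aCOV g) i
      · simp [hlt, hi1, hi2]
        intro u hu0 hu1
        rcases Nat.le_iff_lt_or_eq.1 hu1 with hu1 | rfl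
        · exact (a1 u hu0 hu1).trans hlt.le
        · exact le_rfl
      · simp [hlt]
        refine ⟨fun u hu0 hu1 => ?_, a2⟩
        rcases Nat.le_iff_lt_or_eq.1 hu1 with hu1 | rfl
        · exact a1 u hu0 hu1
        · omega)
  simp only [ev_var, run_asg, setV_v, ix_inj, Nat.reduceEqDiff, false_and, if_false, hH.p0,
    hH.p1] at h1 t1 ⊢
  refine ⟨h1.1, h1.2, ?_⟩
  simp only [cost_asg]
  omega

/-- Hit vertices with maximal counts until all vertices with long lists are hit. -/
def greedy (g : Bool) : Cmd :=
  .asg vMx 1 ;; .loop vRd 0 .top (V vMx)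
    (argmax g ;; .when (V vMx) (.asg vS (V vU2) ;; hit g))

/-- The bound for the number of greedy rounds. -/
def Inst.rho (T : Inst) : ℕ := T.n * (Nat.log 2 T.n + 1) / T.kk + 2

/-- From the averaging bound `M ≥ k * R / N` it follows that `R' ≤ R * (1 - k / N)`, and `log t ≤ t
- 1` shows that `log R` drops by at least `k / N` in every round that does not finish. -/
theorem round_step {N k i R R' M : ℕ} (hk : 0 < k) (hM : k * R ≤ N * M) (hR : R' + M ≤ R)
    (hpos : 0 < R') (hi : (i : ℝ) * k ≤ N * (Real.log N - Real.log R)) :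
    ((i + 1 : ℕ) : ℝ) * k ≤ N * (Real.log N - Real.log R') := by
  have hRp : 0 < R := by omega
  have hN : 0 < N := by
    rcases Nat.eq_zero_or_pos N with rfl | h
    · have := Nat.mul_pos hk hRp; omega
    · exact h
  have h1 : Real.log (R' / R) ≤ R' / R - 1 := Real.log_le_sub_one_of_pos (by positivity)
  rw [Real.log_div (by positivity) (by positivity)] at h1
  have h2 : (N : ℝ) * (R' / R - 1) ≤ -k := by
    have hM' : (k : ℝ) * R ≤ N * M := by exact_mod_cast hM
    have hR' : (R' : ℝ) + M ≤ R := by exact_mod_cast hR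
    have hRr : (0 : ℝ) < R := by exact_mod_cast hRp
    rw [div_sub_one hRr.ne', ← mul_div_assoc, div_le_iff₀ hRr]
    nlinarith [mul_le_mul_of_nonneg_left hR' (Nat.cast_nonneg (α := ℝ) N)]
  have h3 := mul_le_mul_of_nonneg_left h1 (Nat.cast_nonneg (α := ℝ) N)
  push_cast
  linarith [h3.trans h2]

/-- As long as something remains, `R ≥ 1`, so `i * k ≤ N * log N`; the natural logarithm is at most
the binary one rounded up. -/
theorem round_bound {N k i R : ℕ} (hR : 0 < R)
    (hi : (i : ℝ) * k ≤ N * (Real.log N - Real.log R)) :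
    i * k ≤ N * (Nat.log 2 N + 1) := by
  have h1 : Real.log N ≤ (Nat.log 2 N + 1 : ℕ) := by
    rcases Nat.eq_zero_or_pos N with rfl | hN
    · simp
    have h : (N : ℝ) ≤ 2 ^ (Nat.log 2 N + 1) := by
      exact_mod_cast (Nat.lt_pow_succ_log_self (by norm_num) N).le
    have h2 := Real.log_le_log (by positivity) h
    rw [Real.log_pow] at h2
    have h3 : Real.log 2 ≤ 1 := by linarith [Real.log_two_lt_d9]
    exact h2.trans (mul_le_of_le_one_right (Nat.cast_nonneg _) h3)
  have h2 : 0 ≤ Real.log R := Real.log_nonneg (by exact_mod_cast hR)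
  have h3 : (i : ℝ) * k ≤ N * (Nat.log 2 N + 1 : ℕ) :=
    hi.trans (mul_le_mul_of_nonneg_left (by linarith) (Nat.cast_nonneg _))
  exact_mod_cast h3

/-- Hitting a vertex with the largest count shrinks `rem` by the factor `1 - kk / N`. Apart from the
rounds counted by `round_bound` there is one that empties `rem` and one that notices this, whence
the summand `2` in `Inst.rho`. Each round costs `O(S.size)`, and the removal of lists is paid by the
initial `rem`, which is at most `N`. -/
theorem greedy_spec (g : Bool) {Bad : Prop} (hB : Big T K E) (hI : SegInv S K Bad s)
    (hbad : BadPair S K g → Bad) (hC : CovInv S g s) (hL : Lists S K g s) :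
    SegInv S K Bad (run E (greedy g) s) ∧ Lists S K g (run E (greedy g) s) ∧
      ((run E (greedy g) s).v vOK ≠ 0 → s.v vOK ≠ 0) ∧
      (∀ y, s.a (aHIT g) y ≠ 0 → (run E (greedy g) s).a (aHIT g) y ≠ 0) ∧
      (∀ x, S.p0 g ≤ x → x < S.p1 g → (run E (greedy g) s).a (aHIT g) x = 0 →
        (run E (greedy g) s).a (aBIG g) x = 0) ∧
      cost E (greedy g) s ≤ (24 * S.size + 50) * T.rho +
        (3 * T.kk + 8) * (S.p1 g - S.p0 g) + 3 := by
  have hlin := hB.lin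
  have h01 := S.h01 g
  have h12 := S.h12 g
  have h2n := S.h2n g
  have hkp := T.kk_pos
  have hsize : S.p1 g - S.p0 g ≤ S.size := by rw [S.size_eq g]; omega
  set N := S.p1 g - S.p0 g with hN
  have hrem : ∀ s', rem S g s' ≤ N := fun s' => by
    have := liveSum_le (a := S.p0 g) (b := S.p1 g) (hit := s'.a (aHIT g))
      (big := s'.a (aBIG g)) (f := fun _ => 1) (k := 1) fun _ => le_rfl
    rw [mul_one] at this
    exact this
  rw [greedy, run_seq, cost_seq]
  have hI₁ : SegInv S K Bad (run E (.asg vMx 1) s) :=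
    ⟨hI.toSegHolds.run _ (by rfl), by simpa using hI.ok, by simpa using hI.cert⟩
  obtain ⟨i, s', t, hS, h1, t1, h2⟩ := loop_frame (E := E) (x := vRd) (lo := 0) (hi := .top)
    (g := V vMx)
    (c := argmax g ;; .when (V vMx) (.asg vS (V vU2) ;; hit g)) (s := run E (.asg vMx 1) s)
    (fun i s' t => SegInv S K Bad s' ∧ CovInv S g s' ∧ Lists S K g s' ∧
      (s'.v vOK ≠ 0 → s.v vOK ≠ 0) ∧
      (∀ y, s.a (aHIT g) y ≠ 0 → s'.a (aHIT g) y ≠ 0) ∧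
      (s'.v vMx = 0 → rem S g s' = 0 ∧ i * T.kk ≤ N * (Nat.log 2 N + 1) + 2 * T.kk ∧ i ≤ N + 1) ∧
      (s'.v vMx ≠ 0 → (0 < rem S g s' →
          (i : ℝ) * T.kk ≤ N * (Real.log N - Real.log (rem S g s'))) ∧
        (rem S g s' = 0 → i * T.kk ≤ N * (Nat.log 2 N + 1) + T.kk) ∧ i + rem S g s' ≤ N) ∧
      t + (3 * T.kk + 8) * rem S g s' ≤ i * (24 * S.size + 50) + (3 * T.kk + 8) * rem S g s)
    ⟨hI₁, hC, hL, by simp, by simp, by simp, fun _ => ⟨fun h => by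
      have : rem S g (run E (.asg vMx 1) s) = rem S g s := rfl
      rw [this] at h ⊢
      have : Real.log (rem S g s) ≤ Real.log N :=
        Real.log_le_log (by exact_mod_cast h) (by exact_mod_cast hrem s)
      simp only [ev_0, Nat.cast_zero, zero_mul]
      exact mul_nonneg (Nat.cast_nonneg _) (by linarith), by simp, by rw [ev_0, zero_add]; exact hrem _⟩,
      by simp [rem]⟩ (by
      rintro i s' t - - hS ⟨a1, a2, a3, a4, a5, -, a7, a8⟩ hg
      simp only [exec, Nat.reduceEqDiff] at hg
      obtain ⟨d1, d2, d3⟩ := a7 hg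
      have hH' : SegHolds S K (s'.setV vRd i) := a1.toSegHolds.setV _ _ rfl
      obtain ⟨m1, m2, mt⟩ := argmax_spec (E := E) g hH'
      rw [setV_a] at m1 m2
      have hH₂ : SegHolds S K (run E (argmax g) (s'.setV vRd i)) := hH'.run _
      have fa : ∀ j, (run E (argmax g) (s'.setV vRd i)).a j = s'.a j := fun j => by
        rw [run_a _ _ _, setV_a]
      have fo : (run E (argmax g) (s'.setV vRd i)).v vOK = s'.v vOK := by
        rw [run_v _ _ _]; simp
      rw [run_seq, cost_seq]
      set s₂ := run E (argmax g) (s'.setV vRd i) with hs₂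
      clear_value s₂
      have hI₂ : SegInv S K Bad s₂ := ⟨hH₂, by rw [fo]; exact a1.ok, by
        rw [fo]; intro h g' x h0 h1; rw [fa]; exact a1.cert h g' x h0 h1⟩
      have hC₂ : CovInv S g s₂ := by unfold CovInv at a2 ⊢; simp only [fa]; exact a2
      have hL₂ : Lists S K g s₂ := by unfold Lists at a3 ⊢; simp only [fa]; exact a3
      have hr₂ : rem S g s₂ = rem S g s' := by unfold rem; simp only [fa]
      have hsum : T.kk * rem S g s' ≤ N * s₂.v vMx := by
        rw [← sum_cov a2 a3]
        refine (Finset.sum_le_card_nsmul _ _ (s₂.v vMx) fun u hu => ?_).trans (by simp [hN])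
        rw [Finset.mem_Ico] at hu
        exact m1 u hu.1 hu.2
      simp only [exec]
      by_cases hm : s₂.v vMx = 0
      · simp only [hm, exec]
        have hr0 : rem S g s' = 0 := by
          rw [hm, mul_zero] at hsum
          exact (Nat.mul_eq_zero.1 (Nat.le_zero.1 hsum)).resolve_left (by omega)
        refine ⟨hI₂, hC₂, hL₂, by rw [fo]; exact a4, by rw [fa]; exact a5, fun _ => ⟨?_, ?_, ?_⟩,
          fun h => absurd rfl h, ?_⟩
        · rw [hr₂, hr0]
        · have := d2 hr0
          rw [add_mul, one_mul]
          omega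
        · omega
        · rw [hr₂, add_mul i 1, one_mul]
          omega
      · simp only [hm, exec]
        obtain ⟨u1, u2, u3⟩ := m2 hm
        have hI₃ : SegInv S K Bad (s₂.setV vS (s₂.v vU2)) :=
          ⟨hH₂.setV _ _ rfl, by simpa using hI₂.ok, by simpa using hI₂.cert⟩
        obtain ⟨b1, b2, b3, b4, b5, b6⟩ := hit_spec (E := E) g hB hI₃ hbad hC₂ (by simp) u1 u2
        have fl : ∀ j, (j = aBIG g ∨ j = aLU g ∨ j = aLD g ∨ j = aLEN g) →
            (run E (hit g) (s₂.setV vS (s₂.v vU2))).a j = s₂.a j := by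
          intro j hj
          rw [run_a _ _ _ (by rcases hj with rfl | rfl | rfl | rfl <;> cases g <;> rfl), setV_a]
        have fm : (run E (hit g) (s₂.setV vS (s₂.v vU2))).v vMx = s₂.v vMx := by
          rw [run_v _ _ _]; simp
        have hdrop := rem_drop (s := s₂) (s' := run E (hit g) (s₂.setV vS (s₂.v vU2))) u1 u2 hC₂ hL₂
          (fl _ (by simp)) b4 b5
        rw [fa, u3, hr₂] at hdrop
        have hr₃ : rem S g (s₂.setV vS (s₂.v vU2)) = rem S g s' := hr₂
        rw [hr₃] at b6
        have hlist : Lists S K g (run E (hit g) (s₂.setV vS (s₂.v vU2))) := by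
          intro x h0 h1 hx
          rw [fl (aBIG g) (by simp), fl (aLU g) (by simp), fl (aLD g) (by simp),
            fl (aLEN g) (by simp)]
          exact hL₂ x h0 h1 (by by_contra h; exact b4 x h hx)
        set s₃ := run E (hit g) (s₂.setV vS (s₂.v vU2)) with hs₃
        clear_value s₃
        refine ⟨b1, b2, hlist, fun h => a4 ?_, fun y hy => b4 y (by simp [fa, a5 y hy]),
          fun h => absurd (fm ▸ h) hm, fun _ => ⟨fun hpos => ?_, fun h0 => ?_, by omega⟩, ?_⟩
        · have := b3 h
          simpa [fo] using this
        · exact round_step hkp hsum hdrop hpos (d1 (by omega))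
        · rw [add_mul, one_mul]
          rcases Nat.eq_zero_or_pos (rem S g s') with h | h
          · omega
          · have := round_bound h (d1 h)
            omega
        · rw [add_mul i 1, one_mul]
          generalize (3 * T.kk + 8) * rem S g s₃ = A at *
          generalize (3 * T.kk + 8) * rem S g s' = A' at *
          omega)
  -- Each round but the last removes a live vertex, so there are at most `N + 1` rounds. The index
  -- stays below `E.B`, and the loop ends through its guard, that is, with largest count `0`.
  · have hi : i < E.B := by
      by_cases h0 : s'.v vMx = 0
      · have := (h1.2.2.2.2.2.1 h0).2.2; omega
      · have := (h1.2.2.2.2.2.2.1 h0).2.2; omega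
    obtain ⟨-, hg, hr⟩ := h2.resolve_right (by simp; omega)
    simp only [exec, Nat.reduceEqDiff] at hg
    rw [hr]
    obtain ⟨a1, a2, a3, a4, a5, a6, -, a8⟩ := h1
    obtain ⟨b1, b2, b3⟩ := a6 hg
    refine ⟨⟨a1.toSegHolds.setV _ _ rfl, by simpa using a1.ok, by simpa using a1.cert⟩, a3,
      by simpa using a4, a5, fun x h0 h1 hx => ?_, ?_⟩
    · by_contra hb
      unfold rem liveSum at b1
      have := Finset.sum_eq_zero_iff.1 b1 x (Finset.mem_Ico.2 ⟨h0, h1⟩)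
      rw [if_pos ⟨hx, hb⟩] at this
      exact one_ne_zero this
    · have hir : i ≤ T.rho := by
        rw [Inst.rho, ← Nat.sub_le_iff_le_add, Nat.le_div_iff_mul_le hkp, Nat.sub_mul]
        have : N * (Nat.log 2 N + 1) ≤ T.n * (Nat.log 2 T.n + 1) :=
          Nat.mul_le_mul (by omega) (Nat.succ_le_succ (Nat.log_mono_right (by omega)))
        omega
      have c1 := Nat.mul_le_mul_right (24 * S.size + 50) hir
      have c2 := Nat.mul_le_mul_left (3 * T.kk + 8) (hrem s)
      rw [mul_comm T.rho] at c1
      simp only [cost_asg]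
      omega

/-! ## The remaining vertices in the sparse case -/

theorem Inst.wk_cross {g : Bool} {a b k p : ℕ} (h : Wk (T.E g) a b k) (ha : a < p) (hb : p ≤ b) :
    ∃ u v c k₁ k₂, Wk (T.E g) a u k₁ ∧ T.E g u v c ∧ Wk (T.E g) v b k₂ ∧ u < p ∧ p ≤ v ∧
      k₁ + c + k₂ = k := by
  induction h with
  | nil => omega
  | @snoc x y k c hw hr ih =>
    rcases lt_or_ge x p with hx | hx
    · exact ⟨x, y, c, k, 0, hw, hr, .nil _, hx, hb, by omega⟩
    · obtain ⟨u, v, c', k₁, k₂, h1, h2, h3, h4, h5, h6⟩ := ih hx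
      exact ⟨u, v, c', k₁, k₂ + c, h1, h2, h3.snoc hr, h4, h5, by omega⟩

theorem SegInv.setV {Bad : Prop} (h : SegInv S K Bad s) (x n : ℕ)
    (hx : keepsSeg (.asg x 0) = true := by rfl) (hx' : vOK ≠ x := by decide) :
    SegInv S K Bad (s.setV x n) :=
  ⟨h.toSegHolds.setV x n hx, by simpa [hx'] using h.ok, by simpa [hx'] using h.cert⟩

/-- Compared with `s₀` only vertices have been hit, in the orientation `g`, and there are no lists in
this orientation. -/
structure HitInv (S : Seg T) (K : ℕ) (g : Bool) (Bad : Prop) (s₀ s : St) : Prop where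
  inv : SegInv S K Bad s
  cov : CovInv S g s
  big : ∀ x, S.p0 g ≤ x → x < S.p1 g → s.a (aBIG g) x = 0
  ok : s.v vOK ≠ 0 → s₀.v vOK ≠ 0
  mono : ∀ y, s₀.a (aHIT g) y ≠ 0 → s.a (aHIT g) y ≠ 0

theorem HitInv.setV {g : Bool} {Bad : Prop} {s₀ : St} (h : HitInv S K g Bad s₀ s) (x n : ℕ)
    (hx : keepsSeg (.asg x 0) = true := by rfl) (hx' : vOK ≠ x := by decide) :
    HitInv S K g Bad s₀ (s.setV x n) :=
  ⟨h.inv.setV x n hx hx', h.cov, h.big, by simpa [hx'] using h.ok, h.mono⟩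

/-- Without lists in this orientation `rem` is `0`, so the amortized bound of `hit_spec` becomes a
bound for a single hit. -/
theorem HitInv.hit {g : Bool} {Bad : Prop} {s₀ : St} (hB : Big T K E)
    (h : HitInv S K g Bad s₀ s) (hbad : BadPair S K g → Bad) {x : ℕ} (hx : s.v vS = x)
    (hx0 : S.p0 g ≤ x) (hx1 : x < S.p1 g) :
    HitInv S K g Bad s₀ (run E (hit g) s) ∧
      (∀ y, s.a (aHIT g) y ≠ 0 → (run E (hit g) s).a (aHIT g) y ≠ 0) ∧
      (∀ y, S.p0 g ≤ y → y < S.p1 g → Le (T.E g) y x K → (run E (hit g) s).a (aHIT g) y ≠ 0) ∧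
      cost E (hit g) s ≤ 20 * S.size + 40 := by
  obtain ⟨b1, b2, b3, b4, b5, b6⟩ := hit_spec g hB h.inv hbad h.cov hx hx0 hx1
  have hr : rem S g s = 0 := liveSum_eq_zero h.big
  have hbig : (run E (MinDiam.hit g) s).a (aBIG g) = s.a (aBIG g) := run_a _ _ _
  exact ⟨⟨b1, b2, by rw [hbig]; exact h.big, fun h' => h.ok (b3 h'),
    fun y hy => b4 y (h.mono y hy)⟩, b4, b5, by rw [hr] at b6; omega⟩

abbrev vFnd : ℕ := ix 19 true
abbrev vA0 : ℕ := ix 20 false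
abbrev vJ2 : ℕ := ix 20 true
abbrev vU3 : ℕ := ix 21 false
abbrev vE2 : ℕ := ix 21 true
abbrev vV3 : ℕ := ix 22 false
abbrev vY : ℕ := ix 22 true
abbrev vMn : ℕ := ix 23 false

/-- Find a vertex of the first block that is not hit. -/
def findUnhit : Cmd :=
  .asg vFnd 0 ;; .for vX (V (vP0 false)) (V (vP1 false))
    (.when (.eq (.rd (aHIT false) (V vX)) 0) (.asg vFnd 1 ;; .asg vA0 (V vX)))

theorem findUnhit_spec (hH : SegHolds S K s) :
    ((run E findUnhit s).v vFnd = 0 → ∀ x, S.p0 false ≤ x → x < S.p1 false →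
      s.a (aHIT false) x ≠ 0) ∧
    ((run E findUnhit s).v vFnd ≠ 0 → S.p0 false ≤ (run E findUnhit s).v vA0 ∧
      (run E findUnhit s).v vA0 < S.p1 false ∧
      s.a (aHIT false) ((run E findUnhit s).v vA0) = 0) ∧
    cost E findUnhit s ≤ 4 * (S.p1 false - S.p0 false) + 3 := by
  have h01 := S.h01 false
  rw [findUnhit, run_seq, cost_seq]
  obtain ⟨h1, t1⟩ := for_frame_const E (.for vX (V (vP0 false)) (V (vP1 false)) (.when (.eq (.rd (aHIT false) (V vX)) 0) (.asg vFnd 1 ;; .asg vA0 (V vX))))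
      (run E (.asg vFnd 0) s) rfl
    (fun i s' => (s'.v vFnd = 0 → ∀ x, S.p0 false ≤ x → x < i → s.a (aHIT false) x ≠ 0) ∧
      (s'.v vFnd ≠ 0 → S.p0 false ≤ s'.v vA0 ∧ s'.v vA0 < S.p1 false ∧
        s.a (aHIT false) (s'.v vA0) = 0)) 3
    (by simp [hH.p0, hH.p1]; omega) ⟨fun _ u h0 h1 => by simp [hH.p0] at h1; omega, by simp⟩ (by
      rintro i s' hi1 hi2 hS ⟨a1, a2⟩
      simp [hH.p0, hH.p1] at hi1 hi2
      have e : s'.a (aHIT false) = s.a (aHIT false) := hS.a _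
      simp only [exec, e, Nat.reduceEqDiff]
      by_cases hlt : s.a (aHIT false) i = 0
      · simp [hlt, hi1, hi2]
      · simp [hlt]
        refine ⟨fun h0 u hu0 hu1 => ?_, a2⟩
        rcases Nat.le_iff_lt_or_eq.1 hu1 with hu1 | rfl
        · exact a1 h0 u hu0 hu1
        · exact hlt)
  simp only [ev_var, run_asg, setV_v, ix_inj, Nat.reduceEqDiff, false_and, if_false, hH.p0,
    hH.p1] at h1 t1 ⊢
  refine ⟨h1.1, h1.2, ?_⟩
  simp only [cost_asg]
  omega

/-- Hit, in the reversed graph, the neighbors of `U3` in the second block. -/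
def hitNbrs : Cmd :=
  .for vE2 (.rd (aOFF false) (V vU3)) (.rd (aOFF false) (V vU3 + 1))
    (.asg vV3 (.rd (aTGT false) (V vE2)) ;;
    .ite (.lt (V vV3) (V (vP1 false))) .skip (.when (.lt (V vV3) (V (vP2 false)))
      (.asg vS (V vN - 1 - V vV3) ;; hit true)))

theorem hitNbrs_spec {Bad : Prop} {s₀ : St} (hB : Big T K E) (hI : HitInv S K true Bad s₀ s)
    (hbad : BadPair S K true → Bad) {u : ℕ} (hu : s.v vU3 = u) (hun : u < T.n) :
    HitInv S K true Bad s₀ (run E hitNbrs s) ∧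
      (∀ y, s.a (aHIT true) y ≠ 0 → (run E hitNbrs s).a (aHIT true) y ≠ 0) ∧
      (∀ v c y, T.E false u v c → S.p1 false ≤ v → v < S.p2 false → S.p0 true ≤ y →
        y < S.p1 true → Le (T.E true) y (T.n - 1 - v) K →
        (run E hitNbrs s).a (aHIT true) y ≠ 0) ∧
      cost E hitNbrs s ≤ (20 * S.size + 45) * (T.off false (u + 1) - T.off false u) + 2 := by
  have hlin := hB.lin
  have r0 := S.r0 false
  have r1 := S.r1 false
  have h01 := S.h01 false
  have h12 := S.h12 false
  have h2n := S.h2n false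
  simp only [Bool.not_false] at r0 r1
  have hu1 : min (u + 1) E.B = u + 1 := by omega
  have hoff := (T.csr false).off_mono u (u + 1) (by omega) (by omega)
  obtain ⟨h1, t1⟩ := for_frame_const E hitNbrs s rfl
    (fun i s' => HitInv S K true Bad s₀ s' ∧
      (∀ y, s.a (aHIT true) y ≠ 0 → s'.a (aHIT true) y ≠ 0) ∧
      (∀ e y, T.off false u ≤ e → e < i → S.p1 false ≤ T.tgt false e →
        T.tgt false e < S.p2 false → S.p0 true ≤ y → y < S.p1 true →
        Le (T.E true) y (T.n - 1 - T.tgt false e) K → s'.a (aHIT true) y ≠ 0))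
    (20 * S.size + 44)
    (by simp [hI.inv.off, hu, hu1, hoff])
    ⟨hI, fun _ h => h, fun e y h0 h1 => by simp [hI.inv.off, hu] at h1; omega⟩ (by
      rintro i s' hi1 hi2 hS ⟨a1, a2, a3⟩
      simp only [exec, hI.inv.off, hu, hu1] at hi1 hi2
      simp only [exec, Nat.reduceEqDiff, a1.inv.tgt, a1.inv.p1, a1.inv.p2, a1.inv.n]
      have hI' := (a1.setV vE2 i).setV vV3 (T.tgt false i)
      have hcase : ∀ e, e < i + 1 → e < i ∨ e = i := by omega
      by_cases c1 : T.tgt false i < S.p1 false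
      · simp only [c1, exec]
        refine ⟨⟨hI', a2, fun e y h0 h1 h2 h3 h4 h5 h6 => ?_⟩, by omega⟩
        rcases hcase e h1 with h1 | rfl
        · exact a3 e y h0 h1 h2 h3 h4 h5 h6
        · omega
      by_cases c2 : T.tgt false i < S.p2 false
      swap
      · simp only [c1, c2, if_true, if_false]
        refine ⟨⟨hI', a2, fun e y h0 h1 h2 h3 h4 h5 h6 => ?_⟩, by omega⟩
        rcases hcase e h1 with h1 | rfl
        · exact a3 e y h0 h1 h2 h3 h4 h5 h6
        · omega
      simp only [c1, c2, exec]
      obtain ⟨b1, b2, b3, b4⟩ := HitInv.hit hB (hI'.setV vS (T.n - 1 - T.tgt false i)) hbad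
        (x := T.n - 1 - T.tgt false i) (by simp) (by omega) (by omega)
      refine ⟨⟨b1, fun y hy => b2 y (a2 y hy), fun e y h0 h1 h2 h3 h4 h5 h6 => ?_⟩, by omega⟩
      rcases hcase e h1 with h1 | rfl
      · exact b2 y (a3 e y h0 h1 h2 h3 h4 h5 h6)
      · exact b3 y h4 h5 h6)
  simp only [exec, hI.inv.off, hu, hu1] at h1 t1
  refine ⟨h1.1, h1.2.1, fun v c y hE hv1 hv2 hy0 hy1 hl => ?_, t1⟩
  obtain ⟨e, he, h2, rfl, -⟩ := hE
  refine h1.2.2 e y ?_ ?_ hv1 hv2 hy0 hy1 hl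
  · rw [← h2]; exact (T.csr false).off_le e he
  · rw [← h2]; exact (T.csr false).lt_off e he

theorem Big.idx0 (hB : Big T K E) {x : ℕ} (hx : x < T.n) : min (x * T.kk) E.B = x * T.kk := by
  simpa using hB.idx hx T.kk_pos

/-- Hit the neighbors of all vertices in the list of `A0`. -/
def hitAll : Cmd :=
  .for vJ2 0 (.rd (aLEN false) (V vA0))
    (.asg vU3 (.rd (aLU false) (V vA0 * V vKH + V vJ2)) ;; hitNbrs)

/-- The list of `a` has at most `kk` members, each of degree at most `hh` as it lies within `K` of
`a`. So there are at most `kk * hh` hits. -/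
theorem hitAll_spec {Bad : Prop} {s₀ : St} (hB : Big T K E) (hI : HitInv S K true Bad s₀ s)
    (hbad : BadPair S K true → Bad) {a len big : ℕ} (ha : s.v vA0 = a) (ha1 : a < S.p1 false)
    (hlen : s.a (aLEN false) a = len)
    (hL : ListOK S K false a len big (s.a (aLU false)) (s.a (aLD false)))
    (hdeg : ∀ u, a ≤ u → u < S.p1 false → Le (T.E false) a u K →
      T.off false (u + 1) - T.off false u ≤ T.hh) :
    HitInv S K true Bad s₀ (run E hitAll s) ∧
      (∀ j v c y, j < len → T.E false (s.a (aLU false) (a * T.kk + j)) v c → S.p1 false ≤ v →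
        v < S.p2 false → S.p0 true ≤ y → y < S.p1 true → Le (T.E true) y (T.n - 1 - v) K →
        (run E hitAll s).a (aHIT true) y ≠ 0) ∧
      cost E hitAll s ≤ ((20 * S.size + 45) * T.hh + 4) * T.kk + 2 := by
  have h12 := S.h12 false
  have h2n := S.h2n false
  have hkk : (20 * S.size + 45) * T.hh + 4 = (20 * S.size + 45) * T.hh + 3 + 1 := rfl
  obtain ⟨h1, t1⟩ := for_frame_const E hitAll s rfl
    (fun i s' => HitInv S K true Bad s₀ s' ∧
      (∀ j v c y, j < i → T.E false (s.a (aLU false) (a * T.kk + j)) v c → S.p1 false ≤ v →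
        v < S.p2 false → S.p0 true ≤ y → y < S.p1 true → Le (T.E true) y (T.n - 1 - v) K →
        s'.a (aHIT true) y ≠ 0))
    ((20 * S.size + 45) * T.hh + 3) (by simp) ⟨hI, fun j v c y hj => by simp at hj⟩ (by
      rintro i s' - hi hS ⟨a1, a2⟩
      simp only [ev_rd, ev_var, ha, hlen] at hi
      have e1 : s'.v vA0 = a := by rw [hS.v _, ha]
      have e2 : s'.a (aLU false) = s.a (aLU false) := hS.a _
      have hidx := hB.idx (x := a) (i := i) (by omega) (by have := hL.le; omega)
      have hidx0 := hB.idx0 (x := a) (by omega)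
      obtain ⟨m1, m2, m3, m4⟩ := hL.mem i hi
      simp only [exec, Nat.reduceEqDiff, e1, e2, a1.inv.kk, hidx0, hidx]
      obtain ⟨b1, b2, b3, b4⟩ := hitNbrs_spec (E := E) hB
        ((a1.setV vJ2 i).setV vU3 (s.a (aLU false) (a * T.kk + i))) hbad (u := _) (by simp; rfl)
        (by omega)
      have hd := Nat.mul_le_mul_left (20 * S.size + 45) (hdeg _ m1 m2 ⟨_, m3, m4⟩)
      refine ⟨⟨b1, fun j v c y hj h1 h2 h3 h4 h5 h6 => ?_⟩, by omega⟩
      rcases Nat.lt_succ_iff_lt_or_eq.1 hj with hj | rfl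
      · exact b2 y (a2 j v c y hj h1 h2 h3 h4 h5 h6)
      · exact b3 v c y h1 h2 h3 h4 h5 h6)
  simp only [exec, ha, hlen, Nat.sub_zero] at h1 t1
  refine ⟨h1.1, h1.2, t1.trans ?_⟩
  rw [hkk]
  have := Nat.mul_le_mul_left ((20 * S.size + 45) * T.hh + 3 + 1) hL.le
  omega

/-- Check that all vertices of the second block are hit. -/
def checkAll : Cmd :=
  .for vX (V (vP0 true)) (V (vP1 true)) (.when (.eq (.rd (aHIT true) (V vX)) 0) (.asg vOK 0))

theorem checkAll_spec {Bad : Prop} (hH : SegHolds S K s) (hok : s.v vOK = 0 → Bad)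
    (hbad : ∀ y, S.p0 true ≤ y → y < S.p1 true → s.a (aHIT true) y = 0 → Bad) :
    ((run E checkAll s).v vOK = 0 → Bad) ∧
    ((run E checkAll s).v vOK ≠ 0 → s.v vOK ≠ 0 ∧
      ∀ y, S.p0 true ≤ y → y < S.p1 true → s.a (aHIT true) y ≠ 0) ∧
    cost E checkAll s ≤ 3 * (S.p1 true - S.p0 true) + 2 := by
  have h01 := S.h01 true
  obtain ⟨h1, t1⟩ := for_frame_const E checkAll s rfl
    (fun i s' => (s'.v vOK = 0 → Bad) ∧ (s'.v vOK ≠ 0 → s.v vOK ≠ 0 ∧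
      ∀ y, S.p0 true ≤ y → y < i → s.a (aHIT true) y ≠ 0)) 2
    (by simp [hH.p0, hH.p1]; omega) ⟨hok, fun h => ⟨h, fun u h0 h1 => by
      simp [hH.p0] at h1; omega⟩⟩ (by
      rintro i s' hi1 hi2 hS ⟨a1, a2⟩
      simp [hH.p0, hH.p1] at hi1 hi2
      have e : s'.a (aHIT true) = s.a (aHIT true) := hS.a _
      simp only [exec, e]
      by_cases hlt : s.a (aHIT true) i = 0
      · simp [hlt]
        exact hbad i hi1 hi2 hlt
      · simp [hlt]
        refine ⟨a1, fun h => ⟨(a2 h).1, fun u hu0 hu1 => ?_⟩⟩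
        rcases Nat.le_iff_lt_or_eq.1 hu1 with hu1 | rfl
        · exact (a2 h).2 u hu0 hu1
        · exact hlt)
  simp only [ev_var, hH.p0, hH.p1] at h1 t1
  exact ⟨h1.1, h1.2, t1⟩

/-- The last phase in the sparse case. -/
def sparseFinal : Cmd :=
  findUnhit ;; .when (V vFnd) (hitAll ;; checkAll)

/-- All pairs of the two blocks are close. -/
def Close (S : Seg T) (K : ℕ) : Prop :=
  ∀ x y, S.p0 false ≤ x → x < S.p1 false → S.p1 false ≤ y → y < S.p2 false →
    Le (T.E false) x y (2 * K)

theorem close_of_cert_true {x y : ℕ} (hx : S.p0 false ≤ x) (hx' : x < S.p1 false)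
    (hy' : y < S.p2 false) (h : Cert S K true (T.n - 1 - y)) : Le (T.E false) x y (2 * K) := by
  have r1 := S.r1 false
  have r2 := S.r2 false
  have h01 := S.h01 false
  have h12 := S.h12 false
  have h2n := S.h2n false
  simp only [Bool.not_false] at r1 r2
  have := h (T.n - 1 - x) (by omega) (by omega)
  exact (Inst.le_rev_iff (g := false) (by omega) (by omega)).1 this

/-- Take one unmarked vertex `a` of the first block. A walk of weight at most `K` from `a` to the
second block enters it by an edge from a member of the ball of `a`, which is listed completely, to
some `v`; hitting `v` in the reversed graph marks all vertices that `v` reaches within `K`. So a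
vertex left unmarked at the end is farther than `K` from `a`; if there is none, the certificates of
the second block cover all pairs. -/
theorem sparseFinal_spec {Bad : Prop} (hB : Big T K E) (hI : SegInv S K Bad s)
    (hbad : BadPair S K false → Bad) (hC : CovInv S true s)
    (hbig : ∀ x, S.p0 true ≤ x → x < S.p1 true → s.a (aBIG true) x = 0) (hL : Lists S K false s)
    (hbigf : ∀ x, S.p0 false ≤ x → x < S.p1 false → s.a (aHIT false) x = 0 →
      s.a (aBIG false) x = 0)
    (hdeg : ∀ x u, S.p0 false ≤ x → x < S.p1 false → s.a (aHIT false) x = 0 → x ≤ u →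
      u < S.p1 false → Le (T.E false) x u K → T.off false (u + 1) - T.off false u ≤ T.hh) :
    ((run E sparseFinal s).v vOK = 0 → Bad) ∧
    ((run E sparseFinal s).v vOK ≠ 0 → s.v vOK ≠ 0 ∧ Close S K) ∧
    cost E sparseFinal s ≤ ((20 * S.size + 45) * T.hh + 4) * T.kk + 4 * S.size + 12 := by
  have r0 := S.r0 false
  have r1 := S.r1 false
  have r2 := S.r2 false
  have h01 := S.h01 false
  have h12 := S.h12 false
  have h2n := S.h2n false
  simp only [Bool.not_false] at r0 r1 r2
  have hsize := S.size_eq false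
  rw [sparseFinal, run_seq, cost_seq]
  obtain ⟨f1, f2, f3⟩ := findUnhit_spec (E := E) hI.toSegHolds
  have fo : (run E findUnhit s).v vOK = s.v vOK := run_v _ _ _
  have fa : ∀ j, (run E findUnhit s).a j = s.a j := fun j => run_a _ _ _
  have hH₁ : SegHolds S K (run E findUnhit s) := hI.toSegHolds.run _ rfl
  set s₁ := run E findUnhit s with hs₁
  clear_value s₁
  have hI₁ : SegInv S K Bad s₁ := ⟨hH₁, by rw [fo]; exact hI.ok, by
    rw [fo]; intro h g' x h0 h1; rw [fa]; exact hI.cert h g' x h0 h1⟩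
  rw [run_ite, cost_ite, ev_var]
  by_cases hf : s₁.v vFnd = 0
  · simp only [hf, exec]
    refine ⟨hI₁.ok, fun h => ⟨by rwa [← fo], fun x y hx0 hx1 hy0 hy1 => ?_⟩, by omega⟩
    exact hI₁.cert h false x hx0 hx1 (by rw [fa]; exact f1 hf x hx0 hx1) y hy0 hy1
  simp only [hf, exec]
  obtain ⟨g1, g2, g3⟩ := f2 hf
  set a := s₁.v vA0 with ha
  have hHI : HitInv S K true Bad s₁ s₁ := by
    refine ⟨hI₁, ?_, by rw [fa]; exact hbig, fun h => h, fun _ h => h⟩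
    unfold CovInv at hC ⊢; simp only [fa]; exact hC
  have hLa : ListOK S K false a (s₁.a (aLEN false) a) 0 (s₁.a (aLU false)) (s₁.a (aLD false)) := by
    simp only [fa]
    have := hL a g1 g2 g3
    rwa [hbigf a g1 g2 g3] at this
  obtain ⟨b1, b2, b3⟩ := hitAll_spec hB hHI (fun h => hbad (badPair_rev h)) ha.symm g2
    rfl hLa fun u h0 h1 h2 => hdeg a u g1 g2 g3 h0 h1 h2
  have hH₂ := b1.inv
  obtain ⟨d1, d2, d3⟩ := checkAll_spec (E := E) (Bad := Bad) hH₂.toSegHolds hH₂.ok (by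
    intro y hy0 hy1 hy
    -- The unmarked `y` forms a bad pair with `a`: otherwise the crossing edge of a short walk leads
    -- to a vertex that was hit, and this hit would have marked `y`.
    refine hbad ⟨a, T.n - 1 - y, g1, g2, by omega, by omega, fun hl => ?_⟩
    obtain ⟨k, hk, hw⟩ := hl
    obtain ⟨u, v, c, k₁, k₂, w1, w2, w3, w4, w5, w6⟩ := Inst.wk_cross (p := S.p1 false) hw g2
      (by omega)
    obtain ⟨j, hj, rfl, -⟩ := hLa.complete rfl u k₁ w4 (by omega) w1
    have := Inst.le_of_wk w3
    refine b2 j v c y hj w2 w5 (by omega) hy0 hy1 ?_ hy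
    have h := Inst.le_rev (g := false) (by omega) ⟨k₂, by omega, w3⟩ (K := K)
    rwa [Bool.not_false, show T.n - 1 - (T.n - 1 - y) = y by omega] at h)
  refine ⟨d1, fun h => ?_, by omega⟩
  obtain ⟨d4, d5⟩ := d2 h
  refine ⟨by rw [← fo]; exact b1.ok d4, fun x y hx0 hx1 hy0 hy1 => ?_⟩
  exact close_of_cert_true hx0 hx1 hy1
    (hH₂.cert d4 true _ (by omega) (by omega) (d5 _ (by omega) (by omega)))

/-! ## The remaining pairs in the dense case -/

abbrev vW : ℕ := ix 23 true

/-- `dv v` is the smallest weight, as far as it is at most `K`, of a walk from `a` to `v` all of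
whose vertices but the last are in the first block; only edges `e` with `P e` are used last. -/
structure IsDV (S : Seg T) (K a : ℕ) (P : ℕ → Prop) (dv : ℕ → ℕ) : Prop where
  sound : ∀ v, S.p1 false ≤ v → v < S.p2 false → dv v ≤ K → Wk (T.E false) a v (dv v)
  complete : ∀ e k, e < T.m → P e → S.p1 false ≤ T.tgt false e → T.tgt false e < S.p2 false →
    T.src false e < S.p1 false → Wk (T.E false) a (T.src false e) k → k + T.wt false e ≤ K →
    dv (T.tgt false e) ≤ k + T.wt false e

theorem IsDV.mono {a : ℕ} {P Q : ℕ → Prop} {dv : ℕ → ℕ} (h : IsDV S K a P dv)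
    (hPQ : ∀ e, e < T.m → Q e → T.src false e < S.p1 false → P e) : IsDV S K a Q dv :=
  ⟨h.sound, fun e k he hQ h1 h2 h3 => h.complete e k he (hPQ e he hQ h3) h1 h2 h3⟩

def dvInit : Cmd :=
  .for vP (V (vP1 false)) (V (vP2 false)) (.wr aDV (V vP) (V vK + 1))

theorem dvInit_spec (hB : Big T K E) (hH : SegHolds S K s) (a : ℕ) :
    IsDV S K a (fun _ => False) ((run E dvInit s).a aDV) ∧
      cost E dvInit s ≤ 2 * (S.p2 false - S.p1 false) + 2 := by
  have hlin := hB.lin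
  have h12 := S.h12 false
  have hKB : min (K + 1) E.B = K + 1 := by omega
  obtain ⟨h1, t1⟩ := for_frame_const E dvInit s rfl
    (fun i s' => ∀ v, S.p1 false ≤ v → v < i → s'.a aDV v = K + 1) 1
    (by simp [hH.p1, hH.p2]; omega) (by simp [hH.p1]; omega) (by
      rintro i s' - - hS ih
      have e3 : s'.v vK = K := by rw [hS.v _, hH.thr]
      refine ⟨fun v hv0 hv1 => ?_, by simp⟩
      simp [e3, hKB, Function.update_apply]
      rcases Nat.lt_succ_iff_lt_or_eq.1 hv1 with hv1 | rfl
      · intro _; exact ih v hv0 hv1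
      · simp)
  simp only [ev_var, hH.p1, hH.p2] at h1 t1
  refine ⟨⟨fun v h2 h3 h4 => ?_, fun _ _ _ h => h.elim⟩, t1⟩
  have := h1 v h2 h3
  change (run E dvInit s).a aDV v = _ at this
  omega

def dvRelax : Cmd :=
  .for vE2 (.rd (aOFF false) (V vU3)) (.rd (aOFF false) (V vU3 + 1))
    (.asg vV3 (.rd (aTGT false) (V vE2)) ;;
    .ite (.lt (V vV3) (V (vP1 false))) .skip (.when (.lt (V vV3) (V (vP2 false)))
      (.asg vD (V vW + .rd (aWT false) (V vE2)) ;;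
      .when (.lt (V vD) (.rd aDV (V vV3))) (.wr aDV (V vV3) (V vD)))))

/-- By `hmin` the label `l` is the least weight of a walk from `a` to `u` as far as `K` matters, so
relaxing each edge out of `u` once with this label settles all edges with source `u`. -/
theorem dvRelax_spec (hB : Big T K E) (hH : SegHolds S K s) {a u l : ℕ} {P : ℕ → Prop}
    (hu : s.v vU3 = u) (hl : s.v vW = l) (hun : u < T.n) (hw : Wk (T.E false) a u l)
    (hmin : ∀ k, k ≤ K → Wk (T.E false) a u k → l ≤ k) (hD : IsDV S K a P (s.a aDV)) :
    IsDV S K a (fun e => P e ∨ T.src false e = u) ((run E dvRelax s).a aDV) ∧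
      cost E dvRelax s ≤ 8 * (T.off false (u + 1) - T.off false u) + 2 := by
  have hlin := hB.lin
  have hu1 : min (u + 1) E.B = u + 1 := by omega
  have hcsr := T.csr false
  have hoff := hcsr.off_mono u (u + 1) (by omega) (by omega)
  have hoffm := hcsr.off_le_m (p := u + 1) (by omega)
  obtain ⟨h1, t1⟩ := for_frame_const E dvRelax s rfl
    (fun i s' => IsDV S K a (fun e => P e ∨ (T.src false e = u ∧ e < i)) (s'.a aDV)) 7
    (by simp [hH.off, hu, hu1, hoff])
    (hD.mono fun e he hq _ => hq.resolve_right fun h => by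
      have := hcsr.off_le e he
      simp [hH.off, hu] at h
      rw [h.1] at this
      omega) (by
      rintro i s' hi1 hi2 hS a1
      simp only [exec, hH.off, hu, hu1] at hi1 hi2
      have hH' := hH.same hS (by rfl)
      have e1 : s'.v vW = l := by rw [hS.v _, hl]
      have hsrc := hcsr.src_eq hun hi1 hi2
      simp only [exec, Nat.reduceEqDiff, hH'.tgt, hH'.wt, hH'.p1, hH'.p2, e1]
      have hext : ∀ d : ℕ → ℕ, IsDV S K a (fun e => P e ∨ (T.src false e = u ∧ e < i)) d →
          (S.p1 false ≤ T.tgt false i → T.tgt false i < S.p2 false → l + T.wt false i ≤ K →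
            d (T.tgt false i) ≤ l + T.wt false i) →
          IsDV S K a (fun e => P e ∨ (T.src false e = u ∧ e < i + 1)) d := by
        refine fun d hd h => ⟨hd.sound, fun e k he hq h1 h2 h3 h4 h5 => ?_⟩
        by_cases hei : e = i
        · subst hei
          rw [hsrc] at h4
          have := hmin k (by omega) h4
          have := h h1 h2 (by omega)
          omega
        · exact hd.complete e k he (hq.imp_right fun h => ⟨h.1, by omega⟩) h1 h2 h3 h4 h5
      by_cases c1 : T.tgt false i < S.p1 false
      · simp only [c1, exec]
        exact ⟨hext _ a1 fun h => by omega, by omega⟩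
      by_cases c2 : T.tgt false i < S.p2 false
      swap
      · simp only [c1, c2, exec]
        exact ⟨hext _ a1 fun _ h => by omega, by omega⟩
      simp only [c1, c2, exec]
      by_cases c3 : min (l + T.wt false i) E.B < s'.a aDV (T.tgt false i)
      swap
      · simp only [c3, exec]
        exact ⟨hext _ a1 fun _ _ _ => by omega, by omega⟩
      simp only [c3, exec]
      refine ⟨hext _ ⟨fun v hv1 hv2 hv => ?_, fun e k he hq h1 h2 h3 h4 h5 => ?_⟩ fun _ _ _ => ?_,
        by omega⟩
      · by_cases hvt : v = T.tgt false i
        · subst hvt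
          rw [Function.update_self] at hv ⊢
          rw [show min (l + T.wt false i) E.B = l + T.wt false i by omega]
          exact hw.snoc ⟨i, by omega, hsrc, rfl, rfl⟩
        · rw [Function.update_of_ne hvt] at hv ⊢
          exact a1.sound v hv1 hv2 hv
      · have := a1.complete e k he hq h1 h2 h3 h4 h5
        by_cases hvt : T.tgt false e = T.tgt false i
        · rw [hvt] at this ⊢
          rw [Function.update_self]; omega
        · rwa [Function.update_of_ne hvt]
      · rw [Function.update_self]; omega)
  simp only [exec, hH.off, hu, hu1] at h1 t1
  refine ⟨IsDV.mono h1 fun e he hq _ => hq.imp_right fun h => ⟨h, ?_⟩, t1⟩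
  rw [← h]; exact hcsr.lt_off e he

/-- Distances from `A0` to the vertices of the second block that leave the first block with the last
edge. -/
def dvAll : Cmd :=
  dvInit ;; .for vJ2 0 (.rd (aLEN false) (V vA0))
    (.asg vU3 (.rd (aLU false) (V vA0 * V vKH + V vJ2)) ;;
    .asg vW (.rd (aLD false) (V vA0 * V vKH + V vJ2)) ;; dvRelax)

/-- The list of `a` is complete, so the source of every edge that continues a relevant walk from `a`
into the second block is a member. Relaxing the edges that leave the list thus takes care of all
edges. -/
theorem dvAll_spec (hB : Big T K E) (hH : SegHolds S K s) {a len : ℕ} (ha : s.v vA0 = a)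
    (ha1 : a < S.p1 false) (hlen : s.a (aLEN false) a = len)
    (hL : ListOK S K false a len 0 (s.a (aLU false)) (s.a (aLD false)))
    (hdeg : ∀ u, a ≤ u → u < S.p1 false → Le (T.E false) a u K →
      T.off false (u + 1) - T.off false u ≤ T.hh) :
    IsDV S K a (fun _ => True) ((run E dvAll s).a aDV) ∧
      cost E dvAll s ≤ (8 * T.hh + 5) * T.kk + 2 * (S.p2 false - S.p1 false) + 4 := by
  have h12 := S.h12 false
  have h2n := S.h2n false
  obtain ⟨i1, i2⟩ := dvInit_spec hB hH a
  have hH₁ : SegHolds S K (run E dvInit s) := hH.run _ rfl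
  have f1 : (run E dvInit s).v vA0 = a := by rw [run_v _ _ _, ha]
  have f2 : (run E dvInit s).a (aLEN false) = s.a (aLEN false) := run_a _ _ _
  have f3 : (run E dvInit s).a (aLU false) = s.a (aLU false) := run_a _ _ _
  have f4 : (run E dvInit s).a (aLD false) = s.a (aLD false) := run_a _ _ _
  rw [dvAll, run_seq, cost_seq]
  set s₁ := run E dvInit s
  clear_value s₁
  rw [← f3, ← f4] at hL
  obtain ⟨h1, t1⟩ := for_frame_const E (.for vJ2 0 (.rd (aLEN false) (V vA0)) (.asg vU3 (.rd (aLU false) (V vA0 * V vKH + V vJ2)) ;; .asg vW (.rd (aLD false) (V vA0 * V vKH + V vJ2)) ;; dvRelax))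
      s₁ rfl
    (fun i s' => IsDV S K a (fun e => ∃ j, j < i ∧
      T.src false e = s₁.a (aLU false) (a * T.kk + j)) (s'.a aDV)) (8 * T.hh + 4)
    (by simp) (i1.mono fun e he ⟨j, hj, _⟩ _ => by simp at hj) (by
      rintro i s' - hi hS a1
      simp only [ev_rd, ev_var, f1, f2, hlen] at hi
      have e1 : s'.v vA0 = a := by rw [hS.v _, f1]
      have e2 : s'.a (aLU false) = s₁.a (aLU false) := hS.a _
      have e3 : s'.a (aLD false) = s₁.a (aLD false) := hS.a _
      have hH' := hH₁.same hS (by rfl)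
      have hidx := hB.idx (x := a) (i := i) (by omega) (by have := hL.le; omega)
      have hidx0 := hB.idx0 (x := a) (by omega)
      obtain ⟨m1, m2, m3, m4⟩ := hL.mem i hi
      simp only [exec, Nat.reduceEqDiff, e1, e2, e3, hH'.kk, hidx0, hidx]
      obtain ⟨b1, b2⟩ := dvRelax_spec (E := E) (S := S) (K := K)
        (s := ((s'.setV vJ2 i).setV vU3 (s₁.a (aLU false) (a * T.kk + i))).setV vW
          (s₁.a (aLD false) (a * T.kk + i)))
        hB (((hH'.setV _ _ rfl).setV _ _ rfl).setV _ _ rfl)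
        (u := s₁.a (aLU false) (a * T.kk + i)) (l := s₁.a (aLD false) (a * T.kk + i))
        (by simp) (by simp) (by omega) m4 (fun k hk hw => by
          obtain ⟨j, hj, hj1, hj2⟩ := hL.complete rfl _ k m2 hk hw
          rwa [hL.inj j i hj hi hj1] at hj2) a1
      have hd := hdeg _ m1 m2 ⟨_, m3, m4⟩
      refine ⟨b1.mono fun e he ⟨j, hj, hj'⟩ _ => ?_, by omega⟩
      rcases Nat.lt_succ_iff_lt_or_eq.1 hj with hj | rfl
      · exact Or.inl ⟨j, hj, hj'⟩
      · exact Or.inr hj')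
  simp only [exec, f1, f2, hlen, Nat.sub_zero] at h1 t1
  refine ⟨⟨h1.sound, fun e k he _ g1 g2 g3 g4 g5 => ?_⟩, ?_⟩
  · obtain ⟨j, hj, hj1, hj2⟩ := hL.complete rfl _ k g3 (by omega) g4
    exact h1.complete e k he ⟨j, hj, hj1.symm⟩ g1 g2 g3 g4 g5
  · have := Nat.mul_le_mul_left (8 * T.hh + 4 + 1) hL.le
    change _ ≤ (8 * T.hh + 4 + 1) * T.kk at this
    have e5 : (8 * T.hh + 4 + 1) * T.kk = (8 * T.hh + 5) * T.kk := rfl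
    omega

/-- The distance between `A0` and the vertex with number `Y` in the reversed order. -/
def pairMin : Cmd :=
  .asg vMn (V vK + 1) ;; .for vJ2 0 (.rd (aLEN true) (V vY))
    (.asg vD (.rd aDV (V vN - 1 - .rd (aLU true) (V vY * V vKH + V vJ2)) +
      .rd (aLD true) (V vY * V vKH + V vJ2)) ;;
    .when (.lt (V vD) (V vMn)) (.asg vMn (V vD)))

/-- A walk to the second block crosses the border exactly once. Its part up to and including the
crossing edge is measured by `DV`, and its rest, reversed, is a walk within `K` from `y` in the
reversed graph, so that its end is in the complete list of `y`. Minimizing the sum over this list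
decides whether the distance is at most `K`. -/
theorem pairMin_spec (hB : Big T K E) (hH : SegHolds S K s) {a y len : ℕ}
    (ha1 : a < S.p1 false) (hy : s.v vY = y) (hy0 : S.p0 true ≤ y) (hy1 : y < S.p1 true)
    (hlen : s.a (aLEN true) y = len) (hD : IsDV S K a (fun _ => True) (s.a aDV))
    (hL : ListOK S K true y len 0 (s.a (aLU true)) (s.a (aLD true))) :
    ((run E pairMin s).v vMn ≤ K ↔ Le (T.E false) a (T.n - 1 - y) K) ∧
      cost E pairMin s ≤ 4 * T.kk + 3 := by
  have hlin := hB.lin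
  have r0 := S.r0 false
  have r1 := S.r1 false
  have h01 := S.h01 false
  have h12 := S.h12 false
  have h2n := S.h2n false
  simp only [Bool.not_false] at r0 r1
  have hKB : min (K + 1) E.B = K + 1 := by omega
  rw [pairMin, run_seq, cost_seq]
  have hH₁ : SegHolds S K (run E (.asg vMn (V vK + 1)) s) := hH.run _ rfl
  obtain ⟨h1, t1⟩ := for_frame_const E (.for vJ2 0 (.rd (aLEN true) (V vY)) (.asg vD (.rd aDV (V vN - 1 - .rd (aLU true) (V vY * V vKH + V vJ2)) + .rd (aLD true) (V vY * V vKH + V vJ2)) ;; .when (.lt (V vD) (V vMn)) (.asg vMn (V vD))))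
      (run E (.asg vMn (V vK + 1)) s) rfl
    (fun i s' => (s'.v vMn ≤ K → Le (T.E false) a (T.n - 1 - y) K) ∧
      ∀ j, j < i → s.a aDV (T.n - 1 - s.a (aLU true) (y * T.kk + j)) +
        s.a (aLD true) (y * T.kk + j) ≤ K → s'.v vMn ≤ K) 3
    (by simp) ⟨fun h => by simp [hH.thr, hKB] at h, fun j hj => by simp at hj⟩ (by
      rintro i s' - hi hS ⟨a1, a2⟩
      simp [hy, hlen] at hi
      have e1 : s'.v vY = y := by rw [hS.v _]; simp [hy]
      have e2 : s'.a (aLU true) = s.a (aLU true) := by rw [hS.a _]; rfl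
      have e3 : s'.a (aLD true) = s.a (aLD true) := by rw [hS.a _]; rfl
      have e4 : s'.a aDV = s.a aDV := by rw [hS.a _]; rfl
      have hH' := hH₁.same hS (by rfl)
      have hidx := hB.idx (x := y) (i := i) (by omega) (by have := hL.le; omega)
      have hidx0 := hB.idx0 (x := y) (by omega)
      obtain ⟨m1, m2, m3, m4⟩ := hL.mem i hi
      simp only [exec, Nat.reduceEqDiff, reduceCtorEq, e1, e2, e3, e4, hH'.kk, hidx0, hidx, hH'.n]
      set u := s.a (aLU true) (y * T.kk + i) with hu
      set l := s.a (aLD true) (y * T.kk + i) with hl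
      have hcase : ∀ j, j < i + 1 → j < i ∨ j = i := by omega
      by_cases c1 : min (s.a aDV (T.n - 1 - u) + l) E.B < s'.v vMn
      · simp only [c1, exec]
        refine ⟨⟨fun h => ?_, fun j hj hjK => ?_⟩, by omega⟩
        · have h2 := hD.sound (T.n - 1 - u) (by omega) (by omega) (by omega)
          have h3 := Inst.wk_rev (g := true) (by omega) m4
          rw [Bool.not_true] at h3
          exact ⟨_, by omega, h2.trans h3⟩
        · rcases hcase j hj with hj | rfl
          · have := a2 j hj hjK
            omega
          · change s.a aDV (T.n - 1 - u) + l ≤ K at hjK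
            omega
      · simp only [c1, exec, Nat.reduceEqDiff]
        refine ⟨⟨a1, fun j hj hjK => ?_⟩, by omega⟩
        rcases hcase j hj with hj | rfl
        · exact a2 j hj hjK
        · change s.a aDV (T.n - 1 - u) + l ≤ K at hjK
          omega)
  simp only [exec, Nat.reduceEqDiff, hy, hlen, Nat.sub_zero] at h1 t1 ⊢
  refine ⟨⟨h1.1, fun ⟨k, hk, hw⟩ => ?_⟩, by have := hL.le; omega⟩
  obtain ⟨u, v, c, k₁, k₂, w1, w2, w3, w4, w5, w6⟩ := Inst.wk_cross (p := S.p1 false) hw ha1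
    (by omega)
  have hvy := Inst.le_of_wk w3
  have w7 := Inst.wk_rev (by omega) w3
  rw [Bool.not_false, show T.n - 1 - (T.n - 1 - y) = y by omega] at w7
  obtain ⟨j, hj, hj1, hj2⟩ := hL.complete rfl _ k₂ (by omega) (by omega) w7
  refine h1.2 j hj ?_
  rw [hj1, show T.n - 1 - (T.n - 1 - v) = v by omega]
  obtain ⟨e, he, rfl, rfl, rfl⟩ := w2
  have := hD.complete e k₁ he trivial w5 (by omega) w4 w1 (by omega)
  omega

def denseRow : Cmd :=
  .for vY (V (vP0 true)) (V (vP1 true)) (.when (.eq (.rd (aHIT true) (V vY)) 0)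
    (pairMin ;; .when (.lt (V vK) (V vMn)) (.asg vOK 0)))

theorem denseRow_spec {Bad : Prop} (hB : Big T K E) (hH : SegHolds S K s)
    (hok : s.v vOK = 0 → Bad) (hbad : BadPair S K false → Bad) {a : ℕ} (ha0 : S.p0 false ≤ a)
    (ha1 : a < S.p1 false) (hD : IsDV S K a (fun _ => True) (s.a aDV)) (hL : Lists S K true s)
    (hbig : ∀ x, S.p0 true ≤ x → x < S.p1 true → s.a (aHIT true) x = 0 → s.a (aBIG true) x = 0) :
    ((run E denseRow s).v vOK = 0 → Bad) ∧
    ((run E denseRow s).v vOK ≠ 0 → s.v vOK ≠ 0 ∧ ∀ y, S.p0 true ≤ y → y < S.p1 true →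
      s.a (aHIT true) y = 0 → Le (T.E false) a (T.n - 1 - y) K) ∧
    cost E denseRow s ≤ (4 * T.kk + 8) * (S.p1 true - S.p0 true) + 2 := by
  have r0 := S.r0 false
  have r1 := S.r1 false
  have h01 := S.h01 false
  have h12 := S.h12 false
  have h2n := S.h2n false
  simp only [Bool.not_false] at r0 r1
  obtain ⟨h1, t1⟩ := for_frame_const E denseRow s rfl
    (fun i s' => (s'.v vOK = 0 → Bad) ∧ (s'.v vOK ≠ 0 → s.v vOK ≠ 0 ∧
      ∀ y, S.p0 true ≤ y → y < i → s.a (aHIT true) y = 0 → Le (T.E false) a (T.n - 1 - y) K))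
    (4 * T.kk + 7)
    (by simp [hH.p0, hH.p1]; omega) ⟨hok, fun h => ⟨h, fun u h0 h1 => by
      simp [hH.p0] at h1; omega⟩⟩ (by
      rintro i s' hi1 hi2 hS ⟨a1, a2⟩
      simp only [ev_var, hH.p0, hH.p1] at hi1 hi2
      have hH' := hH.same hS (by rfl)
      have e1 : s'.a (aHIT true) = s.a (aHIT true) := hS.a _
      have e2 : s'.a (aLU true) = s.a (aLU true) := hS.a _
      have e3 : s'.a (aLD true) = s.a (aLD true) := hS.a _
      have e4 : s'.a aDV = s.a aDV := hS.a _
      have e5 : s'.a (aLEN true) = s.a (aLEN true) := hS.a _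
      simp only [exec, e1]
      have hcase : ∀ j, j < i + 1 → j < i ∨ j = i := by omega
      by_cases c1 : s.a (aHIT true) i = 0
      swap
      · simp only [c1, exec, Nat.reduceEqDiff]
        refine ⟨⟨a1, fun h => ⟨(a2 h).1, fun y h0 h1 h2 => ?_⟩⟩, by omega⟩
        rcases hcase y h1 with h1 | rfl
        · exact (a2 h).2 y h0 h1 h2
        · exact absurd h2 c1
      simp only [c1, exec]
      have hLi := hL i hi1 hi2 c1
      rw [hbig i hi1 hi2 c1] at hLi
      obtain ⟨b1, b2⟩ := pairMin_spec (E := E) (S := S) (K := K) (s := s'.setV vY i) (a := a)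
        (y := i) (len := s.a (aLEN true) i) hB (hH'.setV _ _ rfl) ha1 (by simp) hi1 hi2
        (by simp [e5]) (by rw [setV_a, e4]; exact hD) (by rw [setV_a, e2, e3]; exact hLi)
      have g1 : (run E pairMin (s'.setV vY i)).v vK = K := by
        rw [run_v _ _ _]; simp [hH'.thr]
      have g2 : (run E pairMin (s'.setV vY i)).v vOK = s'.v vOK := by
        rw [run_v _ _ _]; simp
      simp only [g1]
      by_cases c2 : K < (run E pairMin (s'.setV vY i)).v vMn
      · simp only [c2, exec]
        refine ⟨⟨fun _ => hbad ⟨a, T.n - 1 - i, ha0, ha1, by omega, by omega, fun hl => ?_⟩,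
          fun h => absurd rfl h⟩, by omega⟩
        have := b1.2 hl
        omega
      · simp only [c2, if_true, if_false, g2]
        refine ⟨⟨a1, fun h => ⟨(a2 h).1, fun y h0 h1 h2 => ?_⟩⟩, by omega⟩
        rcases hcase y h1 with h1 | rfl
        · exact (a2 h).2 y h0 h1 h2
        · exact b1.1 (by omega))
  simp only [ev_var, hH.p0, hH.p1] at h1 t1
  exact ⟨h1.1, h1.2, t1⟩

/-- The last phase in the dense case. -/
def denseFinal : Cmd :=
  .for vA0 (V (vP0 false)) (V (vP1 false)) (.when (.eq (.rd (aHIT false) (V vA0)) 0)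
    (dvAll ;; denseRow))

set_option maxHeartbeats 400000 in
-- A pair with a marked vertex is covered by the certificate of that vertex. For two unmarked
-- vertices both lists are complete, and `pairMin_spec` compares the distance with `K` exactly, in
-- time `O(kk)` per pair.
theorem denseFinal_spec {Bad : Prop} (hB : Big T K E) (hI : SegInv S K Bad s)
    (hbad : BadPair S K false → Bad) (hL : ∀ g, Lists S K g s)
    (hbig : ∀ g x, S.p0 g ≤ x → x < S.p1 g → s.a (aHIT g) x = 0 → s.a (aBIG g) x = 0)
    (hdeg : ∀ x u, S.p0 false ≤ x → x < S.p1 false → s.a (aHIT false) x = 0 → x ≤ u →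
      u < S.p1 false → Le (T.E false) x u K → T.off false (u + 1) - T.off false u ≤ T.hh) :
    ((run E denseFinal s).v vOK = 0 → Bad) ∧
    ((run E denseFinal s).v vOK ≠ 0 → s.v vOK ≠ 0 ∧ Close S K) ∧
    cost E denseFinal s ≤ ((8 * T.hh + 5) * T.kk + (4 * T.kk + 10) * (S.p2 false - S.p1 false) +
      8) * (S.p1 false - S.p0 false) + 2 := by
  have r0 := S.r0 false
  have r1 := S.r1 false
  have h01 := S.h01 false
  have h12 := S.h12 false
  have h2n := S.h2n false
  simp only [Bool.not_false] at r0 r1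
  have hN : S.p1 true - S.p0 true = S.p2 false - S.p1 false := by omega
  obtain ⟨h1, t1⟩ := for_frame_const E denseFinal s rfl
    (fun i s' => (s'.v vOK = 0 → Bad) ∧ (s'.v vOK ≠ 0 → s.v vOK ≠ 0 ∧
      ∀ x y, S.p0 false ≤ x → x < i → s.a (aHIT false) x = 0 →
        S.p0 true ≤ y → y < S.p1 true → s.a (aHIT true) y = 0 →
        Le (T.E false) x (T.n - 1 - y) K))
    ((8 * T.hh + 5) * T.kk + (4 * T.kk + 10) * (S.p2 false - S.p1 false) + 7)
    (by simp [hI.p0, hI.p1]; omega) ⟨hI.ok, fun h => ⟨h, fun u _ h0 h1 => by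
      simp [hI.p0] at h1; omega⟩⟩ (by
      rintro i s' hi1 hi2 hS ⟨a1, a2⟩
      simp only [ev_var, hI.p0, hI.p1] at hi1 hi2
      have hH' := hI.toSegHolds.same hS (by rfl)
      have fr : ∀ j, (j = aHIT false ∨ j = aHIT true ∨ j = aLU false ∨ j = aLU true ∨
          j = aLD false ∨ j = aLD true ∨ j = aLEN false ∨ j = aLEN true ∨ j = aBIG true) →
          s'.a j = s.a j := by
        intro j hj
        rcases hj with rfl | rfl | rfl | rfl | rfl | rfl | rfl | rfl | rfl <;> exact hS.a _
      simp only [exec, fr (aHIT false) (by simp)]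
      have hcase : ∀ j, j < i + 1 → j < i ∨ j = i := by omega
      by_cases c1 : s.a (aHIT false) i = 0
      swap
      · simp only [c1, exec, Nat.reduceEqDiff]
        refine ⟨⟨a1, fun h => ⟨(a2 h).1, fun x y h0 h1 h2 => ?_⟩⟩, by omega⟩
        rcases hcase x h1 with h1 | rfl
        · exact (a2 h).2 x y h0 h1 h2
        · exact absurd h2 c1
      simp only [c1, exec]
      have hLi := hL false i hi1 hi2 c1
      rw [hbig false i hi1 hi2 c1] at hLi
      obtain ⟨b1, b2⟩ := dvAll_spec (E := E) (S := S) (K := K) (s := s'.setV vA0 i) (a := i)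
        (len := s.a (aLEN false) i) hB (hH'.setV _ _ rfl) (by simp) hi2
        (by rw [setV_a, fr _ (by simp)]) (by rw [setV_a, fr _ (by simp), fr _ (by simp)]; exact hLi)
        (fun u h0 h1 h2 => hdeg i u hi1 hi2 c1 h0 h1 h2)
      have hH₂ : SegHolds S K (run E dvAll (s'.setV vA0 i)) := (hH'.setV _ _ rfl).run _ rfl
      have g2 : (run E dvAll (s'.setV vA0 i)).v vOK = s'.v vOK := by
        rw [run_v _ _ _]; simp
      have ga : ∀ j, (j = aHIT true ∨ j = aLU true ∨ j = aLD true ∨ j = aLEN true ∨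
          j = aBIG true) → (run E dvAll (s'.setV vA0 i)).a j = s.a j := by
        intro j hj
        rw [run_a _ _ _ (by rcases hj with rfl | rfl | rfl | rfl | rfl <;> rfl), setV_a]
        exact fr j (by tauto)
      set s₂ := run E dvAll (s'.setV vA0 i) with hs₂
      clear_value s₂
      obtain ⟨d1, d2, d3⟩ := denseRow_spec (E := E) (Bad := Bad) (a := i) hB hH₂
        (by rw [g2]; exact a1) hbad hi1 hi2 b1
        (by
          intro y h0 h1 h2
          rw [ga _ (by simp), ga _ (by simp), ga _ (by simp), ga _ (by simp)]
          rw [ga _ (by simp)] at h2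
          exact hL true y h0 h1 h2)
        (by
          intro y h0 h1 h2
          rw [ga _ (by simp)] at h2 ⊢
          exact hbig true y h0 h1 h2)
      rw [g2, ga _ (by simp)] at d2
      refine ⟨⟨d1, fun h => ⟨(a2 (d2 h).1).1, fun x y h0 h1 h2 h3 h4 h5 => ?_⟩⟩, ?_⟩
      · rcases hcase x h1 with h1 | rfl
        · exact (a2 (d2 h).1).2 x y h0 h1 h2 h3 h4 h5
        · exact (d2 h).2 y h3 h4 h5
      · rw [hN] at d3
        simp only [add_mul] at d3 b2 ⊢
        omega)
  simp only [ev_var, hI.p0, hI.p1] at h1 t1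
  refine ⟨h1.1, fun h => ?_, t1⟩
  obtain ⟨h2, h3⟩ := h1.2 h
  refine ⟨h2, fun x y hx0 hx1 hy0 hy1 => ?_⟩
  by_cases c1 : s.a (aHIT false) x = 0
  · by_cases c2 : s.a (aHIT true) (T.n - 1 - y) = 0
    · have := h3 x (T.n - 1 - y) hx0 hx1 c1 (by omega) (by omega) c2
      rw [show T.n - 1 - (T.n - 1 - y) = y by omega] at this
      exact this.mono (by omega)
    · exact close_of_cert_true hx0 hx1 hy1 (hI.cert h2 true _ (by omega) (by omega) c2)
  · exact hI.cert h2 false x hx0 hx1 c1 y hy0 hy1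

/-! ## Two consecutive blocks -/

/-- Hit all vertices of the first block with high degree or with many vertices close to them. -/
def phase (g : Bool) : Cmd := stage1 g ;; explore g ;; greedy g

/-- Degrees, lists and greedy hitting contribute one term each: a hit per vertex of high degree,
`O(kk * (kk + hh))` per vertex for the lists, and a hit per greedy round. Lower order terms are
absorbed into these three. -/
theorem phase_spec (g : Bool) {Bad : Prop} (hB : Big T K E) (hI : SegInv S K Bad s)
    (hbad : BadPair S K g → Bad)
    (hclean : ∀ x, S.p0 g ≤ x → x < S.p1 g → s.a (aBIG g) x = 0 ∧ s.a (aCOV g) x = 0 ∧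
      s.a (aTD g) x = K + 1) :
    SegInv S K Bad (run E (phase g) s) ∧ Lists S K g (run E (phase g) s) ∧
      ((run E (phase g) s).v vOK ≠ 0 → s.v vOK ≠ 0) ∧
      (∀ x, S.p0 g ≤ x → x < S.p1 g → (run E (phase g) s).a (aHIT g) x = 0 →
        (run E (phase g) s).a (aBIG g) x = 0) ∧
      (∀ x u, S.p0 g ≤ x → x < S.p1 g → (run E (phase g) s).a (aHIT g) x = 0 → x ≤ u →
        u < S.p1 g → Le (T.E g) x u K → T.off g (u + 1) - T.off g u ≤ T.hh) ∧
      cost E (phase g) s ≤ 64 * (S.size * T.high g (S.p0 g) (S.p1 g)) + 74 * (S.size * T.rho) +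
        59 * (T.kk * (T.kk + T.hh) * (S.p1 g - S.p0 g)) + 7 := by
  have hC : CovInv S g s := fun u h0 h1 => by
    rw [(hclean u h0 h1).2.1, liveSum_eq_zero fun x h0 h1 => (hclean x h0 h1).1]
  obtain ⟨a1, a2, a3, a4, a5, a6⟩ := stage1_spec (E := E) g hB hI hbad hC
    fun x h0 h1 => (hclean x h0 h1).1
  have e1 : (run E (stage1 g) s).a (aBIG g) = s.a (aBIG g) := run_a _ _ _
  have e2 : (run E (stage1 g) s).a (aTD g) = s.a (aTD g) := run_a _ _ _
  simp only [phase, run_seq, cost_seq]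
  set s₁ := run E (stage1 g) s
  clear_value s₁
  obtain ⟨b1, b2, b3⟩ := explore_spec (E := E) g hB a1.toSegHolds a2
    (fun x h0 h1 => by rw [e1]; exact (hclean x h0 h1).1)
    (fun x h0 h1 => by rw [e2]; exact (hclean x h0 h1).2.2) a5
  have hH₂ : SegHolds S K (run E (explore g) s₁) := a1.toSegHolds.run _
  have f1 : (run E (explore g) s₁).a (aHIT g) = s₁.a (aHIT g) := run_a _ _ _
  have f3 : (run E (explore g) s₁).a (aHIT !g) = s₁.a (aHIT !g) := run_a _ _ _
  have f2 : (run E (explore g) s₁).v vOK = s₁.v vOK := run_v _ _ _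
  set s₂ := run E (explore g) s₁
  clear_value s₂
  have hI₂ : SegInv S K Bad s₂ := ⟨hH₂, by rw [f2]; exact a1.ok, by
    rw [f2]
    intro h g' x h0 h1 hx
    refine a1.cert h g' x h0 h1 ?_
    rcases Bool.eq_or_eq_not g' g with rfl | rfl
    · rwa [← f1]
    · rwa [← f3]⟩
  obtain ⟨c1, c2, c3, c4, c5, c6⟩ := greedy_spec (E := E) g hB hI₂ hbad b1 (fun x h0 h1 hx =>
    b2 x h0 h1 (by rwa [← f1]))
  set s₃ := run E (greedy g) s₂
  clear_value s₃
  refine ⟨c1, c2, fun h => a3 (by rw [← f2]; exact c3 h), c5, fun x u h0 h1 h2 => ?_, ?_⟩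
  · refine a5 x u h0 h1 ?_
    by_contra h
    rw [← f1] at h
    exact c4 x h h2
  · have hk := T.kk_pos
    have h01 := S.h01 g
    have hsz : 1 ≤ S.size := by rw [S.size_eq g]; have := S.h12 g; omega
    have k1 : T.kk ≤ T.kk * T.kk := Nat.le_mul_of_pos_left _ hk
    set N := S.p1 g - S.p0 g
    have k2 : 1 ≤ N := by omega
    have n1 : T.high g (S.p0 g) (S.p1 g) ≤ S.size * T.high g (S.p0 g) (S.p1 g) :=
      Nat.le_mul_of_pos_left _ hsz
    have n2 : T.rho ≤ S.size * T.rho := Nat.le_mul_of_pos_left _ hsz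
    have n3 : N ≤ T.kk * N := Nat.le_mul_of_pos_left _ hk
    have n4 : T.kk * N ≤ T.kk * T.kk * N := Nat.mul_le_mul_right _ k1
    have x1 : (20 * S.size + 44) * T.high g (S.p0 g) (S.p1 g) =
      20 * (S.size * T.high g (S.p0 g) (S.p1 g)) + 44 * T.high g (S.p0 g) (S.p1 g) := by ring
    have x2 : (24 * S.size + 50) * T.rho = 24 * (S.size * T.rho) + 50 * T.rho := by ring
    have x3 : ((5 * T.kk + 11 * T.hh + 16) * T.kk + 18) * N =
      5 * (T.kk * T.kk * N) + 11 * (T.kk * T.hh * N) + 16 * (T.kk * N) + 18 * N := by ring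
    have x4 : (3 * T.kk + 8) * N = 3 * (T.kk * N) + 8 * N := by ring
    have x5 : T.kk * (T.kk + T.hh) * N = T.kk * T.kk * N + T.kk * T.hh * N := by ring
    rw [x1] at a6
    rw [x3] at b3
    rw [x2, x4] at c6
    rw [x5]
    omega

/-- Make sure that all distances between two consecutive blocks are at most `2 * K`. -/
def seg : Cmd :=
  segInit false ;; segInit true ;; phase false ;;
    .ite (V vDense) (phase true ;; denseFinal) sparseFinal

/-- The bound for the time spent on two consecutive blocks, up to a constant. -/
def Seg.work (S : Seg T) : ℕ :=
  S.size * (T.high false (S.p0 false) (S.p1 false) + T.high true (S.p0 true) (S.p1 true) +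
      T.rho + 1 + if T.dense = 0 then T.kk * T.hh else 0) +
    T.kk * (T.kk + T.hh) * (S.p2 false - S.p0 false) +
    if T.dense = 0 then 0 else T.kk * (S.p1 false - S.p0 false) * (S.p2 false - S.p1 false)

/-- Every product that occurs in the cost bounds is replaced by one variable, which makes the
comparison linear. -/
theorem work_dense {i₁ i₂ c d e A A' R Q Q' W H P N M X z : ℕ} (h₁ : i₁ ≤ 5 * N + 2)
    (h₂ : i₂ ≤ 5 * M + 2) (hc : c ≤ 64 * A + 74 * R + 59 * Q + 7)
    (hd : d ≤ 64 * A' + 74 * R + 59 * Q' + 7) (he : e ≤ 8 * H + 5 * P + 4 * W + 10 * X + 8 * N + 2)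
    (hH : H ≤ Q) (hP : P ≤ Q) (hN : N ≤ Q) (hM : M ≤ Q') (hX : X ≤ W) (hz : 1 ≤ z) :
    i₁ + (i₂ + (c + (1 + (d + e)))) ≤ 200 * (A + A' + R + z + 0 + (Q + Q') + W) := by
  linarith

theorem work_sparse {i₁ i₂ c e A A' R Q Q' H H' N M z k : ℕ} (h₁ : i₁ ≤ 5 * N + 2)
    (h₂ : i₂ ≤ 5 * M + 2) (hc : c ≤ 64 * A + 74 * R + 59 * Q + 7)
    (he : e ≤ 20 * H + 45 * H' + 4 * k + 4 * z + 12) (hH : H' ≤ H)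
    (hN : N ≤ Q) (hM : M ≤ Q') (hk : k ≤ Q) (hz : 1 ≤ z) :
    i₁ + (i₂ + (c + (1 + e))) ≤ 200 * (A + A' + R + z + H + (Q + Q') + 0) := by
  linarith

/-- The sparse case runs the marking phase only forwards, because a single unmarked vertex suffices
afterwards; the dense case needs complete lists on both sides and runs it in both orientations. -/
theorem seg_spec {Bad : Prop} (hB : Big T K E) (hH : SegHolds S K s) (hok : s.v vOK = 0 → Bad)
    (hbad : BadPair S K false → Bad) :
    ((run E seg s).v vOK = 0 → Bad) ∧
    ((run E seg s).v vOK ≠ 0 → s.v vOK ≠ 0 ∧ Close S K) ∧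
    cost E seg s ≤ 200 * S.work := by
  have r0 := S.r0 false
  have r1 := S.r1 false
  have h01 := S.h01 false
  have h12 := S.h12 false
  have h2n := S.h2n false
  simp only [Bool.not_false] at r0 r1
  obtain ⟨a1, a2⟩ := segInit_spec (E := E) false hB hH
  have hH₁ : SegHolds S K (run E (segInit false) s) := hH.run _ rfl
  have o1 : (run E (segInit false) s).v vOK = s.v vOK := run_v _ _ _
  simp only [seg, run_seq, cost_seq]
  set s₁ := run E (segInit false) s
  clear_value s₁
  obtain ⟨b1, b2⟩ := segInit_spec (E := E) true hB hH₁
  have hH₂ : SegHolds S K (run E (segInit true) s₁) := hH₁.run _ rfl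
  have o2 : (run E (segInit true) s₁).v vOK = s.v vOK := (run_v _ _ _).trans o1
  have fr₂ : ∀ j, (j = aHIT false ∨ j = aBIG false ∨ j = aCOV false ∨ j = aTD false) →
      (run E (segInit true) s₁).a j = s₁.a j := by
    intro j hj
    exact run_a _ _ _ (by rcases hj with rfl | rfl | rfl | rfl <;> rfl)
  set s₂ := run E (segInit true) s₁
  clear_value s₂
  have hI₂ : SegInv S K Bad s₂ := ⟨hH₂, by rw [o2]; exact hok, fun _ g x h0 h1 hx => by
    cases g
    · rw [fr₂ _ (by simp)] at hx; exact absurd (a1 x h0 h1).1 hx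
    · exact absurd (b1 x h0 h1).1 hx⟩
  obtain ⟨c1, c2, c3, c4, c5, c6⟩ := phase_spec (E := E) false hB hI₂ hbad fun x h0 h1 => by
    obtain ⟨-, e⟩ := a1 x h0 h1
    rwa [fr₂ _ (by simp), fr₂ _ (by simp), fr₂ _ (by simp)]
  have fr₃ : ∀ j, (j = aHIT true ∨ j = aBIG true ∨ j = aCOV true ∨ j = aTD true) →
      (run E (phase false) s₂).a j = s₂.a j := by
    intro j hj
    exact run_a _ _ _ (by rcases hj with rfl | rfl | rfl | rfl <;> rfl)
  set s₃ := run E (phase false) s₂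
  clear_value s₃
  have hsz := S.size_eq false
  have hk := T.kk_pos
  have hM : 1 ≤ T.kk * (T.kk + T.hh) := Nat.mul_pos hk (by omega)
  rw [run_ite, cost_ite, ev_var, c1.dense]
  have hx1 : T.kk * (T.kk + T.hh) * (S.p2 false - S.p0 false) =
      T.kk * (T.kk + T.hh) * (S.p1 false - S.p0 false) +
      T.kk * (T.kk + T.hh) * (S.p2 false - S.p1 false) := by
    rw [← mul_add]; congr 1; omega
  have hsz1 : 1 ≤ S.size := by omega
  have hN : S.p1 true - S.p0 true = S.p2 false - S.p1 false := by omega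
  by_cases hd : T.dense = 0
  · simp only [hd, if_true]
    obtain ⟨d1, d2, d3⟩ := sparseFinal_spec (E := E) hB c1 hbad
      (fun u h0 h1 => by
        rw [fr₃ _ (by simp), fr₃ _ (by simp), fr₃ (aBIG true) (by simp), (b1 u h0 h1).2.2.1,
          liveSum_eq_zero fun x h0 h1 => (b1 x h0 h1).2.1])
      (fun x h0 h1 => by rw [fr₃ _ (by simp)]; exact (b1 x h0 h1).2.1) c2 c4 c5
    refine ⟨d1, fun h => ⟨by rw [← o2]; exact c3 (d2 h).1, (d2 h).2⟩, ?_⟩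
    have x1 : ((20 * S.size + 45) * T.hh + 4) * T.kk =
      20 * (S.size * (T.kk * T.hh)) + 45 * (T.kk * T.hh) + 4 * T.kk := by ring
    have x2 : T.kk * T.hh ≤ S.size * (T.kk * T.hh) := Nat.le_mul_of_pos_left _ (by omega)
    have x3 : T.kk ≤ T.kk * (T.kk + T.hh) * (S.p1 false - S.p0 false) :=
      (Nat.le_mul_of_pos_right _ (by omega : 0 < T.kk + T.hh)).trans
        (Nat.le_mul_of_pos_right _ (by omega))
    rw [x1] at d3
    rw [hN] at b2
    unfold Seg.work
    simp only [hd, if_true, mul_add S.size, mul_one, hx1]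
    exact work_sparse a2 b2 c6 d3 x2 (Nat.le_mul_of_pos_left _ hM) (Nat.le_mul_of_pos_left _ hM)
      x3 hsz1
  · rw [if_neg hd, if_neg hd, run_seq, cost_seq]
    obtain ⟨d1, d2, d3, d4, d5, d6⟩ := phase_spec (E := E) true hB c1
      (fun h => hbad (badPair_rev h)) fun x h0 h1 => by
      obtain ⟨-, e⟩ := b1 x h0 h1
      rwa [fr₃ _ (by simp), fr₃ _ (by simp), fr₃ _ (by simp)]
    have fr₄ : ∀ j, (j = aHIT false ∨ j = aBIG false ∨ j = aLU false ∨ j = aLD false ∨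
        j = aLEN false) → (run E (phase true) s₃).a j = s₃.a j := by
      intro j hj
      exact run_a _ _ _ (by rcases hj with rfl | rfl | rfl | rfl | rfl <;> rfl)
    set s₄ := run E (phase true) s₃
    clear_value s₄
    obtain ⟨e1, e2, e3⟩ := denseFinal_spec (E := E) hB d1 hbad
      (fun g => by
        cases g
        · intro x h0 h1 h2
          rw [fr₄ _ (by simp), fr₄ _ (by simp), fr₄ _ (by simp), fr₄ _ (by simp)]
          rw [fr₄ _ (by simp)] at h2
          exact c2 x h0 h1 h2
        · exact d2)
      (fun g => by
        cases g
        · intro x h0 h1 h2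
          rw [fr₄ _ (by simp)] at h2 ⊢
          exact c4 x h0 h1 h2
        · exact d4)
      (fun x u h0 h1 h2 => by
        rw [fr₄ _ (by simp)] at h2
        exact c5 x u h0 h1 h2)
    refine ⟨e1, fun h => ⟨by rw [← o2]; exact c3 (d3 (e2 h).1), (e2 h).2⟩, ?_⟩
    unfold Seg.work
    simp only [hd, if_false, mul_add S.size, mul_one, mul_zero, hx1]
    rw [hN] at d6 b2
    refine work_dense (H := T.kk * T.hh * (S.p1 false - S.p0 false))
      (P := T.kk * (S.p1 false - S.p0 false))
      (X := (S.p1 false - S.p0 false) * (S.p2 false - S.p1 false)) a2 b2 c6 d6 (e3.trans ?_) ?_ ?_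
      (Nat.le_mul_of_pos_left _ hM) (Nat.le_mul_of_pos_left _ hM) ?_ hsz1
    · ring_nf; exact le_rfl
    · exact Nat.mul_le_mul_right _ (Nat.mul_le_mul_left _ (Nat.le_add_left _ _))
    · exact Nat.mul_le_mul_right _ (Nat.le_mul_of_pos_right _ (by omega))
    · rw [mul_assoc]; exact Nat.le_mul_of_pos_left _ hk

/-! ## The test for a threshold -/

/-- The runs are the maximal blocks of equal color. -/
structure RunsOK (T : Inst) : Prop where
  rs_zero : T.rs 0 = 0
  rs_R : T.rs T.R = T.n
  lt : ∀ r, r < T.R → T.rs r < T.rs (r + 1)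
  col : ∀ r p, r < T.R → T.rs r ≤ p → p < T.rs (r + 1) → T.col false p = T.col false (T.rs r)
  alt : ∀ r, r + 1 < T.R → T.col false (T.rs (r + 1)) ≠ T.col false (T.rs r)
  two : ∀ p, p < T.n → T.col false p ≤ 1
  bw_pos : 1 ≤ T.bw
  bw_le : T.bw ≤ T.n

namespace RunsOK

variable (h : RunsOK T)
include h

theorem mono {r q : ℕ} (hrq : r ≤ q) (hq : q ≤ T.R) : T.rs r ≤ T.rs q := by
  induction q, hrq using Nat.le_induction with
  | base => exact le_rfl
  | succ q _ ih => exact (ih (by omega)).trans (h.lt q (by omega)).le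

theorem le_n {r : ℕ} (hr : r ≤ T.R) : T.rs r ≤ T.n := h.rs_R ▸ h.mono hr le_rfl

theorem add_le {r q : ℕ} (hrq : r ≤ q) (hq : q ≤ T.R) : T.rs r + (q - r) ≤ T.rs q := by
  induction q, hrq using Nat.le_induction with
  | base => omega
  | succ q _ ih => have := ih (by omega); have := h.lt q (by omega); omega

theorem R_le : T.R ≤ T.n := by
  have := h.add_le (Nat.zero_le T.R) le_rfl
  rw [h.rs_R] at this
  omega

theorem exists_run {p : ℕ} (hp : p < T.n) : ∃ r, r < T.R ∧ T.rs r ≤ p ∧ p < T.rs (r + 1) := by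
  have hex : ∃ r, p < T.rs r := ⟨T.R, by rw [h.rs_R]; exact hp⟩
  classical
  have h1 := Nat.find_spec hex
  have h2 : Nat.find hex ≤ T.R := Nat.find_min' hex (by rw [h.rs_R]; exact hp)
  have h3 : Nat.find hex ≠ 0 := fun h0 => by rw [h0, h.rs_zero] at h1; omega
  obtain ⟨r, hr⟩ := Nat.exists_eq_succ_of_ne_zero h3
  have h4 := Nat.find_min hex (m := r) (by omega)
  rw [hr] at h1
  exact ⟨r, by omega, by omega, h1⟩

/-- There are just two colors and they alternate from run to run. So colors of vertices are compared
through the parity of the indices of their runs. -/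
theorem parity {r : ℕ} (hr : r < T.R) :
    T.col false (T.rs r) = (T.col false (T.rs 0) + r) % 2 := by
  have hlt : ∀ r, r < T.R → T.col false (T.rs r) ≤ 1 := fun r hr =>
    h.two _ ((h.lt r hr).trans_le (h.le_n hr))
  induction r with
  | zero => have := hlt 0 hr; omega
  | succ r ih =>
    have h1 := ih (by omega)
    have h2 := h.alt r hr
    have h3 := hlt _ hr
    have h4 := hlt r (by omega)
    omega

theorem col_eq {r p : ℕ} (hr : r < T.R) (h1 : T.rs r ≤ p) (h2 : p < T.rs (r + 1)) :
    T.col false p = (T.col false (T.rs 0) + r) % 2 := by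
  rw [h.col r p hr h1 h2, h.parity hr]

end RunsOK

/-- There are vertices of different colors with distance above `K`. -/
def BadP (T : Inst) (K : ℕ) : Prop :=
  ∃ x y, x < y ∧ y < T.n ∧ T.col false x ≠ T.col false y ∧ ¬ Le (T.E false) x y K

theorem badP_of {g : Bool} {x y : ℕ} (hxy : x < y) (hy : y < T.n)
    (hc : T.col g x ≠ T.col g y) (hl : ¬ Le (T.E g) x y K) : BadP T K := by
  cases g with
  | false => exact ⟨x, y, hxy, hy, hc, hl⟩
  | true =>
    refine ⟨T.n - 1 - y, T.n - 1 - x, by omega, by omega, ?_, ?_⟩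
    · have e1 := T.col_rev true (T.n - 1 - y) (by omega)
      have e2 := T.col_rev true (T.n - 1 - x) (by omega)
      rw [Bool.not_true, show T.n - 1 - (T.n - 1 - y) = y by omega] at e1
      rw [Bool.not_true, show T.n - 1 - (T.n - 1 - x) = x by omega] at e2
      rw [e1, e2]
      exact hc.symm
    · rwa [← Bool.not_true, Inst.le_rev_iff (by omega) hy]

/-- Check the distances from `S` to the vertices of the other color below `HI`. -/
def chk (g : Bool) : Cmd :=
  fwd g ;; .for vP (V vS) (V vHI) (.when (.lt (V vK) (.rd (aDIST g) (V vP)))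
    (.ite (.eq (.rd (aCOL g) (V vP)) (.rd (aCOL g) (V vS))) .skip (.asg vOK 0)))

theorem chk_spec (g : Bool) (hB : Big T K E) (hH : Holds T K s) {x h : ℕ} (hx : s.v vS = x)
    (hh : s.v vHI = h) (hxh : x < h) (hn : h ≤ T.n) (hok : s.v vOK = 0 → BadP T K) :
    ((run E (chk g) s).v vOK = 0 → BadP T K) ∧
    ((run E (chk g) s).v vOK ≠ 0 → s.v vOK ≠ 0 ∧
      ∀ y, x ≤ y → y < h → T.col g y ≠ T.col g x → Le (T.E g) x y K) ∧
    cost E (chk g) s ≤ 8 * (h - x) + 4 * (T.off g h - T.off g x) + 7 := by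
  obtain ⟨d₂, t₂⟩ := fwd_spec (s := s) g hB hH hx hh hxh hn
  have hH₂ : Holds T K (run E (fwd g) s) := hH.run _
  have f1 : (run E (fwd g) s).v vS = x := by rw [run_v _ _ _, hx]
  have f2 : (run E (fwd g) s).v vHI = h := by rw [run_v _ _ _, hh]
  have f3 : (run E (fwd g) s).v vOK = s.v vOK := by rw [run_v _ _ _]
  rw [chk, run_seq, cost_seq]
  set s₂ := run E (fwd g) s
  clear_value s₂
  obtain ⟨h1, t1⟩ := for_frame_const E (.for vP (V vS) (V vHI) (.when (.lt (V vK) (.rd (aDIST g) (V vP))) (.ite (.eq (.rd (aCOL g) (V vP)) (.rd (aCOL g) (V vS))) .skip (.asg vOK 0))))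
      s₂ rfl
    (fun i s' => (s'.v vOK = 0 → BadP T K) ∧ (s'.v vOK ≠ 0 → s.v vOK ≠ 0 ∧
      ∀ y, x ≤ y → y < i → T.col g y ≠ T.col g x → Le (T.E g) x y K)) 3
    (by simp [f1, f2]; omega)
    ⟨fun h => hok (by rw [← f3, h]), fun h => ⟨by rwa [← f3], fun y h1 h2 => by
      simp [f1] at h2; omega⟩⟩ (by
      rintro i s' hi1 hi2 hS ⟨a1, a2⟩
      simp only [ev_var, f1, f2] at hi1 hi2
      have hH' := hH₂.same hS
      have e1 : s'.a (aDIST g) = s₂.a (aDIST g) := hS.a _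
      have e2 : s'.v vS = x := by rw [hS.v _, f1]
      have hd := d₂ i (by omega) hi2 K le_rfl
      simp only [exec, hH'.thr, hH'.col, e1, e2, Nat.reduceEqDiff]
      refine ⟨?_, by split_ifs <;> omega⟩
      have hcase : ∀ j, j < i + 1 → j < i ∨ j = i := by omega
      by_cases c1 : K < s₂.a (aDIST g) i
      · by_cases c2 : T.col g i = T.col g x
        · simp only [c1, c2, exec, Nat.reduceEqDiff]
          refine ⟨a1, fun h => ⟨(a2 h).1, fun y hy1 hy2 hy3 => ?_⟩⟩
          rcases hcase y hy2 with hy | rfl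
          · exact (a2 h).2 y hy1 hy hy3
          · exact absurd c2 hy3
        · simp only [c1, c2, exec]
          refine ⟨fun _ => ?_, fun h => absurd rfl h⟩
          refine badP_of (g := g) (x := x) (y := i) (lt_of_le_of_ne hi1 fun h => c2 (by rw [h]))
            (by omega) (Ne.symm c2) fun hl => ?_
          have := hd.2 hl
          omega
      · simp only [c1, exec, Nat.reduceEqDiff]
        refine ⟨a1, fun h => ⟨(a2 h).1, fun y hy1 hy2 hy3 => ?_⟩⟩
        rcases hcase y hy2 with hy | rfl
        · exact (a2 h).2 y hy1 hy hy3
        · exact hd.1 (by omega))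
  simp only [ev_var, f1, f2] at h1 t1
  exact ⟨h1.1, h1.2, by omega⟩

abbrev vPos : ℕ := ix 24 false
abbrev vWL : ℕ := ix 24 true
abbrev vWH : ℕ := ix 25 false
abbrev vRn : ℕ := ix 25 true

/-- Check the distances between `Pos` and the vertices of the other color in the window. -/
def bnd : Cmd :=
  .asg vS (V vPos) ;; .asg vHI (V vWH) ;; chk false ;;
  .asg vS (V vN - 1 - V vPos) ;; .asg vHI (V vN - V vWL) ;; chk true

/-- What `bnd` checks. -/
def BndOK (T : Inst) (K l h x : ℕ) : Prop :=
  (∀ y, x ≤ y → y < h → T.col false y ≠ T.col false x → Le (T.E false) x y K) ∧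
    ∀ y, l ≤ y → y ≤ x → T.col false y ≠ T.col false x → Le (T.E false) y x K

/-- The number of positions and edges in a window. -/
def Inst.span (T : Inst) (l h : ℕ) : ℕ :=
  (h - l) + (T.off false h - T.off false l) + (T.off true (T.n - l) - T.off true (T.n - h))

theorem bnd_spec (hB : Big T K E) (hH : Holds T K s) {x l h : ℕ} (hx : s.v vPos = x)
    (hl : s.v vWL = l) (hh : s.v vWH = h) (hlx : l ≤ x) (hxh : x < h) (hn : h ≤ T.n)
    (hok : s.v vOK = 0 → BadP T K) :
    ((run E bnd s).v vOK = 0 → BadP T K) ∧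
    ((run E bnd s).v vOK ≠ 0 → s.v vOK ≠ 0 ∧ BndOK T K l h x) ∧
    cost E bnd s ≤ 8 * T.span l h + 26 := by
  simp only [bnd, run_seq, cost_seq]
  set s₁ := run E (.asg vHI (V vWH)) (run E (.asg vS (V vPos)) s) with hs₁
  have hH₁ : Holds T K s₁ := (hH.run _ rfl).run _ rfl
  obtain ⟨a1, a2, a3⟩ := chk_spec (E := E) (s := s₁) (x := x) (h := h) false hB hH₁
    (by simp [hs₁, hx]) (by simp [hs₁, hh]) hxh hn (by simpa [hs₁] using hok)
  have hH₂ : Holds T K (run E (chk false) s₁) := hH₁.run _ rfl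
  have f1 : (run E (chk false) s₁).v vPos = x := by rw [run_v _ _ _]; simp [hs₁, hx]
  have f2 : (run E (chk false) s₁).v vWL = l := by rw [run_v _ _ _]; simp [hs₁, hl]
  have f3 : s₁.v vOK = s.v vOK := by simp [hs₁]
  set s₂ := run E (chk false) s₁
  clear_value s₂
  set s₃ := run E (.asg vHI (V vN - V vWL)) (run E (.asg vS (V vN - 1 - V vPos)) s₂) with hs₃
  have hH₃ : Holds T K s₃ := (hH₂.run _ rfl).run _ rfl
  obtain ⟨b1, b2, b3⟩ := chk_spec (E := E) (s := s₃) (x := T.n - 1 - x) (h := T.n - l) true hB hH₃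
    (by simp [hs₃, f1, hH₂.n]) (by simp [hs₃, f2, hH₂.n]) (by omega) (by omega)
    (by simpa [hs₃] using a1)
  have f4 : s₃.v vOK = s₂.v vOK := by simp [hs₃]
  refine ⟨b1, fun h' => ?_, ?_⟩
  · obtain ⟨b4, b5⟩ := b2 h'
    rw [f4] at b4
    obtain ⟨a4, a5⟩ := a2 b4
    refine ⟨by rwa [← f3], a5, fun y hy1 hy2 hy3 => ?_⟩
    have h6 := b5 (T.n - 1 - y) (by omega) (by omega) (by
      have e1 := T.col_rev false (T.n - 1 - y) (by omega)
      have e2 := T.col_rev false (T.n - 1 - x) (by omega)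
      rw [Bool.not_false] at e1 e2
      rwa [e1, e2, show T.n - 1 - (T.n - 1 - y) = y by omega,
        show T.n - 1 - (T.n - 1 - x) = x by omega])
    exact (Inst.le_rev_iff (g := false) (by omega) (by omega)).1 h6
  · have o1 := (T.csr false).off_mono l x hlx (by omega)
    have o2 := (T.csr true).off_mono (T.n - h) (T.n - 1 - x) (by omega) (by omega)
    simp only [cost_asg, Inst.span]
    omega

/-! ### Windows around the ends of runs. -/

/-- The window of a run. -/
def Inst.wl (T : Inst) (r : ℕ) : ℕ := if r % T.bw < 3 then 0 else T.rs (r - (T.bw + 3))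

/-- Runs whose index is `0`, `1` or `2` modulo `bw` see the whole graph; three residues are needed
so that two consecutive such runs exist for either parity of the first one. All other runs see `bw +
3` runs in each direction, and `rs (r + bw + 4)` is the end of the last of these. -/
def Inst.wh (T : Inst) (r : ℕ) : ℕ :=
  if r % T.bw < 3 then T.n else if r + T.bw + 4 < T.R then T.rs (r + T.bw + 4) else T.n

/-- Compute the window of a run. -/
def win : Cmd :=
  .ite (.lt (.mod (V vRn) (V vBW)) 3) (.asg vWL 0 ;; .asg vWH (V vN))
    (.asg vWL (.rd aRS (V vRn - (V vBW + 3))) ;;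
    .ite (.lt (V vRn + V vBW + 4) (V vR)) (.asg vWH (.rd aRS (V vRn + V vBW + 4)))
      (.asg vWH (V vN)))

theorem win_spec (hB : Big T K E) (hR : RunsOK T) (hH : Holds T K s) {r : ℕ} (hr : s.v vRn = r)
    (hrR : r < T.R) :
    (run E win s).v vWL = T.wl r ∧ (run E win s).v vWH = T.wh r ∧ cost E win s ≤ 4 := by
  have hlin := hB.lin
  have h1 := hR.bw_le
  have h2 := hR.R_le
  have hsq := hB.sq
  have h3 : T.n + T.n + 1 ≤ (T.n + 1) * (T.n + 1) := by nlinarith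
  have e1 : min (T.bw + 3) E.B = T.bw + 3 := by omega
  have e2 : min (r + T.bw) E.B = r + T.bw := by omega
  have e3 : min (r + T.bw + 4) E.B < T.R ↔ r + T.bw + 4 < T.R := by omega
  have e4 : r + T.bw + 4 < T.R → min (r + T.bw + 4) E.B = r + T.bw + 4 := by omega
  simp only [win, exec, hr, hH.bw, Inst.wl, Inst.wh, hH.rs, Nat.reduceEqDiff, e1, e2, hH.R, hH.n,
    e3]
  split_ifs with c1 c2 c3 c4
  all_goals simp_all

/-- Check the distances from and to the first and the last vertex of every run. -/
def windows : Cmd :=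
  .for vRn 0 (V vR) (win ;; .asg vPos (.rd aRS (V vRn)) ;; bnd ;;
    .asg vPos (.rd aRS (V vRn + 1) - 1) ;; bnd)

theorem RunsOK.window (hR : RunsOK T) {r : ℕ} (hr : r < T.R) :
    T.wl r ≤ T.rs r ∧ T.rs (r + 1) ≤ T.wh r ∧ T.wh r ≤ T.n := by
  unfold Inst.wl Inst.wh
  refine ⟨?_, ?_, ?_⟩
  · split_ifs
    · omega
    · exact hR.mono (by omega) (by omega)
  · split_ifs with h1 h2
    · exact hR.le_n hr
    · exact hR.mono (by omega) (by omega)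
    · exact hR.le_n hr
  · split_ifs with h1 h2
    · exact le_rfl
    · exact hR.le_n (by omega)
    · exact le_rfl

theorem windows_spec (hB : Big T K E) (hR : RunsOK T) (hH : Holds T K s)
    (hok : s.v vOK = 0 → BadP T K) :
    ((run E windows s).v vOK = 0 → BadP T K) ∧
    ((run E windows s).v vOK ≠ 0 → s.v vOK ≠ 0 ∧ ∀ r, r < T.R →
      BndOK T K (T.wl r) (T.wh r) (T.rs r) ∧ BndOK T K (T.wl r) (T.wh r) (T.rs (r + 1) - 1)) ∧
    cost E windows s ≤ ∑ r ∈ Finset.range T.R, (16 * T.span (T.wl r) (T.wh r) + 60) + 2 := by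
  have hlin := hB.lin
  have hRn := hR.R_le
  obtain ⟨t, h1, t1⟩ := for_frame E windows s rfl
    (fun i s' t => (s'.v vOK = 0 → BadP T K) ∧ (s'.v vOK ≠ 0 → s.v vOK ≠ 0 ∧ ∀ r, r < i →
      BndOK T K (T.wl r) (T.wh r) (T.rs r) ∧ BndOK T K (T.wl r) (T.wh r) (T.rs (r + 1) - 1)) ∧
      t ≤ ∑ r ∈ Finset.range i, (16 * T.span (T.wl r) (T.wh r) + 60))
    (by simp) ⟨hok, fun h => ⟨h, by simp⟩, Nat.zero_le _⟩ (by
      rintro r s' t - hr hS ⟨a1, a2, a3⟩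
      simp only [ev_var, hH.R] at hr
      have hH' : Holds T K (s'.setV vRn r) := (hH.same hS rfl).setV _ _ rfl
      obtain ⟨w1, w2, w3⟩ := hR.window hr
      have hlt := hR.lt r hr
      simp only [run_seq, cost_seq]
      obtain ⟨b1, b2, b3⟩ := win_spec (E := E) hB hR hH' (r := r) (by simp) hr
      have hH₁ : Holds T K (run E win (s'.setV vRn r)) := hH'.run _ rfl
      have f1 : (run E win (s'.setV vRn r)).v vOK = s'.v vOK := by rw [run_v _ _ _]; simp
      have f2 : (run E win (s'.setV vRn r)).v vRn = r := by rw [run_v _ _ _]; simp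
      set s₁ := run E win (s'.setV vRn r)
      clear_value s₁
      have hH₂ : Holds T K (run E (.asg vPos (.rd aRS (V vRn))) s₁) := hH₁.run _ rfl
      obtain ⟨c1, c2, c3⟩ := bnd_spec (E := E) (s := run E (.asg vPos (.rd aRS (V vRn))) s₁)
        (x := T.rs r) (l := T.wl r) (h := T.wh r) hB hH₂ (by simp [f2, hH₁.rs]) (by simp [b1])
        (by simp [b2]) w1 (by omega) w3 (by simpa [f1] using a1)
      have f3 : (run E (.asg vPos (.rd aRS (V vRn))) s₁).v vOK = s'.v vOK := by simp [f1]
      rw [f3] at c2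
      set s₂ := run E bnd (run E (.asg vPos (.rd aRS (V vRn))) s₁) with hs₂
      have hH₃ : Holds T K s₂ := hH₂.run _ rfl
      have g1 : s₂.v vWL = T.wl r := by rw [hs₂, run_v _ _ _]; simp [b1]
      have g2 : s₂.v vWH = T.wh r := by rw [hs₂, run_v _ _ _]; simp [b2]
      have g3 : s₂.v vRn = r := by rw [hs₂, run_v _ _ _]; simp [f2]
      clear_value s₂
      have hH₄ : Holds T K (run E (.asg vPos (.rd aRS (V vRn + 1) - 1)) s₂) := hH₃.run _ rfl
      have hr1 : min (r + 1) E.B = r + 1 := by omega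
      obtain ⟨d1, d2, d3⟩ := bnd_spec (E := E)
        (s := run E (.asg vPos (.rd aRS (V vRn + 1) - 1)) s₂)
        (x := T.rs (r + 1) - 1) (l := T.wl r) (h := T.wh r) hB hH₄ (by simp [g3, hH₃.rs, hr1])
        (by simp [g1]) (by simp [g2]) (by omega) (by omega) w3 (by simpa using c1)
      have g4 : (run E (.asg vPos (.rd aRS (V vRn + 1) - 1)) s₂).v vOK = s₂.v vOK := by simp
      rw [g4] at d2
      refine ⟨d1, fun h => ?_, ?_⟩
      · obtain ⟨d4, d5⟩ := d2 h
        obtain ⟨c4, c5⟩ := c2 d4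
        obtain ⟨a4, a5⟩ := a2 c4
        refine ⟨a4, fun q hq => ?_⟩
        rcases Nat.lt_succ_iff_lt_or_eq.1 hq with hq | rfl
        · exact a5 q hq
        · exact ⟨c5, d5⟩
      · rw [Finset.sum_range_succ]
        simp only [cost_asg]
        omega)
  simp only [ev_var, hH.R] at h1 t1
  exact ⟨h1.1, h1.2.1, t1.trans (by have := h1.2.2; omega)⟩

/-! ### Pairs of consecutive runs. -/

/-- The blocks of two consecutive runs. -/
def RunsOK.seg (hR : RunsOK T) {r : ℕ} (hr : r + 1 < T.R) : Seg T where
  p0 g := if g then T.n - T.rs (r + 2) else T.rs r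
  p1 g := if g then T.n - T.rs (r + 1) else T.rs (r + 1)
  p2 g := if g then T.n - T.rs r else T.rs (r + 2)
  h01 g := by
    have h1 := hR.lt r (by omega)
    have h2 := hR.lt (r + 1) hr
    have h3 := hR.le_n (r := r + 2) (by omega)
    cases g
    · simpa using h1
    · simp only [if_true]
      change T.rs (r + 1) < T.rs (r + 2) at h2
      omega
  h12 g := by
    have h1 := hR.lt r (by omega)
    have h2 := hR.lt (r + 1) hr
    have h3 := hR.le_n (r := r + 2) (by omega)
    change T.rs (r + 1) < T.rs (r + 2) at h2
    cases g
    · simpa using h2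
    · simp only [if_true]
      omega
  h2n g := by
    have h3 := hR.le_n (r := r + 2) (by omega)
    cases g
    · simpa using h3
    · simp
  r0 g := by
    have h3 := hR.le_n (r := r) (by omega)
    cases g
    · simp
    · simp; omega
  r1 g := by
    have h3 := hR.le_n (r := r + 1) (by omega)
    cases g
    · simp
    · simp; omega
  r2 g := by
    have h3 := hR.le_n (r := r + 2) (by omega)
    cases g
    · simp
    · simp; omega

/-- The bound for the time spent on the runs `r` and `r + 1`, up to a constant. -/
def Inst.segWork (T : Inst) (r : ℕ) : ℕ :=
  T.span (T.rs r) (T.rs (r + 2)) * (T.high false (T.rs r) (T.rs (r + 1)) +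
      T.high true (T.n - T.rs (r + 2)) (T.n - T.rs (r + 1)) +
      T.rho + 1 + if T.dense = 0 then T.kk * T.hh else 0) +
    T.kk * (T.kk + T.hh) * (T.rs (r + 2) - T.rs r) +
    if T.dense = 0 then 0 else
      T.kk * (T.rs (r + 1) - T.rs r) * (T.rs (r + 2) - T.rs (r + 1))

theorem RunsOK.seg_work (hR : RunsOK T) {r : ℕ} (hr : r + 1 < T.R) :
    (hR.seg hr).work = T.segWork r := rfl

/-- Check all pairs of consecutive runs. -/
def segs : Cmd :=
  .for vRn 0 (V vR - 1) (.asg (vP0 false) (.rd aRS (V vRn)) ;;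
    .asg (vP1 false) (.rd aRS (V vRn + 1)) ;; .asg (vP2 false) (.rd aRS (V vRn + 2)) ;;
    .asg (vP0 true) (V vN - V (vP2 false)) ;; .asg (vP1 true) (V vN - V (vP1 false)) ;;
    .asg (vP2 true) (V vN - V (vP0 false)) ;; seg)

theorem segs_spec (hB : Big T K E) (hR : RunsOK T) (hH : Holds T K s)
    (hok : s.v vOK = 0 → BadP T K) :
    ((run E segs s).v vOK = 0 → BadP T K) ∧
    ((run E segs s).v vOK ≠ 0 → s.v vOK ≠ 0 ∧ ∀ r (hr : r + 1 < T.R), Close (hR.seg hr) K) ∧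
    cost E segs s ≤ ∑ r ∈ Finset.range (T.R - 1), (200 * T.segWork r + 7) + 2 := by
  have hlin := hB.lin
  have hRn := hR.R_le
  obtain ⟨t, h1, t1⟩ := for_frame E segs s rfl
    (fun i s' t => (s'.v vOK = 0 → BadP T K) ∧ (s'.v vOK ≠ 0 → s.v vOK ≠ 0 ∧
      ∀ r (hr : r + 1 < T.R), r < i → Close (hR.seg hr) K) ∧
      t ≤ ∑ r ∈ Finset.range i, (200 * T.segWork r + 7))
    (by simp) ⟨hok, fun h => ⟨h, by simp⟩, Nat.zero_le _⟩ (by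
      rintro r s' t - hr hS ⟨a1, a2, a3⟩
      simp only [exec, hH.R] at hr
      have hr1 : r + 1 < T.R := by omega
      have hH' : Holds T K (s'.setV vRn r) := (hH.same hS rfl).setV _ _ rfl
      have m1 : min (r + 1) E.B = r + 1 := by omega
      have m2 : min (r + 2) E.B = r + 2 := by omega
      simp only [run_seq, cost_seq]
      set c₁ : Cmd := .asg (vP0 false) (.rd aRS (V vRn)) ;;
        .asg (vP1 false) (.rd aRS (V vRn + 1)) ;; .asg (vP2 false) (.rd aRS (V vRn + 2)) ;;
        .asg (vP0 true) (V vN - V (vP2 false)) ;; .asg (vP1 true) (V vN - V (vP1 false)) ;;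
        .asg (vP2 true) (V vN - V (vP0 false)) with hc₁
      have hH₁ : Holds T K (run E c₁ (s'.setV vRn r)) := hH'.run _ rfl
      have ers : s'.a aRS = T.rs := hH'.rs
      have en : s'.v vN = T.n := by have := hH'.n; simpa using this
      have hSH : SegHolds (hR.seg hr1) K (run E c₁ (s'.setV vRn r)) := by
        refine ⟨hH₁, fun g => ?_, fun g => ?_, fun g => ?_⟩ <;> cases g <;>
          simp [hc₁, RunsOK.seg, ers, en, m1, m2]
      have o1 : (run E c₁ (s'.setV vRn r)).v vOK = s'.v vOK := by
        rw [run_v _ _ _]; simp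
      obtain ⟨b1, b2, b3⟩ := seg_spec (E := E) (Bad := BadP T K) hB hSH (by rw [o1]; exact a1) (by
        rintro ⟨x, y, h1, h2, h3, h4, h5⟩
        simp only [RunsOK.seg, if_false, Bool.false_eq_true] at h1 h2 h3 h4
        have h6 := hR.le_n (r := r + 2) (by omega)
        refine ⟨x, y, by omega, by omega, ?_, h5⟩
        rw [hR.col_eq (r := r) (by omega) h1 h2, hR.col_eq (r := r + 1) hr1 h3 h4]
        omega)
      rw [o1] at b2
      rw [hR.seg_work hr1] at b3
      refine ⟨b1, fun h => ?_, ?_⟩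
      · obtain ⟨b4, b5⟩ := b2 h
        obtain ⟨a4, a5⟩ := a2 b4
        refine ⟨a4, fun q hq hqr => ?_⟩
        rcases Nat.lt_succ_iff_lt_or_eq.1 hqr with hqr | rfl
        · exact a5 q hq hqr
        · exact b5
      · rw [Finset.sum_range_succ]
        simp only [cost_asg]
        change cost E seg (run E c₁ (s'.setV vRn r)) ≤ _ at b3
        have : cost E seg (run E (.asg (vP2 true) (V vN - V (vP0 false)))
          (run E (.asg (vP1 true) (V vN - V (vP1 false)))
          (run E (.asg (vP0 true) (V vN - V (vP2 false)))
          (run E (.asg (vP2 false) (.rd aRS (V vRn + 2)))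
          (run E (.asg (vP1 false) (.rd aRS (V vRn + 1)))
          (run E (.asg (vP0 false) (.rd aRS (V vRn))) (s'.setV vRn r))))))) ≤
            200 * T.segWork r := b3
        omega)
  simp only [exec, hH.R] at h1 t1
  exact ⟨h1.1, fun h => ⟨(h1.2.1 h).1, fun r hr => (h1.2.1 h).2 r hr (by omega)⟩,
    t1.trans (by have := h1.2.2; omega)⟩

/-! ### Correctness of the test. -/

/-- Set `OK` to `0` only if there is a bad pair, and to `1` only if all distances are small. -/
def test : Cmd := .asg vOK 1 ;; windows ;; segs

/-- If `j` is near `i`, the boundary after run `i + 1` works, since both windows are long enough.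
Otherwise there is a multiple `q` of `bw` in `(i, i + bw]`; according to parity `k` is `q` or `q +
1`, and the residues of `k` and `k + 1` are below `3`, so both runs see everything. The slack `3`
ensures `k + 1 < j`. -/
theorem exists_boundary {i j bw : ℕ} (hij : i + 3 ≤ j) (hbw : 1 ≤ bw) :
    ∃ k, i < k ∧ k + 1 < j ∧ (k - i) % 2 = 1 ∧ (k % bw < 3 ∨ k ≤ i + bw + 3) ∧
      ((k + 1) % bw < 3 ∨ j ≤ k + 1 + bw + 3) := by
  by_cases h : j ≤ i + bw + 3
  · exact ⟨i + 1, by omega, by omega, by omega, Or.inr (by omega), Or.inr (by omega)⟩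
  obtain ⟨q, hq1, hq2, hq3⟩ : ∃ q, i < q ∧ q ≤ i + bw ∧ q % bw = 0 := by
    refine ⟨(i / bw + 1) * bw, ?_, ?_, by simp⟩
    · have := Nat.div_add_mod i bw
      have := Nat.mod_lt i (by omega : bw > 0)
      rw [add_mul, one_mul, mul_comm]
      omega
    · have := Nat.div_add_mod i bw
      rw [add_mul, one_mul, mul_comm]
      omega
  have hmod : ∀ c, (q + c) % bw ≤ c := fun c => by
    rw [Nat.add_mod, hq3, zero_add, Nat.mod_mod]
    exact Nat.mod_le _ _
  rcases Nat.mod_two_eq_zero_or_one (q - i) with hp | hp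
  · refine ⟨q + 1, by omega, by omega, by omega, Or.inl ?_, Or.inl ?_⟩
    · have := hmod 1; omega
    · have := hmod 2; change (q + 2) % bw < 3; omega
  · refine ⟨q, by omega, by omega, by omega, Or.inl (by omega), Or.inl ?_⟩
    have := hmod 1; omega

/-- Positions increase strictly along a walk, so there is no room for an intermediate vertex. -/
theorem wk_consecutive {g : Bool} {u k : ℕ} (h : Wk (T.E g) u (u + 1) k) : T.E g u (u + 1) k := by
  generalize hv : u + 1 = v at h
  cases h with
  | nil => omega
  | @snoc x y k c hw hr =>
    obtain ⟨e, he, rfl, rfl, rfl⟩ := hr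
    have h1 := (T.csr g).src_lt_tgt e he
    have h2 := Inst.le_of_wk hw
    obtain rfl : u = T.src g e := by omega
    have h3 := (T.csr g).wk_start (by have := (T.csr g).src_lt he; omega)
      ((T.csr g).wk_end le_rfl (by have := (T.csr g).src_lt he; omega) hw)
    rw [h3.2, zero_add]
    exact ⟨e, he, rfl, rfl, rfl⟩

/-- For adjacent runs the pairs are covered by `Close`. Otherwise let `u` be the last vertex of the
run `k` from `exists_boundary` and `v` the next position. By the choice of parities the pairs `(x,
u)`, `(u, v)` and `(v, y)` are two-colored and lie in checked windows, so each has distance at most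
`K`. The middle walk is one edge, so it also has weight at most `M₀`. -/
theorem test_spec (hB : Big T K E) (hR : RunsOK T) (hH : Holds T K s) {M₀ : ℕ}
    (hM : ∀ x y c, x < T.n → y < T.n → T.E false x y c → T.col false x ≠ T.col false y → c ≤ M₀) :
    ((run E test s).v vOK = 0 → BadP T K) ∧
    ((run E test s).v vOK ≠ 0 → ∀ x y, x < y → y < T.n → T.col false x ≠ T.col false y →
      Le (T.E false) x y (2 * K + min M₀ K)) ∧
    cost E test s ≤ ∑ r ∈ Finset.range T.R, (16 * T.span (T.wl r) (T.wh r) + 60) +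
      ∑ r ∈ Finset.range (T.R - 1), (200 * T.segWork r + 7) + 5 := by
  simp only [test, run_seq, cost_seq]
  have hH₁ : Holds T K (run E (.asg vOK 1) s) := hH.run _ rfl
  obtain ⟨a1, a2, a3⟩ := windows_spec (E := E) hB hR hH₁ (by simp)
  set s₁ := run E (.asg vOK 1) s
  have hH₂ : Holds T K (run E windows s₁) := hH₁.run _ rfl
  set s₂ := run E windows s₁
  obtain ⟨b1, b2, b3⟩ := segs_spec (E := E) hB hR hH₂ a1
  refine ⟨b1, fun h x y hxy hy hc => ?_, by simp only [cost_asg]; omega⟩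
  obtain ⟨b4, b5⟩ := b2 h
  obtain ⟨-, a5⟩ := a2 b4
  obtain ⟨i, hi, hi1, hi2⟩ := hR.exists_run (p := x) (by omega)
  obtain ⟨j, hj, hj1, hj2⟩ := hR.exists_run hy
  have ci := hR.col_eq hi hi1 hi2
  have cj := hR.col_eq hj hj1 hj2
  have hij : i < j := by
    rcases lt_trichotomy i j with h | h | h
    · exact h
    · subst h; omega
    · have := hR.mono (r := j + 1) (q := i) h (by omega); omega
  have hpar : (j - i) % 2 = 1 := by omega
  by_cases h1 : j = i + 1
  · subst h1
    exact (b5 i hj x y hi1 hi2 hj1 hj2).mono (by omega)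
  obtain ⟨k, k1, k2, k3, k4, k5⟩ := exists_boundary (i := i) (j := j) (by omega) hR.bw_pos
  have hk := (a5 k (by omega)).2
  have hk' := (a5 (k + 1) (by omega)).1
  have l0 := hR.lt k (by omega)
  have l1 := hR.lt (k + 1) (by omega)
  have cu := hR.col_eq (r := k) (p := T.rs (k + 1) - 1) (by omega) (by omega) (by omega)
  have cv := hR.col_eq (r := k + 1) (p := T.rs (k + 1)) (by omega) (by omega) (by omega)
  have m1 := hR.mono (r := i + 1) (q := k) k1 (by omega)
  have m2 := hR.mono (r := k + 2) (q := j) k2 (by omega)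
  have w0 := hR.window (r := k) (by omega)
  have hn1 := hR.le_n (r := k + 2) (by omega)
  have hn2 := hR.le_n (r := j + 1) (by omega)
  change T.rs (k + 1) < T.rs (k + 2) at l1
  have e1 : Le (T.E false) x (T.rs (k + 1) - 1) K := by
    refine hk.2 x ?_ (by omega) (by omega)
    unfold Inst.wl
    split_ifs with hw
    · omega
    · exact (hR.mono (by omega) (by omega)).trans hi1
  have e2 : Le (T.E false) (T.rs (k + 1)) y K := by
    refine hk'.1 y (by omega) ?_ (by omega)
    unfold Inst.wh
    split_ifs with hw hw'
    · omega
    · exact hj2.trans_le (hR.mono (by omega) (by omega))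
    · omega
  have e3 : Le (T.E false) (T.rs (k + 1) - 1) (T.rs (k + 1)) (min M₀ K) := by
    obtain ⟨l, hl, hw⟩ : Le (T.E false) (T.rs (k + 1) - 1) (T.rs (k + 1)) K := by
      refine hk.1 _ (by omega) ?_ (by omega)
      unfold Inst.wh
      split_ifs with hw hw'
      · omega
      · exact l1.trans_le (hR.mono (by omega) (by omega))
      · omega
    obtain ⟨u, hu⟩ : ∃ u, T.rs (k + 1) = u + 1 := ⟨T.rs (k + 1) - 1, by omega⟩
    rw [hu] at hw cu cv ⊢
    have := hM u (u + 1) l (by omega) (by omega) (wk_consecutive hw) (by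
      rw [Nat.add_sub_cancel] at cu
      omega)
    exact ⟨l, by omega, hw⟩
  exact ((e1.trans e3).trans e2).mono (by omega)

/-! ## The total time of a test -/

/-- Shifting the summation by one exchanges a single summand, and each summand is at most `F R`. -/
theorem sum_shift_up {F : ℕ → ℕ} (R a : ℕ) (h : ∀ i, F i ≤ F R) :
    ∑ r ∈ Finset.range R, F (r + a) ≤ ∑ r ∈ Finset.range R, F r + a * F R := by
  induction a with
  | zero => simp
  | succ a ih =>
    have h1 : ∑ r ∈ Finset.range R, F (r + (a + 1)) + F a =
        ∑ r ∈ Finset.range R, F (r + a) + F (R + a) := by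
      have e1 := Finset.sum_range_succ (fun r => F (r + a)) R
      have e2 := Finset.sum_range_succ' (fun r => F (r + a)) R
      have e3 : ∑ r ∈ Finset.range R, F (r + 1 + a) = ∑ r ∈ Finset.range R, F (r + (a + 1)) :=
        Finset.sum_congr rfl fun r _ => by rw [add_right_comm, add_assoc]
      rw [zero_add] at e2
      omega
    have := h (R + a)
    rw [add_mul, one_mul]
    omega

theorem sum_shift_down {F : ℕ → ℕ} (R b : ℕ) (h : ∀ i, F i ≤ F R) :
    ∑ r ∈ Finset.range R, F r ≤ ∑ r ∈ Finset.range R, F (r - b) + b * F R := by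
  induction b with
  | zero => simp
  | succ b ih =>
    have h1 : ∑ r ∈ Finset.range R, F (r - b) ≤ ∑ r ∈ Finset.range R, F (r - (b + 1)) + F R := by
      cases R with
      | zero => simp
      | succ R =>
        rw [Finset.sum_range_succ, Finset.sum_range_succ' (fun r => F (r - (b + 1)))]
        simp only [Nat.add_sub_add_right]
        have := h (R - b)
        omega
    rw [add_mul, one_mul]
    omega

/-- Telescoping: shifting the upper ends by `a` and the lower ends by `b` changes the sum of the
values of `F` by at most `(a + b) * F R`. In other words, every element lies in at most `a + b`
windows. -/
theorem sum_windows {F : ℕ → ℕ} (R a b : ℕ) (hF : ∀ i j, i ≤ j → j ≤ R → F i ≤ F j) :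
    ∑ r ∈ Finset.range R, (F (min (r + a) R) - F (r - b)) ≤ (a + b) * F R := by
  have h1 : ∀ i, F (min i R) ≤ F (min R R) := fun i => by
    rw [min_self]; exact hF _ _ (min_le_right _ _) le_rfl
  have h2 := sum_shift_up (F := fun i => F (min i R)) R a h1
  have h3 := sum_shift_down (F := fun i => F (min i R)) R b h1
  simp only [min_self] at h2 h3
  have h4 : ∑ r ∈ Finset.range R, (F (min (r + a) R) - F (r - b)) +
      ∑ r ∈ Finset.range R, F (min (r - b) R) = ∑ r ∈ Finset.range R, F (min (r + a) R) := by
    rw [← Finset.sum_add_distrib]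
    refine Finset.sum_congr rfl fun r hr => ?_
    have hr := Finset.mem_range.1 hr
    rw [min_eq_left (a := r - b) (by omega)]
    have := hF (r - b) (min (r + a) R) (by omega) (min_le_right _ _)
    omega
  rw [add_mul]
  omega

/-- The map `r ↦ 3 * (r / bw) + r % bw` is injective on the indices with residue below `3`. -/
theorem sum_mod {R bw M : ℕ} :
    ∑ r ∈ Finset.range R, (if r % bw < 3 then M else 0) ≤ 3 * (R / bw + 1) * M := by
  rw [← Finset.sum_filter, Finset.sum_const, smul_eq_mul]
  refine Nat.mul_le_mul_right _ ?_
  calc _ ≤ (Finset.range (3 * (R / bw + 1))).card := by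
        refine Finset.card_le_card_of_injOn (fun r => 3 * (r / bw) + r % bw) ?_ ?_
        · intro r hr
          simp only [Finset.coe_filter, Finset.mem_range, Set.mem_ofPred_eq] at hr
          have := Nat.div_le_div_right (c := bw) hr.1.le
          simp only [Finset.coe_range, Set.mem_Iio]
          omega
        · intro r hr q hq h
          simp only [Finset.coe_filter, Finset.mem_range, Set.mem_ofPred_eq] at hr hq h
          rw [← Nat.div_add_mod r bw, ← Nat.div_add_mod q bw,
            show r / bw = q / bw by omega, show r % bw = q % bw by omega]
    _ = _ := by simp

/-- The number of positions before `p` and of edges that start or end before `p`. -/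
def Inst.cum (T : Inst) (p : ℕ) : ℕ := p + T.off false p + (T.m - T.off true (T.n - p))

theorem Inst.cum_mono {p q : ℕ} (h : p ≤ q) (hq : q ≤ T.n) : T.cum p ≤ T.cum q := by
  have h1 := (T.csr false).off_mono p q h hq
  have h2 := (T.csr true).off_mono (T.n - q) (T.n - p) (by omega) (by omega)
  unfold Inst.cum
  omega

theorem Inst.cum_le {p : ℕ} (hp : p ≤ T.n) : T.cum p ≤ T.n + 2 * T.m := by
  have h1 := (T.csr false).off_le_m hp
  unfold Inst.cum
  omega

theorem Inst.span_eq {l h : ℕ} (hlh : l ≤ h) (hn : h ≤ T.n) : T.span l h = T.cum h - T.cum l := by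
  have h1 := (T.csr false).off_mono l h hlh hn
  have h2 := (T.csr true).off_mono (T.n - h) (T.n - l) (by omega) (by omega)
  have h3 := (T.csr true).off_le_m (p := T.n - l) (by omega)
  unfold Inst.cum Inst.span
  omega

/-- About `3 * (n / bw + 1)` runs have the whole graph as their window, of size at most `n + 2 * m`.
The remaining windows reach `bw + 3` runs back and end `bw + 4` starting points ahead, so they
overlap at most `2 * bw + 7` times. -/
theorem windows_sum (hR : RunsOK T) :
    ∑ r ∈ Finset.range T.R, (16 * T.span (T.wl r) (T.wh r) + 60) ≤
      16 * ((3 * (T.n / T.bw + 1) + (2 * T.bw + 7)) * (T.n + 2 * T.m)) + 60 * T.n := by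
  have hRn := hR.R_le
  set F : ℕ → ℕ := fun i => T.cum (T.rs i) with hF
  have hFm : ∀ i j, i ≤ j → j ≤ T.R → F i ≤ F j := fun i j hij hj =>
    Inst.cum_mono (hR.mono hij hj) (hR.le_n hj)
  have h1 := sum_windows T.R (T.bw + 4) (T.bw + 3) hFm
  have h2 := sum_mod (R := T.R) (bw := T.bw) (M := T.n + 2 * T.m)
  have h3 : ∀ r ∈ Finset.range T.R, T.span (T.wl r) (T.wh r) ≤
      (F (min (r + (T.bw + 4)) T.R) - F (r - (T.bw + 3))) +
        if r % T.bw < 3 then T.n + 2 * T.m else 0 := by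
    intro r hr
    have hr := Finset.mem_range.1 hr
    unfold Inst.wl Inst.wh
    split_ifs with c1 c2
    · rw [Inst.span_eq (Nat.zero_le _) le_rfl]
      have := T.cum_le le_rfl
      omega
    · rw [Inst.span_eq (hR.mono (by omega) (by omega)) (hR.le_n (by omega)),
        min_eq_left (by omega)]
      simp only [hF, ← add_assoc]
      omega
    · rw [Inst.span_eq (hR.le_n (by omega)) le_rfl, min_eq_right (by omega)]
      simp only [hF, hR.rs_R]
      omega
  have h4 := Finset.sum_le_sum h3
  rw [Finset.sum_add_distrib] at h4
  rw [Finset.sum_add_distrib, ← Finset.mul_sum, Finset.sum_const, Finset.card_range, smul_eq_mul]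
  have h5 : F T.R ≤ T.n + 2 * T.m := Inst.cum_le (hR.le_n le_rfl)
  have h6 := Nat.mul_le_mul_left (T.bw + 4 + (T.bw + 3)) h5
  have h7 : T.R / T.bw ≤ T.n / T.bw := Nat.div_le_div_right hRn
  have h8 : 3 * (T.R / T.bw + 1) * (T.n + 2 * T.m) ≤ 3 * (T.n / T.bw + 1) * (T.n + 2 * T.m) :=
    Nat.mul_le_mul_right _ (by omega)
  rw [add_mul, show 2 * T.bw + 7 = T.bw + 4 + (T.bw + 3) by ring]
  omega

theorem Inst.high_mono {g : Bool} {a b : ℕ} (hb : b ≤ T.n) : T.high g a b ≤ T.high g 0 T.n := by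
  refine Finset.card_le_card fun p hp => ?_
  simp only [Finset.mem_filter, Finset.mem_Ico] at hp ⊢
  omega

/-- Markov's inequality for the degrees, which add up to `m`. -/
theorem Inst.high_mul_le (g : Bool) : T.high g 0 T.n * T.hh ≤ T.m := by
  have h1 : T.high g 0 T.n * T.hh ≤ ∑ p ∈ Finset.range T.n, (T.off g (p + 1) - T.off g p) := by
    unfold Inst.high
    rw [← smul_eq_mul, ← Finset.sum_const]
    refine (Finset.sum_le_sum fun p hp => ?_).trans (Finset.sum_le_sum_of_subset fun p hp => ?_)
    · exact (Finset.mem_filter.1 hp).2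
    · simp only [Finset.mem_filter, Finset.mem_Ico] at hp
      simp; omega
  refine h1.trans ?_
  have h2 : ∀ k, k ≤ T.n → ∑ p ∈ Finset.range k, (T.off g (p + 1) - T.off g p) = T.off g k := by
    intro k hk
    induction k with
    | zero => simp [(T.csr g).off_zero]
    | succ k ih =>
      rw [Finset.sum_range_succ, ih (by omega)]
      have := (T.csr g).off_mono k (k + 1) (by omega) hk
      omega
  rw [h2 _ le_rfl, (T.csr g).off_n]

theorem Inst.high_eq_zero (g : Bool) (h : T.n < T.hh) : T.high g 0 T.n = 0 := by
  unfold Inst.high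
  rw [Finset.card_eq_zero, Finset.filter_eq_empty_iff]
  intro p hp
  have := (T.csr g).deg_le (p := p) (by simp at hp; omega)
  omega

/-- The bound for the time of all segments. -/
def Inst.segBound (T : Inst) : ℕ :=
  (T.n + 2 * T.m) * (T.high false 0 T.n + T.high true 0 T.n + T.rho + 1 +
    if T.dense = 0 then T.kk * T.hh else 0) + T.kk * (T.kk + T.hh) * T.n +
    if T.dense = 0 then 0 else T.kk * T.n * T.n

/-- A run belongs to at most two pairs of consecutive runs, so the sizes of the pairs add up to at
most twice the size of the graph. The numbers of vertices of high degree are replaced by the global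
ones. -/
theorem segs_sum (hR : RunsOK T) :
    ∑ r ∈ Finset.range (T.R - 1), (200 * T.segWork r + 7) ≤ 400 * T.segBound + 7 * T.n := by
  have hRn := hR.R_le
  set W := T.high false 0 T.n + T.high true 0 T.n + T.rho + 1 +
    if T.dense = 0 then T.kk * T.hh else 0 with hW
  set Z := if T.dense = 0 then 0 else T.kk * T.n with hZ
  have h0 : ∀ r ∈ Finset.range (T.R - 1), T.segWork r ≤
      (T.cum (T.rs (min (r + 2) T.R)) - T.cum (T.rs (r - 0))) * W +
        (T.rs (min (r + 2) T.R) - T.rs (r - 0)) * (T.kk * (T.kk + T.hh) + Z) := by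
    intro r hr
    have hr := Finset.mem_range.1 hr
    rw [min_eq_left (by omega), Nat.sub_zero]
    have l0 := hR.mono (r := r) (q := r + 1) (by omega) (by omega)
    have l1 := hR.mono (r := r + 1) (q := r + 2) (by omega) (by omega)
    have l2 := hR.le_n (r := r + 2) (by omega)
    rw [← Inst.span_eq (by omega) l2]
    unfold Inst.segWork
    have e1 : T.high false (T.rs r) (T.rs (r + 1)) ≤ T.high false 0 T.n :=
      Inst.high_mono (by omega)
    have e2 : T.high true (T.n - T.rs (r + 2)) (T.n - T.rs (r + 1)) ≤ T.high true 0 T.n :=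
      Inst.high_mono (by omega)
    have e3 : (if T.dense = 0 then 0 else
        T.kk * (T.rs (r + 1) - T.rs r) * (T.rs (r + 2) - T.rs (r + 1))) ≤
        (T.rs (r + 2) - T.rs r) * Z := by
      rw [hZ]
      split_ifs
      · simp
      · rw [mul_comm (T.rs (r + 2) - T.rs r)]
        exact Nat.mul_le_mul (Nat.mul_le_mul_left _ (by omega)) (by omega)
    have e4 : T.span (T.rs r) (T.rs (r + 2)) * (T.high false (T.rs r) (T.rs (r + 1)) +
      T.high true (T.n - T.rs (r + 2)) (T.n - T.rs (r + 1)) +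
      T.rho + 1 + if T.dense = 0 then T.kk * T.hh else 0) ≤
        T.span (T.rs r) (T.rs (r + 2)) * W := Nat.mul_le_mul_left _ (by omega)
    rw [mul_add (T.rs (r + 2) - T.rs r), mul_comm (T.rs (r + 2) - T.rs r) (T.kk * (T.kk + T.hh))]
    omega
  have hFm : ∀ i j, i ≤ j → j ≤ T.R → T.rs i ≤ T.rs j := fun i j hij hj => hR.mono hij hj
  have hGm : ∀ i j, i ≤ j → j ≤ T.R → T.cum (T.rs i) ≤ T.cum (T.rs j) := fun i j hij hj =>
    Inst.cum_mono (hR.mono hij hj) (hR.le_n hj)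
  have h1 := sum_windows (F := T.rs) T.R 2 0 hFm
  have h2 := sum_windows (F := fun i => T.cum (T.rs i)) T.R 2 0 hGm
  have hsub : Finset.range (T.R - 1) ⊆ Finset.range T.R := Finset.range_mono (by omega)
  have h3 := (Finset.sum_le_sum h0).trans (Finset.sum_le_sum_of_subset hsub)
  rw [Finset.sum_add_distrib, ← Finset.sum_mul, ← Finset.sum_mul] at h3
  have h4 : T.cum (T.rs T.R) ≤ T.n + 2 * T.m := Inst.cum_le (hR.le_n le_rfl)
  rw [hR.rs_R] at h1 h2 h4
  have h5 := Nat.mul_le_mul_right W (h2.trans (Nat.mul_le_mul_left _ h4))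
  have h6 := Nat.mul_le_mul_right (T.kk * (T.kk + T.hh) + Z) h1
  rw [Finset.sum_add_distrib, ← Finset.mul_sum, Finset.sum_const, Finset.card_range, smul_eq_mul]
  have h7 : T.segBound = (T.n + 2 * T.m) * W + T.n * (T.kk * (T.kk + T.hh) + Z) := by
    unfold Inst.segBound
    rw [← hW, hZ]
    split_ifs <;> ring
  rw [h7]
  simp only [Nat.add_zero] at h5 h6
  rw [mul_assoc] at h5 h6
  omega

/-- The bound for the time of a test. -/
def Inst.testBound (T : Inst) : ℕ :=
  (3 * (T.n / T.bw + 1) + (2 * T.bw + 7)) * (T.n + 2 * T.m) + T.segBound + T.n + 1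

theorem test_cost (hB : Big T K E) (hR : RunsOK T) (hH : Holds T K s) {M₀ : ℕ}
    (hM : ∀ x y c, x < T.n → y < T.n → T.E false x y c → T.col false x ≠ T.col false y → c ≤ M₀) :
    cost E test s ≤ 400 * T.testBound := by
  have h1 := (test_spec hB hR hH hM).2.2
  have h2 := windows_sum hR
  have h3 := segs_sum hR
  unfold Inst.testBound
  omega

/-! ## Binary search for the threshold -/

abbrev vLo : ℕ := ix 26 false
abbrev vHi : ℕ := ix 26 true
abbrev vKmax : ℕ := ix 27 false
abbrev vM0 : ℕ := ix 27 true
abbrev vIt : ℕ := ix 28 false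

def halve : Cmd :=
  .asg vK (.div (V vLo + V vHi) 2) ;; test ;;
    .ite (V vOK) (.asg vHi (V vK)) (.asg vLo (V vK + 1))

/-- Find a threshold that passes the test, but whose predecessor does not. -/
def search : Cmd :=
  .asg vLo 0 ;; .asg vHi (V vKmax + 1) ;;
  .loop vIt 0 .top (.lt (V vLo) (V vHi)) halve ;;
  .ite (.lt (V vKmax) (V vLo)) (.asg vFlag 0)
    (.asg vFlag 1 ;; .asg vOut (2 * V vLo) ;;
      .ite (.lt (V vM0) (V vLo)) (.asg vOut (V vOut + V vM0)) (.asg vOut (V vOut + V vLo)))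

/-- All distances between vertices of different colors are small. -/
def Good (T : Inst) (M₀ K : ℕ) : Prop := ∀ x y, x < y → y < T.n → T.col false x ≠ T.col false y →
  Le (T.E false) x y (2 * K + min M₀ K)

theorem Holds.setK (h : Holds T K s) (L : ℕ) : Holds T L (s.setV vK L) := by
  constructor
  · have := h.n; simpa using this
  · simp
  · have := h.kk; simpa using this
  · have := h.hh; simpa using this
  · have := h.dense; simpa using this
  · have := h.bw; simpa using this
  · have := h.R; simpa using this
  · exact h.src
  · exact h.tgt
  · exact h.wt
  · exact h.off
  · exact h.col
  · exact h.rs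

theorem halve_spec {M₀ lo hi : ℕ} (hB : Big T (lo + hi) E) (hR : RunsOK T) (hH : Holds T K s)
    (hM : ∀ x y c, x < T.n → y < T.n → T.E false x y c → T.col false x ≠ T.col false y → c ≤ M₀)
    (hlo : s.v vLo = lo) (hhi : s.v vHi = hi) :
    Holds T ((lo + hi) / 2) (run E halve s) ∧
    (((run E halve s).v vLo = lo ∧ (run E halve s).v vHi = (lo + hi) / 2 ∧
      Good T M₀ ((lo + hi) / 2)) ∨
    ((run E halve s).v vLo = (lo + hi) / 2 + 1 ∧ (run E halve s).v vHi = hi ∧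
      BadP T ((lo + hi) / 2))) ∧
    cost E halve s ≤ 400 * T.testBound + 3 := by
  have hlin := hB.lin
  have hB' : Big T ((lo + hi) / 2) E := ⟨by omega, hB.sq⟩
  simp only [halve, exec, hlo, hhi]
  rw [min_eq_left (by omega)]
  have hH₁ : Holds T ((lo + hi) / 2) (s.setV vK ((lo + hi) / 2)) := hH.setK _
  set s₁ := s.setV vK ((lo + hi) / 2) with hs₁
  have l1 : s₁.v vLo = lo := by simp [hs₁, hlo]
  have l2 : s₁.v vHi = hi := by simp [hs₁, hhi]
  clear_value s₁
  obtain ⟨a1, a2, -⟩ := test_spec hB' hR hH₁ hM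
  have a3 := test_cost hB' hR hH₁ hM
  have hH₂ : Holds T ((lo + hi) / 2) (run E test s₁) := hH₁.run _ rfl
  have f1 : (run E test s₁).v vLo = lo := by rw [run_v _ _ _, l1]
  have f2 : (run E test s₁).v vHi = hi := by rw [run_v _ _ _, l2]
  set s₂ := run E test s₁
  clear_value s₂
  by_cases hok : s₂.v vOK = 0
  · simp only [exec, hok, hH₂.thr]
    refine ⟨hH₂.setV _ _ rfl, Or.inr ⟨?_, by simp [f2], a1 hok⟩, by omega⟩
    simp
    omega
  · simp only [run_ite, cost_ite, ev_var, hok, if_false, run_asg, cost_asg, hH₂.thr]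
    exact ⟨hH₂.setV _ _ rfl, Or.inl ⟨by simp [f1], by simp, a2 hok⟩, by omega⟩

/-- The answers of the test need be neither monotone in the threshold nor mutually exclusive; the
search only maintains that `hi` is `Good` or untouched and that `lo - 1` is bad or `lo = 0`. When
the two bounds meet, both facts hold for the same `L`, or the bad one holds for `Kmax`. The room `3
* (Kmax + 1)` keeps the midpoint and the output below saturation. -/
theorem search_spec {M₀ Kmax : ℕ} (hB : Big T (3 * (Kmax + 1)) E) (hR : RunsOK T)
    (hH : Holds T K s)
    (hM : ∀ x y c, x < T.n → y < T.n → T.E false x y c → T.col false x ≠ T.col false y → c ≤ M₀)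
    (hK : s.v vKmax = Kmax) (hM0 : s.v vM0 = M₀) :
    (((run E search s).v vFlag = 0 ∧ BadP T Kmax) ∨
      ((run E search s).v vFlag = 1 ∧ ∃ L, (run E search s).v vOut = 2 * L + min M₀ L ∧
        (L = 0 ∨ BadP T (L - 1)) ∧ Good T M₀ L)) ∧
    cost E search s ≤ (400 * T.testBound + 4) * (Nat.log 2 (Kmax + 1) + 1) + 9 := by
  have hlin := hB.lin
  have hpow : ∀ i, 2 ^ i ≤ Kmax + 1 → i ≤ Nat.log 2 (Kmax + 1) ∧ i < E.B := fun i hi =>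
    ⟨Nat.le_log_of_pow_le (by omega) hi, by have := Nat.lt_two_pow_self (n := i); omega⟩
  simp only [search, run_seq, cost_seq, cost_asg]
  set s₁ := run E (.asg vHi (V vKmax + 1)) (run E (.asg vLo 0) s) with hs₁
  have hH₁ : Holds T K s₁ := (hH.run _ rfl).run _ rfl
  have g1 : s₁.v vLo = 0 := by simp [hs₁]
  have g2 : s₁.v vHi = Kmax + 1 := by simp [hs₁, hK]; omega
  have g3 : s₁.v vKmax = Kmax := by simp [hs₁, hK]
  have g4 : s₁.v vM0 = M₀ := by simp [hs₁, hM0]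
  clear_value s₁
  obtain ⟨i, s', t, hS, ⟨⟨K', h0⟩, lo, hi, h1, h2, h3, h4, h5, h6, h7, h8⟩, hc, hcase⟩ :=
    loop_frame (E := E) (x := vIt)
    (lo := 0) (hi := .top) (g := .lt (V vLo) (V vHi)) (c := halve) (s := s₁)
    (fun i s' t => (∃ K, Holds T K s') ∧ ∃ lo hi, s'.v vLo = lo ∧ s'.v vHi = hi ∧ lo ≤ hi ∧
      hi ≤ Kmax + 1 ∧ (hi = Kmax + 1 ∨ Good T M₀ hi) ∧ (lo = 0 ∨ BadP T (lo - 1)) ∧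
      -- The last round started with a nonempty interval after `i - 1` halvings; this bounds the
      -- number of rounds by a logarithm and keeps `i` below `E.B`.
      (i = 0 ∨ 2 ^ (i - 1) ≤ Kmax + 1) ∧
      ((hi - lo) * 2 ^ i ≤ Kmax + 1 ∧ t ≤ (400 * T.testBound + 4) * i))
    ⟨⟨K, hH₁⟩, 0, Kmax + 1, g1, g2, by omega, le_rfl, Or.inl rfl, Or.inl rfl, Or.inl rfl,
      by simp, Nat.zero_le _⟩ (by
      rintro i s' t - - hS ⟨⟨K', b0⟩, lo, hi, b1, b2, b3, b4, b5, b6, b7, b8, b9⟩ hg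
      have hlt : lo < hi := by
        by_contra hlt
        simp [b1, b2, hlt] at hg
      obtain ⟨d1, d2, d3⟩ := halve_spec (E := E) (s := s'.setV vIt i) (lo := lo) (hi := hi)
        ⟨by omega, hB.sq⟩ hR (b0.setV _ _ rfl) hM (by simp [b1]) (by simp [b2])
      have hp : 2 ^ i ≤ Kmax + 1 := by
        refine le_trans ?_ b8
        exact Nat.le_mul_of_pos_left _ (by omega)
      have htime : t + (cost E halve (s'.setV vIt i) + 1) ≤ (400 * T.testBound + 4) * (i + 1) := by
        rw [mul_add, mul_one]; omega
      have hhalf : ∀ a, 2 * a ≤ hi - lo → a * 2 ^ (i + 1) ≤ Kmax + 1 := fun a ha => by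
        refine le_trans ?_ b8
        rw [pow_succ', ← mul_assoc, mul_comm a 2]
        exact Nat.mul_le_mul_right _ ha
      refine ⟨⟨_, d1⟩, ?_⟩
      rcases d2 with ⟨d4, d5, d6⟩ | ⟨d4, d5, d6⟩
      · exact ⟨_, _, d4, d5, by omega, by omega, Or.inr d6, b6, Or.inr hp,
          hhalf _ (by omega), htime⟩
      · exact ⟨_, _, d4, d5, by omega, by omega, b5, Or.inr d6, Or.inr hp,
          hhalf _ (by omega), htime⟩)
  have hi' : i ≤ Nat.log 2 (Kmax + 1) + 1 := by
    rcases h7 with h7 | h7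
    · omega
    · have := (hpow _ h7).1; omega
  have hdone : lo = hi := by
    rcases hcase with ⟨_, hg, _⟩ | ⟨hmax, _⟩
    · simp [h1, h2] at hg; omega
    · by_contra hne
      have : 2 ^ i ≤ Kmax + 1 := by
        refine le_trans ?_ h8.1
        exact Nat.le_mul_of_pos_left _ (by omega)
      have := (hpow _ this).2
      simp at hmax
      omega
  subst hdone
  obtain ⟨s₂, hs₂, e1, e2, e3⟩ : ∃ s₂, run E (.loop vIt 0 .top (.lt (V vLo) (V vHi)) halve) s₁ = s₂
      ∧ s₂.v vLo = lo ∧ s₂.v vKmax = Kmax ∧ s₂.v vM0 = M₀ := by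
    have k1 : s'.v vKmax = Kmax := by rw [hS.v _, g3]
    have k2 : s'.v vM0 = M₀ := by rw [hS.v _, g4]
    rcases hcase with ⟨_, _, hr⟩ | ⟨_, hr⟩
    · exact ⟨_, hr, by simp [h1], by simp [k1], by simp [k2]⟩
    · exact ⟨_, hr, h1, k1, k2⟩
  rw [hs₂]
  have htot := Nat.mul_le_mul_left (400 * T.testBound + 4) hi'
  constructor
  · by_cases hlo : Kmax < lo
    · left
      simp only [run_ite, ev_lt, ev_var, e1, e2, hlo, if_true, one_ne_zero, if_false, run_asg]
      refine ⟨by simp, ?_⟩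
      rcases h6 with h6 | h6
      · omega
      · rwa [show Kmax = lo - 1 by omega]
    · right
      have hgood : Good T M₀ lo := h5.resolve_left (by omega)
      simp only [exec, e1, e2, hlo, Nat.reduceEqDiff, e3]
      by_cases hml : M₀ < lo
      · simp only [hml, if_true, one_ne_zero, if_false, setV_v, ix_inj, and_false, Bool.false_eq_true]
        exact ⟨trivial, lo, by omega, h6, hgood⟩
      · simp only [hml, if_true, if_false, setV_v, ix_inj, and_false, Bool.false_eq_true]
        exact ⟨trivial, lo, by omega, h6, hgood⟩
  · have : ∀ s₂, cost E (.ite (.lt (V vKmax) (V vLo)) (.asg vFlag 0)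
      (.asg vFlag 1 ;; .asg vOut (2 * V vLo) ;;
        .ite (.lt (V vM0) (V vLo)) (.asg vOut (V vOut + V vM0)) (.asg vOut (V vOut + V vLo)))) s₂
        ≤ 5 := fun s₂ => by
      simp only [exec]
      split_ifs <;> omega
    have := this s₂
    omega

/-! ## Sorting the edges -/

abbrev aKEY : ℕ := ix 14 false
abbrev aKT : ℕ := ix 14 true
abbrev aOF : ℕ := ix 15 false
abbrev aPM : ℕ := ix 15 true
abbrev aNX : ℕ := ix 16 false

/-- Counting sort: `PM` lists the numbers below `M` in the order of their keys, and `OF` gives the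
first place of each key. -/
def csort : Cmd :=
  .for vI 0 (V vN + 1) (.wr aOF (V vI) 0) ;;
  .for vI 0 (V vM) (.wr aOF (.rd aKEY (V vI) + 1) (.rd aOF (.rd aKEY (V vI) + 1) + 1)) ;;
  .for vI 0 (V vN) (.wr aOF (V vI + 1) (.rd aOF (V vI) + .rd aOF (V vI + 1)) ;;
    .wr aNX (V vI) (.rd aOF (V vI))) ;;
  .for vI 0 (V vM) (.wr aPM (.rd aNX (.rd aKEY (V vI))) (V vI) ;;
    .wr aNX (.rd aKEY (V vI)) (.rd aNX (.rd aKEY (V vI)) + 1))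

theorem surj_of_inj {m : ℕ} {f : ℕ → ℕ} (h : ∀ i, i < m → f i < m)
    (hi : ∀ i j, i < m → j < m → f i = f j → i = j) {j : ℕ} (hj : j < m) : ∃ i, i < m ∧ f i = j := by
  have : Function.Injective fun i : Fin m => (⟨f i, h i i.2⟩ : Fin m) := fun i j hij =>
    Fin.ext (hi i j i.2 j.2 (Fin.mk.inj_iff.1 hij))
  obtain ⟨i, hi'⟩ := Finite.surjective_of_injective this ⟨j, hj⟩
  exact ⟨i, i.2, Fin.mk.inj_iff.1 hi'⟩

/-- `pm` is a permutation that sorts `key`, and `off` gives the first place of each key. -/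
structure Sorts (n m : ℕ) (key pm off : ℕ → ℕ) : Prop where
  off_zero : off 0 = 0
  off_n : off n = m
  off_mono : ∀ p q, p ≤ q → q ≤ n → off p ≤ off q
  pm_lt : ∀ j, j < m → pm j < m
  off_le : ∀ j, j < m → off (key (pm j)) ≤ j
  lt_off : ∀ j, j < m → j < off (key (pm j) + 1)
  inj : ∀ i j, i < m → j < m → pm i = pm j → i = j

theorem Sorts.surj {n m : ℕ} {key pm off : ℕ → ℕ} (h : Sorts n m key pm off) {e : ℕ} (he : e < m) :
    ∃ j, j < m ∧ pm j = e := surj_of_inj h.pm_lt h.inj he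

/-- The number of the keys before `i` that are equal to `p`. -/
def eqc (key : ℕ → ℕ) (i p : ℕ) : ℕ := Nat.count (fun e => key e = p) i

def ltc (key : ℕ → ℕ) (i p : ℕ) : ℕ := Nat.count (fun e => key e < p) i

theorem ltc_succ (key : ℕ → ℕ) (i p : ℕ) : ltc key i (p + 1) = ltc key i p + eqc key i p := by
  unfold ltc eqc
  induction i with
  | zero => simp
  | succ i ih =>
    simp only [Nat.count_succ, ih]
    split_ifs <;> omega

theorem ltc_mono (key : ℕ → ℕ) (i : ℕ) {p q : ℕ} (h : p ≤ q) : ltc key i p ≤ ltc key i q :=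
  monotone_nat_of_le_succ (f := ltc key i) (fun p => by rw [ltc_succ]; omega) h

theorem slot_lt {key : ℕ → ℕ} {m i : ℕ} (hi : i < m) :
    ltc key m (key i) + eqc key i (key i) < ltc key m (key i + 1) := by
  rw [ltc_succ]
  exact Nat.add_lt_add_left (Nat.count_strict_mono (p := fun e => key e = key i) rfl hi) _

/-- The place of an item is the number of smaller keys plus the number of equal keys before it.
These places are distinct, hence exhaust the numbers below `m`, so every property of the sorted
order can be read off from the item that owns a place. -/
theorem sorts_of_slots {n m : ℕ} {key pm off : ℕ → ℕ} (hk : ∀ i, i < m → key i < n)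
    (ho : ∀ p, p ≤ n → off p = ltc key m p)
    (hp : ∀ i, i < m → pm (ltc key m (key i) + eqc key i (key i)) = i) :
    Sorts n m key pm off := by
  have hn : ltc key m n = m := (Nat.count_iff_forall).2 fun e he => hk e he
  have hlt : ∀ i, i < m → ltc key m (key i) + eqc key i (key i) < m := fun i hi =>
    (slot_lt hi).trans_le ((ltc_mono key m (hk i hi)).trans hn.le)
  have hs : ∀ j, j < m → ∃ i, i < m ∧ ltc key m (key i) + eqc key i (key i) = j := fun j hj =>
    surj_of_inj hlt (fun i j hi hj h => by rw [← hp i hi, h, hp j hj]) hj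
  refine ⟨?_, by rw [ho n le_rfl, hn], fun p q hpq hq => ?_, fun j hj => ?_, fun j hj => ?_,
    fun j hj => ?_, fun i j hi hj h => ?_⟩
  · rw [ho 0 (Nat.zero_le _)]
    simp [ltc]
  · rw [ho p (hpq.trans hq), ho q hq]
    exact ltc_mono key m hpq
  · obtain ⟨i, hi, rfl⟩ := hs j hj
    rwa [hp i hi]
  · obtain ⟨i, hi, rfl⟩ := hs j hj
    rw [hp i hi, ho _ (hk i hi).le]
    omega
  · obtain ⟨i, hi, rfl⟩ := hs j hj
    rw [hp i hi, ho _ (hk i hi)]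
    exact slot_lt hi
  · obtain ⟨i', hi', rfl⟩ := hs i hi
    obtain ⟨j', hj', rfl⟩ := hs j hj
    rw [hp i' hi', hp j' hj'] at h
    rw [h]

/-- The counts of the keys are kept one place to the right, so that prefix sums formed in place give
the first slot `ltc key m p` of every key `p`. During the distribution `NX p` is the next free slot,
namely this value plus the number of equal keys seen so far. -/
theorem csort_spec {n m : ℕ} (hn : s.v vN = n) (hm : s.v vM = m) (hB : n + m + 1 ≤ E.B)
    (hk : ∀ i, i < m → s.a aKEY i < n) :
    Sorts n m (s.a aKEY) ((run E csort s).a aPM) ((run E csort s).a aOF) ∧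
      cost E csort s ≤ 10 * (n + m) + 20 := by
  set key := s.a aKEY with hkey
  have hct : ∀ i p, eqc key i p ≤ i := fun i p => Nat.count_le _
  have hlt : ∀ i p, ltc key i p ≤ i := fun i p => Nat.count_le _
  simp only [csort, run_seq, cost_seq]
  obtain ⟨a1, t1⟩ := for_frame_const E (.for vI 0 (V vN + 1) (.wr aOF (V vI) 0))
      s rfl (fun i s' => ∀ p, p < i → s'.a aOF p = 0) 1
    (by simp) (by simp) (by
      intro i s' _ _ _ ih
      refine ⟨fun p hp => ?_, by simp⟩
      simp only [exec]
      by_cases h : p = i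
      · simp [h]
      · rw [Function.update_of_ne h]; exact ih p (by omega))
  have n1 := run_v (E := E) (.for vI 0 (V vN + 1) (.wr aOF (V vI) 0)) s vN rfl
  have m1 := run_v (E := E) (.for vI 0 (V vN + 1) (.wr aOF (V vI) 0)) s vM rfl
  have k1 := run_a (E := E) (.for vI 0 (V vN + 1) (.wr aOF (V vI) 0)) s aKEY rfl
  set s₁ := run E (.for vI 0 (V vN + 1) (.wr aOF (V vI) 0)) s
  clear_value s₁
  rw [hn] at n1
  rw [hm] at m1
  rw [← hkey] at k1
  simp only [exec, hn, min_eq_left (show n + 1 ≤ E.B by omega)] at a1 t1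
  set c₂ : Cmd := .wr aOF (.rd aKEY (V vI) + 1) (.rd aOF (.rd aKEY (V vI) + 1) + 1) with hc₂
  obtain ⟨a2, t2⟩ := for_frame_const E (.for vI 0 (V vM) c₂)
      s₁ rfl
    (fun i s' => s'.a aOF 0 = 0 ∧ ∀ p, p < n → s'.a aOF (p + 1) = eqc key i p) 1
    (by simp) ⟨a1 0 (by omega), fun p hp => by rw [a1 _ (by omega)]; simp [eqc]⟩ (by
      rintro i s' _ hi hS ⟨b1, b2⟩
      simp only [ev_var, m1] at hi
      have hk' : s'.a aKEY = key := by rw [hS.a _, k1]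
      have h1 := hk i hi
      have h2 := hct i (key i)
      simp only [hc₂, exec, hk', min_eq_left (show key i + 1 ≤ E.B by omega), b2 _ h1,
        min_eq_left (show eqc key i (key i) + 1 ≤ E.B by omega)]
      refine ⟨⟨by rw [Function.update_of_ne (by omega), b1], fun p hp => ?_⟩, by simp⟩
      unfold eqc at b2 ⊢
      rw [Nat.count_succ]
      by_cases h : p = key i
      · subst h; simp
      · rw [Function.update_of_ne (by omega), b2 p hp, if_neg (Ne.symm h), add_zero])
  have n2 := run_v (E := E) (.for vI 0 (V vM) c₂) s₁ vN rfl
  have m2 := run_v (E := E) (.for vI 0 (V vM) c₂) s₁ vM rfl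
  have k2 := run_a (E := E) (.for vI 0 (V vM) c₂) s₁ aKEY rfl
  set s₂ := run E (.for vI 0 (V vM) c₂) s₁
  clear_value s₂
  rw [n1] at n2
  rw [m1] at m2
  rw [k1] at k2
  simp only [ev_var, ev_0, m1] at a2 t2
  set c₃ : Cmd := .wr aOF (V vI + 1) (.rd aOF (V vI) + .rd aOF (V vI + 1)) ;;
    .wr aNX (V vI) (.rd aOF (V vI)) with hc₃
  obtain ⟨a3, t3⟩ := for_frame_const E (.for vI 0 (V vN) c₃)
      s₂ rfl
    (fun i s' => (∀ p, p ≤ i → s'.a aOF p = ltc key m p) ∧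
      (∀ p, i ≤ p → p < n → s'.a aOF (p + 1) = eqc key m p) ∧
      ∀ p, p < i → s'.a aNX p = ltc key m p) 2
    (by simp) ⟨fun p hp => by
        obtain rfl : p = 0 := by simpa using hp
        rw [a2.1]; simp [ltc], fun p _ hp => a2.2 p hp, by simp⟩ (by
      rintro i s' _ hi hS ⟨b1, b2, b3⟩
      simp only [ev_var, n2] at hi
      have h1 := ltc_succ key m i
      have h2 := hlt m (i + 1)
      simp only [hc₃, exec, min_eq_left (show i + 1 ≤ E.B by omega), b1 i le_rfl, b2 i le_rfl hi,
        ← h1, min_eq_left (show ltc key m (i + 1) ≤ E.B by omega), Nat.reduceEqDiff]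
      rw [Function.update_of_ne (show i ≠ i + 1 by omega), b1 i le_rfl]
      refine ⟨⟨fun p hp => ?_, fun p hp hpn => ?_, fun p hp => ?_⟩, le_rfl⟩
      · by_cases h : p = i + 1
        · simp [h]
        · rw [Function.update_of_ne h, b1 p (by omega)]
      · rw [Function.update_of_ne (by omega), b2 p (by omega) hpn]
      · by_cases h : p = i
        · simp [h]
        · rw [Function.update_of_ne h, b3 p (by omega)])
  have n3 := run_v (E := E) (.for vI 0 (V vN) c₃) s₂ vN rfl
  have m3 := run_v (E := E) (.for vI 0 (V vN) c₃) s₂ vM rfl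
  have k3 := run_a (E := E) (.for vI 0 (V vN) c₃) s₂ aKEY rfl
  set s₃ := run E (.for vI 0 (V vN) c₃) s₂
  clear_value s₃
  rw [m2] at m3
  rw [k2] at k3
  simp only [ev_var, ev_0, n2] at a3 t3
  set c₄ : Cmd := .wr aPM (.rd aNX (.rd aKEY (V vI))) (V vI) ;;
    .wr aNX (.rd aKEY (V vI)) (.rd aNX (.rd aKEY (V vI)) + 1) with hc₄
  obtain ⟨a4, t4⟩ := for_frame_const E (.for vI 0 (V vM) c₄)
      s₃ rfl
    (fun i s' => (∀ p, p < n → s'.a aNX p = ltc key m p + eqc key i p) ∧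
      ∀ e, e < i → s'.a aPM (ltc key m (key e) + eqc key e (key e)) = e) 2
    (by simp) ⟨fun p hp => by rw [a3.2.2 p hp]; simp [eqc], by simp⟩ (by
      rintro i s' _ hi hS ⟨b1, b2⟩
      simp only [ev_var, m3] at hi
      have hk' : s'.a aKEY = key := by rw [hS.a _, k3]
      have h1 := hk i hi
      have h2 := slot_lt (key := key) hi
      have h3 := hlt m (key i + 1)
      simp only [hc₄, exec, hk', b1 _ h1,
        min_eq_left (show ltc key m (key i) + eqc key i (key i) + 1 ≤ E.B by omega),
        Nat.reduceEqDiff]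
      refine ⟨⟨fun p hp => ?_, fun e he => ?_⟩, le_rfl⟩
      · unfold eqc at b1 ⊢
        rw [Nat.count_succ]
        by_cases h : p = key i
        · subst h; simp [add_assoc]
        · rw [Function.update_of_ne h, b1 p hp, if_neg (Ne.symm h), add_zero]
      · by_cases h : e = i
        · subst h; simp
        · have he' : e < i := by omega
          rw [Function.update_of_ne, b2 e he']
          intro heq
          have h4 := slot_lt (key := key) (i := e) (m := m) (by omega)
          rcases lt_trichotomy (key e) (key i) with h5 | h5 | h5
          · have := ltc_mono key m (p := key e + 1) (q := key i) h5
            omega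
          · have := Nat.count_strict_mono (p := fun x => key x = key e) (m := e) rfl he'
            unfold eqc at heq
            rw [← h5] at heq
            omega
          · have := ltc_mono key m (p := key i + 1) (q := key e) h5
            omega)
  have o4 := run_a (E := E) (.for vI 0 (V vM) c₄) s₃ aOF rfl
  simp only [ev_var, ev_0, m3] at a4 t4
  refine ⟨sorts_of_slots hk (fun p hp => by rw [o4, a3.1 p hp]) a4.2, by omega⟩

/-! ## Topological order -/

abbrev aTV : ℕ := ix 17 false
abbrev aDEG : ℕ := ix 18 false
abbrev aQ : ℕ := ix 18 true
abbrev aPOS : ℕ := ix 19 false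
abbrev vT : ℕ := ix 28 true
abbrev vX2 : ℕ := ix 29 false
abbrev vU4 : ℕ := ix 29 true

/-- Add a vertex to the queue if all its incoming edges have been removed. -/
def push (x : ℕ) : Cmd :=
  .when (.eq (.rd aDEG (V x)) 0) (.wr aQ (V vT) (V x) ;; .asg vT (V vT + 1))

/-- Remove the edge number `J`. -/
def removeEdge : Cmd :=
  .asg vX2 (.rd aTV (.rd aPM (V vJ))) ;; .wr aDEG (V vX2) (.rd aDEG (V vX2) - 1) ;; push vX2

/-- Remove the vertex number `I` in the queue. -/
def removeVertex : Cmd :=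
  .asg vU4 (.rd aQ (V vI)) ;; .for vJ (.rd aOF (V vU4)) (.rd aOF (V vU4 + 1)) removeEdge

def inDegrees : Cmd :=
  .for vI 0 (V vM) (.wr aDEG (.rd aTV (V vI)) (.rd aDEG (.rd aTV (V vI)) + 1))

/-- Repeatedly remove a vertex without incoming edges. -/
def topo : Cmd :=
  inDegrees ;; .asg vT 0 ;; .for vI 0 (V vN) (push vI) ;; .for vI 0 (V vN) removeVertex ;;
  .for vI 0 (V vN) (.wr aPOS (.rd aQ (V vI)) (V vI))

variable {n m : ℕ} {sv tv : ℕ → ℕ} {D : Finset ℕ} {q deg : ℕ → ℕ} {t : ℕ}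

/-- The queue after the removal of the edges in `D`. -/
structure Queue (n m : ℕ) (sv tv : ℕ → ℕ) (D : Finset ℕ) (q deg : ℕ → ℕ) (t : ℕ) : Prop where
  sub : D ⊆ Finset.range m
  deg_eq : ∀ v, v < n → deg v = ((Finset.range m \ D).filter fun e => tv e = v).card
  lt : ∀ i, i < t → q i < n
  inj : ∀ i j, i < t → j < t → q i = q j → i = j
  mem : ∀ v, v < n → (deg v = 0 ↔ ∃ i, i < t ∧ q i = v)
  src : ∀ e, e ∈ D → ∃ i, i < t ∧ q i = sv e
  ord : ∀ e, e < m → ∀ j, j < t → q j = tv e → ∃ i, i < j ∧ q i = sv e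

theorem Queue.le (h : Queue n m sv tv D q deg t) : t ≤ n := by
  have : (Finset.range t).card ≤ (Finset.range n).card :=
    Finset.card_le_card_of_injOn q (fun i hi => by simpa using h.lt i (by simpa using hi))
      fun i hi j hj => h.inj i j (by simpa using hi) (by simpa using hj)
  simpa using this

theorem Queue.mem_of_deg (h : Queue n m sv tv D q deg t) {e : ℕ} (he : e < m) (ht : tv e < n)
    (h0 : deg (tv e) = 0) : e ∈ D := by
  rw [h.deg_eq _ ht, Finset.card_eq_zero, Finset.filter_eq_empty_iff] at h0
  by_contra hD
  exact h0 (Finset.mem_sdiff.2 ⟨Finset.mem_range.2 he, hD⟩) rfl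

/-- While an edge into `tv e` is left, `tv e` is not in the queue. If `e` was the last such edge,
all edges into `tv e` have been removed, so their sources are in the queue already and precede the
new entry. -/
theorem Queue.push (h : Queue n m sv tv D q deg t) {e : ℕ} (he : e < m) (hD : e ∉ D)
    (htn : tv e < n) {i : ℕ} (hi : i < t) (hq : q i = sv e) :
    1 ≤ deg (tv e) ∧ (∀ i, i < t → q i ≠ tv e) ∧
    (deg (tv e) - 1 ≠ 0 →
      Queue n m sv tv (insert e D) q (Function.update deg (tv e) (deg (tv e) - 1)) t) ∧
    (deg (tv e) - 1 = 0 → Queue n m sv tv (insert e D) (Function.update q t (tv e))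
      (Function.update deg (tv e) (deg (tv e) - 1)) (t + 1)) := by
  have hpos : deg (tv e) ≠ 0 := fun h0 => hD (h.mem_of_deg he htn h0)
  have hnot : ∀ i, i < t → q i ≠ tv e := fun i hi hq => hpos ((h.mem _ htn).2 ⟨i, hi, hq⟩)
  have hsub : insert e D ⊆ Finset.range m := Finset.insert_subset (Finset.mem_range.2 he) h.sub
  have hdeg : ∀ v, v < n → Function.update deg (tv e) (deg (tv e) - 1) v =
      ((Finset.range m \ insert e D).filter fun e => tv e = v).card := by
    intro v hv
    have h1 : (Finset.range m \ insert e D).filter (fun f => tv f = v) =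
        ((Finset.range m \ D).filter fun f => tv f = v).erase e := by
      ext f
      simp only [Finset.mem_filter, Finset.mem_sdiff, Finset.mem_insert, Finset.mem_erase]
      tauto
    rw [h1]
    by_cases hve : v = tv e
    · subst hve
      rw [Function.update_self, Finset.card_erase_of_mem, h.deg_eq _ hv]
      simp [he, hD]
    · rw [Function.update_of_ne hve, Finset.erase_eq_of_notMem, h.deg_eq _ hv]
      simp [Ne.symm hve]
  have hsrc : ∀ f, f ∈ insert e D → ∃ i, i < t ∧ q i = sv f := fun f hf => by
    rcases Finset.mem_insert.1 hf with rfl | hf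
    · exact ⟨i, hi, hq⟩
    · exact h.src f hf
  refine ⟨by omega, hnot, fun h0 => ⟨hsub, hdeg, h.lt, h.inj, fun v hv => ?_, hsrc, h.ord⟩,
    fun h0 => ?_⟩
  · by_cases hve : v = tv e
    · subst hve
      rw [Function.update_self]
      exact ⟨fun h => absurd h h0, fun ⟨i, hi, hq⟩ => absurd hq (hnot i hi)⟩
    · rw [Function.update_of_ne hve, h.mem v hv]
  · have hq' : ∀ i, i < t → Function.update q t (tv e) i = q i := fun i hi =>
      Function.update_of_ne (by omega) _ _
    have hall : ∀ f, f < m → tv f = tv e → f ∈ insert e D := fun f hf hfe => by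
      have h1 := hdeg _ htn
      rw [Function.update_self, h0, eq_comm, Finset.card_eq_zero, Finset.filter_eq_empty_iff] at h1
      by_contra hfD
      exact h1 (Finset.mem_sdiff.2 ⟨Finset.mem_range.2 hf, hfD⟩) hfe
    refine ⟨hsub, hdeg, fun i hi => ?_, fun i j hi hj hij => ?_, fun v hv => ?_, fun f hf => ?_,
      fun f hf j hj hqj => ?_⟩
    · rcases Nat.lt_succ_iff_lt_or_eq.1 hi with hi | rfl
      · rw [hq' i hi]; exact h.lt i hi
      · rwa [Function.update_self]
    · rcases Nat.lt_succ_iff_lt_or_eq.1 hi with hi | rfl <;>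
        rcases Nat.lt_succ_iff_lt_or_eq.1 hj with hj | rfl
      · rw [hq' i hi, hq' j hj] at hij; exact h.inj i j hi hj hij
      · rw [hq' i hi, Function.update_self] at hij; exact absurd hij (hnot i hi)
      · rw [hq' j hj, Function.update_self] at hij; exact absurd hij.symm (hnot j hj)
      · rfl
    · by_cases hve : v = tv e
      · subst hve
        rw [Function.update_self]
        exact ⟨fun _ => ⟨t, by omega, Function.update_self ..⟩, fun _ => h0⟩
      · rw [Function.update_of_ne hve, h.mem v hv]
        constructor
        · rintro ⟨i, hi, rfl⟩
          exact ⟨i, by omega, hq' i hi⟩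
        · rintro ⟨i, hi, rfl⟩
          rcases Nat.lt_succ_iff_lt_or_eq.1 hi with hi | rfl
          · exact ⟨i, hi, (hq' i hi).symm⟩
          · rw [Function.update_self] at hve; exact absurd rfl hve
    · obtain ⟨i, hi, hf⟩ := hsrc f hf
      exact ⟨i, by omega, by rw [hq' i hi, hf]⟩
    · rcases Nat.lt_succ_iff_lt_or_eq.1 hj with hj | rfl
      · rw [hq' j hj] at hqj
        obtain ⟨i, hi, h1⟩ := h.ord f hf j hj hqj
        exact ⟨i, hi, by rw [hq' i (by omega), h1]⟩
      · rw [Function.update_self] at hqj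
        obtain ⟨i, hi, h1⟩ := hsrc f (hall f hf hqj.symm)
        exact ⟨i, hi, by rw [hq' i hi, h1]⟩

/-- There is no directed cycle. -/
def NoCycle (m : ℕ) (sv tv : ℕ → ℕ) : Prop :=
  WellFounded fun u v => ∃ e, e < m ∧ sv e = u ∧ tv e = v

/-- If the queue ran empty too early, take a minimal vertex outside it. It has an incoming edge that
has not been removed, whose source is then also outside the queue, contrary to minimality. -/
theorem Queue.lt_of_acyclic (h : Queue n m sv tv D q deg t) (hac : NoCycle m sv tv)
    (hsn : ∀ e, e < m → sv e < n) {p : ℕ} (hp : p ≤ t) (hpn : p < n)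
    (hD' : ∀ e, e < m → (∃ i, i < p ∧ q i = sv e) → e ∈ D) : p < t := by
  by_contra hlt
  obtain rfl : p = t := by omega
  have hex : ∃ v, v < n ∧ ∀ i, i < p → q i ≠ v := by
    by_contra! hno
    have : (Finset.range n).card ≤ (Finset.range p).card := by
      refine (Finset.card_le_card fun v hv => ?_).trans (Finset.card_image_le (f := q))
      obtain ⟨i, hi, rfl⟩ := hno v (by simpa using hv)
      exact Finset.mem_image_of_mem _ (by simpa using hi)
    simp at this
    omega
  obtain ⟨v, ⟨hv, hvq⟩, hmin⟩ := hac.has_min {v | v < n ∧ ∀ i, i < p → q i ≠ v} hex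
  have h0 : deg v ≠ 0 := fun h0 => by
    obtain ⟨i, hi, hq⟩ := (h.mem v hv).1 h0
    exact hvq i hi hq
  rw [h.deg_eq v hv, Finset.card_ne_zero] at h0
  obtain ⟨e, he⟩ := h0
  simp only [Finset.mem_filter, Finset.mem_sdiff, Finset.mem_range] at he
  obtain ⟨⟨he, heD⟩, rfl⟩ := he
  exact hmin (sv e) ⟨hsn e he, fun i hi hq => heD (hD' e he ⟨i, hi, hq⟩)⟩ ⟨e, he, rfl, rfl⟩

theorem inDegrees_spec (hm : s.v vM = m) (hB : n + m + 1 ≤ E.B) (ht : s.a aTV = tv)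
    (hd : ∀ v, s.a aDEG v = 0) (htn : ∀ e, e < m → tv e < n) :
    (∀ v, v < n → (run E inDegrees s).a aDEG v =
      ((Finset.range m).filter fun e => tv e = v).card) ∧ cost E inDegrees s ≤ 2 * m + 2 := by
  obtain ⟨a1, t1⟩ := for_frame_const E inDegrees s rfl (fun i s' => ∀ v, v < n →
      s'.a aDEG v = ((Finset.range i).filter fun e => tv e = v).card) 1
    (by simp) (by simp [hd]) (by
      rintro i s' _ hi hS b
      simp only [ev_var, hm] at hi
      have hk' : s'.a aTV = tv := by rw [hS.a _, ht]
      have h1 : ((Finset.range i).filter fun e => tv e = tv i).card ≤ i := by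
        simpa using Finset.card_filter_le (Finset.range i) fun e => tv e = tv i
      simp only [exec, hk', b _ (htn i hi), min_eq_left (show
          ((Finset.range i).filter fun e => tv e = tv i).card + 1 ≤ E.B by omega)]
      refine ⟨fun v hv => ?_, by simp⟩
      rw [Finset.range_add_one, Finset.filter_insert]
      by_cases h : tv i = v
      · subst h; simp
      · rw [if_neg h, Function.update_of_ne (Ne.symm h), b v hv])
  simp only [ev_var, ev_0, hm, Nat.sub_zero] at a1 t1
  exact ⟨a1, t1⟩

theorem initQueue_spec (hn : s.v vN = n) (hB : n + 1 ≤ E.B) (h0 : s.v vT = 0) :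
    ((∀ j, j < (run E (.for vI 0 (V vN) (push vI)) s).v vT →
        (run E (.for vI 0 (V vN) (push vI)) s).a aQ j < n) ∧
      (∀ j k, j < (run E (.for vI 0 (V vN) (push vI)) s).v vT →
        k < (run E (.for vI 0 (V vN) (push vI)) s).v vT →
        (run E (.for vI 0 (V vN) (push vI)) s).a aQ j =
          (run E (.for vI 0 (V vN) (push vI)) s).a aQ k → j = k) ∧
      ∀ v, v < n → (s.a aDEG v = 0 ↔ ∃ j, j < (run E (.for vI 0 (V vN) (push vI)) s).v vT ∧
        (run E (.for vI 0 (V vN) (push vI)) s).a aQ j = v)) ∧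
    cost E (.for vI 0 (V vN) (push vI)) s ≤ 5 * n + 2 := by
  obtain ⟨a3, t3⟩ := for_frame_const E (.for vI 0 (V vN) (push vI))
      s rfl (fun i s' => s'.v vT ≤ i ∧ (∀ j, j < s'.v vT → s'.a aQ j < i) ∧
      (∀ j k, j < s'.v vT → k < s'.v vT → s'.a aQ j = s'.a aQ k → j = k) ∧
      ∀ v, v < i → (s.a aDEG v = 0 ↔ ∃ j, j < s'.v vT ∧ s'.a aQ j = v)) 3
    (by simp) ⟨by simp [h0], by simp [h0], by simp [h0], by simp⟩ (by
      rintro i s' _ hi hS ⟨b1, b2, b3, b4⟩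
      simp only [ev_var, hn] at hi
      have hd' : s'.a aDEG = s.a aDEG := hS.a _
      set τ := s'.v vT with hτ
      have e1 : min (τ + 1) E.B = τ + 1 := by omega
      simp only [push, exec, hd']
      by_cases hi0 : s.a aDEG i = 0
      · simp only [hi0, exec, Nat.reduceEqDiff, ← hτ, e1]
        refine ⟨⟨by omega, fun j hj => ?_, fun j k hj hk h => ?_, fun v hv => ?_⟩, by omega⟩
        · by_cases h : j = τ
          · simp [h]
          · rw [Function.update_of_ne h]; have := b2 j (by omega); omega
        · by_cases hjt : j = τ <;> by_cases hkt : k = τ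
          · omega
          · rw [hjt, Function.update_self, Function.update_of_ne hkt] at h
            have := b2 k (by omega); omega
          · rw [hkt, Function.update_self, Function.update_of_ne hjt] at h
            have := b2 j (by omega); omega
          · rw [Function.update_of_ne hjt, Function.update_of_ne hkt] at h
            exact b3 j k (by omega) (by omega) h
        · by_cases hvi : v = i
          · subst hvi
            exact ⟨fun _ => ⟨τ, by omega, by simp⟩, fun _ => hi0⟩
          · rw [b4 v (by omega)]
            constructor
            · rintro ⟨j, hj, h⟩
              exact ⟨j, by omega, by rw [Function.update_of_ne (by omega), h]⟩
            · rintro ⟨j, hj, h⟩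
              by_cases hjt : j = τ
              · rw [hjt, Function.update_self] at h; omega
              · exact ⟨j, by omega, by rwa [Function.update_of_ne hjt] at h⟩
      · simp only [hi0, exec, Nat.reduceEqDiff, ← hτ]
        refine ⟨⟨by omega, fun j hj => (b2 j hj).trans (by omega), b3, fun v hv => ?_⟩, by omega⟩
        by_cases hvi : v = i
        · subst hvi
          exact ⟨fun h => absurd h hi0, fun ⟨j, hj, h⟩ => by have := b2 j hj; omega⟩
        · exact b4 v (by omega))
  simp only [ev_var, ev_0, hn, Nat.sub_zero] at a3 t3
  exact ⟨a3.2, by omega⟩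

theorem removeEdge_spec {pm : ℕ → ℕ} {j p : ℕ} (hB : n + m + 1 ≤ E.B) (ht : s.a aTV = tv)
    (hpm : s.a aPM = pm) (hj : s.v vJ = j) (hQ : Queue n m sv tv D (s.a aQ) (s.a aDEG) (s.v vT))
    (he : pm j < m) (hD : pm j ∉ D) (hx : tv (pm j) < n) (hpt : p < s.v vT)
    (hp : s.a aQ p = sv (pm j)) :
    Queue n m sv tv (insert (pm j) D) ((run E removeEdge s).a aQ) ((run E removeEdge s).a aDEG)
      ((run E removeEdge s).v vT) ∧ s.v vT ≤ (run E removeEdge s).v vT ∧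
    (∀ i, i < s.v vT → (run E removeEdge s).a aQ i = s.a aQ i) ∧ cost E removeEdge s ≤ 5 := by
  obtain ⟨o1, o2, o3, o4⟩ := hQ.push he hD hx hpt hp
  have hle := hQ.le
  set τ := s.v vT with hτ
  set x := tv (pm j) with hx'
  have e1 : min (τ + 1) E.B = τ + 1 := by omega
  simp only [removeEdge, push, exec, ht, hpm, hj, ← hx', Function.update_self]
  by_cases h0 : s.a aDEG x - 1 = 0
  · simp only [h0, exec, Nat.reduceEqDiff, ← hτ, e1]
    have o5 := o4 h0
    rw [h0] at o5
    exact ⟨o5, by omega, fun i hi => Function.update_of_ne (by omega) _ _, by omega⟩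
  · simp only [h0, exec, Nat.reduceEqDiff, ← hτ]
    exact ⟨o3 h0, le_rfl, fun i hi => trivial, by omega⟩

theorem Sorts.key_eq {key pm off : ℕ → ℕ} (h : Sorts n m key pm off)
    (hk : ∀ e, e < m → key e < n) {j u : ℕ} (hj : j < m) (hu : u < n) :
    key (pm j) = u ↔ off u ≤ j ∧ j < off (u + 1) := by
  have h1 := h.off_le j hj
  have h2 := h.lt_off j hj
  constructor
  · rintro rfl
    exact ⟨h1, h2⟩
  · rintro ⟨h3, h4⟩
    rcases lt_trichotomy (key (pm j)) u with h5 | h5 | h5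
    · have := h.off_mono (key (pm j) + 1) u h5 hu.le; omega
    · exact h5
    · have := h.off_mono (u + 1) (key (pm j)) h5 (hk _ (h.pm_lt j hj)).le; omega

/-- The time is charged to the edges that are removed, at `6` per edge. Each edge is removed only
once, together with its source, so all vertices together cost `O(n + m)`. -/
theorem removeVertex_spec {pm of : ℕ → ℕ} {p : ℕ} (hB : n + m + 1 ≤ E.B) (ht : s.a aTV = tv)
    (hpm : s.a aPM = pm) (hof : s.a aOF = of) (hI : s.v vI = p)
    (hS : Sorts n m sv pm of) (hsn : ∀ e, e < m → sv e < n) (htn : ∀ e, e < m → tv e < n)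
    (hQ : Queue n m sv tv D (s.a aQ) (s.a aDEG) (s.v vT)) (hpt : p < s.v vT)
    (hD : ∀ e, e < m → (e ∈ D ↔ ∃ i, i < p ∧ s.a aQ i = sv e)) :
    ∃ D', Queue n m sv tv D' ((run E removeVertex s).a aQ) ((run E removeVertex s).a aDEG)
      ((run E removeVertex s).v vT) ∧ p < (run E removeVertex s).v vT ∧
    (∀ e, e < m → (e ∈ D' ↔ ∃ i, i < p + 1 ∧ (run E removeVertex s).a aQ i = sv e)) ∧
    cost E removeVertex s + 6 * D.card ≤ 6 * D'.card + 3 := by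
  have hun := hQ.lt p hpt
  simp only [removeVertex, exec, hI]
  set u := s.a aQ p with hu
  have hle := hQ.le
  have hom := (hS.off_mono (u + 1) n hun le_rfl).trans hS.off_n.le
  have m1 : min (u + 1) E.B = u + 1 := by omega
  set s₁ := s.setV vU4 u with hs₁
  have j1 : s₁.a aTV = tv := ht
  have j2 : s₁.a aPM = pm := hpm
  have j3 : s₁.a aOF = of := hof
  have j4 : s₁.v vU4 = u := by simp [hs₁]
  have j5 : s₁.v vT = s.v vT := by simp [hs₁]
  have j6 : s₁.a aQ = s.a aQ := rfl
  have j7 : s₁.a aDEG = s.a aDEG := rfl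
  clear_value s₁
  obtain ⟨t', ⟨D', d1, d2, d3, d4, d5⟩, td⟩ := for_frame E (.for vJ (.rd aOF (V vU4)) (.rd aOF (V vU4 + 1)) removeEdge)
      s₁ rfl
    (fun j s' t => ∃ D', Queue n m sv tv D' (s'.a aQ) (s'.a aDEG) (s'.v vT) ∧
      p < s'.v vT ∧ (∀ i, i ≤ p → s'.a aQ i = s.a aQ i) ∧
      (∀ e, e < m → (e ∈ D' ↔ e ∈ D ∨ ∃ k, of u ≤ k ∧ k < j ∧ pm k = e)) ∧
      t + 6 * D.card ≤ 6 * D'.card)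
    (by
      simp only [exec, j3, j4, m1]
      exact hS.off_mono _ _ (by omega) hun)
    ⟨D, by rwa [j5, j6, j7], by rwa [j5], fun i _ => by rw [j6], fun e he => by
      simp only [ev_rd, ev_var, j3, j4]
      exact ⟨Or.inl, fun h => h.resolve_right (by rintro ⟨k, h1, h2, -⟩; omega)⟩, by omega⟩ (by
      rintro j s' t' hj1 hj2 hSame ⟨D', d1, d2, d3, d4, d5⟩
      simp only [exec, j3, j4, m1] at hj1 hj2
      have hjm : j < m := by omega
      have hem := hS.pm_lt j hjm
      have hsu := (hS.key_eq hsn hjm hun).2 ⟨hj1, hj2⟩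
      have hnD : pm j ∉ D' := fun h => by
        rcases (d4 _ hem).1 h with h | ⟨k, hk1, hk2, h⟩
        · obtain ⟨i, hi, h⟩ := (hD _ hem).1 h
          have := hQ.inj i p (by omega) hpt (by rw [h, hsu]); omega
        · have := hS.inj k j (by omega) hjm h; omega
      obtain ⟨o1, o2, o3, o4⟩ := removeEdge_spec (E := E) (s := s'.setV vJ j) (j := j) (p := p)
        hB (by rw [← j1]; exact hSame.a _) (by rw [← j2]; exact hSame.a _) (by simp)
        (by simpa using d1) hem hnD (htn _ hem) (by simpa using d2) (by simp [d3, hsu, hu])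
      have hv : (s'.setV vJ j).v vT = s'.v vT := by simp
      rw [hv] at o2 o3
      refine ⟨_, o1, by omega, fun i hi => (o3 i (by omega)).trans (d3 i hi), fun e he => ?_, by
        rw [Finset.card_insert_of_notMem hnD]; omega⟩
      rw [Finset.mem_insert, d4 e he]
      constructor
      · rintro (rfl | h | ⟨k, h1, h2, h3⟩)
        · exact Or.inr ⟨j, hj1, by omega, rfl⟩
        · exact Or.inl h
        · exact Or.inr ⟨k, h1, by omega, h3⟩
      · rintro (h | ⟨k, h1, h2, h3⟩)
        · exact Or.inr (Or.inl h)
        · rcases Nat.lt_succ_iff_lt_or_eq.1 h2 with h2 | rfl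
          · exact Or.inr (Or.inr ⟨k, h1, h2, h3⟩)
          · exact Or.inl h3.symm)
  refine ⟨D', d1, d2, fun e he => ?_, by omega⟩
  rw [d4 e he, hD e he]
  simp only [exec, j3, j4, m1]
  constructor
  · rintro (⟨i, hi, h⟩ | ⟨k, hk1, hk2, rfl⟩)
    · exact ⟨i, by omega, by rw [d3 i (by omega), h]⟩
    · exact ⟨p, by omega, by
        rw [d3 p le_rfl]; exact ((hS.key_eq hsn (by omega) hun).2 ⟨hk1, hk2⟩).symm⟩
  · rintro ⟨i, hi, h⟩
    rw [d3 i (by omega)] at h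
    rcases Nat.lt_succ_iff_lt_or_eq.1 hi with hi | rfl
    · exact Or.inl ⟨i, hi, h⟩
    · obtain ⟨k, hk, rfl⟩ := hS.surj he
      obtain ⟨h1, h2⟩ := (hS.key_eq hsn hk hun).1 h.symm
      exact Or.inr ⟨k, h1, h2, rfl⟩

/-- By acyclicity the queue never runs empty before all vertices have entered it; `POS` is the
inverse of the resulting enumeration, and `Queue.ord` says that edges lead forward. -/
theorem topo_spec {pm of : ℕ → ℕ} (hn : s.v vN = n) (hm : s.v vM = m) (hB : n + m + 1 ≤ E.B)
    (ht : s.a aTV = tv) (hpm : s.a aPM = pm) (hof : s.a aOF = of)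
    (hd : ∀ v, s.a aDEG v = 0) (hS : Sorts n m sv pm of) (hsn : ∀ e, e < m → sv e < n)
    (htn : ∀ e, e < m → tv e < n) (hac : NoCycle m sv tv) :
    ((∀ v, v < n → (run E topo s).a aPOS v < n) ∧
      (∀ u v, u < n → v < n → (run E topo s).a aPOS u = (run E topo s).a aPOS v → u = v) ∧
      ∀ e, e < m → (run E topo s).a aPOS (sv e) < (run E topo s).a aPOS (tv e)) ∧
    cost E topo s ≤ 20 * (n + m) + 20 := by
  simp only [topo, run_seq, cost_seq]
  obtain ⟨a1, t1⟩ := inDegrees_spec (E := E) hm hB ht hd htn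
  have n1 := run_v (E := E) inDegrees s vN rfl
  have k1 := run_a (E := E) inDegrees s aTV rfl
  have k2 := run_a (E := E) inDegrees s aPM rfl
  have k3 := run_a (E := E) inDegrees s aOF rfl
  rw [hn] at n1; rw [ht] at k1; rw [hpm] at k2; rw [hof] at k3
  set s₁ := run E inDegrees s
  clear_value s₁
  set s₂ := run E (.asg vT 0) s₁ with hs₂
  have n2 : s₂.v vN = n := by simp [hs₂, n1]
  have d2 : s₂.a aDEG = s₁.a aDEG := rfl
  rw [← d2] at a1
  obtain ⟨a3, t3⟩ := initQueue_spec (E := E) (s := s₂) n2 (by omega) (by simp [hs₂])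
  have n3 := run_v (E := E) (.for vI 0 (V vN) (push vI)) s₂ vN rfl
  have l0 := run_a (E := E) (.for vI 0 (V vN) (push vI)) s₂ aDEG rfl
  have l1 := run_a (E := E) (.for vI 0 (V vN) (push vI)) s₂ aTV rfl
  have l2 := run_a (E := E) (.for vI 0 (V vN) (push vI)) s₂ aPM rfl
  have l3 := run_a (E := E) (.for vI 0 (V vN) (push vI)) s₂ aOF rfl
  rw [n2] at n3
  rw [show s₂.a aTV = tv from k1] at l1
  rw [show s₂.a aPM = pm from k2] at l2
  rw [show s₂.a aOF = of from k3] at l3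
  set s₃ := run E (.for vI 0 (V vN) (push vI)) s₂
  clear_value s₃
  rw [← l0] at a3 a1
  have hQ₀ : Queue n m sv tv ∅ (s₃.a aQ) (s₃.a aDEG) (s₃.v vT) := by
    refine ⟨by simp, fun v hv => by simpa using a1 v hv, a3.1, a3.2.1, a3.2.2, by simp,
      fun e he j hj h => ?_⟩
    have h0 := (a3.2.2 (tv e) (htn e he)).2 ⟨j, hj, h⟩
    rw [a1 _ (htn e he), Finset.card_eq_zero, Finset.filter_eq_empty_iff] at h0
    exact absurd rfl (h0 (Finset.mem_range.2 he))
  obtain ⟨τ, ⟨D, b1, b2, b3, b4⟩, t4⟩ := for_frame E (.for vI 0 (V vN) removeVertex)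
      s₃ rfl
    (fun p s' t => ∃ D, Queue n m sv tv D (s'.a aQ) (s'.a aDEG) (s'.v vT) ∧ p ≤ s'.v vT ∧
      (∀ e, e < m → (e ∈ D ↔ ∃ i, i < p ∧ s'.a aQ i = sv e)) ∧ t ≤ 6 * D.card + 4 * p)
    (by simp) ⟨∅, hQ₀, Nat.zero_le _, by simp, by simp⟩ (by
      rintro p s' t - hp hSame ⟨D, b1, b2, b3, b4⟩
      simp only [ev_var, n3] at hp
      have hpt := b1.lt_of_acyclic hac hsn b2 hp fun e he => (b3 e he).2
      obtain ⟨D', c1, c2, c3, c4⟩ := removeVertex_spec (E := E) (s := s'.setV vI p) (p := p) hB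
        (by rw [← l1]; exact hSame.a _) (by rw [← l2]; exact hSame.a _)
        (by rw [← l3]; exact hSame.a _) (by simp) hS hsn htn (by simpa using b1)
        (by simpa using hpt) (by simpa using b3)
      exact ⟨D', c1, c2, c3, by omega⟩)
  have n5 := run_v (E := E) (.for vI 0 (V vN) removeVertex) s₃ vN rfl
  rw [n3] at n5
  set s₅ := run E (.for vI 0 (V vN) removeVertex) s₃
  clear_value s₅
  simp only [ev_var, n3] at b2 b4
  have hle := b1.le
  have hT : s₅.v vT = n := by omega
  rw [hT] at b1
  have hDm := Finset.card_le_card b1.sub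
  rw [Finset.card_range] at hDm
  obtain ⟨a6, t6⟩ := for_frame_const E (.for vI 0 (V vN) (.wr aPOS (.rd aQ (V vI)) (V vI)))
      s₅ rfl
    (fun i s' => ∀ j, j < i → s'.a aPOS (s₅.a aQ j) = j) 1
    (by simp) (by simp) (by
      rintro i s' _ hi hS b
      simp only [ev_var, n5] at hi
      have hk' : s'.a aQ = s₅.a aQ := hS.a _
      simp only [exec, hk']
      refine ⟨fun j hj => ?_, by simp⟩
      by_cases h : j = i
      · simp [h]
      · rw [Function.update_of_ne, b j (by omega)]
        exact fun h' => h (b1.inj _ _ (by omega) hi h'))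
  simp only [ev_var, ev_0, n5] at a6 t6
  have hsurj : ∀ v, v < n → ∃ i, i < n ∧ s₅.a aQ i = v := fun v hv => surj_of_inj b1.lt b1.inj hv
  refine ⟨⟨fun v hv => ?_, fun u v hu hv h => ?_, fun e he => ?_⟩, ?_⟩
  · obtain ⟨i, hi, rfl⟩ := hsurj v hv
    rwa [a6 i hi]
  · obtain ⟨i, hi, rfl⟩ := hsurj u hu
    obtain ⟨j, hj, rfl⟩ := hsurj v hv
    rw [a6 i hi, a6 j hj] at h
    rw [h]
  · obtain ⟨j, hj, h⟩ := hsurj _ (htn e he)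
    obtain ⟨i, hi, h'⟩ := b1.ord e he j hj h
    rw [← h, ← h', a6 i (by omega), a6 j hj]
    exact hi
  · simp only [cost_asg]
    omega

/-! ## Building the instance -/

/-- The source, the target and the weight of an edge, in the input. -/
abbrev xS (e : Ex) : Ex := .inp (V vN + 3 * e)
abbrev xT (e : Ex) : Ex := .inp (V vN + 3 * e + 1)
abbrev xW (e : Ex) : Ex := .inp (V vN + 3 * e + 2)

def eS (I : ℕ → ℕ) (n e : ℕ) : ℕ := I (n + 3 * e)
def eT (I : ℕ → ℕ) (n e : ℕ) : ℕ := I (n + 3 * e + 1)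
def eW (I : ℕ → ℕ) (n e : ℕ) : ℕ := I (n + 3 * e + 2)

theorem ev_x {x i : ℕ} (hn : s.v vN = n) (hi : s.v x = i) (him : i < m)
    (hB : n + 3 * m ≤ E.B) : ev E s (xS (V x)) = eS E.I n i ∧ ev E s (xT (V x)) = eT E.I n i ∧
      ev E s (xW (V x)) = eW E.I n i := by
  simp only [exec, hn, hi, eS, eT, eW]
  refine ⟨?_, ?_, ?_⟩ <;> congr 1 <;> omega

def copyIn : Cmd :=
  .for vI 0 (V vM) (.wr aKEY (V vI) (xS (V vI)) ;; .wr aTV (V vI) (xT (V vI)))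

theorem copyIn_spec (hn : s.v vN = n) (hm : s.v vM = m) (hB : n + 3 * m ≤ E.B) :
    (∀ e, e < m → (run E copyIn s).a aKEY e = eS E.I n e ∧
      (run E copyIn s).a aTV e = eT E.I n e) ∧ cost E copyIn s ≤ 3 * m + 2 := by
  obtain ⟨a1, t1⟩ := for_frame_const E copyIn s rfl
    (fun i s' => ∀ e, e < i → s'.a aKEY e = eS E.I n e ∧ s'.a aTV e = eT E.I n e) 2
    (by simp) (by simp) (by
      intro i s' _ hi hS b
      simp only [ev_var, hm] at hi
      have h1 : s'.v vN = n := by rw [hS.v _, hn]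
      have h2 := fun s'' => ev_x (E := E) (s := s'') (x := vI) (n := n) (i := i) (m := m)
      have h3 := (h2 (s'.setV vI i) (by simp [h1]) (by simp) hi hB).1
      have h4 := (h2 ((s'.setV vI i).setA aKEY i (eS E.I n i)) (by simp [h1]) (by simp) hi hB).2.1
      simp only [run_seq, run_wr, cost_seq, cost_wr, ev_var, setV_v, if_true, h3]
      simp only [exec, h4]
      refine ⟨fun e he => ?_, le_rfl⟩
      by_cases h : e = i
      · subst h; simp
      · simp [Function.update_of_ne h]; exact b e (by omega))
  simp only [ev_var, ev_0, hm] at a1 t1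
  exact ⟨a1, t1.trans (by omega)⟩

/-- The key and the other end of an edge in the graph with orientation `g`. -/
def pK (g : Bool) (n : ℕ) (pos sv tv : ℕ → ℕ) (e : ℕ) : ℕ :=
  if g then n - 1 - pos (tv e) else pos (sv e)

/-- Build the graph with orientation `g`. -/
def mk (g : Bool) : Cmd :=
  .for vI 0 (V vM) (
    .wr aKEY (V vI) (if g then V vN - 1 - .rd aPOS (xT (V vI)) else .rd aPOS (xS (V vI))) ;;
    .wr aKT (V vI) (if g then V vN - 1 - .rd aPOS (xS (V vI)) else .rd aPOS (xT (V vI)))) ;;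
  csort ;;
  .for vI 0 (V vM) (.wr (aSRC g) (V vI) (.rd aKEY (.rd aPM (V vI))) ;;
    .wr (aTGT g) (V vI) (.rd aKT (.rd aPM (V vI))) ;;
    .wr (aWT g) (V vI) (xW (.rd aPM (V vI)))) ;;
  .for vI 0 (V vN + 1) (.wr (aOFF g) (V vI) (.rd aOF (V vI)))

/-- The edges, with their ends renamed to positions, are sorted by source. For the reversed graph
the ends are exchanged and positions reflected, which `pK` expresses by swapping its last two
function arguments to get the target. -/
theorem mk_spec (g : Bool) {pos : ℕ → ℕ} (hn : s.v vN = n) (hm : s.v vM = m)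
    (hB : n + 3 * m + 1 ≤ E.B) (hpos : s.a aPOS = pos)
    (hlt : ∀ e, e < m → pK g n pos (eS E.I n) (eT E.I n) e < pK g n pos (eT E.I n) (eS E.I n) e)
    (hltn : ∀ e, e < m → pK g n pos (eT E.I n) (eS E.I n) e < n)
    (hinj : ∀ e f, e < m → f < m →
      pK g n pos (eS E.I n) (eT E.I n) e = pK g n pos (eS E.I n) (eT E.I n) f →
      pK g n pos (eT E.I n) (eS E.I n) e = pK g n pos (eT E.I n) (eS E.I n) f → e = f) :
    CSR n m ((run E (mk g) s).a (aSRC g)) ((run E (mk g) s).a (aTGT g))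
      ((run E (mk g) s).a (aWT g)) ((run E (mk g) s).a (aOFF g)) ∧
    (∀ x y c, edg m ((run E (mk g) s).a (aSRC g)) ((run E (mk g) s).a (aTGT g))
      ((run E (mk g) s).a (aWT g)) x y c ↔ ∃ e, e < m ∧ pK g n pos (eS E.I n) (eT E.I n) e = x ∧
        pK g n pos (eT E.I n) (eS E.I n) e = y ∧ eW E.I n e = c) ∧
    cost E (mk g) s ≤ 20 * (n + m) + 40 := by
  set k := pK g n pos (eS E.I n) (eT E.I n) with hk
  set l := pK g n pos (eT E.I n) (eS E.I n) with hl
  simp only [mk, run_seq, cost_seq]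
  set c₁ : Cmd := .wr aKEY (V vI) (if g then V vN - 1 - .rd aPOS (xT (V vI)) else
    .rd aPOS (xS (V vI))) ;; .wr aKT (V vI) (if g then V vN - 1 - .rd aPOS (xS (V vI)) else
    .rd aPOS (xT (V vI))) with hc₁
  obtain ⟨a1, t1⟩ := for_frame_const E (.for vI 0 (V vM) c₁)
      s rfl (fun i s' => ∀ e, e < i → s'.a aKEY e = k e ∧ s'.a aKT e = l e) 2
    (by simp) (by simp) (by
      intro i s' _ hi hS b
      simp only [ev_var, hm] at hi
      have h1 : s'.v vN = n := by rw [hS.v _, hn]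
      have h5 : s'.a aPOS = pos := by rw [hS.a _, hpos]
      have h2 := fun s'' => ev_x (E := E) (s := s'') (x := vI) (n := n) (i := i) (m := m)
      obtain ⟨u1, u2, -⟩ := h2 (s'.setV vI i) (by simp [h1]) (by simp) hi (by omega)
      obtain ⟨w1, w2, -⟩ := h2 ((s'.setV vI i).setA aKEY i (k i)) (by simp [h1]) (by simp) hi
        (by omega)
      have e1 : run E c₁ (s'.setV vI i) = ((s'.setV vI i).setA aKEY i (k i)).setA aKT i (l i) := by
        rw [hc₁, run_seq, run_wr, run_wr]
        have f1 : ev E (s'.setV vI i) (if g then V vN - 1 - .rd aPOS (xT (V vI)) else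
            .rd aPOS (xS (V vI))) = k i := by
          cases g
          · simp only [exec, u1, hk, pK, h5]
          · simp only [exec, u2, hk, pK, h5, h1, Nat.reduceEqDiff]
        rw [f1]
        simp only [exec]
        congr 1
        cases g
        · simp only [exec, w2, hl, pK, h5, Nat.reduceEqDiff]
        · simp only [exec, w1, hl, pK, h5, h1, Nat.reduceEqDiff]
      rw [e1]
      refine ⟨fun e he => ?_, by simp [hc₁]⟩
      by_cases h : e = i
      · subst h; simp
      · simp [Function.update_of_ne h]; exact b e (by omega))
  have n1 := run_v (E := E) (.for vI 0 (V vM) c₁) s vN rfl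
  have m1 := run_v (E := E) (.for vI 0 (V vM) c₁) s vM rfl
  rw [hn] at n1; rw [hm] at m1
  set s₁ := run E (.for vI 0 (V vM) c₁) s
  clear_value s₁
  simp only [ev_var, ev_0, hm, Nat.sub_zero] at a1 t1
  obtain ⟨hS, t2⟩ := csort_spec (E := E) n1 m1 (by omega) fun i hi => by
    rw [(a1 i hi).1]; exact (hlt i hi).trans (hltn i hi)
  have n2 := run_v (E := E) csort s₁ vN rfl
  have m2 := run_v (E := E) csort s₁ vM rfl
  have k2 := run_a (E := E) csort s₁ aKEY rfl
  have l2 := run_a (E := E) csort s₁ aKT rfl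
  rw [n1] at n2; rw [m1] at m2
  set s₂ := run E csort s₁
  rw [← k2] at a1 hS
  rw [← l2] at a1
  clear_value s₂
  set c₃ : Cmd := .wr (aSRC g) (V vI) (.rd aKEY (.rd aPM (V vI))) ;;
    .wr (aTGT g) (V vI) (.rd aKT (.rd aPM (V vI))) ;;
    .wr (aWT g) (V vI) (xW (.rd aPM (V vI))) with hc₃
  obtain ⟨a3, t3⟩ := for_frame_const E (.for vI 0 (V vM) c₃)
      s₂ rfl (fun i s' => ∀ j, j < i → s'.a (aSRC g) j = k (s₂.a aPM j) ∧
      s'.a (aTGT g) j = l (s₂.a aPM j) ∧ s'.a (aWT g) j = eW E.I n (s₂.a aPM j)) 3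
    (by simp) (by simp) (by
      intro i s' _ hi hSame b
      simp only [ev_var, m2] at hi
      have h1 : s'.v vN = n := by rw [hSame.v _, n2]
      have h2 : s'.a aPM = s₂.a aPM := hSame.a _
      have h3 : s'.a aKEY = s₂.a aKEY := hSame.a _
      have h4 : s'.a aKT = s₂.a aKT := hSame.a _
      have h5 := hS.pm_lt i hi
      have q1 : min (3 * s₂.a aPM i) E.B = 3 * s₂.a aPM i := by omega
      have q2 : min (n + 3 * s₂.a aPM i) E.B = n + 3 * s₂.a aPM i := by omega
      have q3 : min (n + 3 * s₂.a aPM i + 2) E.B = n + 3 * s₂.a aPM i + 2 := by omega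
      refine ⟨fun j hj => ?_, by simp [hc₃]⟩
      simp only [hc₃, exec, Nat.reduceEqDiff, h1, h2, h3, h4, q1, q2, q3, (a1 _ h5).1, (a1 _ h5).2]
      by_cases h : j = i
      · subst h; simp [eW]
      · simp only [Function.update_of_ne h]; exact b j (by omega))
  have n3 := run_v (E := E) (.for vI 0 (V vM) c₃) s₂ vN
  have o3 := run_a (E := E) (.for vI 0 (V vM) c₃) s₂ aOF
  rw [n2] at n3
  set s₃ := run E (.for vI 0 (V vM) c₃) s₂
  clear_value s₃
  simp only [ev_var, ev_0, m2, Nat.sub_zero] at a3 t3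
  set c₄ : Cmd := .wr (aOFF g) (V vI) (.rd aOF (V vI)) with hc₄
  obtain ⟨a4, t4⟩ := for_frame_const E (.for vI 0 (V vN + 1) c₄)
      s₃ rfl (fun i s' => ∀ j, j < i → s'.a (aOFF g) j = s₂.a aOF j) 1
    (by simp) (by simp) (by
      intro i s' _ hi hSame b
      have h2 : s'.a aOF = s₂.a aOF := by rw [hSame.a _, o3]
      refine ⟨fun j hj => ?_, by simp [hc₄]⟩
      simp only [hc₄, exec, h2]
      by_cases h : j = i
      · subst h; simp
      · simp only [Function.update_of_ne h]; exact b j (by omega))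
  have x1 := run_a (E := E) (.for vI 0 (V vN + 1) c₄) s₃ (aSRC g)
  have x2 := run_a (E := E) (.for vI 0 (V vN + 1) c₄) s₃ (aTGT g)
  have x3 := run_a (E := E) (.for vI 0 (V vN + 1) c₄) s₃ (aWT g)
  rw [← x1, ← x2, ← x3] at a3
  set s₄ := run E (.for vI 0 (V vN + 1) c₄) s₃
  clear_value s₄
  simp only [exec, n3, Nat.sub_zero, min_eq_left (show n + 1 ≤ E.B by omega)] at a4 t4
  have hkey : ∀ j, j < m → s₂.a aKEY (s₂.a aPM j) = k (s₂.a aPM j) := fun j hj =>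
    (a1 _ (hS.pm_lt j hj)).1
  refine ⟨⟨fun j hj => ?_, fun j hj => ?_, ?_, ?_, fun p q hpq hq => ?_, fun j hj => ?_,
    fun j hj => ?_, fun i j hi hj h1 h2 => ?_⟩, fun x y c => ⟨?_, ?_⟩, by omega⟩
  · rw [(a3 j hj).1, (a3 j hj).2.1]; exact hlt _ (hS.pm_lt j hj)
  · rw [(a3 j hj).2.1]; exact hltn _ (hS.pm_lt j hj)
  · rw [a4 0 (by omega), hS.off_zero]
  · rw [a4 n (by omega), hS.off_n]
  · rw [a4 p (by omega), a4 q (by omega)]; exact hS.off_mono p q hpq hq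
  · have h1 := hlt _ (hS.pm_lt j hj)
    have h2 := hltn _ (hS.pm_lt j hj)
    rw [(a3 j hj).1, a4 _ (by omega), ← hkey j hj]; exact hS.off_le j hj
  · have h1 := hlt _ (hS.pm_lt j hj)
    have h2 := hltn _ (hS.pm_lt j hj)
    rw [(a3 j hj).1, a4 _ (by omega), ← hkey j hj]; exact hS.lt_off j hj
  · rw [(a3 i hi).1, (a3 j hj).1] at h1
    rw [(a3 i hi).2.1, (a3 j hj).2.1] at h2
    exact hS.inj i j hi hj (hinj _ _ (hS.pm_lt i hi) (hS.pm_lt j hj) h1 h2)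
  · rintro ⟨j, hj, rfl, rfl, rfl⟩
    exact ⟨_, hS.pm_lt j hj, (a3 j hj).1.symm, (a3 j hj).2.1.symm, (a3 j hj).2.2.symm⟩
  · rintro ⟨e, he, rfl, rfl, rfl⟩
    obtain ⟨j, hj, rfl⟩ := hS.surj he
    exact ⟨j, hj, (a3 j hj).1, (a3 j hj).2.1, (a3 j hj).2.2⟩

/-! ### Colors, runs and maximal weights. -/

def colors : Cmd :=
  .for vI 0 (V vN) (.wr (aCOL false) (.rd aPOS (V vI)) (.inp (V vI)) ;;
    .wr (aCOL true) (V vN - 1 - .rd aPOS (V vI)) (.inp (V vI)))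

theorem colors_spec {pos : ℕ → ℕ} (hn : s.v vN = n) (hpos : s.a aPOS = pos)
    (hlt : ∀ v, v < n → pos v < n) (hinj : ∀ u v, u < n → v < n → pos u = pos v → u = v) :
    (∀ v, v < n → (run E colors s).a (aCOL false) (pos v) = E.I v ∧
      (run E colors s).a (aCOL true) (n - 1 - pos v) = E.I v) ∧ cost E colors s ≤ 3 * n + 2 := by
  obtain ⟨a1, t1⟩ := for_frame_const E colors s rfl
    (fun i s' => ∀ v, v < i → s'.a (aCOL false) (pos v) = E.I v ∧
      s'.a (aCOL true) (n - 1 - pos v) = E.I v) 2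
    (by simp) (by simp) (by
      intro i s' _ hi hS b
      simp only [ev_var, hn] at hi
      have h1 : s'.v vN = n := by rw [hS.v _, hn]
      have h2 : s'.a aPOS = pos := by rw [hS.a _, hpos]
      refine ⟨fun v hv => ?_, by simp⟩
      simp only [exec, Nat.reduceEqDiff, h1, h2]
      by_cases h : v = i
      · subst h; simp
      · have h3 : pos v ≠ pos i := fun h' => h (hinj v i (by omega) hi h')
        have h4 := hlt v (by omega)
        have h5 := hlt i hi
        rw [Function.update_of_ne h3, Function.update_of_ne (by omega)]
        exact b v (by omega))
  simp only [ev_var, ev_0, hn] at a1 t1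
  exact ⟨a1, t1.trans (by omega)⟩

/-- The maximal blocks of equal values of `col`. -/
structure Blocks (col : ℕ → ℕ) (n R : ℕ) (rs : ℕ → ℕ) : Prop where
  rs_zero : rs 0 = 0
  rs_R : rs R = n
  pos : 1 ≤ R
  lt : ∀ r, r < R → rs r < rs (r + 1)
  const : ∀ r p, r < R → rs r ≤ p → p < rs (r + 1) → col p = col (rs r)
  alt : ∀ r, r + 1 < R → col (rs (r + 1)) ≠ col (rs r)

theorem Blocks.le {col : ℕ → ℕ} {i R : ℕ} {rs : ℕ → ℕ} (h : Blocks col i R rs) : R ≤ i := by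
  have : ∀ r, r ≤ R → r ≤ rs r := fun r hr => by
    induction r with
    | zero => omega
    | succ r ih => have := ih (by omega); have := h.lt r hr; omega
  rw [← h.rs_R]
  exact this R le_rfl

/-- The end of the last run is a sentinel at place `R`. A vertex of the same color moves it by one;
a vertex of the other color turns it into the start of a new run and adds a new sentinel. The
program writes the sentinel just once, at the end, so the invariant speaks of the updated function.
-/
theorem Blocks.extend {col : ℕ → ℕ} {i R : ℕ} {rs : ℕ → ℕ}
    (h : Blocks col i R (Function.update rs R i)) (hi : 1 ≤ i) :
    (col i = col (i - 1) → Blocks col (i + 1) R (Function.update rs R (i + 1))) ∧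
    (col i ≠ col (i - 1) → Blocks col (i + 1) (R + 1)
      (Function.update (Function.update rs R i) (R + 1) (i + 1))) := by
  obtain ⟨h1, -, h3, h4, h5, h6⟩ := h
  obtain ⟨Q, rfl⟩ : ∃ Q, R = Q + 1 := ⟨R - 1, by omega⟩
  have hlast : ∀ p, rs Q ≤ p → p < i → col p = col (rs Q) := fun p hp hpi => by
    have := h5 Q p (by omega)
    rw [Function.update_self, Function.update_of_ne (by omega)] at this
    exact this hp hpi
  have hQ : rs Q < i := by
    have := h4 Q (by omega)
    rwa [Function.update_self, Function.update_of_ne (by omega)] at this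
  constructor
  · intro hc
    have key : ∀ r, r < Q + 1 → Function.update rs (Q + 1) (i + 1) r = rs r := fun r hr =>
      Function.update_of_ne (by omega) _ _
    have key' : ∀ r, r < Q + 1 → Function.update rs (Q + 1) i r = rs r := fun r hr =>
      Function.update_of_ne (by omega) _ _
    refine ⟨by rw [key 0 (by omega), ← key' 0 (by omega), h1], Function.update_self .., h3,
      fun r hr => ?_, fun r p hr hp hp' => ?_, fun r hr => ?_⟩
    · by_cases hrQ : r = Q
      · subst hrQ; rw [Function.update_self, key r hr]; omega
      · have := h4 r hr
        rwa [key' _ hr, key' _ (by omega), ← key _ hr, ← key _ (by omega)] at this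
    · rw [key r hr] at hp ⊢
      by_cases hrQ : r = Q
      · subst hrQ
        rw [Function.update_self] at hp'
        rcases Nat.lt_succ_iff_lt_or_eq.1 hp' with hp' | rfl
        · exact hlast p hp hp'
        · rw [hc]; exact hlast _ (by omega) (by omega)
      · rw [key _ (by omega)] at hp'
        have := h5 r p hr
        rw [key' _ hr, key' _ (by omega)] at this
        exact this hp hp'
    · have := h6 r hr
      rwa [key' _ (by omega), key' _ (by omega), ← key _ (by omega), ← key _ (by omega)] at this
  · intro hc
    have key : ∀ r, r < Q + 2 → Function.update (Function.update rs (Q + 1) i) (Q + 1 + 1) (i + 1) r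
        = Function.update rs (Q + 1) i r := fun r hr => Function.update_of_ne (by omega) _ _
    refine ⟨by rw [key 0 (by omega), h1], Function.update_self .., by omega,
      fun r hr => ?_, fun r p hr hp hp' => ?_, fun r hr => ?_⟩
    · rw [key r (by omega)]
      by_cases hrQ : r = Q + 1
      · subst hrQ; rw [Function.update_self, Function.update_self]; omega
      · rw [key _ (by omega)]; exact h4 r (by omega)
    · rw [key r hr] at hp ⊢
      by_cases hrQ : r = Q + 1
      · subst hrQ
        rw [Function.update_self] at hp hp' ⊢
        rw [show p = i by omega]
      · rw [key _ (by omega)] at hp'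
        exact h5 r p (by omega) hp hp'
    · rw [key r (by omega), key _ (by omega)]
      by_cases hrQ : r = Q
      · subst hrQ
        rw [Function.update_self, Function.update_of_ne (by omega)]
        rwa [← hlast (i - 1) (by omega) (by omega)]
      · exact h6 r (by omega)

def blocks : Cmd :=
  .wr aRS 0 0 ;; .asg vR 1 ;;
  .for vI 1 (V vN) (.ite (.eq (.rd (aCOL false) (V vI)) (.rd (aCOL false) (V vI - 1))) .skip
    (.wr aRS (V vR) (V vI) ;; .asg vR (V vR + 1))) ;;
  .wr aRS (V vR) (V vN)

theorem blocks_spec {col : ℕ → ℕ} (hn : s.v vN = n) (hcol : s.a (aCOL false) = col) (hn1 : 1 ≤ n)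
    (hB : n + 1 ≤ E.B) :
    Blocks col n ((run E blocks s).v vR) ((run E blocks s).a aRS) ∧
      cost E blocks s ≤ 4 * n + 5 := by
  simp only [blocks, run_seq, cost_seq, cost_wr, cost_asg]
  set s₁ := run E (.asg vR 1) (run E (.wr aRS 0 0) s) with hs₁
  have g1 : s₁.v vN = n := by simp [hs₁, hn]
  have g2 : s₁.a (aCOL false) = col := by simp [hs₁, hcol]
  have g3 : s₁.v vR = 1 := by simp [hs₁]
  have g4 : s₁.a aRS 0 = 0 := by simp [hs₁]
  clear_value s₁
  obtain ⟨a1, t1⟩ := for_frame_const E (.for vI 1 (V vN) (.ite (.eq (.rd (aCOL false) (V vI)) (.rd (aCOL false) (V vI - 1))) .skip (.wr aRS (V vR) (V vI) ;; .asg vR (V vR + 1))))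
      s₁ rfl
    (fun i s' => Blocks col i (s'.v vR) (Function.update (s'.a aRS) (s'.v vR) i)) 3
    (by simpa [g1] using hn1) (by
      rw [g3]
      refine ⟨by simp [g4], by simp, le_rfl, ?_, ?_, ?_⟩
      · intro r hr; obtain rfl : r = 0 := by omega
        simp [g4]
      · intro r p hr h1 h2; obtain rfl : r = 0 := by omega
        simp at h1 h2
        simp [g4, h2]
      · intro r hr; omega) (by
      intro i s' hi1 hi hS b
      simp only [ev_var, ev_1, g1] at hi hi1
      have h1 : s'.a (aCOL false) = col := by rw [hS.a _, g2]
      obtain ⟨e1, e2⟩ := b.extend hi1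
      have hle := b.le
      have e3 : min (s'.v vR + 1) E.B = s'.v vR + 1 := by omega
      simp only [exec, h1]
      by_cases h0 : col i = col (i - 1)
      · simp only [h0, exec, Nat.reduceEqDiff]
        exact ⟨e1 h0, by omega⟩
      · simp only [h0, exec, Nat.reduceEqDiff, e3]
        exact ⟨e2 h0, by omega⟩)
  have n2 := run_v (E := E) (.for vI 1 (V vN) (.ite (.eq (.rd (aCOL false) (V vI))
    (.rd (aCOL false) (V vI - 1))) .skip (.wr aRS (V vR) (V vI) ;; .asg vR (V vR + 1)))) s₁ vN rfl
  rw [g1] at n2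
  simp only [ev_var, ev_1, g1] at a1 t1
  refine ⟨?_, by omega⟩
  simp only [exec, n2]
  exact a1

/-- The largest weight times `n` bounds every finite distance, since positions increase along a
walk. It serves as the upper end of the binary search. -/
def maxima : Cmd :=
  .for vI 0 (V vM) (.when (.lt (V vKmax) (xW (V vI))) (.asg vKmax (xW (V vI))) ;;
    .ite (.eq (.inp (xS (V vI))) (.inp (xT (V vI)))) .skip
      (.when (.lt (V vM0) (xW (V vI))) (.asg vM0 (xW (V vI))))) ;;
  .asg vKmax (V vKmax * V vN)

/-- The largest weight of an edge between vertices of different colors. -/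
def supW (I : ℕ → ℕ) (n m : ℕ) : ℕ :=
  ((Finset.range m).filter fun e => I (eS I n e) ≠ I (eT I n e)).sup (eW I n)

theorem maxima_spec (hn : s.v vN = n) (hm : s.v vM = m) (hB : n + 3 * m ≤ E.B)
    (hK : s.v vKmax = 0) (hM : s.v vM0 = 0) :
    (run E maxima s).v vKmax = min ((Finset.range m).sup (eW E.I n) * n) E.B ∧
    (run E maxima s).v vM0 = supW E.I n m ∧ cost E maxima s ≤ 6 * m + 3 := by
  simp only [maxima, exec]
  set c₁ : Cmd := .when (.lt (V vKmax) (xW (V vI))) (.asg vKmax (xW (V vI))) with hc₁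
  set c₂ : Cmd := .ite (.eq (.inp (xS (V vI))) (.inp (xT (V vI)))) .skip
    (.when (.lt (V vM0) (xW (V vI))) (.asg vM0 (xW (V vI)))) with hc₂
  obtain ⟨a1, t1⟩ := for_frame_const E (.for vI 0 (V vM) (c₁ ;; c₂))
      s rfl
    (fun i s' => s'.v vKmax = (Finset.range i).sup (eW E.I n) ∧ s'.v vM0 = supW E.I n i) 5
    (by simp) (by simp [hK, hM, supW]) (by
      intro i s' _ hi hS ⟨b1, b2⟩
      simp only [ev_var, hm] at hi
      have h1 : s'.v vN = n := by rw [hS.v _, hn]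
      have h2 := fun s'' => ev_x (E := E) (s := s'') (x := vI) (n := n) (i := i) (m := m)
      obtain ⟨u1, u2, u3⟩ := h2 (s'.setV vI i) (by simp [h1]) (by simp) hi (by omega)
      have e0 : run E c₁ (s'.setV vI i) =
          (s'.setV vI i).setV vKmax (max (s'.v vKmax) (eW E.I n i)) ∨
          run E c₁ (s'.setV vI i) = s'.setV vI i ∧ eW E.I n i ≤ s'.v vKmax := by
        simp only [hc₁, run_ite, ev_lt, run_skip, run_asg, u3]
        simp only [exec, Nat.reduceEqDiff]
        by_cases h : s'.v vKmax < eW E.I n i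
        · left
          simp only [if_pos h, one_ne_zero, if_false, max_eq_right h.le]
        · right
          simp only [if_neg h, if_true, true_and]
          omega
      have e1 : (run E c₁ (s'.setV vI i)).v vKmax = max (s'.v vKmax) (eW E.I n i) := by
        rcases e0 with e | ⟨e, h⟩
        · rw [e]; simp
        · rw [e, max_eq_left h]; simp
      have e2 := run_v (E := E) c₁ (s'.setV vI i) vM0 rfl
      have e3 := run_v (E := E) c₁ (s'.setV vI i) vN rfl
      have e4 := run_v (E := E) c₁ (s'.setV vI i) vI rfl
      simp only [exec, Nat.reduceEqDiff, h1] at e2 e3 e4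
      rw [run_seq, cost_seq]
      have t0 : cost E c₁ (s'.setV vI i) ≤ 2 := by
        simp only [hc₁, exec]; omega
      set s₁ := run E c₁ (s'.setV vI i)
      clear_value s₁
      obtain ⟨w1, w2, w3⟩ := h2 s₁ e3 e4 hi (by omega)
      have f1 := run_v (E := E) c₂ s₁ vKmax rfl
      refine ⟨⟨?_, ?_⟩, ?_⟩
      · rw [f1, e1, b1, Finset.range_add_one, Finset.sup_insert, max_comm]
      · unfold supW at b2 ⊢
        rw [Finset.range_add_one, Finset.filter_insert]
        simp only [hc₂, exec, ev_inp _ (xS _), ev_inp _ (xT _), w1, w2, w3]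
        by_cases hc : E.I (eS E.I n i) = E.I (eT E.I n i)
        · simp only [hc, exec, ne_eq, not_true]
          rw [e2, b2]
        · simp only [hc, if_true, if_false, ne_eq, not_false_iff]
          rw [Finset.sup_insert]
          by_cases h : s₁.v vM0 < eW E.I n i
          · simp only [h, exec]
            rw [e2, b2] at h
            exact (sup_eq_left.2 h.le).symm
          · simp only [h, if_true, if_false]
            rw [e2, b2] at h ⊢
            exact (sup_eq_right.2 (not_lt.1 h)).symm
      · have : cost E c₂ s₁ ≤ 3 := by
          simp only [hc₂, exec]
          split_ifs <;> omega
        omega)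
  have n2 := run_v (E := E) (.for vI 0 (V vM) (c₁ ;; c₂)) s vN rfl
  rw [hn] at n2
  simp only [ev_var, ev_0, hm] at a1 t1
  refine ⟨?_, ?_, by omega⟩
  · simp only [exec, n2, a1.1]
  · simp only [exec, a1.2]

/-! ## The parameters -/

/-- Powers, as expressions. -/
def pw (e : Ex) : ℕ → Ex
  | 0 => 1
  | k + 1 => pw e k * e

theorem ev_pw {e : Ex} {a k : ℕ} (he : ev E s e = a) (h : a ^ k ≤ E.B) (ha : 1 ≤ a) :
    ev E s (pw e k) = a ^ k := by
  induction k with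
  | zero => rfl
  | succ k ih =>
    rw [pw, ev_mul, ih ((Nat.pow_le_pow_right ha (by omega)).trans h), he, ← pow_succ]
    exact min_eq_left h

theorem find_spec {x N : ℕ} {g : Ex} (hN : 1 ≤ N) (hB : N < E.B)
    (hg : ev E (s.setV x N) g = 0) :
    ∃ i, 1 ≤ i ∧ i ≤ N ∧ run E (.loop x 1 .top g .skip) s = s.setV x i ∧
      ev E (s.setV x i) g = 0 ∧ (i = 1 ∨ ev E (s.setV x (i - 1)) g ≠ 0) ∧
      cost E (.loop x 1 .top g .skip) s ≤ 2 * N + 2 := by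
  have hset : ∀ (s' : St) i j, (s'.setV x i).setV x j = s'.setV x j := fun s' i j => by
    simp [St.setV]
  obtain ⟨i, s', t, ⟨h1, h2, h3, h4, h5⟩, ht, hc⟩ := loop_rule (E := E) (x := x) (lo := 1)
    (hi := .top) (g := g) (c := .skip) (s := s)
    (fun i s' t => (∀ j, s'.setV x j = s.setV x j) ∧ 1 ≤ i ∧ i ≤ N ∧
      (i = 1 ∨ ev E (s.setV x (i - 1)) g ≠ 0) ∧ t + 2 = 2 * i)
    ⟨fun _ => rfl, le_rfl, hN, Or.inl rfl, by simp⟩ (by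
      rintro i s' t - - ⟨h1, h2, h3, h4, h5⟩ h6
      rw [h1] at h6
      have hne : i ≠ N := fun h => h6 (by rw [h, hg])
      exact ⟨fun j => by rw [run_skip, hset, h1], by omega, by omega, Or.inr (by simpa using h6),
        by rw [cost_skip]; omega⟩)
  rcases hc with ⟨-, h6, h7⟩ | ⟨h6, -⟩
  · rw [h1] at h6 h7
    exact ⟨i, h2, h3, h7, h6, h4, by omega⟩
  · simp at h6; omega

/-- The smallest positive `x` with `x ^ k * a ≥ b`. -/
def IsRoot (k a b x : ℕ) : Prop := 1 ≤ x ∧ b ≤ x ^ k * a ∧ (x = 1 ∨ (x - 1) ^ k * a < b)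

def root (x k : ℕ) (a b : Ex) : Cmd := .loop x 1 .top (.lt (pw (V x) k * a) b) .skip

theorem root_spec {x k : ℕ} {a b : Ex} {va vb : ℕ} (hn : 1 ≤ n)
    (ha : ∀ i, ev E (s.setV x i) a = va) (hb : ∀ i, ev E (s.setV x i) b = vb)
    (h : vb ≤ n ^ k * va) (hB : n ^ k * va ≤ E.B) (hk : n ^ k ≤ E.B) (hnB : n < E.B) :
    ∃ i, i ≤ n ∧ run E (root x k a b) s = s.setV x i ∧ IsRoot k va vb i ∧
      cost E (root x k a b) s ≤ 2 * n + 2 := by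
  have hev : ∀ i, 1 ≤ i → i ≤ n → (ev E (s.setV x i) (.lt (pw (V x) k * a) b) = 0 ↔
      vb ≤ i ^ k * va) := fun i hi hin => by
    have h1 : i ^ k ≤ n ^ k := Nat.pow_le_pow_left hin k
    have h2 := Nat.mul_le_mul_right va h1
    rw [ev_lt, ev_mul, ha, hb, ev_pw (a := i) (by simp) (h1.trans hk) hi, min_eq_left (h2.trans hB)]
    simp
  obtain ⟨i, h1, h2, h3, h4, h5, h6⟩ := find_spec (E := E) (s := s) (x := x) hn hnB
    ((hev n hn le_rfl).2 h)
  refine ⟨i, h2, h3, ⟨h1, (hev i h1 h2).1 h4, ?_⟩, h6⟩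
  by_cases hi : i = 1
  · exact Or.inl hi
  · right
    have := h5.resolve_left hi
    rw [ne_eq, hev _ (by omega) (by omega)] at this
    omega

/-- The choice of the parameters. -/
structure Params (n m kk hh dense bw : ℕ) : Prop where
  of_sparse : dense = 0 → m ^ 5 < n ^ 7 ∧ IsRoot 3 m (n ^ 2) kk ∧ IsRoot 3 n (m ^ 2) hh
  of_dense : dense ≠ 0 → n ^ 7 ≤ m ^ 5 ∧ IsRoot 2 n m kk ∧ hh = n + 1
  kk_pos : 1 ≤ kk
  kk_le : kk ≤ n
  bw_root : IsRoot 2 1 n bw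
  bw_le : bw ≤ n

/-- The comparison of `m ^ 5` with `n ^ 7` decides which of the two terms of the time bound is
smaller. In the sparse case `kk` is about `(n ^ 2 / m) ^ (1 / 3)` and `hh` about `(m ^ 2 / n) ^ (1 /
3)`; in the dense case `kk` is about `(m / n) ^ (1 / 2)`, and `hh = n + 1` exceeds all degrees, so
that no vertex counts as high. Trying all candidates up to `n` costs only linear time. -/
def params : Cmd :=
  .asg vDense (.eq (.lt (pw (V vM) 5) (pw (V vN) 7)) 0) ;;
  .ite (V vDense) (root vKH 2 (V vN) (V vM) ;; .asg vHH (V vN + 1))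
    (root vKH 3 (V vM) (pw (V vN) 2) ;; root vHH 3 (V vN) (pw (V vM) 2)) ;;
  root vBW 2 1 (V vN)

theorem params_spec (hn : s.v vN = n) (hm : s.v vM = m) (hn2 : 2 ≤ n) (hm1 : 1 ≤ m)
    (hm2 : m ≤ n ^ 2) (hB : n ^ 10 ≤ E.B) :
    Params n m ((run E params s).v vKH) ((run E params s).v vHH) ((run E params s).v vDense)
      ((run E params s).v vBW) ∧ cost E params s ≤ 6 * n + 9 := by
  have hpow : ∀ k, k ≤ 10 → n ^ k ≤ E.B := fun k hk =>
    (Nat.pow_le_pow_right (by omega) hk).trans hB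
  -- As `m ≤ n ^ 2`, the power `m ^ 5` is at most `n ^ 10`, which accounts for the exponent in `hB`.
  have hpm : ∀ k, k ≤ 5 → m ^ k ≤ E.B := fun k hk => by
    refine (Nat.pow_le_pow_left hm2 k).trans ?_
    rw [← pow_mul]
    exact hpow _ (by omega)
  have hn1 : n + 1 ≤ E.B := by
    have h1 := hpow 2 (by omega)
    nlinarith
  have c1 : n ^ 3 * m ≤ n ^ 5 := by
    calc n ^ 3 * m ≤ n ^ 3 * n ^ 2 := Nat.mul_le_mul_left _ hm2
      _ = n ^ 5 := by ring
  have c2 : m ^ 2 ≤ n ^ 3 * n := by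
    calc m ^ 2 ≤ (n ^ 2) ^ 2 := Nat.pow_le_pow_left hm2 2
      _ = n ^ 3 * n := by ring
  have c3 : n ^ 2 ≤ n ^ 3 * m := by
    calc n ^ 2 ≤ n ^ 3 := Nat.pow_le_pow_right (by omega) (by omega)
      _ ≤ n ^ 3 * m := Nat.le_mul_of_pos_right _ hm1
  have c4 : m ≤ n ^ 2 * n := hm2.trans (Nat.le_mul_of_pos_right _ (by omega))
  have c5 : n ≤ n ^ 2 * 1 := by nlinarith
  simp only [params, run_seq, cost_seq]
  have hd : ev E s (.eq (.lt (pw (V vM) 5) (pw (V vN) 7)) 0) = if m ^ 5 < n ^ 7 then 0 else 1 := by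
    rw [ev_eq, ev_lt, ev_pw (a := m) (by simpa using hm) (hpm 5 le_rfl) hm1,
      ev_pw (a := n) (by simpa using hn) (hpow 7 (by omega)) (by omega), ev_0]
    split_ifs <;> simp_all
  rw [run_asg, hd, cost_asg]
  set s₁ := s.setV vDense (if m ^ 5 < n ^ 7 then 0 else 1) with hs₁
  have n1 : s₁.v vN = n := by simp [hs₁, hn]
  have m1 : s₁.v vM = m := by simp [hs₁, hm]
  have d1 : s₁.v vDense = if m ^ 5 < n ^ 7 then 0 else 1 := by simp [hs₁]
  clear_value s₁
  set c₂ : Cmd := .ite (V vDense) (root vKH 2 (V vN) (V vM) ;; .asg vHH (V vN + 1))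
    (root vKH 3 (V vM) (pw (V vN) 2) ;; root vHH 3 (V vN) (pw (V vM) 2)) with hc₂
  have key : ∃ kk hh, run E c₂ s₁ = (s₁.setV vKH kk).setV vHH hh ∧ 1 ≤ kk ∧ kk ≤ n ∧
      (m ^ 5 < n ^ 7 → IsRoot 3 m (n ^ 2) kk ∧ IsRoot 3 n (m ^ 2) hh) ∧
      (¬ m ^ 5 < n ^ 7 → IsRoot 2 n m kk ∧ hh = n + 1) ∧ cost E c₂ s₁ ≤ 4 * n + 5 := by
    simp only [hc₂, run_ite, cost_ite, ev_var, d1]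
    by_cases hsp : m ^ 5 < n ^ 7
    · simp only [hsp, if_true]
      obtain ⟨k, k1, k2, k3, k4⟩ := root_spec (E := E) (s := s₁) (x := vKH) (k := 3) (a := V vM)
        (b := pw (V vN) 2) (va := m) (vb := n ^ 2) (n := n) (by omega) (by simp [m1])
        (fun i => ev_pw (by simp [n1]) (hpow 2 (by omega)) (by omega)) c3
        (c1.trans (hpow 5 (by omega))) (hpow 3 (by omega)) (by omega)
      obtain ⟨h, h1, h2, h3, h4⟩ := root_spec (E := E) (s := s₁.setV vKH k) (x := vHH) (k := 3)
        (a := V vN) (b := pw (V vM) 2) (va := n) (vb := m ^ 2) (n := n) (by omega) (by simp [n1])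
        (fun i => ev_pw (by simp [m1]) (hpm 2 (by omega)) (by omega)) c2
        (by rw [← pow_succ]; exact hpow 4 (by omega)) (hpow 3 (by omega)) (by omega)
      refine ⟨k, h, by rw [run_seq, k2, h2], k3.1, k1, fun _ => ⟨k3, h3⟩, fun h => absurd trivial h,
        ?_⟩
      rw [cost_seq, k2]
      omega
    · simp only [hsp, if_false, one_ne_zero]
      obtain ⟨k, k1, k2, k3, k4⟩ := root_spec (E := E) (s := s₁) (x := vKH) (k := 2) (a := V vN)
        (b := V vM) (va := n) (vb := m) (n := n) (by omega) (by simp [n1])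
        (by simp [m1]) c4 (by rw [← pow_succ]; exact hpow 3 (by omega)) (hpow 2 (by omega))
        (by omega)
      refine ⟨k, n + 1, ?_, k3.1, k1, fun h => h.elim, fun _ => ⟨k3, rfl⟩, ?_⟩
      · rw [run_seq, k2, run_asg]
        simp [n1, hn1]
      · rw [cost_seq, cost_asg]
        omega
  obtain ⟨kk, hh, e1, e2, e3, e4, e5, e6⟩ := key
  rw [e1]
  obtain ⟨b, b1, b2, b3, b4⟩ := root_spec (E := E) (s := (s₁.setV vKH kk).setV vHH hh) (x := vBW)
    (k := 2) (a := 1) (b := V vN) (va := 1) (vb := n) (n := n) (by omega) (by simp) (by simp [n1])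
    c5 (by simpa using hpow 2 (by omega)) (hpow 2 (by omega)) (by omega)
  rw [b2]
  refine ⟨?_, by omega⟩
  simp only [exec, Nat.reduceEqDiff, d1]
  refine ⟨fun h => ?_, fun h => ?_, e2, e3, b3, b1⟩
  · by_cases hsp : m ^ 5 < n ^ 7
    · exact ⟨hsp, e4 hsp⟩
    · simp [hsp] at h
  · by_cases hsp : m ^ 5 < n ^ 7
    · simp [hsp] at h
    · exact ⟨not_lt.1 hsp, e5 hsp⟩

/-! ## The complete program -/

/-- Build the instance from the input. -/
def build : Cmd :=
  copyIn ;; csort ;; topo ;; mk false ;; mk true ;; colors ;; blocks ;; maxima ;; params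

/-- What the input satisfies. -/
structure InputOK (I : ℕ → ℕ) (n m : ℕ) : Prop where
  two_le : 2 ≤ n
  pos : 1 ≤ m
  le_sq : m ≤ n ^ 2
  src_lt : ∀ e, e < m → eS I n e < n
  tgt_lt : ∀ e, e < m → eT I n e < n
  inj : ∀ e f, e < m → f < m → eS I n e = eS I n f → eT I n e = eT I n f → e = f
  acyclic : NoCycle m (eS I n) (eT I n)
  col_le : ∀ v, v < n → I v ≤ 1

/-- `T` is the input graph, with its vertices in the order `pos`. -/
structure Represents (I : ℕ → ℕ) (n m : ℕ) (T : Inst) (pos : ℕ → ℕ) : Prop where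
  n_eq : T.n = n
  m_eq : T.m = m
  runs : RunsOK T
  params : Params n m T.kk T.hh T.dense T.bw
  lt : ∀ v, v < n → pos v < n
  inj : ∀ u v, u < n → v < n → pos u = pos v → u = v
  edge : ∀ x y c, T.E false x y c ↔
    ∃ e, e < m ∧ pos (eS I n e) = x ∧ pos (eT I n e) = y ∧ eW I n e = c
  col : ∀ v, v < n → T.col false (pos v) = I v

/-- The scalar inputs, before the parameters are set. -/
structure Header (n m : ℕ) (s : St) : Prop where
  n : s.v vN = n
  m : s.v vM = m
  kmax : s.v vKmax = 0
  m0 : s.v vM0 = 0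
  k : s.v vK = 0

theorem Header.run (h : Header n m s) (c : Cmd) (hc : (c.wv vN || c.wv vM || c.wv vKmax ||
    c.wv vM0 || c.wv vK) = false := by rfl) : Header n m (run E c s) := by
  simp only [Bool.or_eq_false_iff] at hc
  obtain ⟨⟨⟨⟨h1, h2⟩, h3⟩, h4⟩, h5⟩ := hc
  exact ⟨(run_v _ _ _ h1).trans h.n, (run_v _ _ _ h2).trans h.m, (run_v _ _ _ h3).trans h.kmax,
    (run_v _ _ _ h4).trans h.m0, (run_v _ _ _ h5).trans h.k⟩

theorem build_spec (hI : InputOK E.I n m) (hB : n ^ 10 ≤ E.B) :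
    ∃ T pos, Represents E.I n m T pos ∧ Holds T 0 (run E build (.init n m)) ∧
      (run E build (.init n m)).v vKmax = min ((Finset.range m).sup (eW E.I n) * n) E.B ∧
      (run E build (.init n m)).v vM0 = supW E.I n m ∧
      cost E build (.init n m) ≤ 200 * (n + m) := by
  have hn2 := hI.two_le
  have hm1 := hI.pos
  have hnm : n + 3 * m + 1 ≤ E.B := by
    have h1 := hI.le_sq
    have h2 : 2 ^ 8 * n ^ 2 ≤ n ^ 10 := by
      rw [show n ^ 10 = n ^ 8 * n ^ 2 by ring]
      exact Nat.mul_le_mul_right _ (Nat.pow_le_pow_left hn2 8)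
    nlinarith
  simp only [build, run_seq, cost_seq]
  obtain ⟨a1, t1⟩ := copyIn_spec (E := E) (s := .init n m) (n := n) (m := m) rfl rfl (by omega)
  set s₁ := run E copyIn (.init n m) with hs₁
  have n1 : Header n m s₁ := (Header.mk (s := .init n m) rfl rfl rfl rfl rfl).run _
  have z4 : s₁.a aDEG = fun _ => 0 := run_a (E := E) copyIn _ aDEG rfl
  clear_value s₁
  obtain ⟨hS, t2⟩ := csort_spec (E := E) n1.n n1.m (by omega) fun i hi => by
    rw [(a1 i hi).1]; exact hI.src_lt i hi
  set s₂ := run E csort s₁ with hs₂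
  have n2 : Header n m s₂ := n1.run _
  have z5 : s₂.a aDEG = fun _ => 0 := (run_a csort _ _).trans z4
  have k2 : s₂.a aTV = s₁.a aTV := run_a csort _ _
  rw [← k2] at a1
  clear_value s₂
  obtain ⟨⟨p1, p2, p3⟩, t3⟩ := topo_spec (E := E) n2.n n2.m (by omega) rfl rfl rfl (by simp [z5]) hS
    (fun e he => by rw [(a1 e he).1]; exact hI.src_lt e he)
    (fun e he => by rw [(a1 e he).2]; exact hI.tgt_lt e he)
    (hI.acyclic.mono fun u v ⟨e, he, h1, h2⟩ => ⟨e, he, by rw [← h1, (a1 e he).1],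
      by rw [← h2, (a1 e he).2]⟩)
  have n3 : Header n m (run E topo s₂) := n2.run _
  set s₃ := run E topo s₂
  clear_value s₃
  set pos := s₃.a aPOS with hpos
  replace p3 : ∀ e, e < m → pos (eS E.I n e) < pos (eT E.I n e) := fun e he => by
    have := p3 e he
    rwa [(a1 e he).1, (a1 e he).2] at this
  have hps : ∀ e, e < m → pos (eS E.I n e) < n := fun e he => p1 _ (hI.src_lt e he)
  have hpt : ∀ e, e < m → pos (eT E.I n e) < n := fun e he => p1 _ (hI.tgt_lt e he)
  obtain ⟨f1, f2, t4⟩ := mk_spec (E := E) (s := s₃) false (pos := pos) n3.n n3.m hnm rfl p3 hpt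
    (fun e f he hf h1 h2 => hI.inj e f he hf (p2 _ _ (hI.src_lt e he) (hI.src_lt f hf) h1)
      (p2 _ _ (hI.tgt_lt e he) (hI.tgt_lt f hf) h2))
  set s₄ := run E (mk false) s₃ with hs₄
  have n4 : Header n m s₄ := n3.run _
  have o4 : s₄.a aPOS = pos := run_a (mk false) _ _
  clear_value s₄
  obtain ⟨g1, g2, t5⟩ := mk_spec (E := E) (s := s₄) true (pos := pos) n4.n n4.m hnm o4
    (fun e he => by have := p3 e he; have := hpt e he; simp [pK]; omega)
    (fun e he => by simp [pK]; omega)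
    (fun e f he hf h1 h2 => by
      have e1 := hps e he
      have e2 := hps f hf
      have e3 := hpt e he
      have e4 := hpt f hf
      simp only [pK, if_true] at h1 h2
      exact hI.inj e f he hf (p2 _ _ (hI.src_lt e he) (hI.src_lt f hf) (by omega))
        (p2 _ _ (hI.tgt_lt e he) (hI.tgt_lt f hf) (by omega)))
  set s₅ := run E (mk true) s₄ with hs₅
  have n5 : Header n m s₅ := n4.run _
  have o5 : s₅.a aPOS = pos := (run_a (mk true) _ _).trans o4
  have i1 : s₅.a (aSRC false) = s₄.a (aSRC false) := run_a (mk true) _ _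
  have i2 : s₅.a (aTGT false) = s₄.a (aTGT false) := run_a (mk true) _ _
  have i3 : s₅.a (aWT false) = s₄.a (aWT false) := run_a (mk true) _ _
  have i4 : s₅.a (aOFF false) = s₄.a (aOFF false) := run_a (mk true) _ _
  rw [← i1, ← i2, ← i3] at f1 f2
  rw [← i4] at f1
  clear_value s₅
  obtain ⟨q1, t6⟩ := colors_spec (E := E) (s := s₅) n5.n o5 p1 p2
  set s₆ := run E colors s₅ with hs₆
  have n6 : Header n m s₆ := n5.run _
  obtain ⟨q2, t7⟩ := blocks_spec (E := E) (s := s₆) n6.n rfl (by omega) (by omega)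
  set s₇ := run E blocks s₆ with hs₇
  have n7 : Header n m s₇ := n6.run _
  obtain ⟨q3, q4, t8⟩ := maxima_spec (E := E) (s := s₇) n7.n n7.m (by omega) n7.kmax n7.m0
  set s₈ := run E maxima s₇ with hs₈
  obtain ⟨q5, t9⟩ := params_spec (E := E) (s := s₈)
    ((run_v maxima _ _).trans n7.n) ((run_v maxima _ _).trans n7.m)
    hn2 hm1 hI.le_sq hB
  set s₉ := run E params s₈ with hs₉
  have fra : ∀ g, s₉.a (aSRC g) = s₅.a (aSRC g) ∧ s₉.a (aTGT g) = s₅.a (aTGT g) ∧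
      s₉.a (aWT g) = s₅.a (aWT g) ∧ s₉.a (aOFF g) = s₅.a (aOFF g) ∧
      s₉.a (aCOL g) = s₆.a (aCOL g) := by
    intro g
    refine ⟨?_, ?_, ?_, ?_, ?_⟩
    iterate 4 exact run_a (colors ;; blocks ;; maxima ;; params) s₅ _
    exact run_a (blocks ;; maxima ;; params) s₆ _
  have R9 : s₉.v vR = s₇.v vR := run_v (maxima ;; params) s₇ _
  have rs9 : s₉.a aRS = s₇.a aRS := run_a (maxima ;; params) s₇ _
  have K9 : s₉.v vKmax = s₈.v vKmax := run_v params _ _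
  have M9 : s₉.v vM0 = s₈.v vM0 := run_v params _ _
  have n9 : s₉.v vN = n := (run_v (maxima ;; params) s₇ _).trans n7.n
  have k9 : s₉.v vK = 0 := (run_v (maxima ;; params) s₇ _).trans n7.k
  rw [← R9, ← rs9] at q2
  rw [← K9] at q3
  rw [← M9] at q4
  simp only [(fra _).2.2.2.2.symm] at q1 q2
  have hcsr : ∀ g, CSR n m (s₉.a (aSRC g)) (s₉.a (aTGT g)) (s₉.a (aWT g)) (s₉.a (aOFF g)) := by
    intro g
    rw [(fra g).1, (fra g).2.1, (fra g).2.2.1, (fra g).2.2.2.1]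
    cases g
    · exact f1
    · exact g1
  have hedge : ∀ g x y c, edg m (s₉.a (aSRC g)) (s₉.a (aTGT g)) (s₉.a (aWT g)) x y c ↔
      ∃ e, e < m ∧ pK g n pos (eS E.I n) (eT E.I n) e = x ∧
        pK g n pos (eT E.I n) (eS E.I n) e = y ∧ eW E.I n e = c := by
    intro g
    rw [(fra g).1, (fra g).2.1, (fra g).2.2.1]
    cases g
    · exact f2
    · exact g2
  clear_value s₉
  -- The instance is read off from the final memory, so that most of `Holds` is true by definition;
  -- its laws are the facts collected above.
  let T : Inst :=
    { n := n, m := m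
      src := fun g => s₉.a (aSRC g)
      tgt := fun g => s₉.a (aTGT g)
      wt := fun g => s₉.a (aWT g)
      off := fun g => s₉.a (aOFF g)
      col := fun g => s₉.a (aCOL g)
      kk := s₉.v vKH, hh := s₉.v vHH, dense := s₉.v vDense, bw := s₉.v vBW, R := s₉.v vR
      rs := s₉.a aRS
      csr := hcsr
      rev := fun g x y c hx hy h => by
        obtain ⟨e, he, rfl, rfl, rfl⟩ := (hedge g x y c).1 h
        refine (hedge _ _ _ _).2 ⟨e, he, ?_, ?_, rfl⟩ <;> have := hps e he <;>
          have := hpt e he <;> cases g <;> simp [pK] <;> omega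
      col_rev := fun g p hp => by
        obtain ⟨v, hv, rfl⟩ := surj_of_inj p1 p2 hp
        have h1 := p1 v hv
        cases g
        · obtain ⟨u, hu, hu'⟩ := surj_of_inj p1 p2 (j := n - 1 - pos v) (by omega)
          rw [← hu', Bool.not_false, (q1 u hu).1, show pos v = n - 1 - pos u by omega, (q1 u hu).2]
        · rw [Bool.not_true, (q1 v hv).1, (q1 v hv).2]
      kk_pos := q5.kk_pos
      kk_le := q5.kk_le }
  refine ⟨T, pos, ⟨rfl, rfl, ⟨q2.rs_zero, q2.rs_R, q2.lt, q2.const, q2.alt, fun p hp => ?_,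
    q5.bw_root.1, q5.bw_le⟩, q5, p1, p2, fun x y c => hedge false x y c, fun v hv => (q1 v hv).1⟩,
    ⟨n9, k9, rfl, rfl, rfl, rfl, rfl, fun _ => rfl, fun _ => rfl, fun _ => rfl, fun _ => rfl,
      fun _ => rfl, rfl⟩, q3, q4, ?_⟩
  · obtain ⟨v, hv, rfl⟩ := surj_of_inj p1 p2 hp
    change s₉.a (aCOL false) (pos v) ≤ 1
    rw [(q1 v hv).1]
    exact hI.col_le v hv
  · omega

/-! ## The time bound -/

/-- The time bound, up to logarithmic factors. -/
noncomputable def timeX (n m : ℕ) : ℝ :=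
  min ((m : ℝ) ^ (4 / 3 : ℝ) * (n : ℝ) ^ (1 / 3 : ℝ)) ((m : ℝ) ^ (1 / 2 : ℝ) * (n : ℝ) ^ (3 / 2 : ℝ))

theorem timeX_nonneg : 0 ≤ timeX n m := le_min (by positivity) (by positivity)

/-- Sixth powers clear all denominators of the exponents, so real estimates become inequalities
between natural numbers. -/
theorem sparse_pow : ((m : ℝ) ^ (4 / 3 : ℝ) * (n : ℝ) ^ (1 / 3 : ℝ)) ^ 6 = (m : ℝ) ^ 8 * n ^ 2 := by
  rw [mul_pow, ← Real.rpow_mul_natCast (by positivity), ← Real.rpow_mul_natCast (by positivity),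
    ← Real.rpow_natCast, ← Real.rpow_natCast]
  norm_num

theorem dense_pow : ((m : ℝ) ^ (1 / 2 : ℝ) * (n : ℝ) ^ (3 / 2 : ℝ)) ^ 6 = (m : ℝ) ^ 3 * n ^ 9 := by
  rw [mul_pow, ← Real.rpow_mul_natCast (by positivity), ← Real.rpow_mul_natCast (by positivity),
    ← Real.rpow_natCast, ← Real.rpow_natCast]
  norm_num

theorem timeX_sparse (h : m ^ 5 < n ^ 7) : timeX n m ^ 6 = (m : ℝ) ^ 8 * n ^ 2 := by
  unfold timeX
  rw [min_eq_left, sparse_pow]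
  rw [← pow_le_pow_iff_left₀ (by positivity) (by positivity) (by norm_num : 6 ≠ 0), sparse_pow,
    dense_pow]
  have h1 : m ^ 8 * n ^ 2 ≤ m ^ 3 * n ^ 9 := by
    calc m ^ 8 * n ^ 2 = m ^ 3 * n ^ 2 * m ^ 5 := by ring
      _ ≤ m ^ 3 * n ^ 2 * n ^ 7 := Nat.mul_le_mul_left _ h.le
      _ = _ := by ring
  exact_mod_cast h1

theorem timeX_dense (h : n ^ 7 ≤ m ^ 5) : timeX n m ^ 6 = (m : ℝ) ^ 3 * n ^ 9 := by
  unfold timeX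
  rw [min_eq_right, dense_pow]
  rw [← pow_le_pow_iff_left₀ (by positivity) (by positivity) (by norm_num : 6 ≠ 0), sparse_pow,
    dense_pow]
  have h1 : m ^ 3 * n ^ 9 ≤ m ^ 8 * n ^ 2 := by
    calc m ^ 3 * n ^ 9 = m ^ 3 * n ^ 2 * n ^ 7 := by ring
      _ ≤ m ^ 3 * n ^ 2 * m ^ 5 := Nat.mul_le_mul_left _ h
      _ = _ := by ring
  exact_mod_cast h1

/-- The bound is the cube root of `m ^ 4 * n` in the sparse case and the square root of `m * n ^ 3`
in the dense case, so cubes or squares are compared. -/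
theorem le_timeX_sparse (hs : m ^ 5 < n ^ 7) {a c : ℕ} (h : a ^ 3 ≤ c ^ 3 * (m ^ 4 * n)) :
    (a : ℝ) ≤ c * timeX n m := by
  rw [← pow_le_pow_iff_left₀ (by positivity) (mul_nonneg (by positivity) timeX_nonneg)
    (by norm_num : 6 ≠ 0), mul_pow, timeX_sparse hs]
  have := Nat.pow_le_pow_left h 2
  rw [← pow_mul, mul_pow, ← pow_mul, mul_pow, ← pow_mul] at this
  exact_mod_cast this

theorem le_timeX_dense (hs : n ^ 7 ≤ m ^ 5) {a c : ℕ} (h : a ^ 2 ≤ c ^ 2 * (m * n ^ 3)) :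
    (a : ℝ) ≤ c * timeX n m := by
  rw [← pow_le_pow_iff_left₀ (by positivity) (mul_nonneg (by positivity) timeX_nonneg)
    (by norm_num : 6 ≠ 0), mul_pow, timeX_dense hs]
  have := Nat.pow_le_pow_left h 3
  rw [← pow_mul, mul_pow, ← pow_mul, mul_pow, ← pow_mul] at this
  exact_mod_cast this

/-- Minimality bounds `(x - 1) ^ k * a`, and `x ≤ 2 * (x - 1)` for `x ≥ 2`; hence rounding up costs
at most a factor `2 ^ k`. -/
theorem IsRoot.le {k a b x M : ℕ} (h : IsRoot k a b x) (h1 : a ≤ M) (h2 : 2 ^ k * b ≤ M) :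
    x ^ k * a ≤ M := by
  rcases h.2.2 with rfl | h3
  · simpa using h1
  · by_cases hx : x = 1
    · subst hx; simpa using h1
    have h4 : x ≤ 2 * (x - 1) := by have := h.1; omega
    calc x ^ k * a ≤ (2 * (x - 1)) ^ k * a := Nat.mul_le_mul_right _ (Nat.pow_le_pow_left h4 k)
      _ = 2 ^ k * ((x - 1) ^ k * a) := by rw [mul_pow, mul_assoc]
      _ ≤ 2 ^ k * b := Nat.mul_le_mul_left _ h3.le
      _ ≤ M := h2

/-- The logarithmic factor. -/
def lg (n : ℕ) : ℕ := Nat.log 2 n + 1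

theorem testBound_le {I : ℕ → ℕ} {pos : ℕ → ℕ} (hT : Represents I n m T pos) (hnm : n ≤ 2 * m) :
    T.testBound ≤ 12 * (m * (n / T.bw)) + 8 * (m * T.bw) +
      4 * (m * (T.high false 0 T.n + T.high true 0 T.n)) + 4 * (m * (n * lg n / T.kk)) +
      4 * (if T.dense = 0 then m * (T.kk * T.hh) else 0) + T.kk * (T.kk + T.hh) * n +
      (if T.dense = 0 then 0 else T.kk * n * n) + 60 * m := by
  obtain ⟨hn, hm⟩ := And.intro hT.n_eq hT.m_eq
  unfold Inst.testBound Inst.segBound Inst.rho lg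
  rw [hn, hm]
  generalize T.high false 0 n = a
  generalize T.high true 0 n = b
  generalize n / T.bw = c
  generalize n * (Nat.log 2 n + 1) / T.kk = d
  have hm1 : n = 0 ∨ 1 ≤ m := by omega
  have h4 : n + 2 * m ≤ 4 * m := by omega
  have h5 := Nat.mul_le_mul_left (3 * (c + 1) + (2 * T.bw + 7)) h4
  have h6 : ∀ z, (n + 2 * m) * (a + b + (d + 2) + 1 + z) ≤ 4 * m * (a + b + (d + 2) + 1 + z) :=
    fun z => Nat.mul_le_mul_right _ h4
  have hbw : 1 ≤ n := by
    have := hT.runs.bw_pos; have := hT.runs.bw_le; omega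
  have hm1 : n + 1 ≤ 3 * m := by omega
  split_ifs
  · have := h6 (T.kk * T.hh)
    nlinarith
  · have := h6 0
    nlinarith

theorem cube_div {a b c d : ℕ} (hc : 0 < c) (h : a * c ≤ b * c) (hd : b ≤ d) : a ≤ d :=
  (Nat.le_of_mul_le_mul_right h hc).trans hd

/-- Each cost is compared separately. The lower bounds from `IsRoot` control quotients such as `n *
lg n / kk` and the number of high vertices, the upper bounds from `IsRoot.le` control products such
as `kk * hh`. The windows cost `m * bw` with `bw ^ 2 ≤ 4 * n`, which is small enough by `n ≤ 2 * m`
in the sparse case and by `m ≤ n ^ 2` in the dense case. -/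
theorem testBound_le_timeX {I : ℕ → ℕ} {pos : ℕ → ℕ} (hT : Represents I n m T pos)
    (hnm : n ≤ 2 * m) (hn2 : 2 ≤ n) (hmn : m ≤ n ^ 2) :
    (m : ℝ) ≤ timeX n m ∧ (T.testBound : ℝ) ≤ 200 * lg n * timeX n m := by
  obtain ⟨hn, hm⟩ := And.intro hT.n_eq hT.m_eq
  have hP := hT.params
  have hX := timeX_nonneg (n := n) (m := m)
  have hl : (1 : ℝ) ≤ lg n := by unfold lg; push_cast; linarith [Nat.cast_nonneg (α := ℝ) (Nat.log 2 n)]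
  have hXl : timeX n m ≤ lg n * timeX n m := le_mul_of_one_le_left hX hl
  have htb := testBound_le hT hnm
  have hbw1 := hP.bw_root.1
  have hbw2 : T.bw ^ 2 ≤ 4 * n := by
    have := hP.bw_root.le (M := 4 * n) (by omega) (by norm_num)
    simpa using this
  have hcb : n / T.bw ≤ T.bw := by
    have := hP.bw_root.2.1
    rw [mul_one, pow_two] at this
    exact Nat.div_le_of_le_mul this
  have hA : m * (n / T.bw) ≤ m * T.bw := Nat.mul_le_mul_left _ hcb
  have hyk : n * lg n / T.kk * T.kk ≤ n * lg n := Nat.div_mul_le_self _ _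
  set y := n * lg n / T.kk with hy
  have hkp := hP.kk_pos
  have hm0 : 0 < m := by omega
  have hn0 : 0 < n := by omega
  by_cases hd : T.dense = 0
  · obtain ⟨hs, hk, hh⟩ := hP.of_sparse hd
    have hk3 : T.kk ^ 3 * m ≤ 8 * n ^ 2 := hk.le (by omega) (by norm_num)
    have hh3 : T.hh ^ 3 * n ≤ 8 * m ^ 2 := hh.le (by nlinarith) (by norm_num)
    have hk3' := hk.2.1
    have hh3' := hh.2.1
    have r1 : (m : ℝ) ≤ (1 : ℕ) * timeX n m := le_timeX_sparse hs (by
      calc m ^ 3 = m ^ 3 * 1 := by ring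
        _ ≤ m ^ 3 * (m * n) := Nat.mul_le_mul_left _ (Nat.mul_pos hm0 hn0)
        _ = 1 ^ 3 * (m ^ 4 * n) := by ring)
    have hB : (m * T.bw) ^ 3 ≤ 3 ^ 3 * (m ^ 4 * n) := by
      rw [← Nat.pow_le_pow_iff_left (n := 2) (by norm_num)]
      calc ((m * T.bw) ^ 3) ^ 2 = m ^ 6 * (T.bw ^ 2) ^ 3 := by ring
        _ ≤ m ^ 6 * (4 * n) ^ 3 := Nat.mul_le_mul_left _ (Nat.pow_le_pow_left hbw2 3)
        _ = 64 * m ^ 6 * n ^ 2 * n := by ring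
        _ ≤ 64 * m ^ 6 * n ^ 2 * (2 * m ^ 2) := Nat.mul_le_mul_left _ (by nlinarith)
        _ = 128 * (m ^ 8 * n ^ 2) := by ring
        _ ≤ 729 * (m ^ 8 * n ^ 2) := Nat.mul_le_mul_right _ (by norm_num)
        _ = _ := by ring
    have rB := le_timeX_sparse hs hB
    have rA := le_timeX_sparse hs ((Nat.pow_le_pow_left hA 3).trans hB)
    have hH : ∀ g, (m * T.high g 0 n) ^ 3 ≤ 1 ^ 3 * (m ^ 4 * n) := fun g => by
      have h1 := Inst.high_mul_le (T := T) g
      rw [hn, hm] at h1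
      refine cube_div (c := m ^ 2) (by positivity) ?_ le_rfl
      -- Multiplying by `m ^ 2 ≤ hh ^ 3 * n` makes the product `high * hh ≤ m` appear.
      calc (m * T.high g 0 n) ^ 3 * m ^ 2 ≤ (m * T.high g 0 n) ^ 3 * (T.hh ^ 3 * n) :=
            Nat.mul_le_mul_left _ hh3'
        _ = m ^ 3 * n * (T.high g 0 n * T.hh) ^ 3 := by ring
        _ ≤ m ^ 3 * n * m ^ 3 := Nat.mul_le_mul_left _ (Nat.pow_le_pow_left h1 3)
        _ = 1 ^ 3 * (m ^ 4 * n) * m ^ 2 := by ring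
    have rH := le_timeX_sparse hs (hH false)
    have rH' := le_timeX_sparse hs (hH true)
    have rY : ((m * y : ℕ) : ℝ) ≤ (lg n : ℕ) * timeX n m := le_timeX_sparse hs (by
      refine cube_div (c := n ^ 2) (by positivity) ?_ le_rfl
      calc (m * y) ^ 3 * n ^ 2 ≤ (m * y) ^ 3 * (T.kk ^ 3 * m) := Nat.mul_le_mul_left _ hk3'
        _ = m ^ 4 * (y * T.kk) ^ 3 := by ring
        _ ≤ m ^ 4 * (n * lg n) ^ 3 := Nat.mul_le_mul_left _ (Nat.pow_le_pow_left hyk 3)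
        _ = lg n ^ 3 * (m ^ 4 * n) * n ^ 2 := by ring)
    have hkh : (T.kk * T.hh) ^ 3 ≤ 64 * (n * m) := by
      refine cube_div (c := n * m) (by positivity) ?_ le_rfl
      calc (T.kk * T.hh) ^ 3 * (n * m) = (T.kk ^ 3 * m) * (T.hh ^ 3 * n) := by ring
        _ ≤ (8 * n ^ 2) * (8 * m ^ 2) := Nat.mul_le_mul hk3 hh3
        _ = 64 * (n * m) * (n * m) := by ring
    have rZ := le_timeX_sparse hs (a := m * (T.kk * T.hh)) (c := 4) (by
      calc (m * (T.kk * T.hh)) ^ 3 = m ^ 3 * (T.kk * T.hh) ^ 3 := by ring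
        _ ≤ m ^ 3 * (64 * (n * m)) := Nat.mul_le_mul_left _ hkh
        _ = 4 ^ 3 * (m ^ 4 * n) := by ring)
    -- Scanning the lists costs `kk ^ 2` per vertex. Here `n ≤ 2 * m` trades `n ^ 6` for `m ^ 6`.
    have rU := le_timeX_sparse hs (a := T.kk ^ 2 * n) (c := 16) (by
      refine cube_div (c := m ^ 2) (by positivity) ?_ le_rfl
      calc (T.kk ^ 2 * n) ^ 3 * m ^ 2 = n ^ 3 * (T.kk ^ 3 * m) ^ 2 := by ring
        _ ≤ n ^ 3 * (8 * n ^ 2) ^ 2 := Nat.mul_le_mul_left _ (Nat.pow_le_pow_left hk3 2)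
        _ = 64 * n * n ^ 6 := by ring
        _ ≤ 64 * n * (2 * m) ^ 6 := Nat.mul_le_mul_left _ (Nat.pow_le_pow_left hnm 6)
        _ = 16 ^ 3 * (m ^ 4 * n) * m ^ 2 := by ring)
    have hU : T.kk * (T.kk + T.hh) * n ≤ T.kk ^ 2 * n + 2 * (m * (T.kk * T.hh)) := by
      have := Nat.mul_le_mul_left (T.kk * T.hh) hnm
      nlinarith
    rw [if_pos hd, if_pos hd, hn] at htb
    have hfin : T.testBound ≤ 12 * (m * (n / T.bw)) + 8 * (m * T.bw) +
      4 * (m * T.high false 0 n) + 4 * (m * T.high true 0 n) + 4 * (m * y) +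
      6 * (m * (T.kk * T.hh)) + T.kk ^ 2 * n + 60 * m := by
      rw [mul_add m] at htb
      omega
    have hfin' := (Nat.cast_le (α := ℝ)).2 hfin
    simp only [Nat.cast_add, Nat.cast_mul, Nat.cast_pow, Nat.cast_ofNat, Nat.cast_one, one_mul] at *
    exact ⟨r1, by linarith⟩
  · obtain ⟨hs, hk, hh⟩ := hP.of_dense hd
    have hk2 : T.kk ^ 2 * n ≤ 4 * m := hk.le (by omega) (by norm_num)
    have hk2' := hk.2.1
    have hkn := hP.kk_le
    have r1 : (m : ℝ) ≤ (1 : ℕ) * timeX n m := le_timeX_dense hs (by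
      calc m ^ 2 = m * m := by ring
        _ ≤ m * n ^ 2 := Nat.mul_le_mul_left _ hmn
        _ ≤ m * n ^ 3 := Nat.mul_le_mul_left _ (Nat.pow_le_pow_right hn0 (by norm_num))
        _ = 1 ^ 2 * (m * n ^ 3) := by ring)
    have hB : (m * T.bw) ^ 2 ≤ 2 ^ 2 * (m * n ^ 3) := by
      calc (m * T.bw) ^ 2 = m * m * T.bw ^ 2 := by ring
        _ ≤ m * n ^ 2 * (4 * n) := Nat.mul_le_mul (Nat.mul_le_mul_left _ hmn) hbw2
        _ = 2 ^ 2 * (m * n ^ 3) := by ring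
    have rB := le_timeX_dense hs hB
    have rA := le_timeX_dense hs ((Nat.pow_le_pow_left hA 2).trans hB)
    have hH : ∀ g, T.high g 0 n = 0 := fun g => by
      have := Inst.high_eq_zero (T := T) g (by omega)
      rwa [hn] at this
    have rY : ((m * y : ℕ) : ℝ) ≤ (lg n : ℕ) * timeX n m := le_timeX_dense hs (by
      calc (m * y) ^ 2 = m * y ^ 2 * m := by ring
        _ ≤ m * y ^ 2 * (T.kk ^ 2 * n) := Nat.mul_le_mul_left _ hk2'
        _ = m * n * (y * T.kk) ^ 2 := by ring
        _ ≤ m * n * (n * lg n) ^ 2 := Nat.mul_le_mul_left _ (Nat.pow_le_pow_left hyk 2)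
        _ = lg n ^ 2 * (m * n ^ 3) := by ring)
    have rW := le_timeX_dense hs (a := T.kk * n * n) (c := 2) (by
      calc (T.kk * n * n) ^ 2 = T.kk ^ 2 * n * n ^ 3 := by ring
        _ ≤ 4 * m * n ^ 3 := Nat.mul_le_mul_right _ hk2
        _ = 2 ^ 2 * (m * n ^ 3) := by ring)
    have hU : T.kk * (T.kk + T.hh) * n ≤ 3 * (T.kk * n * n) := by
      calc T.kk * (T.kk + T.hh) * n ≤ T.kk * (3 * n) * n :=
            Nat.mul_le_mul_right _ (Nat.mul_le_mul_left _ (by omega))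
        _ = _ := by ring
    rw [if_neg hd, if_neg hd, hn, hH, hH] at htb
    have hfin : T.testBound ≤ 12 * (m * (n / T.bw)) + 8 * (m * T.bw) + 4 * (m * y) +
      4 * (T.kk * n * n) + 60 * m := by
      omega
    have hfin' := (Nat.cast_le (α := ℝ)).2 hfin
    simp only [Nat.cast_add, Nat.cast_mul, Nat.cast_ofNat, Nat.cast_one, one_mul] at *
    exact ⟨r1, by linarith⟩

theorem lg_le (hn2 : 2 ≤ n) : (lg n : ℝ) ≤ 2 * Real.logb 2 n := by
  have h1 : (Nat.log 2 n : ℝ) ≤ Real.logb 2 n := by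
    rw [Real.le_logb_iff_rpow_le (by norm_num) (by positivity), Real.rpow_natCast]
    exact_mod_cast Nat.pow_log_le_self 2 (by omega)
  have h2 : 1 ≤ Real.logb 2 n := by
    rw [Real.le_logb_iff_rpow_le (by norm_num) (by positivity), Real.rpow_one]
    exact_mod_cast hn2
  unfold lg
  push_cast
  linarith

/-- The number of search rounds is logarithmic in `n` because the weights are at most `n ^ κ`; this
is how `κ` enters the constant. -/
theorem log_bound {κ Kmax : ℕ} (hK : Kmax ≤ n ^ (κ + 1)) :
    Nat.log 2 (Kmax + 1) + 1 ≤ (κ + 2) * lg n := by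
  have h1 : n < 2 ^ lg n := Nat.lt_pow_succ_log_self (by norm_num) n
  have h2 : Kmax + 1 ≤ 2 ^ (lg n * (κ + 1)) := by
    have := Nat.pow_lt_pow_left h1 (n := κ + 1) (by omega)
    rw [← pow_mul] at this
    omega
  have h3 := Nat.log_mono_right (b := 2) h2
  rw [Nat.log_pow (by norm_num)] at h3
  have h4 : 1 ≤ lg n := by unfold lg; omega
  nlinarith

theorem total_le {I : ℕ → ℕ} {pos : ℕ → ℕ} {κ c l : ℕ} (hT : Represents I n m T pos)
    (hnm : n ≤ 2 * m) (hn2 : 2 ≤ n) (hmn : m ≤ n ^ 2) (hl : l ≤ (κ + 2) * lg n)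
    (hc : c ≤ 200 * (n + m) + ((400 * T.testBound + 4) * l + 9)) :
    (c : ℝ) ≤ 330000 * (κ + 2) * timeX n m * Real.logb 2 n ^ 2 := by
  obtain ⟨h1, h2⟩ := testBound_le_timeX hT hnm hn2 hmn
  have h3 := lg_le hn2
  have hX := timeX_nonneg (n := n) (m := m)
  set X := timeX n m
  have hg : (1 : ℝ) ≤ lg n := by
    unfold lg; push_cast; linarith [Nat.cast_nonneg (α := ℝ) (Nat.log 2 n)]
  have hm1 : (1 : ℝ) ≤ m := by exact_mod_cast (by omega : 1 ≤ m)
  have hX1 : 1 ≤ X := hm1.trans h1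
  have hXg : X ≤ lg n * X := le_mul_of_one_le_left hX hg
  have h4 : (400 * T.testBound + 4 : ℝ) ≤ 80004 * (lg n * X) := by nlinarith
  have h5 : (l : ℝ) ≤ (κ + 2) * lg n := by exact_mod_cast hl
  have h6 : (400 * T.testBound + 4 : ℝ) * l ≤ 80004 * (lg n * X) * ((κ + 2) * lg n) :=
    mul_le_mul h4 h5 (by positivity) (by positivity)
  have h7 : (n : ℝ) ≤ 2 * m := by exact_mod_cast hnm
  have h8 := (Nat.cast_le (α := ℝ)).2 hc
  push_cast at h8
  have hκ : (1 : ℝ) ≤ κ + 2 := by linarith [Nat.cast_nonneg (α := ℝ) κ]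
  have h9 : X ≤ (κ + 2) * X * (lg n) ^ 2 := by
    have e1 : X ≤ (κ + 2) * X := le_mul_of_one_le_left hX hκ
    exact e1.trans (le_mul_of_one_le_right (by positivity) (one_le_pow₀ hg))
  calc (c : ℝ) ≤ 80004 * ((κ + 2) * X * (lg n) ^ 2) + 609 * X := by nlinarith
    _ ≤ 82500 * ((κ + 2) * X * (lg n) ^ 2) := by linarith
    -- Since `n ≥ 2`, the rounded logarithm `lg n` is at most twice `Real.logb 2 n`; the square
    -- yields the factor `4` with `4 * 82500 = 330000`.
    _ ≤ 82500 * ((κ + 2) * X * (2 * Real.logb 2 n) ^ 2) := by gcongr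
    _ = _ := by ring

/-! ## Distances in the input graph -/

variable (G : BicoloredDigraph n m)

theorem inputMem_color (v : Fin n) : G.inputMem v = if G.isRed v then 1 else 0 := by
  simp [BicoloredDigraph.inputMem]

theorem inputMem_edge (e : Fin m) : eS G.inputMem n e = G.src e ∧ eT G.inputMem n e = G.tgt e ∧
    eW G.inputMem n e = G.weight e := by
  have h1 : ¬ n + 3 * (e : ℕ) < n := by omega
  have h2 : ¬ n + 3 * (e : ℕ) + 1 < n := by omega
  have h3 : ¬ n + 3 * (e : ℕ) + 2 < n := by omega
  have d1 : (n + 3 * (e : ℕ) - n) / 3 = e := by omega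
  have d2 : (n + 3 * (e : ℕ) + 1 - n) / 3 = e := by omega
  have d3 : (n + 3 * (e : ℕ) + 2 - n) / 3 = e := by omega
  have r1 : (n + 3 * (e : ℕ) - n) % 3 = 0 := by omega
  have r2 : (n + 3 * (e : ℕ) + 1 - n) % 3 = 1 := by omega
  have r3 : (n + 3 * (e : ℕ) + 2 - n) % 3 = 2 := by omega
  simp [eS, eT, eW, BicoloredDigraph.inputMem, h1, h2, h3, d2, d3, r2, r3]

variable {G}

theorem exists_incident {u v : Fin n} (h : Relation.EqvGen G.Adj u v) :
    u = v ∨ (∃ e, G.src e = u ∨ G.tgt e = u) ∧ ∃ e, G.src e = v ∨ G.tgt e = v := by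
  induction h with
  | rel u v h =>
    obtain ⟨e, rfl, rfl⟩ := h
    exact Or.inr ⟨⟨e, Or.inl rfl⟩, ⟨e, Or.inr rfl⟩⟩
  | refl => exact Or.inl rfl
  | symm u v _ ih => exact ih.imp Eq.symm And.symm
  | trans u v w _ _ ih₁ ih₂ =>
    rcases ih₁ with rfl | ih₁
    · exact ih₂
    · rcases ih₂ with rfl | ih₂
      · exact Or.inr ih₁
      · exact Or.inr ⟨ih₁.1, ih₂.2⟩

/-- With at least two vertices and weak connectivity every vertex is an end of some edge, and `m`
edges have at most `2 * m` ends. -/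
theorem card_le_two_mul (hc : G.WeaklyConnected) {a b : Fin n} (hab : a ≠ b) : n ≤ 2 * m := by
  have hinc : ∀ v, ∃ e, G.src e = v ∨ G.tgt e = v := fun v => by
    by_cases h : v = a
    · exact ((exists_incident (hc v b)).resolve_left (h ▸ hab)).1
    · exact ((exists_incident (hc v a)).resolve_left h).1
  have hs : Function.Surjective fun x : Fin m × Bool => if x.2 then G.src x.1 else G.tgt x.1 := by
    intro v
    obtain ⟨e, h | h⟩ := hinc v
    · exact ⟨(e, true), by simpa⟩
    · exact ⟨(e, false), by simpa⟩
  have := Fintype.card_le_of_surjective _ hs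
  simp at this
  omega

theorem inputOK (ha : G.Acyclic) (hc : G.WeaklyConnected) {a b : Fin n} (hab : a ≠ b) :
    InputOK G.inputMem n m := by
  have hnm := card_le_two_mul hc hab
  have h2 : 2 ≤ n := by
    have h1 := a.2
    have h2 := b.2
    have h3 : (a : ℕ) ≠ b := fun h => hab (Fin.ext h)
    omega
  have hE := fun (e : ℕ) (he : e < m) => inputMem_edge G ⟨e, he⟩
  simp only at hE
  refine ⟨h2, by omega, ?_, fun e he => ?_, fun e he => ?_, fun e f he hf h1 h2 => ?_, ?_,
    fun v hv => ?_⟩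
  · have := Fintype.card_le_of_injective _ G.simple
    simpa [pow_two] using this
  · rw [(hE e he).1]; exact Fin.is_lt _
  · rw [(hE e he).2.1]; exact Fin.is_lt _
  · rw [(hE e he).1, (hE f hf).1] at h1
    rw [(hE e he).2.1, (hE f hf).2.1] at h2
    have := G.simple (a₁ := ⟨e, he⟩) (a₂ := ⟨f, hf⟩) (Prod.ext (Fin.ext h1) (Fin.ext h2))
    simpa using this
  -- On a finite type a transitive irreflexive relation is well-founded, so the absence of cycles
  -- gives the induction that `NoCycle` asks for.
  · have hwf : WellFounded (Relation.TransGen G.Adj) := by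
      have : Std.Irrefl (Relation.TransGen G.Adj) := ⟨ha⟩
      exact Finite.wellFounded_of_trans_of_irrefl _
    have hsub : WellFounded fun u v : Fin n => G.Adj u v :=
      hwf.mono fun u v h => Relation.TransGen.single h
    unfold NoCycle
    refine WellFounded.intro fun v => ⟨_, ?_⟩
    rintro u ⟨e, he, rfl, -⟩
    rw [(hE e he).1]
    suffices ∀ x : Fin n, Acc (fun u v => ∃ e, e < m ∧ eS G.inputMem n e = u ∧
        eT G.inputMem n e = v) (x : ℕ) from this _
    intro x
    induction x using hsub.induction with
    | _ x ih =>
      refine ⟨_, ?_⟩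
      rintro u ⟨e, he, rfl, h⟩
      rw [(hE e he).2.1] at h
      rw [(hE e he).1]
      exact ih _ ⟨⟨e, he⟩, rfl, Fin.ext h⟩
  · rw [inputMem_color G ⟨v, hv⟩]
    split_ifs <;> omega

theorem supW_eq : supW G.inputMem n m = G.maxRedBlueWeight := by
  have hcol : ∀ e : Fin m, (G.inputMem (eS G.inputMem n e) ≠ G.inputMem (eT G.inputMem n e) ↔
      G.isRed (G.src e) ≠ G.isRed (G.tgt e)) := fun e => by
    rw [(inputMem_edge G e).1, (inputMem_edge G e).2.1, inputMem_color, inputMem_color]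
    cases G.isRed (G.src e) <;> cases G.isRed (G.tgt e) <;> simp
  refine le_antisymm (Finset.sup_le fun e he => ?_) (Finset.sup_le fun e he => ?_)
  · obtain ⟨he, hc⟩ := Finset.mem_filter.1 he
    rw [Finset.mem_range] at he
    rw [(inputMem_edge G ⟨e, he⟩).2.2]
    exact Finset.le_sup (f := G.weight) (by simpa using (hcol ⟨e, he⟩).1 hc)
  · rw [← (inputMem_edge G e).2.2]
    exact Finset.le_sup (f := eW G.inputMem n) (by
      simpa using (hcol e).2 (Finset.mem_filter.1 he).2)

theorem HasWalk.snoc {u : Fin n} {e : Fin m} {k : ℕ} (h : G.HasWalk u (G.src e) k) :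
    G.HasWalk u (G.tgt e) (k + G.weight e) := by
  generalize hv : G.src e = v at h
  induction h with
  | nil => subst hv; simpa using BicoloredDigraph.HasWalk.cons e (.nil _)
  | cons f _ ih => rw [add_assoc]; exact .cons f (ih hv)

variable {pos : ℕ → ℕ} (hT : Represents G.inputMem n m T pos)
include hT

theorem wk_iff {u v : Fin n} {k : ℕ} : Wk (T.E false) (pos u) (pos v) k ↔ G.HasWalk u v k := by
  constructor
  · intro h
    generalize hx : pos u = x at h
    generalize hy : pos v = y at h
    induction h generalizing v with
    | nil =>
      obtain rfl : u = v := Fin.ext (hT.inj _ _ u.2 v.2 (hx.trans hy.symm))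
      exact .nil _
    | snoc _ hr ih =>
      obtain ⟨e, he, h1, h2, rfl⟩ := (hT.edge _ _ _).1 hr
      obtain ⟨g1, g2, g3⟩ := inputMem_edge G ⟨e, he⟩
      simp only at g1 g2 g3
      rw [g1] at h1
      rw [g2] at h2
      have hv : G.tgt ⟨e, he⟩ = v := Fin.ext (hT.inj _ _ (Fin.is_lt _) v.2 (h2.trans hy.symm))
      rw [← hv, g3]
      exact HasWalk.snoc (ih h1)
  · intro h
    induction h with
    | nil => exact .nil _
    | cons e _ ih =>
      obtain ⟨g1, g2, g3⟩ := inputMem_edge G e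
      refine (Wk.single ((hT.edge _ _ _).2 ⟨e, e.2, ?_, ?_, ?_⟩)).trans ih
      · rw [g1]
      · rw [g2]
      · rw [g3]

theorem le_iff {u v : Fin n} {K : ℕ} : Le (T.E false) (pos u) (pos v) K ↔ G.dist u v ≤ K := by
  constructor
  · rintro ⟨k, hk, hw⟩
    exact (iInf₂_le k ((wk_iff hT).1 hw)).trans (by exact_mod_cast hk)
  · intro h
    by_contra hno
    have h1 : ((K + 1 : ℕ) : ℕ∞) ≤ G.dist u v := le_iInf₂ fun k hk => by
      have : ¬ k ≤ K := fun hkK => hno ⟨k, hkK, (wk_iff hT).2 hk⟩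
      exact_mod_cast (by omega : K + 1 ≤ k)
    have := h1.trans h
    norm_cast at this
    omega

theorem col_iff {u v : Fin n} :
    T.col false (pos u) ≠ T.col false (pos v) ↔ G.isRed u ≠ G.isRed v := by
  rw [hT.col u u.2, hT.col v v.2, inputMem_color, inputMem_color]
  cases G.isRed u <;> cases G.isRed v <;> simp

theorem dist_eq_top {u v : Fin n} (h : pos u < pos v) : G.dist v u = ⊤ := by
  refine iInf₂_eq_top.2 fun k hk => ?_
  have := Inst.le_of_wk ((wk_iff hT).2 hk)
  omega

theorem diam_le {M K : ℕ} (h : Good T M K) : G.bichromaticMinDiam ≤ ((2 * K + min M K : ℕ) : ℕ∞) := by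
  refine iSup₂_le fun a b => iSup₂_le fun ha hb => ?_
  have hab : G.isRed a ≠ G.isRed b := by simp [ha, hb]
  rcases lt_trichotomy (pos a) (pos b) with hlt | heq | hlt
  · exact (min_le_left _ _).trans ((le_iff hT).1 (h _ _ hlt
      (hT.n_eq ▸ hT.lt b b.2) ((col_iff hT).2 hab)))
  · exact absurd (congrArg G.isRed (Fin.ext (hT.inj _ _ a.2 b.2 heq))) hab
  · exact (min_le_right _ _).trans ((le_iff hT).1 (h _ _ hlt
      (hT.n_eq ▸ hT.lt a a.2) ((col_iff hT).2 hab.symm)))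

/-- The later vertex does not reach the earlier one, so the min-distance equals the distance in
topological order, no matter which of the two vertices is red. -/
theorem exists_far {K : ℕ} (h : BadP T K) : ∃ u v, ¬ G.dist u v ≤ K ∧
    G.dist u v ≤ G.bichromaticMinDiam := by
  obtain ⟨x, y, hxy, hy, hc, hl⟩ := h
  rw [hT.n_eq] at hy
  obtain ⟨u, hu, rfl⟩ := surj_of_inj hT.lt hT.inj (hxy.trans hy)
  obtain ⟨v, hv, rfl⟩ := surj_of_inj hT.lt hT.inj hy
  refine ⟨⟨u, hu⟩, ⟨v, hv⟩, fun h => hl ((le_iff hT (u := ⟨u, hu⟩) (v := ⟨v, hv⟩)).2 h), ?_⟩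
  have htop := dist_eq_top hT (u := ⟨u, hu⟩) (v := ⟨v, hv⟩) hxy
  have hc' := (col_iff hT (u := ⟨u, hu⟩) (v := ⟨v, hv⟩)).1 hc
  unfold BicoloredDigraph.bichromaticMinDiam
  by_cases hr : G.isRed ⟨u, hu⟩ = true
  · refine le_trans ?_ (le_iSup₂_of_le ⟨u, hu⟩ ⟨v, hv⟩ (le_iSup₂_of_le hr ?_ le_rfl))
    · rw [BicoloredDigraph.minDist, htop, min_eq_left le_top]
    · simpa [hr] using hc'
  · refine le_trans ?_ (le_iSup₂_of_le ⟨v, hv⟩ ⟨u, hu⟩ (le_iSup₂_of_le ?_ (by simpa using hr) le_rfl))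
    · rw [BicoloredDigraph.minDist, htop, min_eq_right le_top]
    · simpa [hr] using hc'

/-- Every edge advances the position by at least one, so a walk from `x` to `y` has at most `y - x`
edges. -/
theorem wk_bound {W x y k : ℕ} (hW : ∀ e, G.weight e ≤ W) (hw : Wk (T.E false) x y k) :
    k ≤ (y - x) * W := by
  induction hw with
  | nil => omega
  | @snoc a b _ _ hw hr ih =>
    have h3 := Inst.le_of_wk hw
    have h4 : a < b := by
      obtain ⟨f, hf, rfl, rfl, -⟩ := hr
      exact (T.csr false).src_lt_tgt f hf
    obtain ⟨e, he, -, -, rfl⟩ := (hT.edge _ _ _).1 hr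
    rw [(inputMem_edge G ⟨e, he⟩).2.2]
    calc _ ≤ (a - x) * W + 1 * W := by have := hW ⟨e, he⟩; omega
      _ = (a - x + 1) * W := by ring
      _ ≤ _ := Nat.mul_le_mul_right _ (by omega)

/-- The distance of the bad pair exceeds `W * n`. By `wk_bound` it cannot be finite. -/
theorem diam_eq_top {W : ℕ} (hW : ∀ e, G.weight e ≤ W) (h : BadP T (W * n)) :
    G.bichromaticMinDiam = ⊤ := by
  obtain ⟨u, v, h1, h2⟩ := exists_far hT h
  suffices G.dist u v = ⊤ by rwa [this, top_le_iff] at h2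
  refine iInf₂_eq_top.2 fun k hk => absurd ?_ h1
  refine (iInf₂_le k hk).trans ?_
  have h3 := wk_bound hT hW ((wk_iff hT).2 hk)
  have h4 : (pos v - pos u) * W ≤ n * W := Nat.mul_le_mul_right _ (by
    have := hT.lt v v.2; omega)
  rw [mul_comm n] at h4
  exact_mod_cast h3.trans h4

theorem lt_diam {K : ℕ} (h : BadP T K) : ((K + 1 : ℕ) : ℕ∞) ≤ G.bichromaticMinDiam := by
  obtain ⟨u, v, h1, h2⟩ := exists_far hT h
  refine le_trans ?_ h2
  push_cast
  exact Order.add_one_le_of_lt (not_le.1 h1)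

omit hT

/-! ### Correctness and running time of the complete algorithm. -/

/-- The complete algorithm. -/
def main : Cmd := build ;; search

/-- The search ends either with a bad pair at the threshold `W * n`, so that the diameter is
infinite, or with an `L` for which `L ≤ D ≤ 2 * L + min M₀ L`. Both upper bounds for the output
follow from `L ≤ D` by estimating the minimum by `M₀` or by `L`. -/
theorem main_spec {κ : ℕ} {E : Env} (hE : E.I = G.inputMem) (ha : G.Acyclic)
    (hc : G.WeaklyConnected) {a b : Fin n} (hab : a ≠ b) (hw : ∀ e, G.weight e ≤ n ^ κ)
    (hB : 200 * n ^ (κ + 10) ≤ E.B) :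
    (cost E main (.init n m) : ℝ) ≤ 330000 * (κ + 2) * timeX n m * Real.logb 2 n ^ 2 ∧
    ∃ D : ℕ∞, D = (if (run E main (.init n m)).v vFlag = 0 then (⊤ : ℕ∞) else
      ((run E main (.init n m)).v vOut : ℕ∞)) ∧ G.bichromaticMinDiam ≤ D ∧
      D ≤ 2 * G.bichromaticMinDiam + (G.maxRedBlueWeight : ℕ∞) ∧ D ≤ 3 * G.bichromaticMinDiam := by
  have hI := inputOK ha hc hab
  have hn2 := hI.two_le
  have hnm := card_le_two_mul hc hab
  have hpow : ∀ i, i ≤ κ + 10 → n ^ i ≤ n ^ (κ + 10) := fun i hi =>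
    Nat.pow_le_pow_right (by omega) hi
  rw [← hE] at hI
  obtain ⟨T, pos, hT, hH, hKm, hM0, ht⟩ := build_spec (E := E) hI
    ((hpow 10 (by omega)).trans (by omega))
  rw [hE] at hT
  set W := (Finset.range m).sup (eW E.I n) with hWdef
  have hWe : ∀ e, G.weight e ≤ W := fun e => by
    rw [← (inputMem_edge G e).2.2, hWdef, hE]
    exact Finset.le_sup (f := eW G.inputMem n) (by simp)
  have hWn : W ≤ n ^ κ := Finset.sup_le fun e he => by
    rw [hE, (inputMem_edge G ⟨e, by simpa using he⟩).2.2]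
    exact hw _
  have hK : W * n ≤ n ^ (κ + 1) := by rw [pow_succ]; exact Nat.mul_le_mul_right _ hWn
  have hK1 := hpow (κ + 1) (by omega)
  rw [min_eq_left (by omega)] at hKm
  have h1 := hpow 1 (by omega)
  have h2 := hpow 2 (by omega)
  have h0 := hpow 0 (by omega)
  have hsq : (n + 1) * (n + 1) ≤ 4 * n ^ 2 := by nlinarith
  have hmsq := hI.le_sq
  have hBig : Big T (3 * (W * n + 1)) E := by
    constructor
    · rw [hT.n_eq, hT.m_eq]; omega
    · rw [hT.n_eq]; omega
  have hM : ∀ x y c, x < T.n → y < T.n → T.E false x y c → T.col false x ≠ T.col false y →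
      c ≤ G.maxRedBlueWeight := by
    intro x y c _ _ hr hcol
    obtain ⟨e, he, rfl, rfl, rfl⟩ := (hT.edge _ _ _).1 hr
    obtain ⟨g1, g2, g3⟩ := inputMem_edge G ⟨e, he⟩
    simp only at g1 g2 g3
    rw [g1, g2, col_iff hT] at hcol
    rw [g3]
    exact Finset.le_sup (f := G.weight) (by simpa using hcol)
  rw [hE, supW_eq] at hM0
  obtain ⟨hcase, ht'⟩ := search_spec hBig hT.runs hH hM hKm hM0
  rw [show run E main (.init n m) = run E search (run E build (.init n m)) from rfl]
  refine ⟨total_le hT hnm hn2 hmsq (log_bound hK) (Nat.add_le_add ht ht'), _, rfl, ?_⟩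
  rcases hcase with ⟨hf, hbad⟩ | ⟨hf, L, hout, hbad, hgood⟩
  · have htop := diam_eq_top hT hWe hbad
    rw [if_pos hf, htop]
    refine ⟨le_rfl, ?_, ?_⟩
    · rw [ENat.mul_top (by norm_num), top_add]
    · rw [ENat.mul_top (by norm_num)]
  · rw [if_neg (by omega), hout]
    -- A bad pair for `L - 1` has distance at least `L`, as distances are integers or infinite.
    have hL : (L : ℕ∞) ≤ G.bichromaticMinDiam := by
      rcases hbad with rfl | hbad
      · simp
      · by_cases hL : L = 0
        · simp [hL]
        · have := lt_diam hT hbad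
          rwa [show L - 1 + 1 = L by omega] at this
    refine ⟨diam_le hT hgood, ?_, ?_⟩
    · calc ((2 * L + min G.maxRedBlueWeight L : ℕ) : ℕ∞) ≤ 2 * (L : ℕ∞) + G.maxRedBlueWeight := by
            norm_cast; omega
        _ ≤ _ := by gcongr
    · calc ((2 * L + min G.maxRedBlueWeight L : ℕ) : ℕ∞) ≤ 3 * (L : ℕ∞) := by norm_cast; omega
        _ ≤ _ := by gcongr

end MinDiam

/-! ### The main theorem. -/

theorem theorem4p4 :
    ∃ (P : WordRAM.Program) (c : ℕ), ∀ κ : ℕ, ∃ (C : ℝ) (b : ℕ),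
      ∀ (n m : ℕ) (G : BicoloredDigraph n m),
        G.Acyclic → G.WeaklyConnected →
        (∃ v, G.isRed v = true) → (∃ v, G.isRed v = false) →
        (∀ e, G.weight e ≤ n ^ κ) →
        ∀ w : ℕ, n ^ b ≤ 2 ^ w → ∃ (s : WordRAM.State) (t : ℕ),
            WordRAM.Runs w P G.inputState s t ∧
            (t : ℝ) ≤ C * min ((m : ℝ) ^ (4 / 3 : ℝ) * (n : ℝ) ^ (1 / 3 : ℝ))
              ((m : ℝ) ^ (1 / 2 : ℝ) * (n : ℝ) ^ (3 / 2 : ℝ)) * Real.logb 2 n ^ c ∧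
            G.bichromaticMinDiam ≤ s.output ∧
            s.output ≤ 2 * G.bichromaticMinDiam + (G.maxRedBlueWeight : ℕ∞) ∧
            s.output ≤ 3 * G.bichromaticMinDiam := by
  -- Of the two logarithmic factors one comes from the greedy hitting set and the other from the
  -- binary search.
  refine ⟨SatRAM.compile MinDiam.main, 2, fun κ => ⟨(SatRAM.cmdT MinDiam.main + 11) *
    (330000 * (κ + 2)), κ + 30, fun n m G ha hc ⟨a, hra⟩ ⟨b, hrb⟩ hw w hb => ?_⟩⟩
  have hab : a ≠ b := fun h => by rw [h, hrb] at hra; exact Bool.false_ne_true hra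
  have hI := MinDiam.inputOK ha hc hab
  have hn2 := hI.two_le
  have hpow : ∀ i, i ≤ κ + 10 → n ^ i ≤ n ^ (κ + 10) := fun i hi =>
    Nat.pow_le_pow_right (by omega) hi
  -- As `n ≥ 2`, the surplus `n ^ 20 ≥ 2 ^ 20` in `n ^ (κ + 30)` outweighs the factor `200 * 256`,
  -- so the saturation bound exceeds all powers of `n` and all thresholds that occur.
  have hB : 200 * n ^ (κ + 10) ≤ (2 ^ w - 1) / 256 := by
    rw [Nat.le_div_iff_mul_le (by norm_num)]
    have h1 : 2 ^ 20 * n ^ (κ + 10) ≤ n ^ (κ + 30) := by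
      rw [show n ^ (κ + 30) = n ^ 20 * n ^ (κ + 10) by ring]
      exact Nat.mul_le_mul_right _ (Nat.pow_le_pow_left hn2 20)
    have h2 := hpow 0 (by omega)
    omega
  have h0 : 1 ≤ n ^ (κ + 10) := by simpa using hpow 0 (by omega)
  have h1 : n ≤ n ^ (κ + 10) := by simpa using hpow 1 (by omega)
  have h2 := hpow 2 (by omega)
  have h3 := hI.le_sq
  obtain ⟨s, t, hr, ht, hs⟩ := SatRAM.compile_correct MinDiam.main (by rfl) G (w := w) (by omega)
    (by omega) fun e => ((hw e).trans (hpow κ (by omega))).trans (by omega)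
  obtain ⟨hcost, D, hD, h4, h5, h6⟩ := MinDiam.main_spec (E := SatRAM.Env.of w G) rfl ha hc hab hw hB
  have hD' : s.output = D := by rw [hs, hD]; rfl
  refine ⟨s, t, hr, ?_, hD' ▸ h4, hD' ▸ h5, hD' ▸ h6⟩
  calc (t : ℝ) ≤ (SatRAM.cmdT MinDiam.main + 11 : ℕ) *
        (SatRAM.cost (SatRAM.Env.of w G) MinDiam.main (.init n m) : ℝ) := by exact_mod_cast ht
    _ ≤ (SatRAM.cmdT MinDiam.main + 11 : ℕ) *
        (330000 * (κ + 2) * MinDiam.timeX n m * Real.logb 2 n ^ 2) := by gcongr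
    _ = _ := by unfold MinDiam.timeX; push_cast; ring
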